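/- **Setting.** Let $D=[0,2]^3$ with boundary $\partial$, let $\partial^2$ be the union of its edges, $Q=\{x\in\mathbb R^3: 0\le x_3\le x_1\le x_2\le 1\}$, $\pi_\partial(x_1,x_2,x_3)=(x_1,x_2,0)$, $Q_\partial=\pi_\partial Q$, and write $|x|_P$ for the distance from $x$ to $P$. Let $\xi$ be a white noise on $\mathbb R^3$. For a symmetric ($\rho(-x)=\rho(x)$), nonnegative $\rho\in C_c^\infty(\mathbb R^3)$ with $\int\rho=1$ and for $\varepsilon>0$, put $\rho_\varepsilon(x)=\varepsilon^{-3}\rho(\varepsilon^{-1}x)$ and $\xi_\varepsilon=\rho_\varepsilon*\xi$. Let $Y_\varepsilon$ be the solution (classical, $C^2$ on $D$, unique up to an additive constant) of the Neumann problem $\Delta Y_\varepsilon=\xi_\varepsilon-\frac1{|D|}\int_D\xi_\varepsilon$ in the interior of $D$, $\partial_nY_\varepsilon=0$ on $\partial$, and let $\Psi_\varepsilon=\nabla Y_\varepsilon$. Let $K(x)=\frac1{4\pi|x|}$, fix a compactly supported $\bar K$ such that $K-\bar K$ is smooth and vanishes near the origin, and let $\ell_\varepsilon=\mathbf E|\nabla\bar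 K*\xi_\varepsilon|^2$, a constant independent of the point. For $S\in\{Q,Q_\partial\}$, $P\in\{\partial,\partial^2\}$, $\alpha\in(0,1)$ and $\eta\le 0$, $\mathcal C^{\alpha,\eta}_P(S)$ is the space of functions $u$ on $S\setminus P$ such that, for some $C$, $|u(x)|\le C|x|_P^{\eta}$ for all $x\in S\setminus P$ and $|u(x)-u(y)|\le C\|x-y\|^\alpha|x|_P^{\eta-\alpha}$ for all $x,y\in S\setminus P$ with $\|x-y\|\le\frac12|x|_P$; its norm is the best such $C$. For functions $f$ on $Q_\partial$ and $u$ on $Q$, and smooth compactly supported test functions $\psi$ on $\mathbb R^3$, put $$\langle\delta_\partial f,\psi\rangle=\int_{Q_\partial}f\psi\,dy,\qquad (\mathscr R u)(\psi)=\int_Q u(x)\bigl(\psi(x)-\psi(\pi_\partial x)\bigr)\,dx .$$ **Lemma.** There are functions $R^1_0,R^2_0,R^3_0$, not depending on $\rho$, such that for every $\rho$ as above there are a constant $a_\rho$ and functions $R^1_\varepsilon,R^2_\varepsilon,R^3_\varepsilon$ ($\varepsilon>0$) with the following properties. For all $\varepsilon>0$, $\mathbf E|\Psi_\varepsilon(x)|^2$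 is finite for every $x\in Q$ and integrable over $Q$, and, as distributions on $Q$, $$\mathbf E|\Psi_\varepsilon|^2=\ell_\varepsilon+\Bigl(a_\rho+\frac{|\log\varepsilon|}{8\pi}\Bigr)\delta_\partial+\delta_\partial R^1_\varepsilon+\mathscr R R^2_\varepsilon+R^3_\varepsilon .$$ Moreover, for every $\kappa\in(0,1)$, the following convergences hold as $\varepsilon\to0$ (all functions involved being elements of the indicated spaces): 1. $R^1_\varepsilon\to R^1_0$ in $\mathcal C^{1-\kappa,-\kappa}_{\partial^2}(Q_\partial)$; 2. $R^2_\varepsilon\to R^2_0$ in $\mathcal C^{1-\kappa,-1-\kappa}_{\partial}(Q)$, and $D_{x_1}R^2_\varepsilon=D_{x_2}R^2_\varepsilon=0$ for all $\varepsilon\ge0$; 3. $R^3_\varepsilon\to R^3_0$ in $\mathcal C^{1-\kappa,-1-\kappa}_{\partial^2}(Q)$. -/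

import Mathlib

open MeasureTheory ProbabilityTheory Filter Topology Set
open scoped ContDiff SchwartzMap InnerProductSpace

universe u

noncomputable section

/-! ### Geometry: the cube, its boundary and edges, the tetrahedron -/

/-- Three-dimensional Euclidean space. -/
abbrev E3 : Type := EuclideanSpace ℝ (Fin 3)

/-- The cube `D = [0,2]³`. -/
def cubeD : Set E3 := {x | ∀ i, 0 ≤ x i ∧ x i ≤ 2}

/-- The boundary `∂` of `D`. -/
def bdryD : Set E3 := frontier cubeD

/-- The union `∂²` of the (closed) edges of `D`: at least two coordinates lie in `{0,2}`. -/
def edgesD : Set E3 :=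
  {x | x ∈ cubeD ∧ ∃ i j, i ≠ j ∧ (x i = 0 ∨ x i = 2) ∧ (x j = 0 ∨ x j = 2)}

/-- The tetrahedron `Q = {0 ≤ x₃ ≤ x₁ ≤ x₂ ≤ 1}` (coordinates are indexed by `0, 1, 2`). -/
def tetraQ : Set E3 := {x | 0 ≤ x 2 ∧ x 2 ≤ x 0 ∧ x 0 ≤ x 1 ∧ x 1 ≤ 1}

/-- The projection `π_∂ (x₁,x₂,x₃) = (x₁,x₂,0)`. -/
def projBdry (x : E3) : E3 := !₂[x 0, x 1, 0]

/-- The face `Q_∂ = π_∂ Q` of `Q`. -/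
def faceQ : Set E3 := projBdry '' tetraQ

/-! ### Weighted Hölder spaces of functions -/

/-- For an exponent `α ∈ (0,1)` and a weight exponent `η`, this says that the norm of the function
`u` in the weighted Hölder space `C^{α,η}_P(S)` is at most `C`, where `|x|_P` is the distance of
`x` to `P`. The first field is the bound in `C^{0,η∧0}_P(S)`, which for a function is the weighted
supremum bound. -/
structure WHolderBound (S P : Set E3) (α η C : ℝ) (u : E3 → ℝ) : Prop where
  bound : ∀ x ∈ S \ P, |u x| ≤ C * Metric.infDist x P ^ (min η 0)
  holder : ∀ x ∈ S \ P, ∀ y ∈ S \ P, dist x y ≤ Metric.infDist x P / 2 →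
    |u x - u y| ≤ C * dist x y ^ α * Metric.infDist x P ^ (η - α)

/-- Membership in `C^{α,η}_P(S)`. -/
def MemWHolder (S P : Set E3) (α η : ℝ) (u : E3 → ℝ) : Prop :=
  ∃ C, WHolderBound S P α η C u

/-- The functions `R ε`, `ε > 0`, and `R₀` are in `C^{α,η}_P(S)`, and `R ε → R₀` in that space as
`ε ↓ 0`. -/
def TendstoWHolder (S P : Set E3) (α η : ℝ) (R : ℝ → E3 → ℝ) (R₀ : E3 → ℝ) : Prop :=
  MemWHolder S P α η R₀ ∧ (∀ ε, 0 < ε → MemWHolder S P α η (R ε)) ∧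
    ∃ C : ℝ → ℝ, Tendsto C (𝓝[>] 0) (𝓝 0) ∧
      ∀ᶠ ε in 𝓝[>] (0 : ℝ), WHolderBound S P α η (C ε) (fun x => R ε x - R₀ x)

/-! ### Distributions on `Q`, as functionals of a test function `ψ` on `ℝ³` -/

/-- The function `u` on `Q`, as a distribution. -/
def distQ (u ψ : E3 → ℝ) : ℝ := ∫ x in tetraQ, u x * ψ x

/-- The distribution `δ_∂ f` on `Q`: integration of `f ψ` over the face `Q_∂` with respect to its
two-dimensional Lebesgue measure. -/
def deltaBdry (f ψ : E3 → ℝ) : ℝ :=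
  ∫ p in {p : ℝ × ℝ | 0 ≤ p.1 ∧ p.1 ≤ p.2 ∧ p.2 ≤ 1}, f !₂[p.1, p.2, 0] * ψ !₂[p.1, p.2, 0]

/-- The renormalised distribution `𝓡u`. -/
def renormR (u ψ : E3 → ℝ) : ℝ := ∫ x in tetraQ, u x * (ψ x - ψ (projBdry x))

/-! ### Mollified white noise -/

/-- A symmetric nonnegative `ρ ∈ C_c^∞(ℝ³)` of integral one. -/
structure Mollifier3 where
  toFun : E3 → ℝ
  smooth : ContDiff ℝ ∞ toFun
  compact : HasCompactSupport toFun
  nonneg : ∀ x, 0 ≤ toFun x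
  integral_eq_one : ∫ x, toFun x = 1
  symm : ∀ x, toFun (-x) = toFun x

/-- The rescaling `ρ_ε(x) = ε⁻³ ρ(ε⁻¹ x)`. -/
def Mollifier3.scaled (ρ : Mollifier3) (ε : ℝ) (x : E3) : ℝ := ε⁻¹ ^ 3 * ρ.toFun (ε⁻¹ • x)

theorem Mollifier3.scaled_contDiff (ρ : Mollifier3) (ε : ℝ) (y : E3) :
    ContDiff ℝ ∞ (fun z => ρ.scaled ε (y - z)) := by
  unfold Mollifier3.scaled
  exact contDiff_const.mul (ρ.smooth.comp (by fun_prop : ContDiff ℝ ∞ fun z : E3 => ε⁻¹ • (y - z)))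

theorem Mollifier3.scaled_compact (ρ : Mollifier3) {ε : ℝ} (hε : 0 < ε) (y : E3) :
    HasCompactSupport (fun z => ρ.scaled ε (y - z)) := by
  have h1 : HasCompactSupport (ρ.scaled ε) :=
    (ρ.compact.comp_smul (inv_ne_zero hε.ne')).mul_left
  exact h1.comp_homeomorph (Homeomorph.subLeft y)

/-- The test function `z ↦ ρ_ε(y - z)`, as a Schwartz function. -/
def Mollifier3.testFn (ρ : Mollifier3) {ε : ℝ} (hε : 0 < ε) (y : E3) : 𝓢(E3, ℝ) :=
  (ρ.scaled_compact hε y).toSchwartzMap (ρ.scaled_contDiff ε y)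

/-- `ξ` is a white noise on `ℝ³`: a random (real, tempered) distribution such that, for every
real test function `φ`, the random variable `ξ(φ)` is a centred Gaussian of variance
`‖φ‖²_{L²}`. By linearity, the variables `ξ(φ)` are then jointly Gaussian with covariance
`E ξ(φ)ξ(φ') = ⟨φ, φ'⟩_{L²}`. -/
def IsWhiteNoise {Ω : Type*} [MeasurableSpace Ω] (P : Measure Ω)
    (ξ : Ω → (𝓢(E3, ℝ) →L[ℝ] ℝ)) : Prop :=
  ∀ φ : 𝓢(E3, ℝ),
    HasLaw (fun w => ξ w φ) (gaussianReal 0 (Real.toNNReal (∫ x, φ x ^ 2))) P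

/-- The mollification `ξ_ε = ρ_ε * ξ` of a distribution `ξ`, which is the function
`y ↦ ξ(ρ_ε(y - ·))`. -/
def mollify (ρ : Mollifier3) {ε : ℝ} (hε : 0 < ε) (ξ : 𝓢(E3, ℝ) →L[ℝ] ℝ) (y : E3) : ℝ :=
  ξ (ρ.testFn hε y)

/-! ### The Neumann problem -/

/-- `Y` is a (classical) solution, twice continuously differentiable on the closed cube, of the
Neumann problem for `ΔY = f` on `D`: the normal derivative vanishes on each face of `D`, and, as
always for the Neumann problem, the equation is understood modulo constants, i.e. the average of
`f` over `D` is subtracted (no solution exists otherwise). The solution is unique up to an additive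
constant, so that `∇Y` is unique. -/
structure IsNeumannSolution (f Y : E3 → ℝ) : Prop where
  contDiffOn : ContDiffOn ℝ 2 Y cubeD
  equation : ∀ x ∈ interior cubeD, Laplacian.laplacian Y x = f x - ⨍ y in cubeD, f y
  neumann : ∀ x ∈ cubeD, ∀ i, (x i = 0 ∨ x i = 2) →
    fderivWithin ℝ Y cubeD x (EuclideanSpace.single i 1) = 0

/-- `E|Ψ(x)|²` for `Ψ = ∇Y`, where `Y` is a random function on the cube. -/
def meanSqGrad {Ω : Type*} [MeasurableSpace Ω] (P : Measure Ω) (Y : Ω → E3 → ℝ) (x : E3) : ℝ :=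
  ∫ w, ‖gradientWithin (Y w) cubeD x‖ ^ 2 ∂P

/-! ### The bulk renormalisation constant -/

/-- The Green's function `K(x) = 1 / (4π|x|)` of the Poisson equation (with the value `0` at `0`). -/
def greenK (x : E3) : ℝ := 1 / (4 * Real.pi * ‖x‖)

/-- `K̄` is compactly supported, and `K - K̄` is smooth and vanishes near the origin. -/
structure IsTruncatedGreen (Kbar : E3 → ℝ) : Prop where
  compact : HasCompactSupport Kbar
  smooth : ContDiff ℝ ∞ (fun x => greenK x - Kbar x)
  vanish : ∀ᶠ x in 𝓝 (0 : E3), greenK x - Kbar x = 0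

/-- `E|(∇K̄ * f)(z)|²` for a random function `f` on `ℝ³`. For `f = ξ_ε`, which is stationary, it does
not depend on `z` and is the renormalisation constant `ℓ_ε`. -/
def ellConst {Ω : Type*} [MeasurableSpace Ω] (P : Measure Ω) (Kbar : E3 → ℝ)
    (f : Ω → E3 → ℝ) (z : E3) : ℝ :=
  ∫ w, ‖∫ y, f w y • gradient Kbar (z - y)‖ ^ 2 ∂P

end

noncomputable section

/-! ### Radial integrals -/

/-! White noise turns second moments into correlations: with `q` the autocorrelation of `ρ`, the
variance of `∫ h ξ_ε` is `corr q ε h h`, the integral of `h(y) h(y + εz) q(z)`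
(`IsWhiteNoise.sq_integral_mollify`). So once `∂_j Y_ε(x)` is written as minus the integral of a
kernel `N_j(x, ·)` (`neumannFam`) against `ξ_ε`, the mean square `E|Ψ_ε(x)|²` is the sum over `j` of
the self-correlations of `N_j(x, ·)`.

On `Q` the nearest face is `x₃ = 0`, and the distance to the edges is comparable to `x₁`.
Accordingly `N = k + D + W`: `k` is the gradient of the whole-space Green's function, `k + D` is the
Neumann kernel of the half-space (`halfKern`), and `W` (`cubeRem`) collects the effect of the other
faces. The self-correlation of `k` is `ℓ_ε` up to a convergent constant, because `K` and `K̄` differ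
by a smooth function. Expanding the square leaves `corr(2k + D, D)`, called `halfCorr`, and
`corr(2(k + D) + W, W)`, called `edgeCorr`. All kernels have order `-2` at `x`, but `D` is cut off
at scale `x₃` and `W` at scale `x₁`. A correlation of an order `-2` singularity with one cut off at
scale `r` is at most a constant times `1/r`, and its `β`-Hölder seminorm in `x` is at most a
constant times `r^(-1-β)`, both uniformly in `ε` (`SingFam.abs_corr_le`, `SingFam.abs_corr_sub_le`).
These are the uniform bounds for `R²` = `halfCorr` and for `R³` = bulk error + `edgeCorr`. Together
with pointwise convergence and a little room in the exponents they give convergence in the weighted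
spaces (`tendstoWHolder_of_bounds`).

The limit of `halfCorr` is `1/(8π x₃)` (`halfCorr_zero`), which is not integrable at the face; this
forces the renormalisation. Since `halfCorr` depends on `x₃` only and equals `ε⁻¹ h(x₃/ε)`,
splitting `ψ` as `(ψ - ψ ∘ π_∂) + ψ ∘ π_∂` produces `𝓡R²` and, after integration in the vertical
direction, the density `H(x₁/ε)` on the face, with `H` the primitive of `h`. As `h(t) - 1/(8πt)` is
`O(t^(-3/2))` (`exists_halfCorr_rate`), `H(S) = log S/(8π) + a + o(1)`. With `S = x₁/ε` this is the
counterterm `a + |log ε|/(8π)` plus a remainder `R¹` which tends to `log x₁/(8π)`.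

The kernel `N` is not explicit, but it suffices to know it for `x` in the octant `[0,1]³`. The eight
images of `k` under coordinate reflections satisfy the Neumann condition on the three faces through
the origin. Cutting them off before distance one makes the condition hold trivially on the other
three faces, at the price of a smooth source. That source is inverted by a cosine series, which
contributes a bounded term, Lipschitz in `x` (`exists_neumannRem₀_bound`). Subtracting the mean of
the kernel accounts for the mean subtracted from the noise. -/

theorem integrable_max_norm_rpow {r c : ℝ} (hr : 0 < r) (hc : 3 < c) :
    Integrable (fun y : E3 => (max r ‖y‖) ^ (-c)) := by
  have h1 : Integrable (fun y : E3 => (min r 1 / 2) ^ (-c) * (1 + ‖y‖) ^ (-c)) := by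
    refine Integrable.const_mul (integrable_one_add_norm ?_) _
    simpa using hc
  have hm : 0 < min r 1 / 2 := by positivity
  refine h1.mono' ?_ (Eventually.of_forall fun y => ?_)
  · exact ((measurable_const.max measurable_norm).pow_const _).aestronglyMeasurable
  · have hmax : 0 < max r ‖y‖ := lt_max_of_lt_left hr
    rw [Real.norm_of_nonneg (Real.rpow_nonneg hmax.le _),
      ← Real.mul_rpow hm.le (by positivity)]
    refine Real.rpow_le_rpow_of_nonpos (by positivity) ?_ (by linarith)
    have h2 : min r 1 ≤ r := min_le_left _ _
    have h3 : min r 1 ≤ 1 := min_le_right _ _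
    have h4 : r ≤ max r ‖y‖ := le_max_left _ _
    have h5 : ‖y‖ ≤ max r ‖y‖ := le_max_right _ _
    nlinarith [norm_nonneg y]

def tailConst (c : ℝ) : ℝ := ∫ y : E3, (max 1 ‖y‖) ^ (-c)

theorem tailConst_nonneg (c : ℝ) : 0 ≤ tailConst c :=
  integral_nonneg fun _ => Real.rpow_nonneg (le_trans zero_le_one (le_max_left _ _)) _

theorem integral_comp_inv_smul_E3 (f : E3 → ℝ) {r : ℝ} (hr : 0 < r) :
    ∫ y : E3, f (r⁻¹ • y) = r ^ 3 * ∫ y, f y := by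
  rw [Measure.integral_comp_inv_smul_of_nonneg volume f hr.le]
  simp

theorem integral_max_norm_rpow {r : ℝ} (hr : 0 < r) (c : ℝ) :
    ∫ y : E3, (max r ‖y‖) ^ (-c) = tailConst c * r ^ (3 - c) := by
  have h := integral_comp_inv_smul_E3 (fun y : E3 => (max 1 ‖y‖) ^ (-c)) hr
  have h2 : ∀ y : E3, (max r ‖y‖) ^ (-c) = r ^ (-c) * (max 1 ‖r⁻¹ • y‖) ^ (-c) := by
    intro y
    rw [← Real.mul_rpow hr.le (by positivity), norm_smul, norm_inv, Real.norm_of_nonneg hr.le,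
      mul_max_of_nonneg _ _ hr.le, mul_one, mul_inv_cancel_left₀ hr.ne']
  simp_rw [h2]
  rw [integral_const_mul, h, tailConst, sub_eq_add_neg, Real.rpow_add hr]
  norm_cast
  ring

/-- The integrable core of the singular function `‖y‖ ^ (-a)`. -/
def coreFn (r a : ℝ) (y : E3) : ℝ := (Metric.closedBall (0 : E3) r).indicator (fun y => ‖y‖ ^ (-a)) y

theorem coreFn_nonneg (r a : ℝ) (y : E3) : 0 ≤ coreFn r a y :=
  indicator_nonneg (fun _ _ => Real.rpow_nonneg (norm_nonneg _) _) _

theorem integrable_coreFn (r : ℝ) {a : ℝ} (ha : a < 3) : Integrable (coreFn r a) := by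
  have h1 : coreFn r a = fun y : E3 => ((Iic r).indicator fun s : ℝ => s ^ (-a)) ‖y‖ := by
    ext y
    simp [coreFn, indicator]
  rw [h1, integrable_fun_norm_addHaar volume (f := (Iic r).indicator fun s : ℝ => s ^ (-a))]
  have h2 : IntegrableOn (fun s : ℝ => s ^ (2 - a)) (Ioc 0 (max r 0)) := by
    rw [← intervalIntegrable_iff_integrableOn_Ioc_of_le (le_max_right _ _)]
    exact intervalIntegral.intervalIntegrable_rpow' (by linarith)
  have h3 : (fun y : ℝ => y ^ (Module.finrank ℝ E3 - 1) • ((Iic r).indicator fun s : ℝ => s ^ (-a)) y)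
      = (Iic r).indicator fun s : ℝ => s ^ 2 * s ^ (-a) := by
    ext s
    by_cases hs : s ≤ r <;> simp [indicator, hs]
  rw [h3, integrableOn_indicator_iff measurableSet_Iic]
  have h4 : Iic r ∩ Ioi 0 ⊆ Ioc 0 (max r 0) := fun s hs => ⟨hs.2, le_max_of_le_left hs.1⟩
  refine (h2.mono_set h4).congr_fun (fun s hs => ?_) (measurableSet_Iic.inter measurableSet_Ioi)
  simp only [sub_eq_add_neg]
  rw [Real.rpow_add hs.2]
  norm_cast

def coreConst (a : ℝ) : ℝ := ∫ y, coreFn 1 a y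

theorem coreConst_nonneg (a : ℝ) : 0 ≤ coreConst a := integral_nonneg fun _ => coreFn_nonneg _ _ _

theorem integral_coreFn {r : ℝ} (hr : 0 < r) (a : ℝ) :
    ∫ y, coreFn r a y = coreConst a * r ^ (3 - a) := by
  have h := integral_comp_inv_smul_E3 (coreFn 1 a) hr
  have h2 : ∀ y : E3, coreFn r a y = r ^ (-a) * coreFn 1 a (r⁻¹ • y) := by
    intro y
    have hn : ‖r⁻¹ • y‖ = r⁻¹ * ‖y‖ := by rw [norm_smul, norm_inv, Real.norm_of_nonneg hr.le]
    have hiff : r⁻¹ * ‖y‖ ≤ 1 ↔ ‖y‖ ≤ r := by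
      rw [inv_mul_le_iff₀ hr, mul_one]
    by_cases hy : ‖y‖ ≤ r
    · have h3 : y ∈ Metric.closedBall (0 : E3) r := by simpa using hy
      have h4 : r⁻¹ • y ∈ Metric.closedBall (0 : E3) 1 := by
        rw [mem_closedBall_zero_iff, hn]; exact hiff.2 hy
      rw [coreFn, coreFn, indicator_of_mem h3, indicator_of_mem h4, hn,
        ← Real.mul_rpow hr.le (by positivity), mul_inv_cancel_left₀ hr.ne']
    · have h3 : y ∉ Metric.closedBall (0 : E3) r := by simpa using hy
      have h4 : r⁻¹ • y ∉ Metric.closedBall (0 : E3) 1 := by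
        rw [mem_closedBall_zero_iff, hn]; exact fun h => hy (hiff.1 h)
      rw [coreFn, coreFn, indicator_of_notMem h3, indicator_of_notMem h4, mul_zero]
  simp_rw [h2]
  rw [integral_const_mul, h, coreConst, sub_eq_add_neg, Real.rpow_add hr]
  norm_cast
  ring

/-! ### Correlation integrals -/

/-- A probability density which plays the role of `ρ * ρ`. -/
structure CorrWeight (q : E3 → ℝ) : Prop where
  continuous : Continuous q
  compact : HasCompactSupport q
  nonneg : ∀ z, 0 ≤ q z
  integral_eq_one : ∫ z, q z = 1
  even : ∀ z, q (-z) = q z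

theorem CorrWeight.integrable {q : E3 → ℝ} (hq : CorrWeight q) : Integrable q :=
  hq.continuous.integrable_of_hasCompactSupport hq.compact

def corrIntegrand (q : E3 → ℝ) (ε : ℝ) (f w : E3 → ℝ) (p : E3 × E3) : ℝ :=
  q p.1 * (f p.2 * w (p.2 + ε • p.1))

/-- The correlation `∫∫ f(y) w(y + εz) q(z) dy dz`. -/
def corr (q : E3 → ℝ) (ε : ℝ) (f w : E3 → ℝ) : ℝ := ∫ p : E3 × E3, corrIntegrand q ε f w p

/-- The shifted point `y + εz` is as good as `y`: almost-everywhere bounds on the second factor may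
be used there, and integrals of its majorants do not see the shift. -/
theorem measurePreserving_shear (ε : ℝ) :
    MeasurePreserving (fun p : E3 × E3 => (p.1, p.2 + ε • p.1)) volume volume := by
  refine MeasurePreserving.skew_product (MeasurePreserving.id volume)
    (g := fun a c => c + ε • a) (by fun_prop) (Eventually.of_forall fun a => ?_)
  exact (measurePreserving_add_right volume (ε • a)).map_eq

theorem quasiMeasurePreserving_shear_snd (ε : ℝ) :
    Measure.QuasiMeasurePreserving (fun p : E3 × E3 => p.2 + ε • p.1) volume volume :=
  Measure.quasiMeasurePreserving_snd.comp (measurePreserving_shear ε).quasiMeasurePreserving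

theorem aestronglyMeasurable_corrIntegrand {q f w : E3 → ℝ} (hq : CorrWeight q) (ε : ℝ)
    (hf : AEStronglyMeasurable f) (hw : AEStronglyMeasurable w) :
    AEStronglyMeasurable (corrIntegrand q ε f w) := by
  have h1 : AEStronglyMeasurable (fun p : E3 × E3 => f p.2) :=
    hf.comp_quasiMeasurePreserving Measure.quasiMeasurePreserving_snd
  have h2 : AEStronglyMeasurable (fun p : E3 × E3 => w (p.2 + ε • p.1)) :=
    hw.comp_quasiMeasurePreserving (quasiMeasurePreserving_shear_snd ε)
  have h3 : AEStronglyMeasurable (fun p : E3 × E3 => q p.1) :=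
    (hq.continuous.comp continuous_fst).aestronglyMeasurable
  exact h3.mul (h1.mul h2)

theorem integrable_weight_mul_snd {q h : E3 → ℝ} (hq : CorrWeight q) (hh : Integrable h) :
    Integrable (fun p : E3 × E3 => q p.1 * h p.2) := hq.integrable.mul_prod hh

theorem integral_weight_mul_snd {q h : E3 → ℝ} (hq : CorrWeight q) :
    ∫ p : E3 × E3, q p.1 * h p.2 = ∫ y, h y := by
  rw [Measure.volume_eq_prod, integral_prod_mul q h, hq.integral_eq_one, one_mul]

theorem integrable_weight_mul_shear {q h : E3 → ℝ} (hq : CorrWeight q) (hh : Integrable h)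
    (ε : ℝ) : Integrable (fun p : E3 × E3 => q p.1 * h (p.2 + ε • p.1)) :=
  (measurePreserving_shear ε).integrable_comp_of_integrable (integrable_weight_mul_snd hq hh)

theorem integral_weight_mul_shear {q h : E3 → ℝ} (hq : CorrWeight q) (hh : Integrable h)
    (ε : ℝ) : ∫ p : E3 × E3, q p.1 * h (p.2 + ε • p.1) = ∫ y, h y := by
  rw [← integral_weight_mul_snd hq]
  have h1 := (measurePreserving_shear ε)
  have h2 := integral_map (φ := fun p : E3 × E3 => (p.1, p.2 + ε • p.1)) (μ := volume)
    h1.measurable.aemeasurable (f := fun p : E3 × E3 => q p.1 * h p.2)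
    (by rw [h1.map_eq]; exact (integrable_weight_mul_snd hq hh).aestronglyMeasurable)
  rw [h1.map_eq] at h2
  exact h2.symm

/-- The constant in `corr_bound`. -/
def corrConst (a b : ℝ) : ℝ := coreConst a + 2 * tailConst (a + b)

theorem corrConst_nonneg (a b : ℝ) : 0 ≤ corrConst a b :=
  add_nonneg (coreConst_nonneg a) (mul_nonneg zero_le_two (tailConst_nonneg _))

/-- The smaller of `s` and `t` controls both factors. -/
theorem rpow_neg_mul_rpow_neg_le {s t a b : ℝ} (hs : 0 < s) (ht : 0 < t) (ha : 0 ≤ a) (hb : 0 ≤ b) :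
    s ^ (-a) * t ^ (-b) ≤ s ^ (-(a + b)) + t ^ (-(a + b)) := by
  rcases le_total s t with h | h
  · have h1 : t ^ (-b) ≤ s ^ (-b) := Real.rpow_le_rpow_of_nonpos hs h (by linarith)
    calc s ^ (-a) * t ^ (-b) ≤ s ^ (-a) * s ^ (-b) := by gcongr
      _ = s ^ (-(a + b)) := by rw [← Real.rpow_add hs]; ring_nf
      _ ≤ _ := le_add_of_nonneg_right (by positivity)
  · have h1 : s ^ (-a) ≤ t ^ (-a) := Real.rpow_le_rpow_of_nonpos ht h (by linarith)
    calc s ^ (-a) * t ^ (-b) ≤ t ^ (-a) * t ^ (-b) := by gcongr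
      _ = t ^ (-(a + b)) := by rw [← Real.rpow_add ht]; ring_nf
      _ ≤ _ := le_add_of_nonneg_left (by positivity)

/-- Both sides separate the variables: every term on the right depends on `s` alone or on `t` alone.
In the correlation `s` belongs to `y` and `t` to `y + εz`, so each term can be integrated
independently of the shift. -/
theorem singular_mul_regular_le {a b r s t : ℝ} (ha : 0 ≤ a) (hb : 0 ≤ b) (hr : 0 < r)
    (hs : 0 ≤ s) :
    s ^ (-a) * (max r t) ^ (-b) ≤ r ^ (-b) * (if s ≤ r then s ^ (-a) else 0)
      + (max r s) ^ (-(a + b)) + (max r t) ^ (-(a + b)) := by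
  have ht : 0 < max r t := lt_max_of_lt_left hr
  have hs' : 0 < max r s := lt_max_of_lt_left hr
  split_ifs with h
  · have h1 : (max r t) ^ (-b) ≤ r ^ (-b) :=
      Real.rpow_le_rpow_of_nonpos hr (le_max_left _ _) (by linarith)
    have h2 : s ^ (-a) * (max r t) ^ (-b) ≤ s ^ (-a) * r ^ (-b) := by gcongr
    have : 0 ≤ (max r s) ^ (-(a + b)) := by positivity
    have : 0 ≤ (max r t) ^ (-(a + b)) := by positivity
    linarith
  · push Not at h
    rw [max_eq_right h.le, mul_zero, zero_add]
    exact rpow_neg_mul_rpow_neg_le (hr.trans h) ht ha hb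

/-- The basic estimate. Inside the ball of radius `r` the regular factor is at most `r^(-b)` and the
singular one is integrable since `a < 3`. Outside, the product is dominated by powers of order
`-(a+b)`, integrable since `a + b > 3`. Each majorant involves only `y` or only `y + εz`, so the
density `q` integrates out and the bound is uniform in `ε`. -/
theorem integrable_corrIntegrand_and_bound {q f w : E3 → ℝ} (hq : CorrWeight q) (ε : ℝ)
    {a b r A B : ℝ} (ha : 0 ≤ a) (ha3 : a < 3) (hb : 0 ≤ b) (hab : 3 < a + b) (hr : 0 < r)
    (hA : 0 ≤ A) (hB : 0 ≤ B) (hf : AEStronglyMeasurable f) (hw : AEStronglyMeasurable w)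
    (x x' : E3) (hfA : ∀ᵐ y, |f y| ≤ A * ‖x - y‖ ^ (-a))
    (hwB : ∀ᵐ y, |w y| ≤ B * (max r ‖x' - y‖) ^ (-b)) :
    Integrable (corrIntegrand q ε f w) ∧
      ∫ p, |corrIntegrand q ε f w p| ≤ A * B * corrConst a b * r ^ (3 - a - b) := by
  set c := a + b with hc
  have hi1 : Integrable fun y : E3 => coreFn r a (x - y) := (integrable_coreFn r ha3).comp_sub_left x
  have hi2 : Integrable fun y : E3 => (max r ‖x - y‖) ^ (-c) :=
    (integrable_max_norm_rpow hr hab).comp_sub_left x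
  have hi3 : Integrable fun y : E3 => (max r ‖x' - y‖) ^ (-c) :=
    (integrable_max_norm_rpow hr hab).comp_sub_left x'
  have e1 : ∫ y : E3, coreFn r a (x - y) = coreConst a * r ^ (3 - a) := by
    rw [integral_sub_left_eq_self (coreFn r a) volume x, integral_coreFn hr]
  have e2 : ∀ x : E3, ∫ y : E3, (max r ‖x - y‖) ^ (-c) = tailConst c * r ^ (3 - c) := by
    intro x
    rw [integral_sub_left_eq_self (fun y : E3 => (max r ‖y‖) ^ (-c)) volume x,
      integral_max_norm_rpow hr]
  have hi12 : Integrable fun y => A * B * ((r ^ (-b) * coreFn r a (x - y)) +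
      (max r ‖x - y‖) ^ (-c)) := ((hi1.const_mul (r ^ (-b))).add hi2).const_mul (A * B)
  have hsum := (integrable_weight_mul_snd hq hi12).add
    (integrable_weight_mul_shear hq (hi3.const_mul (A * B)) ε)
  have hle : ∀ᵐ p : E3 × E3, ‖corrIntegrand q ε f w p‖ ≤
      ((fun p : E3 × E3 => q p.1 * (A * B * ((r ^ (-b) * coreFn r a (x - p.2)) +
        (max r ‖x - p.2‖) ^ (-c)))) +
        fun p : E3 × E3 => q p.1 * (A * B * (max r ‖x' - (p.2 + ε • p.1)‖) ^ (-c))) p := by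
    have h1 := (Measure.quasiMeasurePreserving_snd (μ := (volume : Measure E3))
      (ν := (volume : Measure E3))).ae hfA
    have h2 := (quasiMeasurePreserving_shear_snd ε).ae hwB
    rw [← Measure.volume_eq_prod] at h1
    filter_upwards [h1, h2] with p hp1 hp2
    rw [corrIntegrand, Real.norm_eq_abs, abs_mul, abs_mul, abs_of_nonneg (hq.nonneg _),
      Pi.add_apply, ← mul_add]
    refine mul_le_mul_of_nonneg_left ?_ (hq.nonneg _)
    have h3 := singular_mul_regular_le (t := ‖x' - (p.2 + ε • p.1)‖) ha hb hr (norm_nonneg (x - p.2))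
    have h4 : coreFn r a (x - p.2) = if ‖x - p.2‖ ≤ r then ‖x - p.2‖ ^ (-a) else 0 := by
      simp [coreFn, indicator]
    rw [h4, ← mul_add]
    calc |f p.2| * |w (p.2 + ε • p.1)|
        ≤ (A * ‖x - p.2‖ ^ (-a)) * (B * (max r ‖x' - (p.2 + ε • p.1)‖) ^ (-b)) := by
          refine mul_le_mul hp1 hp2 (abs_nonneg _) (by positivity)
      _ = A * B * (‖x - p.2‖ ^ (-a) * (max r ‖x' - (p.2 + ε • p.1)‖) ^ (-b)) := by ring
      _ ≤ _ := mul_le_mul_of_nonneg_left h3 (by positivity)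
  have hint : Integrable (corrIntegrand q ε f w) :=
    hsum.mono' (aestronglyMeasurable_corrIntegrand hq ε hf hw) hle
  refine ⟨hint, ?_⟩
  refine (integral_mono_ae hint.norm hsum hle).trans (le_of_eq ?_)
  rw [integral_add' (integrable_weight_mul_snd hq hi12)
    (integrable_weight_mul_shear hq (hi3.const_mul (A * B)) ε)]
  rw [integral_weight_mul_shear hq (hi3.const_mul (A * B)) ε,
    integral_weight_mul_snd hq (h := fun y => A * B * ((r ^ (-b) * coreFn r a (x - y)) +
        (max r ‖x - y‖) ^ (-c)))]
  rw [integral_const_mul, integral_const_mul, integral_add (hi1.const_mul _) hi2,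
    integral_const_mul, e1, e2, e2, corrConst, ← hc]
  have h5 : r ^ (-b) * r ^ (3 - a) = r ^ (3 - a - b) := by
    rw [← Real.rpow_add hr]; ring_nf
  have h6 : (3 - c) = 3 - a - b := by rw [hc]; ring
  rw [h6]
  linear_combination A * B * coreConst a * h5

theorem integrable_corrIntegrand {q f w : E3 → ℝ} (hq : CorrWeight q) (ε : ℝ)
    {a b r A B : ℝ} (ha : 0 ≤ a) (ha3 : a < 3) (hb : 0 ≤ b) (hab : 3 < a + b) (hr : 0 < r)
    (hA : 0 ≤ A) (hB : 0 ≤ B) (hf : AEStronglyMeasurable f) (hw : AEStronglyMeasurable w)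
    (x x' : E3) (hfA : ∀ᵐ y, |f y| ≤ A * ‖x - y‖ ^ (-a))
    (hwB : ∀ᵐ y, |w y| ≤ B * (max r ‖x' - y‖) ^ (-b)) :
    Integrable (corrIntegrand q ε f w) :=
  (integrable_corrIntegrand_and_bound hq ε ha ha3 hb hab hr hA hB hf hw x x' hfA hwB).1

theorem abs_corr_le {q f w : E3 → ℝ} (hq : CorrWeight q) (ε : ℝ)
    {a b r A B : ℝ} (ha : 0 ≤ a) (ha3 : a < 3) (hb : 0 ≤ b) (hab : 3 < a + b) (hr : 0 < r)
    (hA : 0 ≤ A) (hB : 0 ≤ B) (hf : AEStronglyMeasurable f) (hw : AEStronglyMeasurable w)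
    (x x' : E3) (hfA : ∀ᵐ y, |f y| ≤ A * ‖x - y‖ ^ (-a))
    (hwB : ∀ᵐ y, |w y| ≤ B * (max r ‖x' - y‖) ^ (-b)) :
    |corr q ε f w| ≤ A * B * corrConst a b * r ^ (3 - a - b) :=
  (abs_integral_le_integral_abs).trans
    (integrable_corrIntegrand_and_bound hq ε ha ha3 hb hab hr hA hB hf hw x x' hfA hwB).2

/-- The change of variables `z ↦ -z`, `y ↦ y + εz` exchanges the two factors of a correlation; this
is where the evenness of `q` enters. -/
theorem measurePreserving_shear_neg (ε : ℝ) :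
    MeasurePreserving (fun p : E3 × E3 => (-p.1, p.2 + ε • p.1)) volume volume := by
  refine MeasurePreserving.skew_product (Measure.measurePreserving_neg volume)
    (g := fun a c => c + ε • a) (by fun_prop) (Eventually.of_forall fun a => ?_)
  exact (measurePreserving_add_right volume (ε • a)).map_eq

theorem corrIntegrand_swap {q : E3 → ℝ} (hq : CorrWeight q) (ε : ℝ) (f w : E3 → ℝ) (p : E3 × E3) :
    corrIntegrand q ε w f (-p.1, p.2 + ε • p.1) = corrIntegrand q ε f w p := by
  simp only [corrIntegrand, hq.even, smul_neg, add_neg_cancel_right]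
  ring

theorem integrable_corrIntegrand_swap {q f w : E3 → ℝ} (hq : CorrWeight q) {ε : ℝ}
    (h : Integrable (corrIntegrand q ε f w)) : Integrable (corrIntegrand q ε w f) := by
  have h1 := (measurePreserving_shear_neg ε).integrable_comp_of_integrable h
  refine h1.congr (Eventually.of_forall fun p => ?_)
  exact corrIntegrand_swap hq ε w f p

theorem corr_swap {q f w : E3 → ℝ} (hq : CorrWeight q) {ε : ℝ}
    (hf : AEStronglyMeasurable f) (hw : AEStronglyMeasurable w) :
    corr q ε f w = corr q ε w f := by
  have h1 := (measurePreserving_shear_neg ε)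
  have h2 := integral_map (φ := fun p : E3 × E3 => (-p.1, p.2 + ε • p.1)) (μ := volume)
    h1.measurable.aemeasurable (f := corrIntegrand q ε w f)
    (by rw [h1.map_eq]; exact aestronglyMeasurable_corrIntegrand hq ε hw hf)
  rw [h1.map_eq] at h2
  rw [corr, corr, h2]
  exact integral_congr_ae (Eventually.of_forall fun p => (corrIntegrand_swap hq ε f w p).symm)

/-- At `ε = 0` the weight enters only through its integral, which is why the limits of the
remainders do not depend on the mollifier. -/
theorem corr_zero {q f w : E3 → ℝ} (hq : CorrWeight q) :
    corr q 0 f w = ∫ y, f y * w y := by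
  rw [← integral_weight_mul_snd hq]
  simp [corr, corrIntegrand]

theorem corr_add_right {q f w w' : E3 → ℝ} {ε : ℝ} (h : Integrable (corrIntegrand q ε f w))
    (h' : Integrable (corrIntegrand q ε f w')) :
    corr q ε f (w + w') = corr q ε f w + corr q ε f w' := by
  rw [corr, corr, corr, ← integral_add h h']
  congr 1; ext p; simp only [corrIntegrand, Pi.add_apply]; ring

theorem corr_add_left {q f f' w : E3 → ℝ} {ε : ℝ} (h : Integrable (corrIntegrand q ε f w))
    (h' : Integrable (corrIntegrand q ε f' w)) :
    corr q ε (f + f') w = corr q ε f w + corr q ε f' w := by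
  rw [corr, corr, corr, ← integral_add h h']
  congr 1; ext p; simp only [corrIntegrand, Pi.add_apply]; ring

theorem corr_sub_right {q f w w' : E3 → ℝ} {ε : ℝ} (h : Integrable (corrIntegrand q ε f w))
    (h' : Integrable (corrIntegrand q ε f w')) :
    corr q ε f (w - w') = corr q ε f w - corr q ε f w' := by
  rw [corr, corr, corr, ← integral_sub h h']
  congr 1; ext p; simp only [corrIntegrand, Pi.sub_apply]; ring

theorem corr_sub_left {q f f' w : E3 → ℝ} {ε : ℝ} (h : Integrable (corrIntegrand q ε f w))
    (h' : Integrable (corrIntegrand q ε f' w)) :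
    corr q ε (f - f') w = corr q ε f w - corr q ε f' w := by
  rw [corr, corr, corr, ← integral_sub h h']
  congr 1; ext p; simp only [corrIntegrand, Pi.sub_apply]; ring

section

/-! ### Families of singular and regular functions -/

theorem aestronglyMeasurable_norm_sub_rpow (x : E3) (a : ℝ) :
    AEStronglyMeasurable (fun y : E3 => ‖x - y‖ ^ (-a)) :=
  ((measurable_norm.comp (measurable_const.sub measurable_id)).pow_const _).aestronglyMeasurable

theorem aestronglyMeasurable_max_norm_sub_rpow (r : ℝ) (x : E3) (a : ℝ) :
    AEStronglyMeasurable (fun y : E3 => (max r ‖x - y‖) ^ (-a)) :=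
  ((measurable_const.max (measurable_norm.comp
    (measurable_const.sub measurable_id))).pow_const _).aestronglyMeasurable

/-- The two-centre version of the correlation bound. -/
theorem corr_two_centres {q f w : E3 → ℝ} (hq : CorrWeight q) (ε : ℝ)
    {a b r A B : ℝ} (ha : 0 ≤ a) (ha3 : a < 3) (hb : 0 ≤ b) (hab : 3 < a + b) (hr : 0 < r)
    (hA : 0 ≤ A) (hB : 0 ≤ B) (hf : AEStronglyMeasurable f) (hw : AEStronglyMeasurable w)
    (x x' : E3) (hfA : ∀ᵐ y, |f y| ≤ A * (‖x - y‖ ^ (-a) + ‖x' - y‖ ^ (-a)))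
    (hwB : ∀ᵐ y, |w y| ≤ B * ((max r ‖x - y‖) ^ (-b) + (max r ‖x' - y‖) ^ (-b))) :
    Integrable (corrIntegrand q ε f w) ∧
      |corr q ε f w| ≤ 4 * (A * B * corrConst a b * r ^ (3 - a - b)) := by
  have key : ∀ u v : E3, Integrable (corrIntegrand q ε (fun y => A * ‖u - y‖ ^ (-a))
        (fun y => B * (max r ‖v - y‖) ^ (-b))) ∧
      ∫ p, |corrIntegrand q ε (fun y => A * ‖u - y‖ ^ (-a))
        (fun y => B * (max r ‖v - y‖) ^ (-b)) p| ≤ A * B * corrConst a b * r ^ (3 - a - b) := by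
    intro u v
    refine integrable_corrIntegrand_and_bound hq ε ha ha3 hb hab hr hA hB
      ((aestronglyMeasurable_norm_sub_rpow u a).const_mul A)
      ((aestronglyMeasurable_max_norm_sub_rpow r v b).const_mul B) u v
      (Eventually.of_forall fun y => ?_) (Eventually.of_forall fun y => ?_)
    · rw [abs_of_nonneg (by positivity)]
    · have : 0 < max r ‖v - y‖ := lt_max_of_lt_left hr
      rw [abs_of_nonneg (by positivity)]
  have k1 := key x x; have k2 := key x x'; have k3 := key x' x; have k4 := key x' x'
  have hsum := ((k1.1.norm.add k2.1.norm).add k3.1.norm).add k4.1.norm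
  have h1 := (Measure.quasiMeasurePreserving_snd (μ := (volume : Measure E3))
      (ν := (volume : Measure E3))).ae hfA
  have h2 := (quasiMeasurePreserving_shear_snd ε).ae hwB
  rw [← Measure.volume_eq_prod] at h1
  have hle : ∀ᵐ p : E3 × E3, ‖corrIntegrand q ε f w p‖ ≤ (((fun p : E3 × E3 => ‖corrIntegrand q ε (fun y => A * ‖x - y‖ ^ (-a))
      (fun y => B * (max r ‖x - y‖) ^ (-b)) p‖) +
      (fun p : E3 × E3 => ‖corrIntegrand q ε (fun y => A * ‖x - y‖ ^ (-a))
      (fun y => B * (max r ‖x' - y‖) ^ (-b)) p‖) +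
      (fun p : E3 × E3 => ‖corrIntegrand q ε (fun y => A * ‖x' - y‖ ^ (-a))
      (fun y => B * (max r ‖x - y‖) ^ (-b)) p‖)) +
      (fun p : E3 × E3 => ‖corrIntegrand q ε (fun y => A * ‖x' - y‖ ^ (-a))
      (fun y => B * (max r ‖x' - y‖) ^ (-b)) p‖)) p := by
    filter_upwards [h1, h2] with p hp1 hp2
    have m1 : 0 < max r ‖x - (p.2 + ε • p.1)‖ := lt_max_of_lt_left hr
    have m2 : 0 < max r ‖x' - (p.2 + ε • p.1)‖ := lt_max_of_lt_left hr
    simp only [corrIntegrand, Pi.add_apply, Real.norm_eq_abs, abs_mul, abs_of_nonneg (hq.nonneg _)]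
    rw [← mul_add, ← mul_add, ← mul_add]
    refine mul_le_mul_of_nonneg_left ?_ (hq.nonneg _)
    refine (mul_le_mul hp1 hp2 (abs_nonneg _) (by positivity)).trans (le_of_eq ?_)
    rw [abs_of_nonneg hA, abs_of_nonneg hB, abs_of_nonneg (by positivity),
      abs_of_nonneg (by positivity), abs_of_nonneg (by positivity), abs_of_nonneg (by positivity)]
    ring
  have hint : Integrable (corrIntegrand q ε f w) :=
    hsum.mono' (aestronglyMeasurable_corrIntegrand hq ε hf hw) hle
  refine ⟨hint, abs_integral_le_integral_abs.trans ((integral_mono_ae hint.norm hsum hle).trans ?_)⟩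
  rw [integral_add' ((k1.1.norm.add k2.1.norm).add k3.1.norm) k4.1.norm,
    integral_add' (k1.1.norm.add k2.1.norm) k3.1.norm, integral_add' k1.1.norm k2.1.norm]
  simp only [Real.norm_eq_abs]
  linarith [k1.2, k2.2, k3.2, k4.2]

/-- A family of functions `f x` with a singularity of order `-2` at `x`. -/
structure SingFam (X : Set E3) (β C : ℝ) (f : E3 → E3 → ℝ) : Prop where
  nonneg : 0 ≤ C
  meas : ∀ x ∈ X, AEStronglyMeasurable (f x)
  bound : ∀ x ∈ X, ∀ᵐ y, |f x y| ≤ C * ‖x - y‖ ^ (-2 : ℝ)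
  holder : ∀ x ∈ X, ∀ x' ∈ X, ∀ᵐ y, |f x y - f x' y| ≤
    C * ‖x - x'‖ ^ β * (‖x - y‖ ^ (-(2 + β)) + ‖x' - y‖ ^ (-(2 + β)))

/-- A family of functions `w x` with a singularity of order `-2` at `x` cut off at scale `r x`. -/
structure RegFam (X : Set E3) (r : E3 → ℝ) (β C : ℝ) (w : E3 → E3 → ℝ) : Prop where
  nonneg : 0 ≤ C
  pos : ∀ x ∈ X, 0 < r x
  meas : ∀ x ∈ X, AEStronglyMeasurable (w x)
  bound : ∀ x ∈ X, ∀ᵐ y, |w x y| ≤ C * (max (r x) ‖x - y‖) ^ (-2 : ℝ)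
  holder : ∀ x ∈ X, ∀ x' ∈ X, ∀ᵐ y, |w x y - w x' y| ≤
    C * ‖x - x'‖ ^ β * ((max (r x) ‖x - y‖) ^ (-(2 + β)) + (max (r x') ‖x' - y‖) ^ (-(2 + β)))

theorem ae_ne_E3 (x : E3) : ∀ᵐ y : E3, y ≠ x := by
  simp [ae_iff, measure_singleton]

theorem max_rpow_le {r s b : ℝ} (hs : 0 < s) (hb : 0 ≤ b) : (max r s) ^ (-b) ≤ s ^ (-b) :=
  Real.rpow_le_rpow_of_nonpos hs (le_max_right _ _) (by linarith)

theorem max_rpow_mono {r r' s b : ℝ} (hr : 0 < r) (h : r ≤ r') (hb : 0 ≤ b) :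
    (max r' s) ^ (-b) ≤ (max r s) ^ (-b) :=
  Real.rpow_le_rpow_of_nonpos (lt_max_of_lt_left hr) (max_le_max_right _ h) (by linarith)

theorem RegFam.singFam {X : Set E3} {r : E3 → ℝ} {β C : ℝ} {w : E3 → E3 → ℝ} (hβ : 0 ≤ β)
    (h : RegFam X r β C w) : SingFam X β C w where
  nonneg := h.nonneg
  meas := h.meas
  bound x hx := by
    filter_upwards [h.bound x hx, ae_ne_E3 x] with y hy hne
    have : 0 < ‖x - y‖ := norm_pos_iff.2 (sub_ne_zero.2 hne.symm)
    exact hy.trans (mul_le_mul_of_nonneg_left (max_rpow_le this zero_le_two) h.nonneg)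
  holder x hx x' hx' := by
    filter_upwards [h.holder x hx x' hx', ae_ne_E3 x, ae_ne_E3 x'] with y hy hne hne'
    have h1 : 0 < ‖x - y‖ := norm_pos_iff.2 (sub_ne_zero.2 hne.symm)
    have h2 : 0 < ‖x' - y‖ := norm_pos_iff.2 (sub_ne_zero.2 hne'.symm)
    have hC := h.nonneg
    exact hy.trans (mul_le_mul_of_nonneg_left (add_le_add (max_rpow_le h1 (by linarith))
      (max_rpow_le h2 (by linarith))) (by positivity))

theorem SingFam.add {X : Set E3} {β C C' : ℝ} {f g : E3 → E3 → ℝ}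
    (hf : SingFam X β C f) (hg : SingFam X β C' g) :
    SingFam X β (C + C') (fun x y => f x y + g x y) where
  nonneg := add_nonneg hf.nonneg hg.nonneg
  meas x hx := (hf.meas x hx).add (hg.meas x hx)
  bound x hx := by
    filter_upwards [hf.bound x hx, hg.bound x hx] with y h1 h2
    linarith [abs_add_le (f x y) (g x y)]
  holder x hx x' hx' := by
    filter_upwards [hf.holder x hx x' hx', hg.holder x hx x' hx'] with y h1 h2
    have := abs_add_le (f x y - f x' y) (g x y - g x' y)
    rw [add_sub_add_comm]
    linarith

theorem SingFam.const_mul {X : Set E3} {β C : ℝ} {f : E3 → E3 → ℝ}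
    (hf : SingFam X β C f) (c : ℝ) : SingFam X β (|c| * C) (fun x y => c * f x y) where
  nonneg := mul_nonneg (abs_nonneg _) hf.nonneg
  meas x hx := (hf.meas x hx).const_mul c
  bound x hx := by
    filter_upwards [hf.bound x hx] with y h1
    rw [abs_mul, mul_assoc]
    exact mul_le_mul_of_nonneg_left h1 (abs_nonneg _)
  holder x hx x' hx' := by
    filter_upwards [hf.holder x hx x' hx'] with y h1
    rw [← mul_sub, abs_mul, mul_assoc, mul_assoc]
    rw [mul_assoc] at h1
    exact mul_le_mul_of_nonneg_left h1 (abs_nonneg _)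

theorem RegFam.add {X : Set E3} {r : E3 → ℝ} {β C C' : ℝ} {f g : E3 → E3 → ℝ}
    (hf : RegFam X r β C f) (hg : RegFam X r β C' g) :
    RegFam X r β (C + C') (fun x y => f x y + g x y) where
  nonneg := add_nonneg hf.nonneg hg.nonneg
  pos := hf.pos
  meas x hx := (hf.meas x hx).add (hg.meas x hx)
  bound x hx := by
    filter_upwards [hf.bound x hx, hg.bound x hx] with y h1 h2
    linarith [abs_add_le (f x y) (g x y)]
  holder x hx x' hx' := by
    filter_upwards [hf.holder x hx x' hx', hg.holder x hx x' hx'] with y h1 h2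
    have := abs_add_le (f x y - f x' y) (g x y - g x' y)
    rw [add_sub_add_comm]
    linarith

theorem RegFam.neg {X : Set E3} {r : E3 → ℝ} {β C : ℝ} {f : E3 → E3 → ℝ}
    (hf : RegFam X r β C f) : RegFam X r β C (fun x y => -f x y) where
  nonneg := hf.nonneg
  pos := hf.pos
  meas x hx := (hf.meas x hx).neg
  bound x hx := by simpa only [abs_neg] using hf.bound x hx
  holder x hx x' hx' := by
    filter_upwards [hf.holder x hx x' hx'] with y h1
    rwa [neg_sub_neg, abs_sub_comm]

theorem RegFam.sum {ι : Type*} (s : Finset ι) {X : Set E3} {r : E3 → ℝ} {β : ℝ} {C : ι → ℝ}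
    {f : ι → E3 → E3 → ℝ} (hr : ∀ x ∈ X, 0 < r x) (hf : ∀ i ∈ s, RegFam X r β (C i) (f i)) :
    RegFam X r β (∑ i ∈ s, C i) (fun x y => ∑ i ∈ s, f i x y) := by
  classical
  induction s using Finset.induction_on with
  | empty =>
    refine ⟨by simp, hr, fun x _ => ?_, fun x _ => ?_, fun x _ x' _ => ?_⟩
    · simpa using aestronglyMeasurable_const
    · simp
    · simp
  | insert i s his ih =>
    simp only [Finset.sum_insert his]
    exact (hf i (Finset.mem_insert_self _ _)).add
      (ih fun j hj => hf j (Finset.mem_insert_of_mem hj))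

/-! ### Correlation estimates for families -/

section
variable {X : Set E3} {r : E3 → ℝ} {β C C' : ℝ} {f w : E3 → E3 → ℝ} {q : E3 → ℝ}

theorem SingFam.integrable_corr (hq : CorrWeight q) (hf : SingFam X β C f)
    (hw : RegFam X r β C' w) (ε : ℝ) {x : E3} (hx : x ∈ X) :
    Integrable (corrIntegrand q ε (f x) (w x)) :=
  integrable_corrIntegrand hq ε zero_le_two (by norm_num) zero_le_two (by norm_num) (hw.pos x hx)
    hf.nonneg hw.nonneg (hf.meas x hx) (hw.meas x hx) x x (hf.bound x hx) (hw.bound x hx)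

theorem SingFam.abs_corr_le (hq : CorrWeight q) (hf : SingFam X β C f)
    (hw : RegFam X r β C' w) (ε : ℝ) {x : E3} (hx : x ∈ X) :
    |corr q ε (f x) (w x)| ≤ C * C' * corrConst 2 2 * (r x) ^ (-1 : ℝ) := by
  have := _root_.abs_corr_le hq ε zero_le_two (by norm_num) zero_le_two (by norm_num) (hw.pos x hx)
    hf.nonneg hw.nonneg (hf.meas x hx) (hw.meas x hx) x x (hf.bound x hx) (hw.bound x hx)
  norm_num at this ⊢
  exact this

/-- Telescoping: the singular function is moved from `x` to `x'` with the regular one kept at `x`,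
and then the regular one is moved. Either move raises one order from `2` to `2 + β`, so both terms
have homogeneity `3 - 2 - (2 + β) = -1 - β`; `β < 1` keeps the singular order below `3`. -/
theorem SingFam.abs_corr_sub_le (hq : CorrWeight q) (hβ : 0 < β) (hβ1 : β < 1)
    (hf : SingFam X β C f) (hw : RegFam X r β C' w) (ε : ℝ) {x x' : E3} (hx : x ∈ X) (hx' : x' ∈ X) :
    |corr q ε (f x) (w x) - corr q ε (f x') (w x')| ≤
      4 * (C * C' * (corrConst (2 + β) 2 + corrConst 2 (2 + β))) *
        ‖x - x'‖ ^ β * (min (r x) (r x')) ^ (-1 - β) := by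
  set R := min (r x) (r x') with hR
  have hRpos : 0 < R := lt_min (hw.pos x hx) (hw.pos x' hx')
  have hC := hf.nonneg
  have hC' := hw.nonneg
  have bw : ∀ u ∈ X, R ≤ r u → ∀ᵐ y, |w u y| ≤ C' * (max R ‖u - y‖) ^ (-2 : ℝ) := by
    intro u hu hRu
    filter_upwards [hw.bound u hu] with y hy
    exact hy.trans (mul_le_mul_of_nonneg_left (max_rpow_mono hRpos hRu zero_le_two) hC')
  have hposm : ∀ u y : E3, 0 < max R ‖u - y‖ := fun u y => lt_max_of_lt_left hRpos
  have g1 := corr_two_centres hq ε (a := 2 + β) (b := 2) (r := R) (A := C * ‖x - x'‖ ^ β) (B := C')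
    (by linarith) (by linarith) zero_le_two (by linarith) hRpos (by positivity) hC'
    ((hf.meas x hx).sub (hf.meas x' hx')) (hw.meas x hx) x x' (hf.holder x hx x' hx')
    (by
      filter_upwards [bw x hx (min_le_left _ _)] with y hy
      refine hy.trans (mul_le_mul_of_nonneg_left ?_ hC')
      have := hposm x' y
      exact le_add_of_nonneg_right (by positivity))
  have g2 := corr_two_centres hq ε (a := 2) (b := 2 + β) (r := R) (A := C) (B := C' * ‖x - x'‖ ^ β)
    zero_le_two (by norm_num) (by linarith) (by linarith) hRpos hC (by positivity)
    (hf.meas x' hx') ((hw.meas x hx).sub (hw.meas x' hx')) x x'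
    (by
      filter_upwards [hf.bound x' hx'] with y hy
      refine hy.trans (mul_le_mul_of_nonneg_left ?_ hC)
      exact le_add_of_nonneg_left (by positivity))
    (by
      filter_upwards [hw.holder x hx x' hx'] with y hy
      refine hy.trans (mul_le_mul_of_nonneg_left (add_le_add ?_ ?_) (by positivity))
      · exact max_rpow_mono hRpos (min_le_left _ _) (by linarith)
      · exact max_rpow_mono hRpos (min_le_right _ _) (by linarith))
  -- In the mixed term the two functions have different centres, which the basic estimate allows.
  have hx'w : Integrable (corrIntegrand q ε (f x') (w x)) := by
    refine integrable_corrIntegrand hq ε (a := 2) (b := 2) zero_le_two (by norm_num) zero_le_two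
      (by norm_num) (hw.pos x hx) hf.nonneg hw.nonneg (hf.meas x' hx') (hw.meas x hx) x' x
      (hf.bound x' hx') (hw.bound x hx)
  have e1 := corr_sub_left (hf.integrable_corr hq hw ε hx) hx'w
  have e2 := corr_sub_right hx'w (hf.integrable_corr hq hw ε hx')
  have e3 : (3 - (2 + β) - 2 : ℝ) = -1 - β := by ring
  have e4 : (3 - 2 - (2 + β) : ℝ) = -1 - β := by ring
  have b1 := g1.2
  have b2 := g2.2
  rw [e3] at b1
  rw [e4] at b2
  have e5 : corr q ε (f x) (w x) - corr q ε (f x') (w x') =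
      corr q ε (f x - f x') (w x) + corr q ε (f x') (w x - w x') := by rw [e1, e2]; ring
  rw [e5]
  refine (abs_add_le _ _).trans ((add_le_add b1 b2).trans (le_of_eq ?_))
  ring

/-! ### Convergence of correlations -/

theorem CorrWeight.exists_radius {q : E3 → ℝ} (hq : CorrWeight q) :
    ∃ M, 0 < M ∧ ∀ z, q z ≠ 0 → ‖z‖ ≤ M := by
  obtain ⟨M, hM⟩ := hq.compact.isBounded.subset_closedBall (0 : E3)
  refine ⟨max M 1, by positivity, fun z hz => ?_⟩
  have := hM (subset_tsupport _ hz)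
  exact (mem_closedBall_zero_iff.1 this).trans (le_max_left _ _)

/-- Dominated convergence. For `|ε| ≤ 1` and `z` in the support of `q`, a ball of radius `M`, the
shift by `εz` changes `max r ‖x - y‖` by a factor of at most `L = 1 + M / r`, which gives a majorant
free of `ε`. Only `w` is evaluated at the shifted point, so continuity of the regular factor is
enough. -/
theorem tendsto_corr {q f w : E3 → ℝ} (hq : CorrWeight q) {r A B : ℝ} (hr : 0 < r)
    (hA : 0 ≤ A) (hB : 0 ≤ B) (hf : AEStronglyMeasurable f) (hw : AEStronglyMeasurable w)
    (x : E3) (hfA : ∀ᵐ y, |f y| ≤ A * ‖x - y‖ ^ (-2 : ℝ))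
    (hwB : ∀ᵐ y, |w y| ≤ B * (max r ‖x - y‖) ^ (-2 : ℝ)) (hc : ∀ᵐ y, ContinuousAt w y) :
    Tendsto (fun ε => corr q ε f w) (𝓝 0) (𝓝 (corr q 0 f w)) := by
  obtain ⟨M, hM, hMq⟩ := hq.exists_radius
  set L := 1 + M / r with hL
  have hLpos : 0 < L := by positivity
  have hbd : Integrable (corrIntegrand q 0 (fun y => A * ‖x - y‖ ^ (-2 : ℝ))
      (fun y => (B * L ^ (2 : ℝ)) * (max r ‖x - y‖) ^ (-2 : ℝ))) := by
    refine integrable_corrIntegrand hq 0 (a := 2) (b := 2) zero_le_two (by norm_num) zero_le_two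
      (by norm_num) hr hA (B := B * L ^ (2 : ℝ)) (by positivity)
      ((aestronglyMeasurable_norm_sub_rpow x 2).const_mul A)
      ((aestronglyMeasurable_max_norm_sub_rpow r x 2).const_mul _) x x
      (Eventually.of_forall fun y => ?_) (Eventually.of_forall fun y => ?_)
    · rw [abs_of_nonneg (by positivity)]
    · have : 0 < max r ‖x - y‖ := lt_max_of_lt_left hr
      rw [abs_of_nonneg (by positivity)]
  refine tendsto_integral_filter_of_dominated_convergence _
    (Eventually.of_forall fun ε => aestronglyMeasurable_corrIntegrand hq ε hf hw) ?_ hbd ?_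
  · have hε : ∀ᶠ ε : ℝ in 𝓝 0, |ε| ≤ 1 := by
      have := Metric.closedBall_mem_nhds (0 : ℝ) one_pos
      filter_upwards [this] with ε h
      simpa using h
    filter_upwards [hε] with ε hε
    have h1 := (Measure.quasiMeasurePreserving_snd (μ := (volume : Measure E3))
      (ν := (volume : Measure E3))).ae hfA
    have h2 := (quasiMeasurePreserving_shear_snd ε).ae hwB
    rw [← Measure.volume_eq_prod] at h1
    filter_upwards [h1, h2] with p hp1 hp2
    simp only [corrIntegrand, Real.norm_eq_abs, abs_mul, abs_of_nonneg (hq.nonneg _), zero_smul,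
      add_zero]
    by_cases hz : q p.1 = 0
    · simp [hz]
    refine mul_le_mul_of_nonneg_left ?_ (hq.nonneg _)
    refine mul_le_mul hp1 (hp2.trans ?_) (abs_nonneg _) (by positivity)
    rw [mul_assoc]
    refine mul_le_mul_of_nonneg_left ?_ hB
    have m1 : 0 < max r ‖x - (p.2 + ε • p.1)‖ := lt_max_of_lt_left hr
    have m2 : 0 < max r ‖x - p.2‖ := lt_max_of_lt_left hr
    have h3 : max r ‖x - p.2‖ ≤ L * max r ‖x - (p.2 + ε • p.1)‖ := by
      have hrm : r ≤ max r ‖x - (p.2 + ε • p.1)‖ := le_max_left _ _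
      have h4 : ‖x - p.2‖ ≤ ‖x - (p.2 + ε • p.1)‖ + M := by
        have h5 : x - p.2 = (x - (p.2 + ε • p.1)) + ε • p.1 := by abel
        have h6 : ‖ε • p.1‖ ≤ M := by
          rw [norm_smul, Real.norm_eq_abs]
          nlinarith [hMq _ hz, norm_nonneg p.1, abs_nonneg ε]
        calc ‖x - p.2‖ = ‖(x - (p.2 + ε • p.1)) + ε • p.1‖ := by rw [← h5]
          _ ≤ _ := (norm_add_le _ _).trans (by linarith)
      have h7 : M ≤ M / r * max r ‖x - (p.2 + ε • p.1)‖ := by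
        rw [div_mul_eq_mul_div, le_div_iff₀ hr]
        exact mul_le_mul_of_nonneg_left hrm hM.le
      have h8 : 0 ≤ M / r * max r ‖x - (p.2 + ε • p.1)‖ := by positivity
      refine max_le ?_ ?_
      · rw [hL, add_mul, one_mul]; linarith
      · rw [hL, add_mul, one_mul]
        linarith [le_max_right r ‖x - (p.2 + ε • p.1)‖]
    calc (max r ‖x - (p.2 + ε • p.1)‖) ^ (-2 : ℝ)
        = L ^ (2 : ℝ) * (L * max r ‖x - (p.2 + ε • p.1)‖) ^ (-2 : ℝ) := by
          rw [Real.mul_rpow hLpos.le m1.le, ← mul_assoc, ← Real.rpow_add hLpos]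
          norm_num
      _ ≤ _ := mul_le_mul_of_nonneg_left
          (Real.rpow_le_rpow_of_nonpos m2 h3 (by norm_num)) (by positivity)
  · have h1 := (Measure.quasiMeasurePreserving_snd (μ := (volume : Measure E3))
      (ν := (volume : Measure E3))).ae hc
    rw [← Measure.volume_eq_prod] at h1
    filter_upwards [h1] with p hp
    have h2 : Tendsto (fun ε : ℝ => p.2 + ε • p.1) (𝓝 0) (𝓝 (p.2 + (0 : ℝ) • p.1)) :=
      (Continuous.tendsto (by fun_prop) 0)
    have h3 : Tendsto w (𝓝 (p.2 + (0 : ℝ) • p.1)) (𝓝 (w (p.2 + (0 : ℝ) • p.1))) := by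
      rw [zero_smul, add_zero]; exact hp
    exact ((h3.comp h2).const_mul (f p.2)).const_mul (q p.1)

/-! ### Correlations of two singular functions -/

theorem measurePreserving_shear_fst (δ : ℝ) :
    MeasurePreserving (fun p : E3 × E3 => (p.1 + δ • p.2, p.2)) volume volume := by
  have h := (Measure.measurePreserving_swap (μ := (volume : Measure E3)) (ν := (volume : Measure E3)))
  have h2 := measurePreserving_shear δ
  exact (h.comp (h2.comp h))

theorem norm_rpow_split (v : E3) (a : ℝ) :
    ‖v‖ ^ (-a) ≤ coreFn 1 a v + (max 1 ‖v‖) ^ (-a) := by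
  by_cases hv : ‖v‖ ≤ 1
  · have : v ∈ Metric.closedBall (0 : E3) 1 := by simpa using hv
    rw [coreFn, indicator_of_mem this]
    exact le_add_of_nonneg_right (by positivity)
  · push Not at hv
    rw [max_eq_right hv.le]
    exact le_add_of_nonneg_left (coreFn_nonneg _ _ _)

theorem coreFn_le (r a : ℝ) (v : E3) : coreFn r a v ≤ ‖v‖ ^ (-a) :=
  indicator_le_self' (fun _ _ => by positivity) v

/-- At fixed `ε > 0` the averaging over `z` makes even two order `-2` singularities at the same
point correlate finitely. Each is split into a core in the unit ball and a bounded tail. Terms with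
a tail fall under the basic estimate with `r = 1`; for the product of the cores, `q` is bounded and
integration in `z` smooths one of the two. The constant depends on `ε`, so this serves only for
statements at a fixed `ε`. -/
theorem exists_corr_sing_bound {q : E3 → ℝ} (hq : CorrWeight q) {ε : ℝ} (hε : 0 < ε) :
    ∃ C, 0 ≤ C ∧ ∀ (x : E3) (f g : E3 → ℝ) (A B : ℝ), 0 ≤ A → 0 ≤ B →
      AEStronglyMeasurable f → AEStronglyMeasurable g →
      (∀ᵐ y, |f y| ≤ A * ‖x - y‖ ^ (-2 : ℝ)) → (∀ᵐ y, |g y| ≤ B * ‖x - y‖ ^ (-2 : ℝ)) →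
      Integrable (corrIntegrand q ε f g) ∧ |corr q ε f g| ≤ A * B * C := by
  obtain ⟨Q, hQ⟩ := hq.continuous.bounded_above_of_compact_support hq.compact
  have hQ0 : 0 ≤ Q := (norm_nonneg _).trans (hQ 0)
  set I := ∫ z : E3, coreFn 1 2 (-ε • z)
  refine ⟨2 * corrConst 2 2 + Q * (I * coreConst 2), ?_, ?_⟩
  · have := corrConst_nonneg 2 2
    have : 0 ≤ I := integral_nonneg fun _ => coreFn_nonneg _ _ _
    have := coreConst_nonneg 2
    positivity
  intro x f g A B hA hB hf hg hfA hgB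
  have hm1 : AEStronglyMeasurable (fun y : E3 => coreFn 1 2 (x - y)) :=
    ((integrable_coreFn 1 (by norm_num : (2 : ℝ) < 3)).comp_sub_left x).aestronglyMeasurable
  have hm2 := aestronglyMeasurable_max_norm_sub_rpow 1 x 2
  have hm3 := aestronglyMeasurable_norm_sub_rpow x 2
  have k1 := integrable_corrIntegrand_and_bound hq ε (a := 2) (b := 2) (r := 1) (A := 1) (B := 1)
    zero_le_two (by norm_num) zero_le_two (by norm_num) one_pos zero_le_one zero_le_one hm3 hm2 x x
    (Eventually.of_forall fun y => by rw [abs_of_nonneg (by positivity), one_mul])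
    (Eventually.of_forall fun y => by rw [abs_of_nonneg (by positivity), one_mul])
  have k2 := integrable_corrIntegrand_and_bound hq ε (a := 2) (b := 2) (r := 1) (A := 1) (B := 1)
    zero_le_two (by norm_num) zero_le_two (by norm_num) one_pos zero_le_one zero_le_one hm1 hm2 x x
    (Eventually.of_forall fun y => by
      rw [abs_of_nonneg (coreFn_nonneg _ _ _), one_mul]; exact coreFn_le _ _ _)
    (Eventually.of_forall fun y => by rw [abs_of_nonneg (by positivity), one_mul])
  have k2' := integrable_corrIntegrand_swap hq k2.1
  have k2b : ∫ p, |corrIntegrand q ε (fun y => (max 1 ‖x - y‖) ^ (-2 : ℝ))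
      (fun y => coreFn 1 2 (x - y)) p| = ∫ p, |corrIntegrand q ε (fun y => coreFn 1 2 (x - y))
        (fun y => (max 1 ‖x - y‖) ^ (-2 : ℝ)) p| := by
    have e : ∀ p, |corrIntegrand q ε (fun y => (max 1 ‖x - y‖) ^ (-2 : ℝ))
      (fun y => coreFn 1 2 (x - y)) p| = corrIntegrand q ε (fun y => (max 1 ‖x - y‖) ^ (-2 : ℝ))
      (fun y => coreFn 1 2 (x - y)) p := fun p => abs_of_nonneg
        (mul_nonneg (hq.nonneg _) (mul_nonneg (by positivity) (coreFn_nonneg _ _ _)))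
    have e' : ∀ p, |corrIntegrand q ε (fun y => coreFn 1 2 (x - y))
        (fun y => (max 1 ‖x - y‖) ^ (-2 : ℝ)) p| = corrIntegrand q ε (fun y => coreFn 1 2 (x - y))
        (fun y => (max 1 ‖x - y‖) ^ (-2 : ℝ)) p := fun p => abs_of_nonneg
        (mul_nonneg (hq.nonneg _) (mul_nonneg (coreFn_nonneg _ _ _) (by positivity)))
    simp_rw [e, e']
    exact corr_swap hq hm2 hm1
  -- the product of the two cores
  have hc1 : Integrable (coreFn 1 2) := integrable_coreFn 1 (by norm_num)
  have hg1 : Integrable fun z : E3 => coreFn 1 2 (-ε • z) :=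
    hc1.comp_smul (neg_ne_zero.2 hε.ne')
  have hprod' : Integrable fun p : E3 × E3 => coreFn 1 2 (-ε • p.1) * coreFn 1 2 (x - p.2) :=
    hg1.mul_prod (hc1.comp_sub_left x)
  -- The substitution `z ↦ z + ε⁻¹(y - x)` turns `x - (y + εz)` into `-εz`, which decouples the two
  -- cores.
  have hmp := (((measurePreserving_add_right (volume : Measure E3) (-(ε⁻¹ • x))).prod
      (MeasurePreserving.id (volume : Measure E3))).comp (measurePreserving_shear_fst ε⁻¹))
  have hk4 : Integrable fun p : E3 × E3 =>
      coreFn 1 2 (x - (p.2 + ε • p.1)) * coreFn 1 2 (x - p.2) := by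
    refine (hmp.integrable_comp_of_integrable hprod').congr (Eventually.of_forall fun p => ?_)
    simp only [Function.comp_apply, Prod.map, id]
    congr 2
    simp only [smul_add, smul_neg, neg_smul, smul_inv_smul₀ hε.ne']
    abel
  have hk4v : ∫ p : E3 × E3, coreFn 1 2 (x - (p.2 + ε • p.1)) * coreFn 1 2 (x - p.2) =
      I * coreConst 2 := by
    have e1 : ∫ p : E3 × E3, coreFn 1 2 (-ε • p.1) * coreFn 1 2 (x - p.2) = I * coreConst 2 := by
      rw [Measure.volume_eq_prod, integral_prod_mul (fun z : E3 => coreFn 1 2 (-ε • z))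
        (fun y : E3 => coreFn 1 2 (x - y)), integral_sub_left_eq_self (coreFn 1 2) volume x]
      rfl
    rw [← e1]
    have h2 := integral_map (μ := volume)
      hmp.measurable.aemeasurable (f := fun p : E3 × E3 => coreFn 1 2 (-ε • p.1) * coreFn 1 2 (x - p.2))
      (by rw [hmp.map_eq]; exact hprod'.aestronglyMeasurable)
    rw [hmp.map_eq] at h2
    rw [Measure.volume_eq_prod] at h2 ⊢
    rw [h2]
    refine integral_congr_ae (Eventually.of_forall fun p => ?_)
    simp only [Function.comp_apply, Prod.map, id]
    congr 2
    simp only [smul_add, smul_neg, neg_smul, smul_inv_smul₀ hε.ne']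
    abel
  have hsum := ((k1.1.norm.add k2'.norm).add (hk4.const_mul Q)).const_mul (A * B)
  have h1 := (Measure.quasiMeasurePreserving_snd (μ := (volume : Measure E3))
      (ν := (volume : Measure E3))).ae hfA
  have h2 := (quasiMeasurePreserving_shear_snd ε).ae hgB
  rw [← Measure.volume_eq_prod] at h1
  have hle : ∀ᵐ p : E3 × E3, ‖corrIntegrand q ε f g p‖ ≤ A * B *
      ((((fun p => ‖corrIntegrand q ε (fun y => ‖x - y‖ ^ (-2 : ℝ))
      (fun y => (max 1 ‖x - y‖) ^ (-2 : ℝ)) p‖) + (fun p => ‖corrIntegrand q ε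
        (fun y => (max 1 ‖x - y‖) ^ (-2 : ℝ)) (fun y => coreFn 1 2 (x - y)) p‖)) +
      fun p : E3 × E3 => Q * (coreFn 1 2 (x - (p.2 + ε • p.1)) * coreFn 1 2 (x - p.2))) p) := by
    filter_upwards [h1, h2] with p hp1 hp2
    simp only [corrIntegrand, Pi.add_apply, Real.norm_eq_abs, abs_mul, abs_of_nonneg (hq.nonneg _)]
    have a1 := norm_rpow_split (x - p.2) 2
    have a2 := norm_rpow_split (x - (p.2 + ε • p.1)) 2
    set s := ‖x - p.2‖ ^ (-2 : ℝ) with hs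
    set t := ‖x - (p.2 + ε • p.1)‖ ^ (-2 : ℝ) with ht
    set s1 := coreFn 1 2 (x - p.2) with hs1
    set t1 := coreFn 1 2 (x - (p.2 + ε • p.1)) with ht1
    set s2 := (max 1 ‖x - p.2‖) ^ (-2 : ℝ) with hs2
    set t2 := (max 1 ‖x - (p.2 + ε • p.1)‖) ^ (-2 : ℝ) with ht2
    have p1 : 0 ≤ s := by positivity
    have p2 : 0 ≤ t := by positivity
    have p3 : 0 ≤ s1 := coreFn_nonneg _ _ _
    have p4 : 0 ≤ t1 := coreFn_nonneg _ _ _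
    have p5 : 0 ≤ s2 := by positivity
    have p6 : 0 ≤ t2 := by positivity
    rw [abs_of_nonneg p1, abs_of_nonneg p6, abs_of_nonneg p5, abs_of_nonneg p4]
    have hqQ : q p.1 ≤ Q := (le_abs_self _).trans (hQ p.1)
    have q0 := hq.nonneg p.1
    have c1 : |f p.2| * |g (p.2 + ε • p.1)| ≤ (A * s) * (B * t) :=
      mul_le_mul hp1 hp2 (abs_nonneg _) (by positivity)
    -- The factor `t` is split as `t1 + t2`, and `s` only where it multiplies `t1`: the full
    -- singularity `s` is kept against the tail `t2`, and only the cores meet each other.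
    have c2 : s * t ≤ s * t2 + s2 * t1 + t1 * s1 := by nlinarith
    calc q p.1 * (|f p.2| * |g (p.2 + ε • p.1)|) ≤ q p.1 * ((A * s) * (B * t)) := by gcongr
      _ = A * B * (q p.1 * (s * t)) := by ring
      _ ≤ A * B * (q p.1 * (s * t2 + s2 * t1 + t1 * s1)) := by gcongr
      _ = A * B * (q p.1 * (s * t2) + q p.1 * (s2 * t1) + q p.1 * (t1 * s1)) := by ring
      _ ≤ _ := by gcongr
  have hint : Integrable (corrIntegrand q ε f g) :=
    hsum.mono' (aestronglyMeasurable_corrIntegrand hq ε hf hg) hle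
  refine ⟨hint, abs_integral_le_integral_abs.trans ((integral_mono_ae hint.norm hsum hle).trans ?_)⟩
  rw [integral_const_mul]
  refine mul_le_mul_of_nonneg_left ?_ (by positivity)
  rw [integral_add' (k1.1.norm.add k2'.norm) (hk4.const_mul Q), integral_add' k1.1.norm k2'.norm,
    integral_const_mul, hk4v]
  simp only [Real.norm_eq_abs]
  have b1 := k1.2
  have b2 := k2.2
  rw [k2b]
  simp only [Real.one_rpow, mul_one, one_mul] at b1 b2
  linarith

end

/-! ### Coordinates and reflections -/

theorem norm_le_norm_of_abs_le {a b : E3} (h : ∀ i, |a i| ≤ |b i|) : ‖a‖ ≤ ‖b‖ := by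
  rw [EuclideanSpace.norm_eq, EuclideanSpace.norm_eq]
  refine Real.sqrt_le_sqrt (Finset.sum_le_sum fun i _ => ?_)
  simp only [Real.norm_eq_abs]
  exact pow_le_pow_left₀ (abs_nonneg _) (h i) 2

theorem abs_coord_le_norm (z : E3) (j : Fin 3) : |z j| ≤ ‖z‖ := by
  simpa using PiLp.norm_apply_le z j

theorem continuous_coord (j : Fin 3) : Continuous fun z : E3 => z j := by fun_prop

theorem measurable_coord (j : Fin 3) : Measurable fun z : E3 => z j := (continuous_coord j).measurable

/-- Reflection of the coordinates `i` with `σ i = -1`. -/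
def reflect (σ : Fin 3 → ℤˣ) : E3 ≃ₗᵢ[ℝ] E3 where
  toFun y := WithLp.toLp 2 fun i => ((σ i : ℤ) : ℝ) * y i
  invFun y := WithLp.toLp 2 fun i => ((σ i : ℤ) : ℝ) * y i
  map_add' x y := by ext i; simp [mul_add]
  map_smul' c y := by ext i; simp; ring
  left_inv y := by
    ext i
    rcases Int.units_eq_one_or (σ i) with h | h <;> simp [h]
  right_inv y := by
    ext i
    rcases Int.units_eq_one_or (σ i) with h | h <;> simp [h]
  norm_map' y := by
    simp only [EuclideanSpace.norm_eq]
    congr 1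
    refine Finset.sum_congr rfl fun i _ => ?_
    rcases Int.units_eq_one_or (σ i) with h | h <;> simp [h]

theorem reflect_apply (σ : Fin 3 → ℤˣ) (y : E3) (i : Fin 3) :
    reflect σ y i = ((σ i : ℤ) : ℝ) * y i := rfl

theorem reflect_reflect (σ : Fin 3 → ℤˣ) (y : E3) : reflect σ (reflect σ y) = y :=
  (reflect σ).left_inv y

theorem reflect_one (y : E3) : reflect 1 y = y := by ext i; simp [reflect_apply]

/-- The reflection of the coordinate `i`. -/
def flipSign (i : Fin 3) : Fin 3 → ℤˣ := Pi.mulSingle i (-1)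

theorem reflect_flip_same (i : Fin 3) (y : E3) : reflect (flipSign i) y i = -y i := by
  simp [reflect_apply, flipSign]

theorem reflect_flip_ne {i j : Fin 3} (h : j ≠ i) (y : E3) : reflect (flipSign i) y j = y j := by
  simp [reflect_apply, flipSign, h]

/-! ### The gradient of the Green's function -/

/-- The component `∂_j K` of the gradient of `K(x) = 1 / (4π|x|)`. -/
def kern (j : Fin 3) (z : E3) : ℝ := -(z j) / (4 * Real.pi * ‖z‖ ^ 3)

theorem measurable_kern (j : Fin 3) : Measurable (kern j) :=
  (measurable_coord j).neg.div (measurable_const.mul (measurable_norm.pow_const 3))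

theorem continuousAt_kern (j : Fin 3) {z : E3} (hz : z ≠ 0) : ContinuousAt (kern j) z := by
  refine ContinuousAt.div (by fun_prop) (by fun_prop) ?_
  have := norm_pos_iff.2 hz
  positivity

theorem one_le_four_pi : 1 ≤ 4 * Real.pi := by linarith [Real.pi_gt_three]

theorem abs_kern_le (j : Fin 3) (z : E3) : |kern j z| ≤ ‖z‖ ^ (-2 : ℝ) := by
  rcases eq_or_ne z 0 with rfl | hz
  · simp [kern]
  have h0 := norm_pos_iff.2 hz
  rw [kern, abs_div, abs_neg, abs_of_pos (by positivity : 0 < 4 * Real.pi * ‖z‖ ^ 3),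
    div_le_iff₀ (by positivity)]
  have h1 : ‖z‖ ^ (-2 : ℝ) * (4 * Real.pi * ‖z‖ ^ 3) = 4 * Real.pi * ‖z‖ := by
    rw [Real.rpow_neg h0.le, Real.rpow_two]; field_simp
  rw [h1]
  nlinarith [abs_coord_le_norm z j, one_le_four_pi]

/-- When `d = ‖z - z'‖` is at most `‖z‖`, the difference is at most a multiple of `d / ‖z‖³`, and `d
= d^β d^(1-β) ≤ d^β ‖z‖^(1-β)`. When `d` is larger, the triangle inequality suffices, because
`‖z‖^(-2) ≤ d^β ‖z‖^(-2-β)`. -/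
theorem abs_kern_sub_le_of_le (j : Fin 3) {β : ℝ} (hβ : 0 < β) (hβ1 : β < 1) {z z' : E3}
    (hz : z ≠ 0) (h : ‖z‖ ≤ ‖z'‖) :
    |kern j z - kern j z'| ≤ 2 * ‖z - z'‖ ^ β * ‖z‖ ^ (-(2 + β)) := by
  set a := ‖z‖ with ha
  set b := ‖z'‖ with hb
  set d := ‖z - z'‖ with hd
  have ha0 : 0 < a := norm_pos_iff.2 hz
  have hb0 : 0 < b := ha0.trans_le h
  have hd0 : 0 ≤ d := norm_nonneg _
  by_cases hda : d ≤ a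
  · have h1 : |z j - z' j| ≤ d := by simpa using abs_coord_le_norm (z - z') j
    have h2 : |z' j| ≤ b := abs_coord_le_norm z' j
    have h3 : b - a ≤ d := by
      rw [hd, norm_sub_rev]
      exact norm_sub_norm_le z' z
    -- The numerators are compared with the denominator `a³` kept fixed; the rest is `a⁻³ - b⁻³ = (b
    -- - a)(a² + ab + b²) / (a³b³)`.
    have e1 : kern j z - kern j z' =
        -((z j - z' j) / a ^ 3 + z' j * ((b - a) * (a ^ 2 + a * b + b ^ 2) / (a ^ 3 * b ^ 3)))
          / (4 * Real.pi) := by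
      rw [kern, kern, ← ha, ← hb]
      field_simp
      ring
    have h4 : |z j - z' j| / a ^ 3 ≤ d / a ^ 3 := by gcongr
    have h5 : |z' j| * ((b - a) * (a ^ 2 + a * b + b ^ 2) / (a ^ 3 * b ^ 3)) ≤ 3 * (d / a ^ 3) := by
      have : (b - a) * (a ^ 2 + a * b + b ^ 2) / (a ^ 3 * b ^ 3) ≤ d * (3 * b ^ 2) / (a ^ 3 * b ^ 3) := by
        have h6 : a ^ 2 + a * b + b ^ 2 ≤ 3 * b ^ 2 := by nlinarith
        have h7 : 0 ≤ b - a := by linarith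
        gcongr
      calc _ ≤ b * (d * (3 * b ^ 2) / (a ^ 3 * b ^ 3)) := by
            refine mul_le_mul h2 this ?_ hb0.le
            have h7 : 0 ≤ b - a := by linarith
            positivity
        _ = 3 * (d / a ^ 3) := by field_simp
    have h8 : |kern j z - kern j z'| ≤ 4 * (d / a ^ 3) / (4 * Real.pi) := by
      rw [e1, abs_div, abs_neg, abs_of_pos (by positivity : 0 < 4 * Real.pi)]
      refine div_le_div_of_nonneg_right ?_ (by positivity)
      refine (abs_add_le _ _).trans ?_
      rw [abs_div, abs_mul, abs_of_pos (pow_pos ha0 3)]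
      have h7 : 0 ≤ b - a := by linarith
      rw [abs_of_nonneg (by positivity : 0 ≤ (b - a) * (a ^ 2 + a * b + b ^ 2) / (a ^ 3 * b ^ 3))]
      linarith
    have h9 : 4 * (d / a ^ 3) / (4 * Real.pi) ≤ 2 * (d / a ^ 3) := by
      rw [div_le_iff₀ (by positivity)]
      have : 0 ≤ d / a ^ 3 := by positivity
      nlinarith [Real.pi_gt_three]
    have h10 : d / a ^ 3 ≤ d ^ β * a ^ (-(2 + β)) := by
      rcases hd0.eq_or_lt with h0 | h0
      · rw [← h0, zero_div]; positivity
      have e2 : d = d ^ β * d ^ (1 - β) := by rw [← Real.rpow_add h0]; simp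
      have e3 : a ^ (-(2 + β)) = a ^ (1 - β) * (a ^ 3)⁻¹ := by
        rw [← Real.rpow_natCast a 3, ← Real.rpow_neg ha0.le, ← Real.rpow_add ha0]
        norm_num; ring_nf
      have h11 : d ^ (1 - β) ≤ a ^ (1 - β) := Real.rpow_le_rpow hd0 hda (by linarith)
      rw [e3, ← mul_assoc, div_eq_mul_inv]
      refine mul_le_mul_of_nonneg_right ?_ (by positivity)
      calc d = d ^ β * d ^ (1 - β) := e2
        _ ≤ _ := by gcongr
    calc _ ≤ 2 * (d / a ^ 3) := h8.trans h9
      _ ≤ 2 * (d ^ β * a ^ (-(2 + β))) := by gcongr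
      _ = _ := by ring
  · push Not at hda
    have h1 := abs_kern_le j z
    have h2 := abs_kern_le j z'
    have h3 : b ^ (-2 : ℝ) ≤ a ^ (-2 : ℝ) := Real.rpow_le_rpow_of_nonpos ha0 h (by norm_num)
    have h4 : a ^ (-2 : ℝ) ≤ d ^ β * a ^ (-(2 + β)) := by
      have h5 : a ^ β ≤ d ^ β := Real.rpow_le_rpow ha0.le hda.le hβ.le
      calc a ^ (-2 : ℝ) = a ^ β * a ^ (-(2 + β)) := by rw [← Real.rpow_add ha0]; ring_nf
        _ ≤ _ := by gcongr
    have h6 := abs_sub (kern j z) (kern j z')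
    linarith

theorem abs_kern_sub_le (j : Fin 3) {β : ℝ} (hβ : 0 < β) (hβ1 : β < 1) {z z' : E3}
    (hz : z ≠ 0) (hz' : z' ≠ 0) :
    |kern j z - kern j z'| ≤ 2 * ‖z - z'‖ ^ β * (‖z‖ ^ (-(2 + β)) + ‖z'‖ ^ (-(2 + β))) := by
  rcases le_total ‖z‖ ‖z'‖ with h | h
  · refine (abs_kern_sub_le_of_le j hβ hβ1 hz h).trans ?_
    gcongr
    exact le_add_of_nonneg_right (by positivity)
  · rw [abs_sub_comm, norm_sub_rev]
    refine (abs_kern_sub_le_of_le j hβ hβ1 hz' h).trans ?_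
    gcongr
    exact le_add_of_nonneg_left (by positivity)

/-- The reflected kernel, restricted to a region. -/
def imageKern (j : Fin 3) (σ : Fin 3 → ℤˣ) (A : Set E3) (x y : E3) : ℝ :=
  A.indicator (fun y => kern j (x - reflect σ y)) y

theorem measurable_imageKern (j : Fin 3) (σ : Fin 3 → ℤˣ) {A : Set E3} (hA : MeasurableSet A)
    (x : E3) : Measurable (imageKern j σ A x) :=
  ((measurable_kern j).comp
    (measurable_const.sub (reflect σ).continuous.measurable)).indicator hA

/-- Reflection moves `y` away from `x` when both lie on the same side of the mirror, so a reflected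
kernel is no more singular than the original one. -/
theorem singFam_imageKern (j : Fin 3) (σ : Fin 3 → ℤˣ) {A X : Set E3} (hA : MeasurableSet A)
    {β : ℝ} (hβ : 0 < β) (hβ1 : β < 1) (h : ∀ x ∈ X, ∀ y ∈ A, ‖x - y‖ ≤ ‖x - reflect σ y‖) :
    SingFam X β 2 (imageKern j σ A) where
  nonneg := zero_le_two
  meas x _ := (measurable_imageKern j σ hA x).aestronglyMeasurable
  bound x hx := by
    filter_upwards [ae_ne_E3 x] with y hne
    have h1 : 0 < ‖x - y‖ := norm_pos_iff.2 (sub_ne_zero.2 hne.symm)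
    by_cases hy : y ∈ A
    · rw [imageKern, indicator_of_mem hy]
      have h2 := Real.rpow_le_rpow_of_nonpos h1 (h x hx y hy) (by norm_num : (-2 : ℝ) ≤ 0)
      have h3 : 0 ≤ ‖x - y‖ ^ (-2 : ℝ) := by positivity
      linarith [abs_kern_le j (x - reflect σ y)]
    · rw [imageKern, indicator_of_notMem hy, abs_zero]
      positivity
  holder x hx x' hx' := by
    filter_upwards [ae_ne_E3 x, ae_ne_E3 x'] with y hne hne'
    have h1 : 0 < ‖x - y‖ := norm_pos_iff.2 (sub_ne_zero.2 hne.symm)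
    have h1' : 0 < ‖x' - y‖ := norm_pos_iff.2 (sub_ne_zero.2 hne'.symm)
    by_cases hy : y ∈ A
    · rw [imageKern, imageKern, indicator_of_mem hy, indicator_of_mem hy]
      have h2 := Real.rpow_le_rpow_of_nonpos h1 (h x hx y hy) (by linarith : (-(2 + β) : ℝ) ≤ 0)
      have h2' := Real.rpow_le_rpow_of_nonpos h1' (h x' hx' y hy)
        (by linarith : (-(2 + β) : ℝ) ≤ 0)
      have n1 : x - reflect σ y ≠ 0 := norm_pos_iff.1 (h1.trans_le (h x hx y hy))
      have n2 : x' - reflect σ y ≠ 0 := norm_pos_iff.1 (h1'.trans_le (h x' hx' y hy))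
      have h3 := abs_kern_sub_le j hβ hβ1 n1 n2
      rw [sub_sub_sub_cancel_right] at h3
      refine h3.trans ?_
      gcongr
    · rw [imageKern, imageKern, indicator_of_notMem hy, indicator_of_notMem hy, sub_zero, abs_zero]
      positivity

/-- If in addition the image stays at distance at least `r x` from `x`, the singularity is cut off
at that scale. -/
theorem regFam_imageKern (j : Fin 3) (σ : Fin 3 → ℤˣ) {A X : Set E3} (hA : MeasurableSet A)
    {r : E3 → ℝ} (hr : ∀ x ∈ X, 0 < r x)
    {β : ℝ} (hβ : 0 < β) (hβ1 : β < 1) (h : ∀ x ∈ X, ∀ y ∈ A, ‖x - y‖ ≤ ‖x - reflect σ y‖)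
    (h' : ∀ x ∈ X, ∀ y ∈ A, r x ≤ ‖x - reflect σ y‖) :
    RegFam X r β 2 (imageKern j σ A) where
  nonneg := zero_le_two
  pos := hr
  meas x _ := (measurable_imageKern j σ hA x).aestronglyMeasurable
  bound x hx := by
    refine Eventually.of_forall fun y => ?_
    have h1 : 0 < max (r x) ‖x - y‖ := lt_max_of_lt_left (hr x hx)
    by_cases hy : y ∈ A
    · rw [imageKern, indicator_of_mem hy]
      have h2 := Real.rpow_le_rpow_of_nonpos h1 (max_le (h' x hx y hy) (h x hx y hy))
        (by norm_num : (-2 : ℝ) ≤ 0)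
      have h3 : 0 ≤ (max (r x) ‖x - y‖) ^ (-2 : ℝ) := by positivity
      linarith [abs_kern_le j (x - reflect σ y)]
    · rw [imageKern, indicator_of_notMem hy, abs_zero]
      positivity
  holder x hx x' hx' := by
    refine Eventually.of_forall fun y => ?_
    have h1 : 0 < max (r x) ‖x - y‖ := lt_max_of_lt_left (hr x hx)
    have h1' : 0 < max (r x') ‖x' - y‖ := lt_max_of_lt_left (hr x' hx')
    by_cases hy : y ∈ A
    · rw [imageKern, imageKern, indicator_of_mem hy, indicator_of_mem hy]
      have m1 := max_le (h' x hx y hy) (h x hx y hy)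
      have m2 := max_le (h' x' hx' y hy) (h x' hx' y hy)
      have h2 := Real.rpow_le_rpow_of_nonpos h1 m1 (by linarith : (-(2 + β) : ℝ) ≤ 0)
      have h2' := Real.rpow_le_rpow_of_nonpos h1' m2 (by linarith : (-(2 + β) : ℝ) ≤ 0)
      have n1 : x - reflect σ y ≠ 0 := norm_pos_iff.1 (h1.trans_le m1)
      have n2 : x' - reflect σ y ≠ 0 := norm_pos_iff.1 (h1'.trans_le m2)
      have h3 := abs_kern_sub_le j hβ hβ1 n1 n2
      rw [sub_sub_sub_cancel_right] at h3
      refine h3.trans ?_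
      gcongr
    · rw [imageKern, imageKern, indicator_of_notMem hy, indicator_of_notMem hy, sub_zero, abs_zero]
      positivity

theorem singFam_kern (j : Fin 3) {X : Set E3} {β : ℝ} (hβ : 0 < β) (hβ1 : β < 1) :
    SingFam X β 2 (fun x y => kern j (x - y)) := by
  have h := singFam_imageKern (X := X) j 1 MeasurableSet.univ hβ hβ1
    (fun x _ y _ => by rw [reflect_one])
  have e : imageKern j 1 univ = fun x y => kern j (x - y) := by
    ext x y; simp [imageKern, reflect_one]
  rwa [e] at h

theorem continuousAt_imageKern (j : Fin 3) (σ : Fin 3 → ℤˣ) {A : Set E3} {x y : E3}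
    (hy : y ∉ frontier A) (hx : y ∈ A → x - reflect σ y ≠ 0) :
    ContinuousAt (imageKern j σ A x) y := by
  by_cases hyA : y ∈ A
  · have h1 : A ∈ 𝓝 y := by
      rw [mem_nhds_iff]
      have : y ∈ interior A := by
        by_contra h
        exact hy ⟨subset_closure hyA, h⟩
      exact ⟨interior A, interior_subset, isOpen_interior, this⟩
    have h2 : ContinuousAt (fun y => kern j (x - reflect σ y)) y :=
      ContinuousAt.comp (f := fun y => x - reflect σ y) (continuousAt_kern j (hx hyA)) (by fun_prop)
    refine h2.congr ?_
    filter_upwards [h1] with z hz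
    rw [imageKern, indicator_of_mem hz]
  · have h1 : Aᶜ ∈ 𝓝 y := by
      have : y ∉ closure A := fun h => hy ⟨h, fun h' => hyA (interior_subset h')⟩
      exact mem_of_superset (isClosed_closure.isOpen_compl.mem_nhds this)
        (compl_subset_compl.2 subset_closure)
    refine (continuousAt_const (y := (0 : ℝ))).congr ?_
    filter_upwards [h1] with z hz
    rw [imageKern, indicator_of_notMem hz]

/-! ### The half-space -/

/-- The upper half-space. -/
def halfSpace : Set E3 := {y | 0 ≤ y 2}

theorem measurableSet_halfSpace : MeasurableSet halfSpace :=
  measurableSet_le measurable_const (measurable_coord 2)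

/-- The difference between the half-space Neumann kernel and the whole-space kernel. -/
def halfDiff (j : Fin 3) (x y : E3) : ℝ :=
  imageKern j (flipSign 2) halfSpace x y + -imageKern j 1 halfSpaceᶜ x y

/-- The half-space Neumann kernel. -/
def halfKern (j : Fin 3) (x y : E3) : ℝ :=
  imageKern j 1 halfSpace x y + imageKern j (flipSign 2) halfSpace x y

theorem halfKern_eq (j : Fin 3) (x y : E3) : halfKern j x y = kern j (x - y) + halfDiff j x y := by
  by_cases hy : y ∈ halfSpace <;>
    simp [halfKern, halfDiff, imageKern, indicator, hy, reflect_one]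

theorem norm_sub_le_norm_sub_flip {i : Fin 3} {x y : E3} (hx : 0 ≤ x i) (hy : 0 ≤ y i) :
    ‖x - y‖ ≤ ‖x - reflect (flipSign i) y‖ := by
  refine norm_le_norm_of_abs_le fun k => ?_
  rcases eq_or_ne k i with rfl | hk
  · simp only [PiLp.sub_apply, reflect_flip_same, sub_neg_eq_add]
    rw [abs_of_nonneg (add_nonneg hx hy), abs_sub_le_iff]
    constructor <;> linarith
  · simp only [PiLp.sub_apply, reflect_flip_ne hk, le_refl]

/-- The images of points above the boundary plane and the points below it are all on the other side
from `x`, hence at distance at least `x 2`. Below the plane the half-space kernel is zero, so the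
difference there is minus the whole-space kernel. -/
theorem regFam_halfDiff (j : Fin 3) {β : ℝ} (hβ : 0 < β) (hβ1 : β < 1) :
    RegFam {x : E3 | 0 < x 2} (fun x => x 2) β 4 (halfDiff j) := by
  have h1 : RegFam {x : E3 | 0 < x 2} (fun x => x 2) β 2 (imageKern j (flipSign 2) halfSpace) := by
    refine regFam_imageKern j _ measurableSet_halfSpace (fun x hx => hx) hβ hβ1
      (fun x hx y hy => norm_sub_le_norm_sub_flip (le_of_lt hx) hy) (fun x hx y hy => ?_)
    refine le_trans ?_ (abs_coord_le_norm _ 2)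
    have hy' : 0 ≤ y 2 := hy
    have hx' : 0 < x 2 := hx
    simp only [PiLp.sub_apply, reflect_flip_same, sub_neg_eq_add]
    rw [abs_of_nonneg (by linarith)]
    linarith
  have h2 : RegFam {x : E3 | 0 < x 2} (fun x => x 2) β 2 (imageKern j 1 halfSpaceᶜ) := by
    refine regFam_imageKern j _ measurableSet_halfSpace.compl (fun x hx => hx) hβ hβ1
      (fun x hx y hy => by rw [reflect_one]) (fun x hx y hy => ?_)
    refine le_trans ?_ (abs_coord_le_norm _ 2)
    have hy' : y 2 < 0 := not_le.1 hy
    have hx' : 0 < x 2 := hx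
    rw [reflect_one, PiLp.sub_apply, abs_of_nonneg (by linarith)]
    linarith
  have := h1.add h2.neg
  norm_num at this
  exact this

theorem singFam_halfKern (j : Fin 3) {β : ℝ} (hβ : 0 < β) (hβ1 : β < 1) :
    SingFam {x : E3 | 0 ≤ x 2} β 4 (halfKern j) := by
  have h1 := (singFam_imageKern (X := {x : E3 | 0 ≤ x 2}) j 1 measurableSet_halfSpace hβ hβ1
    (fun x hx y hy => by rw [reflect_one])).add
    (singFam_imageKern (X := {x : E3 | 0 ≤ x 2}) j (flipSign 2) measurableSet_halfSpace hβ hβ1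
    (fun x hx y hy => norm_sub_le_norm_sub_flip hx hy))
  norm_num at h1
  exact h1

theorem singFam_two_kern_add (j : Fin 3) {β : ℝ} (hβ : 0 < β) (hβ1 : β < 1) :
    SingFam {x : E3 | 0 < x 2} β 8 (fun x y => 2 * kern j (x - y) + halfDiff j x y) := by
  have h := ((singFam_kern (X := {x : E3 | 0 < x 2}) j hβ hβ1).const_mul 2).add
    ((regFam_halfDiff j hβ hβ1).singFam hβ.le)
  norm_num at h
  exact h

/-- The boundary layer correction to `E|∇Y|²` at the point `x` of the half-space. -/
def halfCorr (q : E3 → ℝ) (ε : ℝ) (x : E3) : ℝ :=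
  ∑ j, corr q ε (fun y => 2 * kern j (x - y) + halfDiff j x y) (halfDiff j x)

theorem exists_halfCorr_bound {q : E3 → ℝ} (hq : CorrWeight q) :
    ∃ C, 0 ≤ C ∧ ∀ ε : ℝ, ∀ x : E3, 0 < x 2 → |halfCorr q ε x| ≤ C * (x 2)⁻¹ := by
  refine ⟨∑ _j : Fin 3, 8 * 4 * corrConst 2 2, ?_, fun ε x hx => ?_⟩
  · have := corrConst_nonneg 2 2
    positivity
  · rw [halfCorr, Finset.sum_mul]
    refine (Finset.abs_sum_le_sum_abs _ _).trans (Finset.sum_le_sum fun j _ => ?_)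
    have h := (singFam_two_kern_add j one_half_pos one_half_lt_one).abs_corr_le hq
      (regFam_halfDiff j one_half_pos one_half_lt_one) ε hx
    rwa [Real.rpow_neg_one] at h

theorem exists_halfCorr_holder {q : E3 → ℝ} (hq : CorrWeight q) {β : ℝ} (hβ : 0 < β) (hβ1 : β < 1) :
    ∃ C, 0 ≤ C ∧ ∀ ε : ℝ, ∀ x x' : E3, 0 < x 2 → 0 < x' 2 →
      |halfCorr q ε x - halfCorr q ε x'| ≤ C * ‖x - x'‖ ^ β * (min (x 2) (x' 2)) ^ (-1 - β) := by
  refine ⟨∑ _j : Fin 3, 4 * (8 * 4 * (corrConst (2 + β) 2 + corrConst 2 (2 + β))), ?_,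
    fun ε x x' hx hx' => ?_⟩
  · have := corrConst_nonneg (2 + β) 2
    have := corrConst_nonneg 2 (2 + β)
    positivity
  · rw [halfCorr, halfCorr, Finset.sum_mul, Finset.sum_mul, ← Finset.sum_sub_distrib]
    refine (Finset.abs_sum_le_sum_abs _ _).trans (Finset.sum_le_sum fun j _ => ?_)
    exact (singFam_two_kern_add j hβ hβ1).abs_corr_sub_le hq hβ hβ1
      (regFam_halfDiff j hβ hβ1) ε hx hx'

theorem ae_coord_ne (i : Fin 3) (c : ℝ) : ∀ᵐ y : E3, y i ≠ c := by
  have h := Measure.addHaar_affineSubspace (volume : Measure E3)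
    ((AffineSubspace.mk' (EuclideanSpace.single i c) (LinearMap.ker
      ((EuclideanSpace.proj i : E3 →L[ℝ] ℝ) : E3 →ₗ[ℝ] ℝ)))) ?_
  · rw [ae_iff]
    convert h using 2
    ext y
    simp [AffineSubspace.mem_mk', sub_eq_zero]
  · intro h
    have h1 : (EuclideanSpace.single i (c + 1) : E3) ∈ (AffineSubspace.mk' (EuclideanSpace.single i c)
      (LinearMap.ker ((EuclideanSpace.proj i : E3 →L[ℝ] ℝ) : E3 →ₗ[ℝ] ℝ))) := by
      rw [h]; trivial
    simp [AffineSubspace.mem_mk'] at h1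

theorem frontier_halfSpace_subset : frontier halfSpace ⊆ {y | y 2 = 0} := by
  intro y hy
  have := frontier_le_subset_eq continuous_const (continuous_coord 2) hy
  exact (Eq.symm this)

theorem ae_continuousAt_halfDiff (j : Fin 3) {x : E3} (hx : 0 < x 2) :
    ∀ᵐ y, ContinuousAt (halfDiff j x) y := by
  filter_upwards [ae_coord_ne 2 0] with y hy
  have h1 : y ∉ frontier halfSpace := fun h => hy (frontier_halfSpace_subset h)
  refine (continuousAt_imageKern j _ h1 fun hyA h => ?_).add
    (continuousAt_imageKern j _ (by rwa [frontier_compl]) fun hyA h => ?_).neg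
  · have := congrArg (fun z : E3 => z 2) h
    have hy' : 0 ≤ y 2 := hyA
    simp [reflect_flip_same] at this
    linarith
  · have := congrArg (fun z : E3 => z 2) h
    have hy' : y 2 < 0 := not_le.1 hyA
    simp [reflect_one] at this
    linarith

theorem tendsto_halfCorr {q : E3 → ℝ} (hq : CorrWeight q) {x : E3} (hx : 0 < x 2) :
    Tendsto (fun ε => halfCorr q ε x) (𝓝 0) (𝓝 (halfCorr q 0 x)) := by
  refine tendsto_finsetSum _ fun j _ => ?_
  have h1 := singFam_two_kern_add j one_half_pos one_half_lt_one
  have h2 := regFam_halfDiff j one_half_pos one_half_lt_one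
  exact tendsto_corr hq hx h1.nonneg h2.nonneg (h1.meas x hx) (h2.meas x hx) x (h1.bound x hx)
    (h2.bound x hx) (ae_continuousAt_halfDiff j hx)

/-! ### Scaling and translation -/

theorem corr_translate (q : E3 → ℝ) (ε : ℝ) (f w : E3 → ℝ) (h : E3) :
    corr q ε (fun y => f (y + h)) (fun y => w (y + h)) = corr q ε f w := by
  have := integral_add_right_eq_self (μ := (volume : Measure E3).prod volume)
    (corrIntegrand q ε f w) ((0 : E3), h)
  rw [corr, corr, Measure.volume_eq_prod, ← this]
  refine integral_congr_ae (Eventually.of_forall fun p => ?_)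
  simp only [corrIntegrand, Prod.fst_add, Prod.snd_add, add_zero, add_right_comm]

theorem imageKern_add (j : Fin 3) (σ : Fin 3 → ℤˣ) {A : Set E3} {h : E3} (hh : reflect σ h = h)
    (hA : ∀ y, y + h ∈ A ↔ y ∈ A) (x y : E3) :
    imageKern j σ A (x + h) (y + h) = imageKern j σ A x y := by
  by_cases hy : y ∈ A
  · rw [imageKern, imageKern, indicator_of_mem hy, indicator_of_mem ((hA y).2 hy), map_add, hh]
    congr 1; abel
  · rw [imageKern, imageKern, indicator_of_notMem hy, indicator_of_notMem (mt (hA y).1 hy)]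

theorem halfDiff_add (j : Fin 3) {h : E3} (hh : h 2 = 0) (x y : E3) :
    halfDiff j (x + h) (y + h) = halfDiff j x y := by
  have hA : ∀ y, y + h ∈ halfSpace ↔ y ∈ halfSpace := fun y => by simp [halfSpace, hh]
  have hr : reflect (flipSign 2) h = h := by
    ext i
    rcases eq_or_ne i 2 with rfl | hi
    · rw [reflect_flip_same, hh, neg_zero]
    · rw [reflect_flip_ne hi]
  rw [halfDiff, halfDiff, imageKern_add j _ hr hA,
    imageKern_add j 1 (reflect_one h) (fun y => not_congr (hA y))]

/-- Horizontal translations preserve the half-space and commute with the reflection, so only the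
height of `x` matters. -/
theorem halfCorr_congr (q : E3 → ℝ) (ε : ℝ) {x x' : E3} (h : x 2 = x' 2) :
    halfCorr q ε x = halfCorr q ε x' := by
  refine Finset.sum_congr rfl fun j _ => ?_
  have hh : (x' - x) 2 = 0 := by simp [h]
  rw [← corr_translate q ε (fun y => 2 * kern j (x' - y) + halfDiff j x' y) (halfDiff j x') (x' - x)]
  have e : ∀ y, halfDiff j x' (y + (x' - x)) = halfDiff j x y := fun y => by
    rw [← halfDiff_add j hh x y, add_sub_cancel]
  have e2 : ∀ y, x' - (y + (x' - x)) = x - y := fun y => by abel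
  simp_rw [e, e2]

/-- Only `y` is rescaled: the weight stays in the variable `z`, and the shift `εz` becomes `z`. -/
theorem corr_scale (q : E3 → ℝ) {ε : ℝ} (hε : 0 < ε) (f w : E3 → ℝ) :
    corr q ε f w = ε ^ 3 * corr q 1 (fun y => f (ε • y)) (fun y => w (ε • y)) := by
  let L : E3 × E3 ≃ₜ E3 × E3 := (Homeomorph.refl E3).prodCongr (Homeomorph.smulOfNeZero ε hε.ne')
  have hmap : Measure.map (fun p : E3 × E3 => (p.1, ε • p.2)) volume =
      ENNReal.ofReal (ε⁻¹ ^ 3) • (volume : Measure (E3 × E3)) := by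
    have h1 := Measure.map_prod_map (volume : Measure E3) (volume : Measure E3) (f := id)
      (g := fun y : E3 => ε • y) measurable_id (measurable_const_smul ε)
    have h2 : Measure.map (fun y : E3 => ε • y) volume = ENNReal.ofReal (ε⁻¹ ^ 3) • volume := by
      rw [Measure.map_addHaar_smul volume hε.ne']
      simp [abs_of_pos hε]
    rw [h2, Measure.map_id, Measure.prod_smul_right] at h1
    exact h1.symm
  have h3 : ∫ p : E3 × E3, corrIntegrand q ε f w p
      ∂(Measure.map (fun p : E3 × E3 => (p.1, ε • p.2)) volume)
      = ∫ p : E3 × E3, corrIntegrand q ε f w (p.1, ε • p.2) :=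
    L.measurableEmbedding.integral_map _
  have h4 : ∀ p : E3 × E3, corrIntegrand q ε f w (p.1, ε • p.2) =
      corrIntegrand q 1 (fun y => f (ε • y)) (fun y => w (ε • y)) p := fun p => by
    simp only [corrIntegrand, smul_add, one_smul]
  rw [hmap, integral_smul_measure, ENNReal.toReal_ofReal (by positivity)] at h3
  simp_rw [h4] at h3
  rw [corr, corr, ← h3, smul_eq_mul, ← mul_assoc, ← mul_pow, mul_inv_cancel₀ hε.ne', one_pow, one_mul]

theorem kern_smul (j : Fin 3) {c : ℝ} (hc : 0 < c) (z : E3) :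
    kern j (c • z) = (c ^ 2)⁻¹ * kern j z := by
  rw [kern, kern, norm_smul, Real.norm_of_nonneg hc.le, PiLp.smul_apply, smul_eq_mul]
  rcases eq_or_ne z 0 with rfl | hz
  · simp
  have := norm_pos_iff.2 hz
  field_simp

theorem imageKern_smul (j : Fin 3) (σ : Fin 3 → ℤˣ) {A : Set E3} {c : ℝ} (hc : 0 < c)
    (hA : ∀ y, c • y ∈ A ↔ y ∈ A) (x y : E3) :
    imageKern j σ A x (c • y) = (c ^ 2)⁻¹ * imageKern j σ A (c⁻¹ • x) y := by
  by_cases hy : y ∈ A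
  · rw [imageKern, imageKern, indicator_of_mem hy, indicator_of_mem ((hA y).2 hy), map_smul,
      ← kern_smul j hc, smul_sub, smul_inv_smul₀ hc.ne']
  · rw [imageKern, imageKern, indicator_of_notMem hy, indicator_of_notMem (mt (hA y).1 hy),
      mul_zero]

theorem halfDiff_smul (j : Fin 3) {c : ℝ} (hc : 0 < c) (x y : E3) :
    halfDiff j x (c • y) = (c ^ 2)⁻¹ * halfDiff j (c⁻¹ • x) y := by
  have hA : ∀ y, c • y ∈ halfSpace ↔ y ∈ halfSpace := fun y => by
    simp [halfSpace, hc]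
  rw [halfDiff, halfDiff, imageKern_smul j _ hc hA, imageKern_smul j 1 hc (fun y => not_congr (hA y))]
  ring

theorem corr_const_mul_mul (q : E3 → ℝ) (ε c : ℝ) (f w : E3 → ℝ) :
    corr q ε (fun y => c * f y) (fun y => c * w y) = c ^ 2 * corr q ε f w := by
  rw [corr, corr, ← integral_const_mul]
  refine integral_congr_ae (Eventually.of_forall fun p => ?_)
  simp only [corrIntegrand]
  ring

/-- The kernels are jointly homogeneous of degree `-2` in `x` and `y`: the product contributes `ε⁻⁴`
and the volume element `ε³`. -/
theorem halfCorr_scale (q : E3 → ℝ) {ε : ℝ} (hε : 0 < ε) (x : E3) :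
    halfCorr q ε x = ε⁻¹ * halfCorr q 1 (ε⁻¹ • x) := by
  rw [halfCorr, halfCorr, Finset.mul_sum]
  refine Finset.sum_congr rfl fun j _ => ?_
  rw [corr_scale q hε]
  have e : ∀ y, x - ε • y = ε • (ε⁻¹ • x - y) := fun y => by rw [smul_sub, smul_inv_smul₀ hε.ne']
  have e1 : ∀ y, 2 * kern j (x - ε • y) + halfDiff j x (ε • y) =
      (ε ^ 2)⁻¹ * (2 * kern j (ε⁻¹ • x - y) + halfDiff j (ε⁻¹ • x) y) := fun y => by
    rw [e, kern_smul j hε, halfDiff_smul j hε]; ring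
  simp_rw [e1, halfDiff_smul j hε]
  rw [corr_const_mul_mul, ← mul_assoc]
  congr 1
  field_simp

/-- With `H = k + D`, this is `H² - k² = (2k + D) D` for the symmetric form `corr`. The separate
terms on the right make sense only for `ε > 0`, where `exists_corr_sing_bound` supplies the
integrability of `k` against itself. -/
theorem halfCorr_eq {q : E3 → ℝ} (hq : CorrWeight q) {ε : ℝ} (hε : 0 < ε) {x : E3} (hx : 0 < x 2) :
    halfCorr q ε x = ∑ j, (corr q ε (halfKern j x) (halfKern j x) -
      corr q ε (fun y => kern j (x - y)) (fun y => kern j (x - y))) := by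
  refine Finset.sum_congr rfl fun j _ => ?_
  have hk := singFam_kern (X := {x : E3 | 0 < x 2}) j one_half_pos one_half_lt_one
  have hw := regFam_halfDiff j one_half_pos one_half_lt_one
  have i1 := hk.integrable_corr hq hw ε hx
  have i2 := (hw.singFam one_half_pos.le).integrable_corr hq hw ε hx
  obtain ⟨C, -, hC⟩ := exists_corr_sing_bound hq hε
  have i3 := (hC x _ _ 2 2 zero_le_two zero_le_two (hk.meas x hx) (hk.meas x hx) (hk.bound x hx)
    (hk.bound x hx)).1
  have e : halfKern j x = (fun y => kern j (x - y)) + halfDiff j x := by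
    ext y; exact halfKern_eq j x y
  have e2 : (fun y => 2 * kern j (x - y) + halfDiff j x y) =
      (fun y => kern j (x - y)) + ((fun y => kern j (x - y)) + halfDiff j x) := by
    ext y; simp only [Pi.add_apply]; ring
  have i1' := integrable_corrIntegrand_swap hq i1
  have add_int : ∀ {f g h : E3 → ℝ}, Integrable (corrIntegrand q ε f h) →
      Integrable (corrIntegrand q ε g h) → Integrable (corrIntegrand q ε (f + g) h) := by
    intro f g h h1 h2
    refine (h1.add h2).congr (Eventually.of_forall fun p => ?_)
    simp only [corrIntegrand, Pi.add_apply]; ring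
  rw [e, e2, corr_add_left i1 (add_int i1 i2), corr_add_left i1 i2,
    corr_add_right (add_int i3 i1') (add_int i1 i2), corr_add_left i3 i1', corr_add_left i1 i2,
    corr_swap hq (hw.meas x hx) (hk.meas x hx)]
  ring

/-- The uniform bound by a multiple of `1 / x 2` is not integrable down to the face. At fixed `ε` a
difference of two bounded self-correlations gives a bound up to the face. -/
theorem exists_halfCorr_bound_of_pos {q : E3 → ℝ} (hq : CorrWeight q) {ε : ℝ} (hε : 0 < ε) :
    ∃ C, 0 ≤ C ∧ ∀ x : E3, 0 < x 2 → |halfCorr q ε x| ≤ C := by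
  obtain ⟨C, hC0, hC⟩ := exists_corr_sing_bound hq hε
  refine ⟨∑ _j : Fin 3, (4 * 4 * C + 2 * 2 * C), by positivity, fun x hx => ?_⟩
  rw [halfCorr_eq hq hε hx]
  refine (Finset.abs_sum_le_sum_abs _ _).trans (Finset.sum_le_sum fun j _ => ?_)
  have hk := singFam_kern (X := {x : E3 | 0 ≤ x 2}) j one_half_pos one_half_lt_one
  have hh := singFam_halfKern j one_half_pos one_half_lt_one
  have hx' : x ∈ {x : E3 | 0 ≤ x 2} := hx.le
  have h1 := (hC x _ _ 4 4 (by norm_num) (by norm_num) (hh.meas x hx') (hh.meas x hx')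
    (hh.bound x hx') (hh.bound x hx')).2
  have h2 := (hC x _ _ 2 2 (by norm_num) (by norm_num) (hk.meas x hx') (hk.meas x hx')
    (hk.bound x hx') (hk.bound x hx')).2
  exact (abs_sub _ _).trans (add_le_add h1 h2)

/-! ### Cartesian coordinates -/

theorem measurePreserving_coords :
    MeasurePreserving (fun y : E3 => (y 2, (y 0, y 1))) volume volume := by
  have h1 := EuclideanSpace.volume_preserving_symm_measurableEquiv_toLp (Fin 3)
  have h2 := volume_preserving_piFinSuccAbove (fun _ : Fin 3 => ℝ) 2
  have h3 := (MeasurePreserving.id (volume : Measure ℝ)).prod (volume_preserving_finTwoArrow ℝ)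
  have h := (h3.comp h2).comp h1
  exact h

def coordsEquiv : E3 ≃ᵐ ℝ × (ℝ × ℝ) where
  toFun y := (y 2, (y 0, y 1))
  invFun p := !₂[p.2.1, p.2.2, p.1]
  left_inv y := by ext i; fin_cases i <;> simp
  right_inv p := by simp
  measurable_toFun := measurePreserving_coords.measurable
  measurable_invFun := by
    refine (WithLp.measurable_toLp 2 _).comp (measurable_pi_iff.2 fun i => ?_)
    fin_cases i <;> simp <;> fun_prop

theorem integral_coords (f : E3 → ℝ) :
    ∫ y, f y = ∫ p : ℝ × (ℝ × ℝ), f !₂[p.2.1, p.2.2, p.1] := by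
  rw [← (show MeasurePreserving coordsEquiv volume volume from
    measurePreserving_coords).integral_comp' (g := fun p : ℝ × (ℝ × ℝ) => f !₂[p.2.1, p.2.2, p.1])]
  refine integral_congr_ae (Eventually.of_forall fun y => ?_)
  exact congrArg f (coordsEquiv.left_inv y).symm

theorem integrable_coords_iff {f : E3 → ℝ} :
    Integrable (fun p : ℝ × (ℝ × ℝ) => f !₂[p.2.1, p.2.2, p.1]) ↔ Integrable f := by
  rw [← (show MeasurePreserving coordsEquiv volume volume from
    measurePreserving_coords).integrable_comp_emb coordsEquiv.measurableEmbedding]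
  refine integrable_congr (Eventually.of_forall fun y => ?_)
  exact congrArg f (coordsEquiv.left_inv y)

theorem norm_sq_E3 (y : E3) : ‖y‖ ^ 2 = y 0 ^ 2 + y 1 ^ 2 + y 2 ^ 2 := by
  rw [EuclideanSpace.real_norm_sq_eq, Fin.sum_univ_three]

theorem norm_E3 (y : E3) : ‖y‖ = √(y 0 ^ 2 + y 1 ^ 2 + y 2 ^ 2) := by
  rw [← norm_sq_E3, Real.sqrt_sq (norm_nonneg y)]

/-! ### A weight with a mild singularity on the boundary of the half-space -/

def vertical (t : ℝ) : E3 := EuclideanSpace.single 2 t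

@[simp] theorem vertical_two (t : ℝ) : vertical t 2 = t := by simp [vertical]
@[simp] theorem vertical_zero (t : ℝ) : vertical t 0 = 0 := by simp [vertical]
@[simp] theorem vertical_one (t : ℝ) : vertical t 1 = 0 := by simp [vertical]

/-- The kernel `halfDiff` jumps across the boundary plane. A pair of points straddling the plane is
close to it, and the factor `|y 2| ^ (-1/2)` absorbs such pairs while remaining integrable. -/
def layerWeight (t : ℝ) (y : E3) : ℝ := |y 2| ^ (-(1 / 2) : ℝ) * (max t ‖vertical t - y‖) ^ (-4 : ℝ)

theorem integrable_max_abs_rpow {c : ℝ} (hc : 1 < c) :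
    Integrable (fun s : ℝ => (max 1 |s|) ^ (-c)) := by
  have h1 : Integrable (fun y : ℝ => (1 / 2 : ℝ) ^ (-c) * (1 + ‖y‖) ^ (-c)) := by
    refine Integrable.const_mul (integrable_one_add_norm ?_) _
    simpa using hc
  refine h1.mono' ?_ (Eventually.of_forall fun y => ?_)
  · exact ((measurable_const.max (measurable_norm (α := ℝ))).pow_const _).aestronglyMeasurable
  · have hmax : 0 < max 1 |y| := lt_max_of_lt_left one_pos
    rw [Real.norm_of_nonneg (Real.rpow_nonneg hmax.le _),
      ← Real.mul_rpow (by norm_num) (by positivity)]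
    refine Real.rpow_le_rpow_of_nonpos (by positivity) ?_ (by linarith)
    have h4 : 1 ≤ max 1 |y| := le_max_left _ _
    have h5 : |y| ≤ max 1 |y| := le_max_right _ _
    rw [Real.norm_eq_abs]
    linarith

theorem integrable_abs_rpow_mul_max :
    Integrable (fun s : ℝ => |s| ^ (-(1 / 2) : ℝ) * (max 1 |1 - s|) ^ (-1 : ℝ)) := by
  have h1 : IntegrableOn (fun s : ℝ => ‖s‖ ^ (-(1 / 2) : ℝ)) (Metric.ball 0 3) := by
    rw [integrableOn_fun_norm_addHaar volume (f := fun s : ℝ => s ^ (-(1 / 2) : ℝ))]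
    simp only [Module.finrank_self, tsub_self, pow_zero, one_smul]
    have := intervalIntegral.intervalIntegrable_rpow' (a := 0) (b := 3) (r := -(1 / 2)) (by norm_num)
    rw [intervalIntegrable_iff_integrableOn_Ioc_of_le (by norm_num)] at this
    exact this.mono_set Ioo_subset_Ioc_self
  have h2 := (integrable_max_abs_rpow (c := 3 / 2) (by norm_num)).const_mul 2
  rw [← integrable_indicator_iff measurableSet_ball] at h1
  refine (h1.add h2).mono' ?_ (Eventually.of_forall fun s => ?_)
  · refine Measurable.aestronglyMeasurable ?_
    exact ((measurable_norm (α := ℝ)).pow_const _).mul ((measurable_const.max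
      ((measurable_norm (α := ℝ)).comp (measurable_const.sub measurable_id))).pow_const _)
  · have hm : 0 < max 1 |1 - s| := lt_max_of_lt_left one_pos
    have hm2 : 0 < max 1 |s| := lt_max_of_lt_left one_pos
    rw [Real.norm_of_nonneg (by positivity), Pi.add_apply]
    by_cases hs : |s| < 3
    · rw [indicator_of_mem (by simpa using hs)]
      have : (max 1 |1 - s|) ^ (-1 : ℝ) ≤ 1 :=
        Real.rpow_le_one_of_one_le_of_nonpos (le_max_left _ _) (by norm_num)
      have h3 : 0 ≤ 2 * max 1 |s| ^ (-(3 / 2) : ℝ) := by positivity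
      have h4 : 0 ≤ |s| ^ (-(1 / 2) : ℝ) := by positivity
      rw [Real.norm_eq_abs]
      nlinarith
    · rw [indicator_of_notMem (by simpa using hs), zero_add]
      push Not at hs
      have hs0 : 0 < |s| := by linarith
      have h3 : max 1 |s| = |s| := max_eq_right (by linarith)
      have h4 : |s| / 2 ≤ max 1 |1 - s| := by
        refine le_max_of_le_right ?_
        have := abs_sub_abs_le_abs_sub s 1
        rw [abs_sub_comm s 1, abs_one] at this
        linarith
      have h5 : (max 1 |1 - s|) ^ (-1 : ℝ) ≤ (|s| / 2) ^ (-1 : ℝ) :=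
        Real.rpow_le_rpow_of_nonpos (by positivity) h4 (by norm_num)
      rw [h3]
      calc _ ≤ |s| ^ (-(1 / 2) : ℝ) * (|s| / 2) ^ (-1 : ℝ) := by gcongr
        _ = 2 * (|s| ^ (-(1 / 2) : ℝ) * |s| ^ (-1 : ℝ)) := by
            rw [Real.rpow_neg_one, Real.rpow_neg_one]; field_simp
        _ = _ := by rw [← Real.rpow_add hs0]; norm_num

/-- The decay of order `4` is shared out as `1` in the vertical direction, where the weight adds
`1/2`, and `3/2` in each horizontal direction. The majorant is then a product of three integrable
functions of one variable. -/
theorem integrable_layerWeight_one : Integrable (layerWeight 1) := by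
  rw [← integrable_coords_iff]
  have h1 := integrable_abs_rpow_mul_max.mul_prod
    ((integrable_max_abs_rpow (c := 3 / 2) (by norm_num)).mul_prod
      (integrable_max_abs_rpow (c := 3 / 2) (by norm_num)))
  have hmeas : Measurable (layerWeight 1) := by
    refine Measurable.mul (((measurable_norm (α := ℝ)).comp (measurable_coord 2)).pow_const _) ?_
    exact (measurable_const.max (measurable_norm.comp (measurable_const.sub measurable_id))).pow_const _
  refine h1.mono' ?_ (Eventually.of_forall fun p => ?_)
  · exact (hmeas.comp coordsEquiv.symm.measurable).aestronglyMeasurable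
  · set y : E3 := !₂[p.2.1, p.2.2, p.1] with hy
    have e0 : y 0 = p.2.1 := by simp [hy]
    have e1 : y 1 = p.2.2 := by simp [hy]
    have e2 : y 2 = p.1 := by simp [hy]
    have b0 : |p.2.1| ≤ ‖vertical 1 - y‖ := by
      have := abs_coord_le_norm (vertical 1 - y) 0
      simpa [e0] using this
    have b1 : |p.2.2| ≤ ‖vertical 1 - y‖ := by
      have := abs_coord_le_norm (vertical 1 - y) 1
      simpa [e1] using this
    have b2 : |1 - p.1| ≤ ‖vertical 1 - y‖ := by
      have := abs_coord_le_norm (vertical 1 - y) 2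
      simpa [e2] using this
    set m := max 1 ‖vertical 1 - y‖ with hm
    have hm0 : 0 < m := lt_max_of_lt_left one_pos
    have c : ∀ {s a : ℝ}, |s| ≤ ‖vertical 1 - y‖ → 0 ≤ a → m ^ (-a) ≤ (max 1 |s|) ^ (-a) :=
      fun h ha => Real.rpow_le_rpow_of_nonpos (lt_max_of_lt_left one_pos) (max_le_max_left _ h)
        (by linarith)
    have h4 : m ^ (-4 : ℝ) = m ^ (-1 : ℝ) * (m ^ (-(3 / 2) : ℝ) * m ^ (-(3 / 2) : ℝ)) := by
      rw [← Real.rpow_add hm0, ← Real.rpow_add hm0]; norm_num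
    rw [layerWeight, Real.norm_of_nonneg (by positivity), e2, ← hm, h4, ← mul_assoc]
    have := c b2 zero_le_one
    have := c b0 (by norm_num : (0 : ℝ) ≤ 3 / 2)
    have := c b1 (by norm_num : (0 : ℝ) ≤ 3 / 2)
    gcongr

theorem layerWeight_smul {t : ℝ} (ht : 0 < t) (y : E3) :
    layerWeight t y = t ^ (-(9 / 2) : ℝ) * layerWeight 1 (t⁻¹ • y) := by
  have e : vertical t - y = t • (vertical 1 - t⁻¹ • y) := by
    rw [smul_sub, smul_inv_smul₀ ht.ne']
    congr 1
    ext i; fin_cases i <;> simp [vertical]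
  have e2 : max t ‖vertical t - y‖ = t * max 1 ‖vertical 1 - t⁻¹ • y‖ := by
    rw [mul_max_of_nonneg _ _ ht.le, mul_one, e, norm_smul, Real.norm_of_nonneg ht.le]
  have e3 : |y 2| = t * |(t⁻¹ • y) 2| := by
    rw [PiLp.smul_apply, smul_eq_mul, abs_mul, abs_of_pos (inv_pos.2 ht), mul_inv_cancel_left₀ ht.ne']
  have h9 : t ^ (-(9 / 2) : ℝ) = t ^ (-(1 / 2) : ℝ) * t ^ (-4 : ℝ) := by
    rw [← Real.rpow_add ht]; norm_num
  have hm : 0 ≤ max 1 ‖vertical 1 - t⁻¹ • y‖ := le_max_of_le_left zero_le_one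
  rw [layerWeight, layerWeight, e2, e3, Real.mul_rpow ht.le (abs_nonneg _), Real.mul_rpow ht.le hm, h9]
  ring

theorem integrable_layerWeight {t : ℝ} (ht : 0 < t) : Integrable (layerWeight t) := by
  have h := (integrable_layerWeight_one.comp_smul (inv_ne_zero ht.ne')).const_mul (t ^ (-(9 / 2) : ℝ))
  refine h.congr (Eventually.of_forall fun y => (layerWeight_smul ht y).symm)

theorem integral_layerWeight {t : ℝ} (ht : 0 < t) :
    ∫ y, layerWeight t y = t ^ (-(3 / 2) : ℝ) * ∫ y, layerWeight 1 y := by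
  simp_rw [layerWeight_smul ht]
  rw [integral_const_mul, integral_comp_inv_smul_E3 (layerWeight 1) ht, ← mul_assoc]
  congr 1
  rw [← Real.rpow_natCast t 3, ← Real.rpow_add ht]; norm_num

/-! ### Rate of convergence of the half-space correction -/

theorem reflect_sub_norm (σ : Fin 3 → ℤˣ) (y y' : E3) : ‖reflect σ y - reflect σ y'‖ = ‖y - y'‖ := by
  rw [← map_sub, LinearIsometryEquiv.norm_map]

theorem max_le_norm_sub_flip {x y : E3} (hx : 0 < x 2) (hy : 0 ≤ y 2) :
    max (x 2) ‖x - y‖ ≤ ‖x - reflect (flipSign 2) y‖ := by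
  refine max_le (le_trans ?_ (abs_coord_le_norm _ 2)) (norm_sub_le_norm_sub_flip hx.le hy)
  simp only [PiLp.sub_apply, reflect_flip_same, sub_neg_eq_add]
  rw [abs_of_nonneg (by linarith)]
  linarith

theorem max_le_norm_sub {x y : E3} (hx : 0 < x 2) (hy : y 2 < 0) :
    max (x 2) ‖x - y‖ ≤ ‖x - y‖ := by
  refine max_le (le_trans ?_ (abs_coord_le_norm _ 2)) le_rfl
  rw [PiLp.sub_apply, abs_of_nonneg (by linarith)]
  linarith

theorem halfDiff_of_nonneg (j : Fin 3) (x : E3) {y : E3} (hy : 0 ≤ y 2) :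
    halfDiff j x y = kern j (x - reflect (flipSign 2) y) := by
  have h1 : y ∈ halfSpace := hy
  simp [halfDiff, imageKern, indicator, h1]

theorem halfDiff_of_neg (j : Fin 3) (x : E3) {y : E3} (hy : y 2 < 0) :
    halfDiff j x y = -kern j (x - y) := by
  have h1 : y ∉ halfSpace := not_le.2 hy
  simp [halfDiff, imageKern, indicator, h1, reflect_one]

theorem abs_halfDiff_le (j : Fin 3) {x : E3} (hx : 0 < x 2) (y : E3) :
    |halfDiff j x y| ≤ (max (x 2) ‖x - y‖) ^ (-2 : ℝ) := by
  have hm : 0 < max (x 2) ‖x - y‖ := lt_max_of_lt_left hx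
  rcases le_or_gt 0 (y 2) with hy | hy
  · rw [halfDiff_of_nonneg j x hy]
    exact (abs_kern_le _ _).trans (Real.rpow_le_rpow_of_nonpos hm (max_le_norm_sub_flip hx hy)
      (by norm_num))
  · rw [halfDiff_of_neg j x hy, abs_neg]
    exact (abs_kern_le _ _).trans (Real.rpow_le_rpow_of_nonpos hm (max_le_norm_sub hx hy)
      (by norm_num))

theorem abs_kern_sub_le_of_max {j : Fin 3} {a b : E3} {s t d : ℝ} (hs : 0 < s) (ht : 0 < t)
    (ha : s ≤ ‖a‖) (hb : t ≤ ‖b‖) (hd : ‖a - b‖ = d) :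
    |kern j a - kern j b| ≤ 2 * d ^ (1 / 2 : ℝ) * (s ^ (-(5 / 2) : ℝ) + t ^ (-(5 / 2) : ℝ)) := by
  have h := abs_kern_sub_le j one_half_pos one_half_lt_one (norm_pos_iff.1 (hs.trans_le ha))
    (norm_pos_iff.1 (ht.trans_le hb))
  rw [hd] at h
  have e : (-(2 + 1 / 2) : ℝ) = -(5 / 2) := by norm_num
  rw [e] at h
  have hd0 : 0 ≤ d := hd ▸ norm_nonneg _
  refine h.trans (mul_le_mul_of_nonneg_left (add_le_add ?_ ?_) (by positivity))
  · exact Real.rpow_le_rpow_of_nonpos hs ha (by norm_num)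
  · exact Real.rpow_le_rpow_of_nonpos ht hb (by norm_num)

theorem halfDiff_sub_le_of_same_side (j : Fin 3) {x y y' : E3} (hx : 0 < x 2)
    (h : 0 ≤ y 2 ∧ 0 ≤ y' 2 ∨ y 2 < 0 ∧ y' 2 < 0) :
    |halfDiff j x y' - halfDiff j x y| ≤ 2 * ‖y' - y‖ ^ (1 / 2 : ℝ) *
      ((max (x 2) ‖x - y‖) ^ (-(5 / 2) : ℝ) + (max (x 2) ‖x - y'‖) ^ (-(5 / 2) : ℝ)) := by
  have hm : 0 < max (x 2) ‖x - y‖ := lt_max_of_lt_left hx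
  have hm' : 0 < max (x 2) ‖x - y'‖ := lt_max_of_lt_left hx
  rcases h with ⟨h1, h2⟩ | ⟨h1, h2⟩
  · rw [halfDiff_of_nonneg j x h1, halfDiff_of_nonneg j x h2, abs_sub_comm]
    refine abs_kern_sub_le_of_max hm hm' (max_le_norm_sub_flip hx h1) (max_le_norm_sub_flip hx h2) ?_
    rw [sub_sub_sub_cancel_left, reflect_sub_norm]
  · rw [halfDiff_of_neg j x h1, halfDiff_of_neg j x h2, neg_sub_neg]
    refine abs_kern_sub_le_of_max hm hm' (max_le_norm_sub hx h1) (max_le_norm_sub hx h2) ?_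
    rw [sub_sub_sub_cancel_left]

/-- Points on opposite sides of the boundary are close to it. -/
theorem layer_le {M s s' a a' : ℝ} (hs : s ≠ 0) (hs' : s' ≠ 0)
    (h : ¬ (0 ≤ s ∧ 0 ≤ s' ∨ s < 0 ∧ s' < 0)) (hM : |s' - s| ≤ M) (ha : 0 ≤ a)
    (ha' : 0 ≤ a') : a ≤ M ^ (1 / 2 : ℝ) * (|s| ^ (-(1 / 2) : ℝ) * a) ∧
      a' ≤ M ^ (1 / 2 : ℝ) * (|s'| ^ (-(1 / 2) : ℝ) * a') := by
  have h1 : |s| ≤ |s' - s| ∧ |s'| ≤ |s' - s| := by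
    push Not at h
    rcases lt_or_ge s 0 with h0 | h0
    · have h2 := h.2 h0
      rw [abs_of_neg h0, abs_of_nonneg h2, abs_of_nonneg (by linarith)]
      constructor <;> linarith
    · have h2 := h.1 h0
      rw [abs_of_nonneg h0, abs_of_neg h2, abs_of_neg (by linarith)]
      constructor <;> linarith
  have key : ∀ {u : ℝ}, u ≠ 0 → |u| ≤ M → 1 ≤ M ^ (1 / 2 : ℝ) * |u| ^ (-(1 / 2) : ℝ) := by
    intro u hu huM
    have hu0 := abs_pos.2 hu
    have h3 : |u| ^ (1 / 2 : ℝ) ≤ M ^ (1 / 2 : ℝ) := Real.rpow_le_rpow hu0.le huM (by norm_num)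
    calc 1 = |u| ^ (1 / 2 : ℝ) * |u| ^ (-(1 / 2) : ℝ) := by rw [← Real.rpow_add hu0]; norm_num
      _ ≤ _ := by gcongr
  rw [← mul_assoc, ← mul_assoc]
  exact ⟨le_mul_of_one_le_left ha (key hs (h1.1.trans hM)),
    le_mul_of_one_le_left ha' (key hs' (h1.2.trans hM))⟩

/-- Moving the argument by a bounded `z` gains half a power: the increment of a kernel has order
`-5/2`, and its correlation with order `-2` is `O(t^(-3/2))`. Across the jump of `halfDiff` this
fails, but then both points lie within `M` of the plane, and `layerWeight` controls the product; its
integral is also of order `t^(-3/2)`. Any rate better than `1/t` suffices, since what matters is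
integrability of the error at infinity. -/
theorem exists_halfCorr_rate {q : E3 → ℝ} (hq : CorrWeight q) :
    ∃ C, 0 ≤ C ∧ ∀ x : E3, 0 < x 2 →
      |halfCorr q 1 x - halfCorr q 0 x| ≤ C * (x 2) ^ (-(3 / 2) : ℝ) := by
  obtain ⟨M, hM, hMq⟩ := hq.exists_radius
  set c1 := corrConst (5 / 2) 2 with hc1
  have hc1' : 0 ≤ c1 := corrConst_nonneg _ _
  set I1 := ∫ y, layerWeight 1 y with hI1
  have hI1' : 0 ≤ I1 := integral_nonneg fun y => by rw [layerWeight]; positivity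
  set S := M ^ (1 / 2 : ℝ) with hS
  have hS0 : 0 ≤ S := by positivity
  refine ⟨∑ _j : Fin 3, (2 * (4 * S * c1) + (4 * S * c1 + 4 * S * I1)), by positivity, fun x hx => ?_⟩
  rw [halfCorr_congr q 1 (x' := vertical (x 2)) (by simp),
    halfCorr_congr q 0 (x' := vertical (x 2)) (by simp)]
  have ht : 0 < x 2 := hx
  generalize x 2 = t at ht
  set v := vertical t with hv
  have hv2 : v 2 = t := vertical_two t
  have hvt : 0 < v 2 := by rw [hv2]; exact ht
  rw [halfCorr, halfCorr, ← Finset.sum_sub_distrib, Finset.sum_mul]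
  refine (Finset.abs_sum_le_sum_abs _ _).trans (Finset.sum_le_sum fun j _ => ?_)
  have hk := singFam_kern (X := {x : E3 | 0 < x 2}) j one_half_pos one_half_lt_one
  have hw := regFam_halfDiff j one_half_pos one_half_lt_one
  have hvX : v ∈ {x : E3 | 0 < x 2} := hvt
  have hWm := hw.meas v hvX
  have hkm := hk.meas v hvX
  have e2 : (fun y => 2 * kern j (v - y) + halfDiff j v y) =
      ((fun y => kern j (v - y)) + (fun y => kern j (v - y))) + halfDiff j v := by
    ext y; simp only [Pi.add_apply]; ring
  have hkW := fun ε => hk.integrable_corr hq hw ε hvX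
  have hWW := fun ε => (hw.singFam one_half_pos.le).integrable_corr hq hw ε hvX
  have hWk := fun ε => integrable_corrIntegrand_swap hq (hkW ε)
  have add_int : ∀ {ε : ℝ} {f g h : E3 → ℝ}, Integrable (corrIntegrand q ε f h) →
      Integrable (corrIntegrand q ε g h) → Integrable (corrIntegrand q ε (f + g) h) := by
    intro ε f g h h1 h2
    refine (h1.add h2).congr (Eventually.of_forall fun p => ?_)
    simp only [corrIntegrand, Pi.add_apply]; ring
  -- In the mixed term the factors are swapped so that the shifted one is `k`, which has no jump;
  -- only the self-correlation of `halfDiff` needs the layer weight.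
  have split : ∀ ε, corr q ε (fun y => 2 * kern j (v - y) + halfDiff j v y) (halfDiff j v) =
      2 * corr q ε (halfDiff j v) (fun y => kern j (v - y)) +
        corr q ε (halfDiff j v) (halfDiff j v) := by
    intro ε
    rw [e2, corr_add_left (add_int (hkW ε) (hkW ε)) (hWW ε), corr_add_left (hkW ε) (hkW ε),
      corr_swap hq hkm hWm]
    ring
  rw [split, split]
  -- regular against singular weights
  have hm2 := aestronglyMeasurable_max_norm_sub_rpow t v 2
  have hm52 := aestronglyMeasurable_max_norm_sub_rpow t v (5 / 2)
  have hs52 := aestronglyMeasurable_norm_sub_rpow v (5 / 2)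
  have bnd : ∀ ε, ∀ g : E3 → ℝ, AEStronglyMeasurable g →
      (∀ᵐ y, |g y| ≤ 1 * ‖v - y‖ ^ (-(5 / 2) : ℝ)) →
      Integrable (corrIntegrand q ε (fun y => (max t ‖v - y‖) ^ (-2 : ℝ)) g) ∧
      |corr q ε (fun y => (max t ‖v - y‖) ^ (-2 : ℝ)) g| ≤ c1 * t ^ (-(3 / 2) : ℝ) := by
    intro ε g hg hgb
    have h := integrable_corrIntegrand_and_bound hq ε (a := 5 / 2) (b := 2) (r := t) (A := 1) (B := 1)
      (by norm_num) (by norm_num) zero_le_two (by norm_num) ht zero_le_one zero_le_one hg hm2 v v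
      hgb (Eventually.of_forall fun y => by
        rw [abs_of_nonneg (Real.rpow_nonneg (le_max_of_le_left ht.le) _), one_mul])
    refine ⟨integrable_corrIntegrand_swap hq h.1, ?_⟩
    rw [corr_swap hq hm2 hg]
    refine abs_integral_le_integral_abs.trans (h.2.trans (le_of_eq ?_))
    norm_num [hc1]
  have bs := fun ε => bnd ε (fun y => ‖v - y‖ ^ (-(5 / 2) : ℝ)) hs52 (Eventually.of_forall fun y => by
    rw [abs_of_nonneg (by positivity), one_mul])
  have bm := fun ε => bnd ε (fun y => (max t ‖v - y‖) ^ (-(5 / 2) : ℝ)) hm52 (by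
    filter_upwards [ae_ne_E3 v] with y hy
    have h1 : 0 < ‖v - y‖ := norm_pos_iff.2 (sub_ne_zero.2 hy.symm)
    rw [abs_of_nonneg (Real.rpow_nonneg (le_max_of_le_left ht.le) _), one_mul]
    exact max_rpow_le h1 (by norm_num))
  have qae : ∀ {P : E3 → Prop}, (∀ᵐ y, P y) → ∀ᵐ p : E3 × E3, P p.2 := by
    intro P hP
    have h1 := (Measure.quasiMeasurePreserving_snd (μ := (volume : Measure E3))
      (ν := (volume : Measure E3))).ae hP
    rwa [← Measure.volume_eq_prod] at h1
  have qae1 : ∀ {P : E3 → Prop}, (∀ᵐ y, P y) → ∀ᵐ p : E3 × E3, P (p.2 + (1 : ℝ) • p.1) :=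
    fun hP => (quasiMeasurePreserving_shear_snd 1).ae hP
  have hSz : ∀ {z : E3}, q z ≠ 0 → ‖z‖ ^ (1 / 2 : ℝ) ≤ S := fun hz =>
    Real.rpow_le_rpow (norm_nonneg _) (hMq _ hz) (by norm_num)
  have part1 : |corr q 1 (halfDiff j v) (fun y => kern j (v - y)) -
      corr q 0 (halfDiff j v) (fun y => kern j (v - y))| ≤ 4 * S * c1 * t ^ (-(3 / 2) : ℝ) := by
    rw [corr, corr, ← integral_sub (hWk 1) (hWk 0)]
    refine abs_integral_le_integral_abs.trans ?_
    have hle : ∀ᵐ p : E3 × E3, |corrIntegrand q 1 (halfDiff j v) (fun y => kern j (v - y)) p -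
        corrIntegrand q 0 (halfDiff j v) (fun y => kern j (v - y)) p| ≤ 2 * S *
        (corrIntegrand q 1 (fun y => (max t ‖v - y‖) ^ (-2 : ℝ)) (fun y => ‖v - y‖ ^ (-(5 / 2) : ℝ)) p +
        corrIntegrand q 0 (fun y => (max t ‖v - y‖) ^ (-2 : ℝ)) (fun y => ‖v - y‖ ^ (-(5 / 2) : ℝ)) p) := by
      filter_upwards [qae (ae_ne_E3 v), qae1 (ae_ne_E3 v)] with p hp hp'
      by_cases hz : q p.1 = 0
      · simp [corrIntegrand, hz]
      have h1 : 0 < ‖v - p.2‖ := norm_pos_iff.2 (sub_ne_zero.2 hp.symm)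
      have h2 : 0 < ‖v - (p.2 + (1 : ℝ) • p.1)‖ := norm_pos_iff.2 (sub_ne_zero.2 hp'.symm)
      have h3 := abs_kern_sub_le_of_max (j := j) h2 h1 le_rfl le_rfl (d := ‖p.1‖) (by
        rw [sub_sub_sub_cancel_left, one_smul, ← norm_neg]; congr 1; abel)
      have h4 := abs_halfDiff_le j hvt p.2
      rw [hv2] at h4
      simp only [corrIntegrand, zero_smul, add_zero]
      rw [← mul_sub, ← mul_sub, abs_mul, abs_mul, abs_of_nonneg (hq.nonneg _), ← mul_add, ← mul_add]
      have h5 := hSz hz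
      calc _ ≤ q p.1 * ((max t ‖v - p.2‖) ^ (-2 : ℝ) * (2 * ‖p.1‖ ^ (1 / 2 : ℝ) *
            (‖v - (p.2 + (1 : ℝ) • p.1)‖ ^ (-(5 / 2) : ℝ) + ‖v - p.2‖ ^ (-(5 / 2) : ℝ)))) := by
            refine mul_le_mul_of_nonneg_left ?_ (hq.nonneg _)
            exact mul_le_mul h4 h3 (abs_nonneg _) ((abs_nonneg _).trans h4)
        _ ≤ q p.1 * ((max t ‖v - p.2‖) ^ (-2 : ℝ) * (2 * S *
            (‖v - (p.2 + (1 : ℝ) • p.1)‖ ^ (-(5 / 2) : ℝ) + ‖v - p.2‖ ^ (-(5 / 2) : ℝ)))) := by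
            refine mul_le_mul_of_nonneg_left (mul_le_mul_of_nonneg_left ?_ ((abs_nonneg _).trans h4))
              (hq.nonneg _)
            gcongr
        _ = _ := by ring
    refine (integral_mono_ae ((hWk 1).sub (hWk 0)).abs (((bs 1).1.add (bs 0).1).const_mul (2 * S)) hle).trans ?_
    simp only [Pi.add_apply]
    rw [integral_const_mul, integral_add (bs 1).1 (bs 0).1]
    have a1 := (le_abs_self _).trans (bs 1).2
    have a0 := (le_abs_self _).trans (bs 0).2
    rw [corr] at a1 a0
    nlinarith
  have part2 : |corr q 1 (halfDiff j v) (halfDiff j v) - corr q 0 (halfDiff j v) (halfDiff j v)| ≤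
      (4 * S * c1 + 4 * S * I1) * t ^ (-(3 / 2) : ℝ) := by
    rw [corr, corr, ← integral_sub (hWW 1) (hWW 0)]
    refine abs_integral_le_integral_abs.trans ?_
    have hL1 := integrable_weight_mul_snd hq (integrable_layerWeight ht)
    have hL2 := integrable_weight_mul_shear hq (integrable_layerWeight ht) 1
    have hle : ∀ᵐ p : E3 × E3, |corrIntegrand q 1 (halfDiff j v) (halfDiff j v) p -
        corrIntegrand q 0 (halfDiff j v) (halfDiff j v) p| ≤ 2 * S *
        (corrIntegrand q 1 (fun y => (max t ‖v - y‖) ^ (-2 : ℝ))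
          (fun y => (max t ‖v - y‖) ^ (-(5 / 2) : ℝ)) p +
        corrIntegrand q 0 (fun y => (max t ‖v - y‖) ^ (-2 : ℝ))
          (fun y => (max t ‖v - y‖) ^ (-(5 / 2) : ℝ)) p) + 2 * S * (q p.1 * layerWeight t p.2 +
            q p.1 * layerWeight t (p.2 + (1 : ℝ) • p.1)) := by
      filter_upwards [qae (ae_coord_ne 2 0), qae1 (ae_coord_ne 2 0)] with p hp hp'
      by_cases hz : q p.1 = 0
      · simp [corrIntegrand, hz]
      have h4 := abs_halfDiff_le j hvt p.2
      have h4' := abs_halfDiff_le j hvt (p.2 + (1 : ℝ) • p.1)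
      simp only [corrIntegrand, zero_smul, add_zero]
      set y := p.2
      set y' := p.2 + (1 : ℝ) • p.1 with hy'
      have hyy : y' - y = p.1 := by rw [hy', one_smul]; abel
      have h5 := hSz hz
      have hm : 0 < max t ‖v - y‖ := lt_max_of_lt_left ht
      have hm' : 0 < max t ‖v - y'‖ := lt_max_of_lt_left ht
      rw [hv2] at h4 h4'
      have e4 : ∀ {s : ℝ}, 0 < s → s ^ (-2 : ℝ) * s ^ (-2 : ℝ) = s ^ (-4 : ℝ) := fun hs => by
        rw [← Real.rpow_add hs]; norm_num
      have e4a := e4 hm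
      have e4b := e4 hm'
      have L0 : 0 ≤ layerWeight t y := by rw [layerWeight]; positivity
      have L1 : 0 ≤ layerWeight t y' := by rw [layerWeight]; positivity
      set m2 := (max t ‖v - y‖) ^ (-2 : ℝ)
      set m2' := (max t ‖v - y'‖) ^ (-2 : ℝ)
      have p2 : 0 < m2 := by positivity
      have p2' : 0 < m2' := by positivity
      have hmain : |halfDiff j v y| * |halfDiff j v y' - halfDiff j v y| ≤
          2 * S * (m2 * ((max t ‖v - y'‖) ^ (-(5 / 2) : ℝ) + (max t ‖v - y‖) ^ (-(5 / 2) : ℝ)))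
          + 2 * S * (layerWeight t y + layerWeight t y') := by
        by_cases hside : 0 ≤ y 2 ∧ 0 ≤ y' 2 ∨ y 2 < 0 ∧ y' 2 < 0
        · have h6 := halfDiff_sub_le_of_same_side j hvt hside
          rw [hyy, hv2] at h6
          have h7 : |halfDiff j v y' - halfDiff j v y| ≤ 2 * S *
            ((max t ‖v - y‖) ^ (-(5 / 2) : ℝ) + (max t ‖v - y'‖) ^ (-(5 / 2) : ℝ)) :=
              h6.trans (by gcongr)
          have h8 := mul_le_mul h4 h7 (abs_nonneg _) p2.le
          have h9 : 0 ≤ 2 * S * (layerWeight t y + layerWeight t y') := by positivity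
          linarith
        · have hM2 : |y' 2 - y 2| ≤ M := by
            have : |(y' - y) 2| ≤ M := by
              rw [hyy]; exact (abs_coord_le_norm _ 2).trans (hMq _ hz)
            simpa using this
          have h10 := layer_le hp hp' hside hM2 (a := m2 * m2) (a' := m2' * m2') (by positivity)
            (by positivity)
          have h11 : |halfDiff j v y' - halfDiff j v y| ≤ m2' + m2 :=
            (abs_sub _ _).trans (add_le_add h4' h4)
          have h12 := mul_le_mul h4 h11 (abs_nonneg _) p2.le
          have h13 : m2 * (m2' + m2) ≤ 2 * (m2 * m2) + 2 * (m2' * m2') := by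
            nlinarith [sq_nonneg (m2 - m2'), mul_pos p2' p2']
          have h14 : 0 ≤ 2 * S * (m2 * ((max t ‖v - y'‖) ^ (-(5 / 2) : ℝ) +
            (max t ‖v - y‖) ^ (-(5 / 2) : ℝ))) := by positivity
          have l1 : layerWeight t y = |y 2| ^ (-(1 / 2) : ℝ) * (m2 * m2) := by
            rw [e4a, layerWeight]
          have l2 : layerWeight t y' = |y' 2| ^ (-(1 / 2) : ℝ) * (m2' * m2') := by
            rw [e4b, layerWeight]
          rw [l1, l2]
          linarith [h10.1, h10.2]
      rw [← mul_sub, ← mul_sub, abs_mul, abs_mul, abs_of_nonneg (hq.nonneg _)]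
      refine (mul_le_mul_of_nonneg_left hmain (hq.nonneg _)).trans (le_of_eq ?_)
      ring
    refine (integral_mono_ae ((hWW 1).sub (hWW 0)).abs ((((bm 1).1.add (bm 0).1).const_mul
      (2 * S)).add ((hL1.add hL2).const_mul (2 * S))) hle).trans ?_
    have i1 := ((bm 1).1.add (bm 0).1).const_mul (2 * S)
    have i2 := (hL1.add hL2).const_mul (2 * S)
    simp only [Pi.add_apply] at i1 i2 ⊢
    rw [integral_add i1 i2, integral_const_mul, integral_const_mul, integral_add (bm 1).1 (bm 0).1,
      integral_add hL1 hL2, integral_weight_mul_snd hq,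
      integral_weight_mul_shear hq (integrable_layerWeight ht) 1, integral_layerWeight ht]
    have a1 := (le_abs_self _).trans (bm 1).2
    have a0 := (le_abs_self _).trans (bm 0).2
    rw [corr] at a1 a0
    have : 0 ≤ S * (t ^ (-(3 / 2) : ℝ) * I1) := by positivity
    nlinarith
  calc _ = |2 * (corr q 1 (halfDiff j v) (fun y => kern j (v - y)) -
      corr q 0 (halfDiff j v) (fun y => kern j (v - y))) +
        (corr q 1 (halfDiff j v) (halfDiff j v) - corr q 0 (halfDiff j v) (halfDiff j v))| := by
        congr 1; ring
    _ ≤ 2 * (4 * S * c1 * t ^ (-(3 / 2) : ℝ)) +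
        (4 * S * c1 + 4 * S * I1) * t ^ (-(3 / 2) : ℝ) := by
        refine (abs_add_le _ _).trans (add_le_add ?_ part2)
        rw [abs_mul, abs_two]
        linarith
    _ = _ := by ring

/-! ### The exact limit -/

/-- With `a` and `b` the distances to a point and to its mirror image, the integrand over a
horizontal plane has an elementary primitive with denominator `a b`. The derivative reduces to the
polynomial identity `2a²b² - (r² + h² - t²)(a² + b²) = 4t²(r² + t² - h²)`. -/
theorem hasDerivAt_radialPrimitive {t h : ℝ} (ht : 0 < t) {A B : ℝ} (hA : A = (t - h) ^ 2)
    (hB : B = (t + h) ^ 2) {r : ℝ} (hrA : 0 < r ^ 2 + A) (hrB : 0 < r ^ 2 + B) :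
    HasDerivAt (fun r : ℝ => (r ^ 2 + h ^ 2 - t ^ 2) / (4 * t ^ 2 * (√(r ^ 2 + A) * √(r ^ 2 + B))))
      (r * ((r ^ 2 + t ^ 2 - h ^ 2) / (√(r ^ 2 + A) ^ 3 * √(r ^ 2 + B) ^ 3))) r := by
  have hd : ∀ C : ℝ, HasDerivAt (fun r : ℝ => r ^ 2 + C) (2 * r) r := fun C => by
    simpa using (hasDerivAt_pow 2 r).add_const C
  have ha := (hd A).sqrt hrA.ne'
  have hb := (hd B).sqrt hrB.ne'
  have hn : HasDerivAt (fun r : ℝ => r ^ 2 + h ^ 2 - t ^ 2) (2 * r) r := by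
    simpa [add_sub_assoc] using hd (h ^ 2 - t ^ 2)
  have sa : 0 < √(r ^ 2 + A) := Real.sqrt_pos.2 hrA
  have sb : 0 < √(r ^ 2 + B) := Real.sqrt_pos.2 hrB
  have qa := Real.sq_sqrt hrA.le
  have qb := Real.sq_sqrt hrB.le
  have hden : 4 * t ^ 2 * (√(r ^ 2 + A) * √(r ^ 2 + B)) ≠ 0 := by positivity
  have H := hn.div ((ha.mul hb).const_mul (4 * t ^ 2)) hden
  refine H.congr_deriv ?_
  simp only [Pi.mul_apply]
  set a := √(r ^ 2 + A)
  set b := √(r ^ 2 + B)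
  have e1 : a ^ 2 = r ^ 2 + (t - h) ^ 2 := by rw [qa, hA]
  have e2 : b ^ 2 = r ^ 2 + (t + h) ^ 2 := by rw [qb, hB]
  have key : 2 * (a ^ 2 * b ^ 2) - (r ^ 2 + h ^ 2 - t ^ 2) * (a ^ 2 + b ^ 2) =
      4 * t ^ 2 * (r ^ 2 + t ^ 2 - h ^ 2) := by rw [e1, e2]; ring
  have hsa := sa.ne'
  have hsb := sb.ne'
  have e3 : r * ((r ^ 2 + t ^ 2 - h ^ 2) / (a ^ 3 * b ^ 3)) =
      r * (4 * t ^ 2 * (r ^ 2 + t ^ 2 - h ^ 2)) / (4 * t ^ 2 * (a ^ 3 * b ^ 3)) := by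
    field_simp
  rw [e3, ← key]
  field_simp
  ring

theorem tendsto_radialPrimitive {t h A B : ℝ} (ht : 0 < t) :
    Tendsto (fun r : ℝ => (r ^ 2 + h ^ 2 - t ^ 2) / (4 * t ^ 2 * (√(r ^ 2 + A) * √(r ^ 2 + B))))
      atTop (𝓝 (1 / (4 * t ^ 2))) := by
  have hF : ContinuousAt (fun u : ℝ => (1 + (h ^ 2 - t ^ 2) * u ^ 2) /
      (4 * t ^ 2 * (√(1 + A * u ^ 2) * √(1 + B * u ^ 2)))) 0 := by
    refine ContinuousAt.div (by fun_prop) (by fun_prop) ?_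
    simp; positivity
  have h1 : Tendsto (fun r : ℝ => (1 + (h ^ 2 - t ^ 2) * (r⁻¹) ^ 2) /
      (4 * t ^ 2 * (√(1 + A * (r⁻¹) ^ 2) * √(1 + B * (r⁻¹) ^ 2)))) atTop (𝓝 (1 / (4 * t ^ 2))) := by
    have h2 := hF.tendsto.comp tendsto_inv_atTop_zero
    have e : (1 + (h ^ 2 - t ^ 2) * (0 : ℝ) ^ 2) /
        (4 * t ^ 2 * (√(1 + A * (0 : ℝ) ^ 2) * √(1 + B * (0 : ℝ) ^ 2))) = 1 / (4 * t ^ 2) := by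
      simp
    rwa [e] at h2
  refine h1.congr' ?_
  filter_upwards [eventually_gt_atTop (0 : ℝ)] with r hr
  have e : ∀ C : ℝ, √(r ^ 2 + C) = r * √(1 + C * r⁻¹ ^ 2) := fun C => by
    rw [← Real.sqrt_sq hr.le, ← Real.sqrt_mul (sq_nonneg r), Real.sqrt_sq hr.le]
    congr 1; field_simp
  rw [e, e]
  have e2 : r ^ 2 + h ^ 2 - t ^ 2 = r ^ 2 * (1 + (h ^ 2 - t ^ 2) * r⁻¹ ^ 2) := by
    field_simp; ring
  rw [e2, show 4 * t ^ 2 * (r * √(1 + A * r⁻¹ ^ 2) * (r * √(1 + B * r⁻¹ ^ 2))) =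
    r ^ 2 * (4 * t ^ 2 * (√(1 + A * r⁻¹ ^ 2) * √(1 + B * r⁻¹ ^ 2))) by ring,
    mul_div_mul_left _ _ (by positivity)]

/-- The radial profile of `∇K(x - y) · ∇K(x - ȳ)`. -/
def radialProfile (t h r : ℝ) : ℝ :=
  (r ^ 2 + t ^ 2 - h ^ 2) / (√(r ^ 2 + (t - h) ^ 2) ^ 3 * √(r ^ 2 + (t + h) ^ 2) ^ 3)

/-- The primitive tends to `1/(4t²)` at infinity. At `r = 0` it equals `(h² - t²) / (4t² |t - h| (t
+ h))`, that is `-1/(4t²)` if `h < t` and `1/(4t²)` if `h > t`: planes above the point do not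
contribute. -/
theorem integral_radialProfile {t h : ℝ} (ht : 0 < t) (hh : 0 < h) (hne : h ≠ t)
    (hint : IntegrableOn (fun r => r * radialProfile t h r) (Ioi 0)) :
    ∫ r in Ioi (0 : ℝ), r * radialProfile t h r = if h < t then 1 / (2 * t ^ 2) else 0 := by
  have hA : 0 < (t - h) ^ 2 := by
    have : t - h ≠ 0 := sub_ne_zero.2 hne.symm
    positivity
  have hB : 0 < (t + h) ^ 2 := by positivity
  unfold radialProfile at hint ⊢
  rw [integral_Ioi_of_hasDerivAt_of_tendsto' (fun r _ => hasDerivAt_radialPrimitive ht rfl rfl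
    (by positivity) (by positivity)) hint (tendsto_radialPrimitive ht)]
  simp only [ne_eq, OfNat.ofNat_ne_zero, not_false_eq_true, zero_pow, zero_add]
  rw [Real.sqrt_sq_eq_abs, Real.sqrt_sq_eq_abs, abs_of_pos (by linarith : 0 < t + h)]
  split_ifs with hlt
  · rw [abs_of_pos (by linarith)]
    have h1 : t - h ≠ 0 := by linarith
    field_simp
    ring
  · have h1 : h - t ≠ 0 := sub_ne_zero.2 hne
    rw [abs_of_neg (by rcases lt_or_gt_of_ne hne with h2 | h2; exacts [absurd h2 hlt, by linarith])]
    have h3 : -(t - h) = h - t := by ring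
    rw [h3]
    field_simp
    ring

theorem integral_radial_plane (f : ℝ → ℝ) :
    ∫ p : ℝ × ℝ, f √(p.1 ^ 2 + p.2 ^ 2) = 2 * Real.pi * ∫ r in Ioi (0 : ℝ), r * f r := by
  have h1 := Complex.volume_preserving_equiv_real_prod.integral_comp'
    (g := fun p : ℝ × ℝ => f √(p.1 ^ 2 + p.2 ^ 2))
  rw [← h1]
  have h2 : ∀ z : ℂ, f √((Complex.measurableEquivRealProd z).1 ^ 2 +
      (Complex.measurableEquivRealProd z).2 ^ 2) = f ‖z‖ := fun z => by
    rw [Complex.norm_eq_sqrt_sq_add_sq]; rfl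
  simp_rw [h2]
  rw [integral_fun_norm_addHaar volume f]
  simp [Measure.real, Complex.volume_ball, mul_assoc]

theorem integrable_radial_plane {f : ℝ → ℝ}
    (h : Integrable fun p : ℝ × ℝ => f √(p.1 ^ 2 + p.2 ^ 2)) :
    IntegrableOn (fun r => r * f r) (Ioi 0) := by
  have h1 := Complex.volume_preserving_equiv_real_prod.integrable_comp_of_integrable h
  have h2 : ((fun p : ℝ × ℝ => f √(p.1 ^ 2 + p.2 ^ 2)) ∘ Complex.measurableEquivRealProd) =
      fun z : ℂ => f ‖z‖ := by
    ext z
    rw [Complex.norm_eq_sqrt_sq_add_sq]; rfl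
  rw [h2, integrable_fun_norm_addHaar volume (f := f)] at h1
  simpa using h1

/-- Horizontal components coincide and give `r²`, and the vertical ones multiply to `(t - h)(t +
h)`. -/
theorem sum_kern_mul_kern_flip (t : ℝ) (p : ℝ × (ℝ × ℝ)) :
    ∑ j, kern j (vertical t - !₂[p.2.1, p.2.2, p.1]) *
      kern j (vertical t - reflect (flipSign 2) !₂[p.2.1, p.2.2, p.1]) =
      (16 * Real.pi ^ 2)⁻¹ * radialProfile t p.1 √(p.2.1 ^ 2 + p.2.2 ^ 2) := by
  have h01 : (0 : Fin 3) ≠ 2 := by decide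
  have h11 : (1 : Fin 3) ≠ 2 := by decide
  have e1 : ‖vertical t - !₂[p.2.1, p.2.2, p.1]‖ = √(p.2.1 ^ 2 + p.2.2 ^ 2 + (t - p.1) ^ 2) := by
    rw [norm_E3]; simp
  have e2 : ‖vertical t - reflect (flipSign 2) !₂[p.2.1, p.2.2, p.1]‖ =
      √(p.2.1 ^ 2 + p.2.2 ^ 2 + (t + p.1) ^ 2) := by
    rw [norm_E3]; simp [reflect_flip_same, reflect_flip_ne h01, reflect_flip_ne h11]
  have e3 : √(p.2.1 ^ 2 + p.2.2 ^ 2) ^ 2 = p.2.1 ^ 2 + p.2.2 ^ 2 := Real.sq_sqrt (by positivity)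
  rw [Fin.sum_univ_three]
  simp only [kern, e1, e2, radialProfile, e3]
  simp only [PiLp.sub_apply, vertical_zero, vertical_one, vertical_two, reflect_flip_same,
    reflect_flip_ne h01, reflect_flip_ne h11, zero_sub]
  simp only [PiLp.toLp_apply, Matrix.cons_val_zero, Matrix.cons_val_one, Matrix.cons_val]
  set a := √(p.2.1 ^ 2 + p.2.2 ^ 2 + (t - p.1) ^ 2) ^ 3
  set b := √(p.2.1 ^ 2 + p.2.2 ^ 2 + (t + p.1) ^ 2) ^ 3
  have hpi := Real.pi_ne_zero
  by_cases ha : a = 0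
  · simp [ha]
  by_cases hb : b = 0
  · simp [hb]
  field_simp
  ring

/-- With `k̄` the reflected kernel, `(2k + D) D` is `2 k k̄ + k̄²` above the plane and `-k²` below
it. Reflection exchanges the two squares, so they cancel in the integral and `2 ∫ k k̄` over the
half-space remains. Slicing horizontally, each height in `(0, t)` contributes `(16π²)⁻¹ · 2π ·
1/(2t²) = 1/(16πt²)` and the others nothing; the total is `2t/(16πt²) = 1/(8πt)`. -/
theorem halfCorr_zero {q : E3 → ℝ} (hq : CorrWeight q) {x : E3} (hx : 0 < x 2) :
    halfCorr q 0 x = 1 / (8 * Real.pi * x 2) := by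
  rw [halfCorr_congr q 0 (x' := vertical (x 2)) (by simp)]
  have ht : 0 < x 2 := hx
  generalize x 2 = t at ht
  set v := vertical t with hv
  have hv2 : v 2 = t := vertical_two t
  have hvt : 0 < v 2 := by rw [hv2]; exact ht
  have hvX : v ∈ {x : E3 | 0 < x 2} := hvt
  -- the product with the reflected kernel
  set F : Fin 3 → E3 → ℝ := fun j => halfSpace.indicator
    fun y => kern j (v - y) * kern j (v - reflect (flipSign 2) y) with hF
  have hm4 : Integrable fun y : E3 => (max t ‖v - y‖) ^ (-4 : ℝ) :=
    (integrable_max_norm_rpow ht (by norm_num)).comp_sub_left v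
  have hsq : ∀ j, Integrable fun y => halfDiff j v y ^ 2 := by
    intro j
    have hm := ((regFam_halfDiff j one_half_pos one_half_lt_one).meas v hvX)
    refine hm4.mono' (hm.pow 2) (Eventually.of_forall fun y => ?_)
    have h4 := abs_halfDiff_le j hvt y
    rw [hv2] at h4
    have hm : 0 < max t ‖v - y‖ := lt_max_of_lt_left ht
    rw [Real.norm_of_nonneg (sq_nonneg _), ← sq_abs]
    calc |halfDiff j v y| ^ 2 ≤ ((max t ‖v - y‖) ^ (-2 : ℝ)) ^ 2 := by gcongr
      _ = _ := by rw [sq, ← Real.rpow_add hm]; norm_num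
  have hprod : ∀ j, Integrable fun y => (2 * kern j (v - y) + halfDiff j v y) * halfDiff j v y := by
    intro j
    have h1 := integrable_corrIntegrand hq 0 (a := 2) (b := 2) zero_le_two (by norm_num) zero_le_two
      (by norm_num) hvt (by norm_num) (by norm_num)
      ((singFam_two_kern_add j one_half_pos one_half_lt_one).meas v hvX)
      ((regFam_halfDiff j one_half_pos one_half_lt_one).meas v hvX) v v
      ((singFam_two_kern_add j one_half_pos one_half_lt_one).bound v hvX)
      ((regFam_halfDiff j one_half_pos one_half_lt_one).bound v hvX)
    have h2 : corrIntegrand q 0 (fun y => 2 * kern j (v - y) + halfDiff j v y) (halfDiff j v) =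
        fun p : E3 × E3 => q p.1 * ((2 * kern j (v - p.2) + halfDiff j v p.2) * halfDiff j v p.2) := by
      ext p; simp [corrIntegrand]
    rw [h2, Measure.volume_eq_prod] at h1
    -- Fubini gives integrability in `y` for almost every `z`, up to the factor `q z`; as `q` has
    -- integral one, that factor is nonzero for some such `z`.
    obtain ⟨z, hz, hz0⟩ : ∃ z, Integrable (fun y => q z * ((2 * kern j (v - y) + halfDiff j v y) *
        halfDiff j v y)) ∧ q z ≠ 0 := by
      by_contra hcon
      push Not at hcon
      have h3 : ∀ᵐ z, q z = 0 := by
        filter_upwards [h1.prod_right_ae] with z hz using hcon z hz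
      have := integral_congr_ae h3
      simp [hq.integral_eq_one] at this
    have := hz.const_mul (q z)⁻¹
    simpa [inv_mul_cancel_left₀ hz0] using this
  have hdecomp : ∀ j y, (2 * kern j (v - y) + halfDiff j v y) * halfDiff j v y = 2 * F j y +
      (halfSpace.indicator (fun y => halfDiff j v y ^ 2) y -
        halfSpaceᶜ.indicator (fun y => halfDiff j v y ^ 2) y) := by
    intro j y
    by_cases hy : y ∈ halfSpace
    · have hy' : 0 ≤ y 2 := hy
      simp only [hF, indicator, hy, if_true, mem_compl_iff, not_true, if_false,
        halfDiff_of_nonneg j v hy']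
      ring
    · have hy' : y 2 < 0 := not_le.1 hy
      simp only [hF, indicator, hy, if_true, mem_compl_iff, not_false_iff, if_false,
        halfDiff_of_neg j v hy']
      ring
  have hsq1 := fun j => (hsq j).indicator measurableSet_halfSpace
  have hsq2 := fun j => (hsq j).indicator measurableSet_halfSpace.compl
  have hFint : ∀ j, Integrable (F j) := by
    intro j
    have := ((hprod j).sub ((hsq1 j).sub (hsq2 j))).const_mul (1 / 2)
    refine this.congr (Eventually.of_forall fun y => ?_)
    simp only [Pi.sub_apply, hdecomp j y]
    ring
  have hcancel : ∀ j, ∫ y, halfSpace.indicator (fun y => halfDiff j v y ^ 2) y =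
      ∫ y, halfSpaceᶜ.indicator (fun y => halfDiff j v y ^ 2) y := by
    intro j
    have hmp := (reflect (flipSign 2)).measurePreserving
    rw [← hmp.integral_comp (reflect (flipSign 2)).toHomeomorph.measurableEmbedding]
    refine integral_congr_ae ?_
    filter_upwards [ae_coord_ne 2 0] with y hy
    rcases lt_or_gt_of_ne hy with h | h
    · have h1 : y ∉ halfSpace := not_le.2 h
      have h2 : reflect (flipSign 2) y ∈ halfSpace := by
        show 0 ≤ (reflect (flipSign 2) y) 2
        rw [reflect_flip_same]; linarith
      have h3 : 0 ≤ (reflect (flipSign 2) y) 2 := h2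
      rw [indicator_of_mem h2, indicator_of_mem (mem_compl h1), halfDiff_of_nonneg j v h3,
        halfDiff_of_neg j v h, reflect_reflect]
      ring
    · have h1 : y ∈ halfSpace := le_of_lt h
      have h3 : (reflect (flipSign 2) y) 2 < 0 := by rw [reflect_flip_same]; linarith
      have h2 : reflect (flipSign 2) y ∉ halfSpace := not_le.2 h3
      rw [indicator_of_notMem h2, indicator_of_notMem (notMem_compl_iff.2 h1)]
  have e1 : halfCorr q 0 v = 2 * ∫ y, ∑ j, F j y := by
    rw [halfCorr, integral_finsetSum _ fun j _ => hFint j, Finset.mul_sum]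
    refine Finset.sum_congr rfl fun j _ => ?_
    rw [corr_zero hq]
    simp_rw [hdecomp j]
    have hs : Integrable fun y => halfSpace.indicator (fun y => halfDiff j v y ^ 2) y -
        halfSpaceᶜ.indicator (fun y => halfDiff j v y ^ 2) y := (hsq1 j).sub (hsq2 j)
    rw [integral_add ((hFint j).const_mul 2) hs, integral_sub (hsq1 j) (hsq2 j),
      hcancel, sub_self, add_zero, integral_const_mul]
  have hsumint : Integrable fun y => ∑ j, F j y := integrable_finsetSum _ fun j _ => hFint j
  have e2 : ∀ p : ℝ × (ℝ × ℝ), ∑ j, F j !₂[p.2.1, p.2.2, p.1] = (Ici (0 : ℝ)).indicator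
      (fun h => (16 * Real.pi ^ 2)⁻¹ * radialProfile t h √(p.2.1 ^ 2 + p.2.2 ^ 2)) p.1 := by
    intro p
    have hiff : (!₂[p.2.1, p.2.2, p.1] : E3) ∈ halfSpace ↔ p.1 ∈ Ici (0 : ℝ) := by
      simp [halfSpace]
    by_cases hp : p.1 ∈ Ici (0 : ℝ)
    · rw [indicator_of_mem hp, ← sum_kern_mul_kern_flip]
      refine Finset.sum_congr rfl fun j _ => ?_
      rw [hF]; simp only; rw [indicator_of_mem (hiff.2 hp)]
    · rw [indicator_of_notMem hp]
      refine Finset.sum_eq_zero fun j _ => ?_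
      rw [hF]; simp only; rw [indicator_of_notMem (mt hiff.1 hp)]
  have hint := integrable_coords_iff.2 hsumint
  simp_rw [e2] at hint
  rw [Measure.volume_eq_prod] at hint
  rw [e1, integral_coords]
  simp_rw [e2]
  rw [Measure.volume_eq_prod, integral_prod _ hint]
  have hpi := Real.pi_pos
  have e3 : ∀ᵐ h : ℝ, ∫ p : ℝ × ℝ, (Ici (0 : ℝ)).indicator
      (fun h => (16 * Real.pi ^ 2)⁻¹ * radialProfile t h √(p.1 ^ 2 + p.2 ^ 2)) h =
      (Ioo 0 t).indicator (fun _ => (16 * Real.pi * t ^ 2)⁻¹) h := by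
    have n1 : ∀ᵐ h : ℝ, h ≠ t := by simp [ae_iff]
    have n0 : ∀ᵐ h : ℝ, h ≠ 0 := by simp [ae_iff]
    filter_upwards [hint.prod_right_ae, n1, n0] with h hh hne hne0
    rcases lt_or_gt_of_ne hne0 with h0 | h0
    · rw [indicator_of_notMem (fun hm => by have := hm.1; linarith)]
      simp [indicator, not_le.2 h0]
    · have hmem : h ∈ Ici (0 : ℝ) := h0.le
      simp only [indicator_of_mem hmem] at hh ⊢
      have hh2 : Integrable fun p : ℝ × ℝ => radialProfile t h √(p.1 ^ 2 + p.2 ^ 2) := by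
        have := hh.const_mul (16 * Real.pi ^ 2)
        refine this.congr (Eventually.of_forall fun p => ?_)
        field_simp
      rw [integral_const_mul, integral_radial_plane (radialProfile t h),
        integral_radialProfile ht h0 hne (integrable_radial_plane hh2)]
      by_cases hlt : h < t
      · rw [if_pos hlt, indicator_of_mem (show h ∈ Ioo 0 t from ⟨h0, hlt⟩)]
        field_simp
      · rw [if_neg hlt, indicator_of_notMem (fun hm => hlt hm.2)]
        simp
  rw [integral_congr_ae e3, integral_indicator measurableSet_Ioo]
  simp only [setIntegral_const, measureReal_def, Real.volume_Ioo, sub_zero,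
    ENNReal.toReal_ofReal ht.le, smul_eq_mul]
  field_simp
  norm_num

/-! ### Weighted Hölder spaces: convergence from uniform bounds and pointwise convergence -/

theorem WHolderBound.mono {S P : Set E3} {α η C C' : ℝ} {u : E3 → ℝ} (h : WHolderBound S P α η C u)
    (hC : C ≤ C') : WHolderBound S P α η C' u where
  bound x hx := (h.bound x hx).trans
    (mul_le_mul_of_nonneg_right hC (Real.rpow_nonneg Metric.infDist_nonneg _))
  holder x hx y hy hxy := (h.holder x hx y hy hxy).trans
    (mul_le_mul_of_nonneg_right (mul_le_mul_of_nonneg_right hC (Real.rpow_nonneg dist_nonneg _))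
      (Real.rpow_nonneg Metric.infDist_nonneg _))

theorem exists_tendsto_wHolderBound {S P : Set E3} {α η : ℝ} {U : ℝ → E3 → ℝ}
    (h : ∀ δ : ℝ, 0 < δ → ∀ᶠ ε in 𝓝[>] (0 : ℝ), WHolderBound S P α η δ (U ε)) :
    ∃ C : ℝ → ℝ, Tendsto C (𝓝[>] 0) (𝓝 0) ∧
      ∀ᶠ ε in 𝓝[>] (0 : ℝ), WHolderBound S P α η (C ε) (U ε) := by
  set s : ℝ → Set ℝ := fun ε => {δ | 0 ≤ δ ∧ WHolderBound S P α η δ (U ε)} with hs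
  have hbdd : ∀ ε, BddBelow (s ε) := fun ε => ⟨0, fun δ hδ => hδ.1⟩
  have h0 : ∀ ε, 0 ≤ sInf (s ε) := fun ε => Real.sInf_nonneg fun δ hδ => hδ.1
  -- The infimum is the best constant; adding `ε` produces an admissible constant strictly above it
  -- without affecting the limit.
  refine ⟨fun ε => sInf (s ε) + ε, ?_, ?_⟩
  · have h1 : Tendsto (fun ε => sInf (s ε)) (𝓝[>] 0) (𝓝 0) := by
      rw [Metric.tendsto_nhds]
      intro δ hδ
      filter_upwards [h (δ / 2) (half_pos hδ)] with ε hε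
      rw [Real.dist_eq, sub_zero, abs_of_nonneg (h0 ε)]
      exact (csInf_le (hbdd ε) ⟨(half_pos hδ).le, hε⟩).trans_lt (half_lt_self hδ)
    simpa using h1.add (tendsto_id.mono_left nhdsWithin_le_nhds)
  · filter_upwards [h 1 one_pos, self_mem_nhdsWithin] with ε h1 hε
    obtain ⟨δ, hδ, hlt⟩ := exists_lt_of_csInf_lt (s := s ε) ⟨1, zero_le_one, h1⟩
      (lt_add_of_pos_right (sInf (s ε)) hε)
    exact hδ.2.mono hlt.le

/-- At distance at least `r` from `P` the weight is bounded, so the family is equicontinuous on a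
compact set, and pointwise convergence on a finite net is enough. -/
theorem eventually_uniform_of_wHolderBound {S P : Set E3} (hS : IsCompact S) {α η C : ℝ} (hα : 0 < α)
    {U : ℝ → E3 → ℝ} (hU : ∀ᶠ ε in 𝓝[>] (0 : ℝ), WHolderBound S P α η C (U ε)) (hηα : η ≤ α)
    (hT : ∀ x ∈ S \ P, Tendsto (fun ε => U ε x) (𝓝[>] 0) (𝓝 0)) {r : ℝ} (hr : 0 < r) {δ : ℝ}
    (hδ : 0 < δ) :
    ∀ᶠ ε in 𝓝[>] (0 : ℝ), ∀ x ∈ S, r ≤ Metric.infDist x P → |U ε x| ≤ δ := by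
  have hmem : ∀ x ∈ S, r ≤ Metric.infDist x P → x ∈ S \ P := fun x hx hrx =>
    ⟨hx, fun hP => by rw [Metric.infDist_zero_of_mem hP] at hrx; linarith⟩
  set K := S ∩ {x | r ≤ Metric.infDist x P} with hK
  have hKc : IsCompact K := hS.inter_right
    (isClosed_le continuous_const (Metric.continuous_infDist_pt P))
  set D := |C| * r ^ (η - α) with hD
  have hD0 : 0 ≤ D := by positivity
  obtain ⟨s, hs0, hsr, hs⟩ : ∃ s : ℝ, 0 < s ∧ s ≤ r / 2 ∧ D * s ^ α ≤ δ / 2 := by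
    have h1 : Tendsto (fun s : ℝ => D * s ^ α) (𝓝[>] 0) (𝓝 0) := by
      have : Tendsto (fun s : ℝ => D * s ^ α) (𝓝 0) (𝓝 (D * 0 ^ α)) :=
        (tendsto_const_nhds.mul ((Real.continuousAt_rpow_const 0 α (Or.inr hα.le)).tendsto))
      rw [Real.zero_rpow hα.ne', mul_zero] at this
      exact this.mono_left nhdsWithin_le_nhds
    have h2 := h1.eventually (eventually_le_nhds (half_pos hδ))
    have h3 : ∀ᶠ s in 𝓝[>] (0 : ℝ), s ≤ r / 2 :=
      nhdsWithin_le_nhds (eventually_le_nhds (half_pos hr))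
    obtain ⟨s, h4, h5, h6⟩ := (h2.and (h3.and self_mem_nhdsWithin)).exists
    exact ⟨s, h6, h5, h4⟩
  obtain ⟨F, hFK, hF, hcov⟩ := hKc.finite_cover_balls hs0
  have hev : ∀ᶠ ε in 𝓝[>] (0 : ℝ), ∀ x ∈ F, |U ε x| ≤ δ / 2 := by
    rw [eventually_all_finite hF]
    intro x hx
    have := (hT x (hmem x (hFK hx).1 (hFK hx).2)).abs
    rw [abs_zero] at this
    exact this.eventually (eventually_le_nhds (half_pos hδ))
  filter_upwards [hev, hU] with ε h1 h2 y hy hry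
  obtain ⟨x, hx, hyx⟩ := mem_iUnion₂.1 (hcov ⟨hy, hry⟩)
  have hxK := hFK hx
  have hd : dist x y < s := by rw [dist_comm]; exact hyx
  have hrx : r ≤ Metric.infDist x P := hxK.2
  have h3 := h2.holder x (hmem x hxK.1 hxK.2) y (hmem y hy hry) (by linarith)
  have h4 : |U ε x - U ε y| ≤ D * s ^ α := by
    refine h3.trans ?_
    calc C * dist x y ^ α * Metric.infDist x P ^ (η - α) ≤
        |C| * s ^ α * r ^ (η - α) := by
          refine mul_le_mul (mul_le_mul (le_abs_self C) (Real.rpow_le_rpow dist_nonneg hd.le hα.le)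
            (by positivity) (abs_nonneg C)) (Real.rpow_le_rpow_of_nonpos hr hrx (by linarith))
            (Real.rpow_nonneg Metric.infDist_nonneg _) (by positivity)
      _ = D * s ^ α := by rw [hD]; ring
  have h5 := h1 x hx
  have h6 : |U ε y| ≤ |U ε x| + |U ε x - U ε y| := by
    have := abs_sub (U ε x) (U ε x - U ε y)
    simpa using this
  linarith

/-- Interpolation between a stronger uniform bound and local uniform convergence. The bounds with
`κ/2` pass to the pointwise limit. Against the norm with `κ` they leave a surplus power `κ/2` of the
distance to `P`, or of `dist x y`, which is small below a scale `h0`. Above that scale the points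
are at distance at least `h0` from `P`, where convergence is uniform. -/
theorem tendstoWHolder_of_bounds {S P : Set E3} (hS : IsCompact S)
    (hpos : ∀ x ∈ S \ P, 0 < Metric.infDist x P) {η : ℝ} (hη : η ≤ 0) {R : ℝ → E3 → ℝ} {R0 : E3 → ℝ}
    (hM : ∀ κ : ℝ, 0 < κ → κ < 1 → ∀ ε, 0 < ε → MemWHolder S P (1 - κ) (η - κ) (R ε))
    (hB : ∀ κ : ℝ, 0 < κ → κ < 1 → ∃ C, ∀ ε, 0 < ε → ε ≤ 1 →
      WHolderBound S P (1 - κ) (η - κ) C (R ε))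
    (hT : ∀ x ∈ S \ P, Tendsto (fun ε => R ε x) (𝓝[>] 0) (𝓝 (R0 x))) {κ : ℝ} (hκ : 0 < κ)
    (hκ1 : κ < 1) : TendstoWHolder S P (1 - κ) (η - κ) R R0 := by
  have hev : ∀ᶠ ε in 𝓝[>] (0 : ℝ), 0 < ε ∧ ε ≤ 1 := by
    filter_upwards [self_mem_nhdsWithin, nhdsWithin_le_nhds (eventually_le_nhds zero_lt_one)]
      with ε h1 h2 using ⟨h1, h2⟩
  have hlim : ∀ κ : ℝ, 0 < κ → κ < 1 → ∀ C, (∀ ε, 0 < ε → ε ≤ 1 →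
      WHolderBound S P (1 - κ) (η - κ) C (R ε)) → WHolderBound S P (1 - κ) (η - κ) C R0 := by
    intro κ hκ hκ1 C hC
    constructor
    · intro x hx
      exact le_of_tendsto (hT x hx).abs (hev.mono fun ε h => (hC ε h.1 h.2).bound x hx)
    · intro x hx y hy hxy
      exact le_of_tendsto ((hT x hx).sub (hT y hy)).abs
        (hev.mono fun ε h => (hC ε h.1 h.2).holder x hx y hy hxy)
  obtain ⟨C, hC⟩ := hB κ hκ hκ1
  refine ⟨⟨C, hlim κ hκ hκ1 C hC⟩, hM κ hκ hκ1, exists_tendsto_wHolderBound fun δ hδ => ?_⟩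
  -- a better bound, for an exponent with room
  have hκ2 : 0 < κ / 2 := half_pos hκ
  have hκ2' : κ / 2 < 1 := by linarith
  obtain ⟨C', hC'⟩ := hB (κ / 2) hκ2 hκ2'
  set A := 2 * |C'| + 1 with hA
  have hApos : 0 < A := by positivity
  have hU : ∀ᶠ ε in 𝓝[>] (0 : ℝ), WHolderBound S P (1 - κ / 2) (η - κ / 2) A
      (fun x => R ε x - R0 x) := by
    filter_upwards [hev] with ε h
    have h1 := (hC' ε h.1 h.2).mono (le_abs_self C')
    have h2 := (hlim _ hκ2 hκ2' C' hC').mono (le_abs_self C')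
    constructor
    · intro x hx
      have h3 := h1.bound x hx
      have h4 := h2.bound x hx
      have h5 := abs_sub (R ε x) (R0 x)
      have h6 : 0 ≤ Metric.infDist x P ^ min (η - κ / 2) 0 :=
        Real.rpow_nonneg Metric.infDist_nonneg _
      rw [hA]
      nlinarith
    · intro x hx y hy hxy
      have h3 := h1.holder x hx y hy hxy
      have h4 := h2.holder x hx y hy hxy
      have h5 := abs_sub (R ε x - R ε y) (R0 x - R0 y)
      have h6 : 0 ≤ dist x y ^ (1 - κ / 2) * Metric.infDist x P ^ (η - κ / 2 - (1 - κ / 2)) :=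
        mul_nonneg (Real.rpow_nonneg dist_nonneg _) (Real.rpow_nonneg Metric.infDist_nonneg _)
      rw [show R ε x - R0 x - (R ε y - R0 y) = R ε x - R ε y - (R0 x - R0 y) by ring, hA]
      nlinarith
  have hT0 : ∀ x ∈ S \ P, Tendsto (fun ε => R ε x - R0 x) (𝓝[>] 0) (𝓝 0) := fun x hx => by
    simpa using (hT x hx).sub_const (R0 x)
  obtain ⟨M, hM1, hMd⟩ : ∃ M : ℝ, 1 ≤ M ∧ ∀ x ∈ S, Metric.infDist x P ≤ M := by
    obtain ⟨M, hM⟩ := hS.bddAbove_image (Metric.continuous_infDist_pt P).continuousOn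
    exact ⟨max M 1, le_max_right _ _, fun x hx => (hM (mem_image_of_mem _ hx)).trans (le_max_left _ _)⟩
  have hM0 : 0 < M := zero_lt_one.trans_le hM1
  -- `h0` solves `A h0^(κ/2) = δ`: below this scale the surplus power alone brings the constant down
  -- to `δ`.
  obtain ⟨h0, hh0, hh0A⟩ : ∃ h0 : ℝ, 0 < h0 ∧ A * h0 ^ (κ / 2) ≤ δ := by
    refine ⟨(δ / A) ^ (κ / 2)⁻¹, by positivity, ?_⟩
    rw [Real.rpow_inv_rpow (by positivity) hκ2.ne']
    field_simp
    exact le_rfl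
  -- All weights have negative exponents, so on `S` they are bounded below by the same powers of
  -- `M`. The two entries are what the supremum bound and the Hölder bound require once the relevant
  -- scale exceeds `h0`.
  set δ1 := min (δ * M ^ (η - κ)) (δ * h0 ^ (1 - κ) * M ^ (η - 1) / 2) with hδ1
  have hδ1pos : 0 < δ1 := by positivity
  have hunif := eventually_uniform_of_wHolderBound hS (by linarith) hU (by linarith) hT0 hh0 hδ1pos
  have e1 : η - κ / 2 - (1 - κ / 2) = η - 1 := by ring
  have e2 : η - κ - (1 - κ) = η - 1 := by ring
  filter_upwards [hunif, hU] with ε hu hb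
  constructor
  · intro x hx
    have hd := hpos x hx
    rw [min_eq_left (by linarith)]
    rcases le_total (Metric.infDist x P) h0 with hle | hle
    · have h1 := hb.bound x hx
      rw [min_eq_left (by linarith)] at h1
      refine h1.trans ?_
      calc A * Metric.infDist x P ^ (η - κ / 2)
          = A * Metric.infDist x P ^ (κ / 2) * Metric.infDist x P ^ (η - κ) := by
            rw [mul_assoc, ← Real.rpow_add hd]; ring_nf
        _ ≤ δ * Metric.infDist x P ^ (η - κ) := by
            refine mul_le_mul_of_nonneg_right (le_trans ?_ hh0A) (by positivity)
            gcongr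
    · refine (hu x hx.1 hle).trans ((min_le_left _ _).trans ?_)
      exact mul_le_mul_of_nonneg_left (Real.rpow_le_rpow_of_nonpos hd (hMd x hx.1) (by linarith)) hδ.le
  · intro x hx y hy hxy
    have hd := hpos x hx
    rw [e2]
    rcases le_total (dist x y) h0 with hle | hle
    · have h1 := hb.holder x hx y hy hxy
      rw [e1] at h1
      refine h1.trans (mul_le_mul_of_nonneg_right ?_ (by positivity))
      rcases eq_or_lt_of_le (dist_nonneg (x := x) (y := y)) with h0' | h0'
      · rw [← h0', Real.zero_rpow (by linarith), Real.zero_rpow (by linarith)]; simp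
      · calc A * dist x y ^ (1 - κ / 2) = A * dist x y ^ (κ / 2) * dist x y ^ (1 - κ) := by
              rw [mul_assoc, ← Real.rpow_add h0']; ring_nf
          _ ≤ δ * dist x y ^ (1 - κ) := by
              refine mul_le_mul_of_nonneg_right (le_trans ?_ hh0A) (by positivity)
              gcongr
    · have hdx : h0 ≤ Metric.infDist x P := by linarith
      have hdy : h0 ≤ Metric.infDist y P := by
        have := Metric.infDist_le_infDist_add_dist (s := P) (x := x) (y := y)
        linarith
      have h1 := hu x hx.1 hdx
      have h2 := hu y hy.1 hdy
      have h3 := abs_sub (R ε x - R0 x) (R ε y - R0 y)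
      have h4 : 2 * δ1 ≤ δ * h0 ^ (1 - κ) * M ^ (η - 1) := by
        have := min_le_right (δ * M ^ (η - κ)) (δ * h0 ^ (1 - κ) * M ^ (η - 1) / 2)
        linarith
      calc _ ≤ δ * h0 ^ (1 - κ) * M ^ (η - 1) := by linarith
        _ ≤ _ := by
          refine mul_le_mul (mul_le_mul_of_nonneg_left (Real.rpow_le_rpow hh0.le hle (by linarith))
            hδ.le) (Real.rpow_le_rpow_of_nonpos hd (hMd x hx.1) (by linarith)) (by positivity)
            (by positivity)

/-- Weighted Hölder bounds in terms of a function `r` comparable to the distance. -/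
theorem wHolderBound_of_comparable {S P : Set E3} {r : E3 → ℝ}
    (hr : ∀ x ∈ S \ P, 0 < r x ∧ r x ≤ Metric.infDist x P ∧ Metric.infDist x P ≤ 3 / 2 * r x)
    (hlip : ∀ x y, |r x - r y| ≤ dist x y) {η κ A : ℝ} (hη : η ≤ 0) (hκ : 0 < κ) (hκ1 : κ < 1)
    (hA : 0 ≤ A) {u : E3 → ℝ} (hb : ∀ x ∈ S \ P, |u x| ≤ A * r x ^ (η - κ))
    (hh : ∀ x ∈ S \ P, ∀ y ∈ S \ P, dist x y ≤ 3 * min (r x) (r y) →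
      |u x - u y| ≤ A * dist x y ^ (1 - κ) * min (r x) (r y) ^ (η - 1)) :
    WHolderBound S P (1 - κ) (η - κ) (A * 6 ^ (1 - η)) u := by
  have key : ∀ {m d s : ℝ}, 0 < d → d / 6 ≤ m → s ≤ 0 → η - 1 ≤ s →
      m ^ s ≤ 6 ^ (1 - η) * d ^ s := by
    intro m d s hd hm hs hs1
    calc m ^ s ≤ (d / 6) ^ s := Real.rpow_le_rpow_of_nonpos (by positivity) hm hs
      _ = 6 ^ (-s) * d ^ s := by
          rw [div_eq_mul_inv, Real.mul_rpow hd.le (by norm_num), Real.inv_rpow (by norm_num),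
            Real.rpow_neg (by norm_num), mul_comm]
      _ ≤ _ := by gcongr <;> linarith
  -- From `r x ≥ 2/3` of the distance and `dist x y ≤ 1/2` of it, the Lipschitz bound leaves `2/3 -
  -- 1/2 = 1/6` for `r y`.
  have hcomp : ∀ x ∈ S \ P, ∀ y ∈ S \ P, dist x y ≤ Metric.infDist x P / 2 →
      Metric.infDist x P / 6 ≤ min (r x) (r y) := by
    intro x hx y hy hxy
    obtain ⟨h1, h2, h3⟩ := hr x hx
    have h4 := (abs_le.1 (hlip x y)).2
    refine le_min ?_ ?_ <;> linarith
  constructor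
  · intro x hx
    obtain ⟨h1, h2, h3⟩ := hr x hx
    rw [min_eq_left (by linarith), mul_assoc]
    exact (hb x hx).trans (mul_le_mul_of_nonneg_left (key (h1.trans_le h2) (by linarith)
      (by linarith) (by linarith)) hA)
  · intro x hx y hy hxy
    have h4 := hcomp x hx y hy hxy
    refine (hh x hx y hy (by linarith)).trans ?_
    rw [show η - κ - (1 - κ) = η - 1 by ring]
    calc _ ≤ A * dist x y ^ (1 - κ) * (6 ^ (1 - η) * Metric.infDist x P ^ (η - 1)) :=
          mul_le_mul_of_nonneg_left (key ((hr x hx).1.trans_le (hr x hx).2.1) h4 (by linarith) le_rfl)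
            (by positivity)
      _ = _ := by ring

/-! ### Geometry of the tetrahedron -/

theorem isClosed_cubeD : IsClosed cubeD := by
  simp only [cubeD, ofPred_forall, ofPred_and]
  exact isClosed_iInter fun i => (isClosed_le continuous_const (continuous_coord i)).inter
    (isClosed_le (continuous_coord i) continuous_const)

theorem interior_cubeD : interior cubeD = {x : E3 | ∀ i, 0 < x i ∧ x i < 2} := by
  have h : cubeD = (EuclideanSpace.equiv (Fin 3) ℝ).toHomeomorph ⁻¹' (univ.pi fun _ => Icc 0 2) := by
    ext x; simp [cubeD, -Set.pi_univ_Icc, Set.mem_pi]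
  rw [h, ← Homeomorph.preimage_interior, interior_pi_set finite_univ]
  ext x
  simp [Set.mem_pi]

theorem mem_bdryD {x : E3} : x ∈ bdryD ↔ x ∈ cubeD ∧ ∃ i, x i = 0 ∨ x i = 2 := by
  rw [bdryD, isClosed_cubeD.frontier_eq, interior_cubeD]
  simp only [Set.mem_sdiff, mem_ofPred_eq, not_forall, not_and_or, not_lt]
  refine and_congr_right fun hx => exists_congr fun i => ?_
  have := hx i
  constructor
  · rintro (h | h)
    · exact Or.inl (by linarith)
    · exact Or.inr (by linarith)
  · rintro (h | h)
    · exact Or.inl h.le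
    · exact Or.inr h.ge

theorem isClosed_tetraQ : IsClosed tetraQ := by
  simp only [tetraQ, ofPred_and]
  exact (isClosed_le continuous_const (continuous_coord 2)).inter
    ((isClosed_le (continuous_coord 2) (continuous_coord 0)).inter
      ((isClosed_le (continuous_coord 0) (continuous_coord 1)).inter
        (isClosed_le (continuous_coord 1) continuous_const)))

theorem tetraQ_bounds {x : E3} (hx : x ∈ tetraQ) (i : Fin 3) : x 2 ≤ x i ∧ 0 ≤ x i ∧ x i ≤ 1 := by
  obtain ⟨h1, h2, h3, h4⟩ := hx
  fin_cases i <;> simp only [Fin.zero_eta, Fin.mk_one, Fin.reduceFinMk] <;>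
    refine ⟨?_, ?_, ?_⟩ <;> linarith

theorem tetraQ_subset_cubeD : tetraQ ⊆ cubeD := fun x hx i => by
  have := tetraQ_bounds hx i
  constructor <;> linarith

theorem isCompact_tetraQ : IsCompact tetraQ := by
  refine Metric.isCompact_of_isClosed_isBounded isClosed_tetraQ
    (isBounded_iff_forall_norm_le.2 ⟨√3, fun x hx => ?_⟩)
  rw [norm_E3]
  refine Real.sqrt_le_sqrt ?_
  have h := tetraQ_bounds hx
  nlinarith [h 0, h 1, h 2]

@[simp] theorem projBdry_zero (x : E3) : projBdry x 0 = x 0 := by simp [projBdry]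
@[simp] theorem projBdry_one (x : E3) : projBdry x 1 = x 1 := by simp [projBdry]
@[simp] theorem projBdry_two (x : E3) : projBdry x 2 = 0 := by simp [projBdry]

theorem continuous_projBdry : Continuous projBdry := by
  unfold projBdry
  fun_prop

theorem mem_faceQ {x : E3} : x ∈ faceQ ↔ x ∈ tetraQ ∧ x 2 = 0 := by
  constructor
  · rintro ⟨y, hy, rfl⟩
    obtain ⟨h1, h2, h3, h4⟩ := hy
    exact ⟨⟨by simp, by simp; linarith, by simpa, by simpa⟩, by simp⟩
  · rintro ⟨hx, h0⟩
    refine ⟨x, hx, ?_⟩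
    ext i; fin_cases i <;> simp [h0]

theorem isCompact_faceQ : IsCompact faceQ := isCompact_tetraQ.image continuous_projBdry

/-- In `Q` the third coordinate is the smallest and all are at most one, so the bottom face is at
least as close as any other. -/
theorem infDist_bdryD {x : E3} (hx : x ∈ tetraQ) : Metric.infDist x bdryD = x 2 := by
  have hb := tetraQ_bounds hx
  have hmem : projBdry x ∈ bdryD := by
    refine mem_bdryD.2 ⟨?_, 2, Or.inl (by simp)⟩
    exact tetraQ_subset_cubeD (mem_faceQ.1 (mem_image_of_mem _ hx)).1
  refine le_antisymm ?_ ?_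
  · refine (Metric.infDist_le_dist_of_mem hmem).trans (le_of_eq ?_)
    rw [dist_eq_norm, norm_E3]
    simp [Real.sqrt_sq (hb 2).2.1]
  · refine (Metric.le_infDist ⟨_, hmem⟩).2 fun p hp => ?_
    obtain ⟨-, i, hi⟩ := mem_bdryD.1 hp
    have h1 := abs_coord_le_norm (x - p) i
    rw [dist_eq_norm]
    refine le_trans ?_ h1
    rw [PiLp.sub_apply]
    have h2 := hb i
    have h3 := hb 2
    rcases hi with hi | hi
    · rw [hi, sub_zero]
      exact h2.1.trans (le_abs_self _)
    · rw [hi, abs_sub_comm]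
      exact le_trans (by linarith) (le_abs_self _)

/-- A point of an edge has two coordinates in `{0, 2}`, hence one among the first two, which gives
the lower bound. The point `(0, x₂, 0)` gives the upper bound: `√(x₁² + x₃²) ≤ √2 x₁`, as `x₃ ≤ x₁`.
-/
theorem infDist_edgesD {x : E3} (hx : x ∈ tetraQ) :
    x 0 ≤ Metric.infDist x edgesD ∧ Metric.infDist x edgesD ≤ 3 / 2 * x 0 := by
  have hb := tetraQ_bounds hx
  have hx01 : x 0 ≤ x 1 := hx.2.2.1
  have hmem : (!₂[0, x 1, 0] : E3) ∈ edgesD := by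
    refine ⟨fun i => ?_, 0, 2, by decide, by simp, by simp⟩
    have := hb 1
    fin_cases i <;> simp <;> constructor <;> linarith
  constructor
  · refine (Metric.le_infDist ⟨_, hmem⟩).2 fun p hp => ?_
    obtain ⟨-, i, j, hij, hi, hj⟩ := hp
    rw [dist_eq_norm]
    have key : ∀ k : Fin 3, k ≠ 2 → (p k = 0 ∨ p k = 2) → x 0 ≤ ‖x - p‖ := by
      intro k hk hpk
      refine le_trans ?_ (abs_coord_le_norm (x - p) k)
      rw [PiLp.sub_apply]
      have hk0 : x 0 ≤ x k := by
        fin_cases k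
        · exact le_rfl
        · exact hx01
        · exact absurd rfl hk
      have := hb k
      rcases hpk with h | h
      · rw [h, sub_zero]; exact hk0.trans (le_abs_self _)
      · rw [h, abs_sub_comm]; exact le_trans (by linarith) (le_abs_self _)
    by_cases h2 : i = 2
    · exact key j (fun h => hij (h2.trans h.symm)) hj
    · exact key i h2 hi
  · refine (Metric.infDist_le_dist_of_mem hmem).trans ?_
    rw [dist_eq_norm, norm_E3]
    refine Real.sqrt_le_iff.2 ⟨by linarith [(hb 0).2.1], ?_⟩
    simp
    nlinarith [hb 0, hb 2]

theorem mem_tetraQ_diff_bdryD {x : E3} : x ∈ tetraQ \ bdryD ↔ x ∈ tetraQ ∧ 0 < x 2 := by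
  refine and_congr_right fun hx => ?_
  have hb := tetraQ_bounds hx
  rw [mem_bdryD, not_and]
  constructor
  · intro h
    exact lt_of_le_of_ne (hb 2).2.1 fun h0 => h (tetraQ_subset_cubeD hx) ⟨2, Or.inl h0.symm⟩
  · rintro h - ⟨i, h0 | h0⟩ <;> have := hb i <;> linarith

theorem mem_tetraQ_diff_edgesD {x : E3} : x ∈ tetraQ \ edgesD ↔ x ∈ tetraQ ∧ 0 < x 0 := by
  refine and_congr_right fun hx => ?_
  have hb := tetraQ_bounds hx
  constructor
  · intro h
    refine lt_of_le_of_ne (hb 0).2.1 fun h0 => h ⟨tetraQ_subset_cubeD hx, 0, 2, by decide,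
      Or.inl h0.symm, Or.inl ?_⟩
    have := hb 0
    have := hb 2
    linarith
  · intro h hE
    have h1 := (infDist_edgesD hx).1
    rw [Metric.infDist_zero_of_mem hE] at h1
    linarith

theorem abs_coord_sub_le_dist (j : Fin 3) (x y : E3) : |x j - y j| ≤ dist x y := by
  rw [dist_eq_norm]; exact abs_coord_le_norm (x - y) j

theorem comparable_bdryD : ∀ x ∈ tetraQ \ bdryD, 0 < x 2 ∧ x 2 ≤ Metric.infDist x bdryD ∧
    Metric.infDist x bdryD ≤ 3 / 2 * x 2 := by
  intro x hx
  obtain ⟨h1, h2⟩ := mem_tetraQ_diff_bdryD.1 hx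
  rw [infDist_bdryD h1]
  refine ⟨h2, le_rfl, by linarith⟩

theorem comparable_edgesD : ∀ x ∈ tetraQ \ edgesD, 0 < x 0 ∧ x 0 ≤ Metric.infDist x edgesD ∧
    Metric.infDist x edgesD ≤ 3 / 2 * x 0 := by
  intro x hx
  obtain ⟨h1, h2⟩ := mem_tetraQ_diff_edgesD.1 hx
  exact ⟨h2, infDist_edgesD h1⟩

theorem faceQ_diff_subset : faceQ \ edgesD ⊆ tetraQ \ edgesD :=
  fun _ hx => ⟨(mem_faceQ.1 hx.1).1, hx.2⟩

/-! ### The second remainder -/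

theorem rpow_sub_le_of_le_one {t a b : ℝ} (ht : 0 < t) (ht1 : t ≤ 1) (h : b ≤ a) : t ^ a ≤ t ^ b :=
  Real.rpow_le_rpow_of_exponent_ge ht ht1 h

theorem exists_wHolderBound_halfCorr {q : E3 → ℝ} (hq : CorrWeight q) {κ : ℝ} (hκ : 0 < κ)
    (hκ1 : κ < 1) :
    ∃ C, ∀ ε, WHolderBound tetraQ bdryD (1 - κ) (-1 - κ) C (halfCorr q ε) := by
  obtain ⟨C1, hC1, h1⟩ := exists_halfCorr_bound hq
  obtain ⟨C2, hC2, h2⟩ := exists_halfCorr_holder hq (β := 1 - κ) (by linarith) (by linarith)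
  refine ⟨max C1 C2 * 6 ^ (1 - (-1) : ℝ), fun ε => wHolderBound_of_comparable comparable_bdryD
    (abs_coord_sub_le_dist 2) (by norm_num) hκ hκ1 (le_max_of_le_left hC1) ?_ ?_⟩
  · intro x hx
    obtain ⟨hxQ, hx2⟩ := mem_tetraQ_diff_bdryD.1 hx
    refine (h1 ε x hx2).trans (mul_le_mul (le_max_left _ _) ?_ (by positivity)
      (le_max_of_le_left hC1))
    rw [← Real.rpow_neg_one]
    exact rpow_sub_le_of_le_one hx2 (tetraQ_bounds hxQ 2).2.2 (by linarith)
  · intro x hx y hy _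
    obtain ⟨hxQ, hx2⟩ := mem_tetraQ_diff_bdryD.1 hx
    obtain ⟨hyQ, hy2⟩ := mem_tetraQ_diff_bdryD.1 hy
    have hm : 0 < min (x 2) (y 2) := lt_min hx2 hy2
    refine (h2 ε x y hx2 hy2).trans ?_
    rw [dist_eq_norm]
    refine mul_le_mul (mul_le_mul_of_nonneg_right (le_max_right _ _) (by positivity)) ?_
      (by positivity) (mul_nonneg (le_max_of_le_left hC1) (by positivity))
    exact rpow_sub_le_of_le_one hm (min_le_of_left_le (tetraQ_bounds hxQ 2).2.2) (by linarith)

theorem tendstoWHolder_halfCorr {q : E3 → ℝ} (hq : CorrWeight q) {κ : ℝ} (hκ : 0 < κ)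
    (hκ1 : κ < 1) :
    TendstoWHolder tetraQ bdryD (1 - κ) (-1 - κ) (halfCorr q) (fun x => 1 / (8 * Real.pi * x 2)) := by
  refine tendstoWHolder_of_bounds isCompact_tetraQ
    (fun x hx => (comparable_bdryD x hx).1.trans_le (comparable_bdryD x hx).2.1) (by norm_num) ?_ ?_ ?_
    hκ hκ1
  · intro κ hκ hκ1 ε _
    obtain ⟨C, hC⟩ := exists_wHolderBound_halfCorr hq hκ hκ1
    exact ⟨C, hC ε⟩
  · intro κ hκ hκ1
    obtain ⟨C, hC⟩ := exists_wHolderBound_halfCorr hq hκ hκ1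
    exact ⟨C, fun ε _ _ => hC ε⟩
  · intro x hx
    have hx2 := (mem_tetraQ_diff_bdryD.1 hx).2
    rw [← halfCorr_zero hq hx2]
    exact (tendsto_halfCorr hq hx2).mono_left nhdsWithin_le_nhds

theorem hasLineDerivWithinAt_of_coord {u : E3 → ℝ} (hu : ∀ x x' : E3, x 2 = x' 2 → u x = u x')
    {i : Fin 3} (hi : i ≠ 2) (s : Set E3) (x : E3) :
    HasLineDerivWithinAt ℝ u 0 s x (EuclideanSpace.single i 1) := by
  have h : (fun t : ℝ => u (x + t • EuclideanSpace.single i 1)) = fun _ => u x := by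
    ext t
    refine hu _ _ ?_
    simp [hi.symm]
  rw [HasLineDerivWithinAt, h]
  exact hasDerivWithinAt_const _ _ _

/-! ### The first remainder -/

theorem continuous_vertical : Continuous vertical := by
  have h : vertical = fun t => t • EuclideanSpace.single 2 1 := by
    ext t i
    fin_cases i <;> simp [vertical]
  rw [h]
  fun_prop

/-- The half-space correction as a function of the height. -/
def halfProfile (q : E3 → ℝ) (ε t : ℝ) : ℝ := halfCorr q ε (vertical t)

theorem halfProfile_apply (q : E3 → ℝ) (ε : ℝ) (x : E3) : halfProfile q ε (x 2) = halfCorr q ε x :=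
  halfCorr_congr q ε (by simp)

theorem continuousOn_halfProfile {q : E3 → ℝ} (hq : CorrWeight q) (ε : ℝ) :
    ContinuousOn (halfProfile q ε) (Ioi 0) := by
  obtain ⟨C, hC, h⟩ := exists_halfCorr_holder hq one_half_pos one_half_lt_one
  intro t ht
  have ht' : 0 < t := ht
  refine ContinuousAt.continuousWithinAt ?_
  rw [ContinuousAt, tendsto_iff_dist_tendsto_zero]
  have hlim : Tendsto (fun s : ℝ => C * ‖vertical s - vertical t‖ ^ (1 / 2 : ℝ) *
      (min s t) ^ (-1 - 1 / 2 : ℝ)) (𝓝 t) (𝓝 0) := by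
    have hc : ContinuousAt (fun s : ℝ => C * ‖vertical s - vertical t‖ ^ (1 / 2 : ℝ) *
      (min s t) ^ (-1 - 1 / 2 : ℝ)) t := by
      have hv : Continuous vertical := continuous_vertical
      refine (continuousAt_const.mul ((hv.continuousAt.sub continuousAt_const).norm.rpow_const
        (Or.inr (by norm_num)))).mul ((continuousAt_id.min continuousAt_const).rpow_const (Or.inl ?_))
      simp [ht'.ne']
    have := hc.tendsto
    rwa [sub_self, norm_zero, Real.zero_rpow (by norm_num), mul_zero, zero_mul] at this
  refine squeeze_zero' (Eventually.of_forall fun _ => dist_nonneg) ?_ hlim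
  filter_upwards [lt_mem_nhds ht'] with s hs
  have := h ε (vertical s) (vertical t) (by simpa) (by simpa)
  rw [Real.dist_eq]
  simpa [halfProfile] using this

/-- The primitive of the half-space correction. -/
def halfPrim (q : E3 → ℝ) (ε s : ℝ) : ℝ := ∫ t in (0 : ℝ)..s, halfProfile q ε t

theorem intervalIntegrable_halfProfile {q : E3 → ℝ} (hq : CorrWeight q) {ε : ℝ} (hε : 0 < ε) {a b : ℝ}
    (ha : 0 ≤ a) (hb : 0 ≤ b) : IntervalIntegrable (halfProfile q ε) volume a b := by
  obtain ⟨C, hC, h⟩ := exists_halfCorr_bound_of_pos hq hε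
  rw [intervalIntegrable_iff]
  have hsub : uIoc a b ⊆ Ioi 0 := fun t ht => lt_of_le_of_lt (le_min ha hb) ht.1
  refine IntegrableOn.of_bound (by simp)
    (((continuousOn_halfProfile hq ε).mono hsub).aestronglyMeasurable measurableSet_uIoc) C ?_
  filter_upwards [ae_restrict_mem measurableSet_uIoc] with t ht
  exact h _ (by simpa using hsub ht)

theorem halfPrim_scale {q : E3 → ℝ} {ε : ℝ} (hε : 0 < ε) (s : ℝ) :
    halfPrim q ε s = halfPrim q 1 (ε⁻¹ * s) := by
  have e : ∀ t, halfProfile q ε t = ε⁻¹ * halfProfile q 1 (ε⁻¹ * t) := fun t => by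
    rw [halfProfile, halfCorr_scale q hε, halfProfile]
    congr 1
    exact halfCorr_congr q 1 (by simp)
  unfold halfPrim
  simp_rw [e]
  rw [intervalIntegral.integral_const_mul, intervalIntegral.mul_integral_comp_mul_left, mul_zero]

theorem halfPrim_sub {q : E3 → ℝ} (hq : CorrWeight q) {ε : ℝ} (hε : 0 < ε) {a b : ℝ}
    (ha : 0 ≤ a) (hb : 0 ≤ b) : halfPrim q ε b - halfPrim q ε a = ∫ t in a..b, halfProfile q ε t :=
  intervalIntegral.integral_interval_sub_left (intervalIntegrable_halfProfile hq hε le_rfl hb)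
    (intervalIntegrable_halfProfile hq hε le_rfl ha)

/-- The difference `d(t) = h(t) - 1/(8πt)` is `O(t^(-3/2))`, so `∫ d` converges at infinity and the
primitive is `log S/(8π)` plus a constant plus `o(1)`. Below `S = 1` the profile itself is bounded.
The limit `a` is the constant of the boundary counterterm. -/
theorem exists_tendsto_halfPrim {q : E3 → ℝ} (hq : CorrWeight q) :
    ∃ a C : ℝ, 0 ≤ C ∧ Tendsto (fun S => halfPrim q 1 S - Real.log S / (8 * Real.pi)) atTop (𝓝 a) ∧
      (∀ S, 1 ≤ S → |halfPrim q 1 S - Real.log S / (8 * Real.pi)| ≤ C) ∧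
      ∀ S, 0 < S → S ≤ 1 → |halfPrim q 1 S| ≤ C := by
  obtain ⟨C1, hC1, h1⟩ := exists_halfCorr_rate hq
  obtain ⟨C2, hC2, h2⟩ := exists_halfCorr_bound_of_pos hq one_pos
  set d : ℝ → ℝ := fun t => halfProfile q 1 t - 1 / (8 * Real.pi * t) with hd
  have hdb : ∀ t, 0 < t → |d t| ≤ C1 * t ^ (-(3 / 2) : ℝ) := by
    intro t ht
    have := h1 (vertical t) (by simpa)
    rw [halfCorr_zero hq (by simpa)] at this
    simpa [hd, halfProfile] using this
  have hg : IntegrableOn (fun t : ℝ => C1 * t ^ (-(3 / 2) : ℝ)) (Ioi 1) :=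
    (integrableOn_Ioi_rpow_of_lt (by norm_num) one_pos).const_mul C1
  have hdc : ContinuousOn d (Ioi 0) := by
    refine (continuousOn_halfProfile hq 1).sub (ContinuousOn.div continuousOn_const (by fun_prop) ?_)
    intro t ht
    have : (0 : ℝ) < t := ht
    positivity
  have hsub : Ioi (1 : ℝ) ⊆ Ioi 0 := Ioi_subset_Ioi zero_le_one
  have hdi : IntegrableOn d (Ioi 1) := by
    refine hg.mono' ((hdc.mono hsub).aestronglyMeasurable measurableSet_Ioi) ?_
    filter_upwards [ae_restrict_mem measurableSet_Ioi] with t ht using hdb t (hsub ht)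
  have hbound : ∀ S, 0 ≤ S → S ≤ 1 → |halfPrim q 1 S| ≤ C2 := by
    intro S hS hS1
    have := intervalIntegral.norm_integral_le_of_norm_le_const (a := 0) (b := S) (C := C2)
      (f := halfProfile q 1) (fun t ht => by
        rw [uIoc_of_le hS] at ht
        exact h2 _ (by simpa using ht.1))
    rw [sub_zero, abs_of_nonneg hS] at this
    exact this.trans (mul_le_of_le_one_right hC2 hS1)
  have heq : ∀ S, 1 ≤ S → halfPrim q 1 S - Real.log S / (8 * Real.pi) =
      halfPrim q 1 1 + ∫ t in (1 : ℝ)..S, d t := by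
    intro S hS
    have hsub2 : uIcc 1 S ⊆ Ioi 0 := fun t ht => by
      rw [uIcc_of_le hS] at ht
      exact zero_lt_one.trans_le ht.1
    have i1 := intervalIntegrable_halfProfile hq one_pos zero_le_one (zero_le_one.trans hS)
    have i2 : IntervalIntegrable (fun t : ℝ => 1 / (8 * Real.pi * t)) volume 1 S := by
      refine ContinuousOn.intervalIntegrable (ContinuousOn.div continuousOn_const (by fun_prop) ?_)
      intro t ht
      have : (0 : ℝ) < t := hsub2 ht
      positivity
    rw [hd, intervalIntegral.integral_sub i1 i2, ← halfPrim_sub hq one_pos zero_le_one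
      (zero_le_one.trans hS)]
    have e : (fun t : ℝ => 1 / (8 * Real.pi * t)) = fun t => 1 / (8 * Real.pi) * (1 / t) := by
      ext t
      rw [one_div_mul_one_div]
    rw [e, intervalIntegral.integral_const_mul, integral_one_div_of_pos one_pos (by linarith), div_one]
    ring
  refine ⟨halfPrim q 1 1 + ∫ t in Ioi 1, d t, C2 + ∫ t in Ioi 1, C1 * t ^ (-(3 / 2) : ℝ), ?_, ?_, ?_, ?_⟩
  · have : 0 ≤ ∫ t in Ioi (1 : ℝ), C1 * t ^ (-(3 / 2) : ℝ) :=
      setIntegral_nonneg measurableSet_Ioi fun t ht => by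
        have : (0 : ℝ) < t := hsub ht
        positivity
    linarith
  · refine ((intervalIntegral_tendsto_integral_Ioi 1 hdi tendsto_id).const_add _).congr' ?_
    filter_upwards [eventually_ge_atTop 1] with S hS using (heq S hS).symm
  · intro S hS
    rw [heq S hS]
    refine (abs_add_le _ _).trans (add_le_add (hbound 1 zero_le_one le_rfl) ?_)
    rw [intervalIntegral.integral_of_le hS]
    refine abs_integral_le_integral_abs.trans ?_
    refine (setIntegral_mono_set hdi.abs (Eventually.of_forall fun t => abs_nonneg _)
      (Eventually.of_forall fun t ht => ht.1)).trans ?_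
    exact setIntegral_mono_on hdi.abs hg measurableSet_Ioi fun t ht => hdb t (hsub ht)
  · intro S hS hS1
    have : 0 ≤ ∫ t in Ioi (1 : ℝ), C1 * t ^ (-(3 / 2) : ℝ) :=
      setIntegral_nonneg measurableSet_Ioi fun t ht => by
        have : (0 : ℝ) < t := hsub ht
        positivity
    exact (hbound S hS.le hS1).trans (by linarith)

/-- The first remainder. -/
def faceRem (q : E3 → ℝ) (a ε : ℝ) (x : E3) : ℝ :=
  halfPrim q ε (x 0) - a - |Real.log ε| / (8 * Real.pi)

theorem abs_halfPrim_sub_le {q : E3 → ℝ} (hq : CorrWeight q) {ε C : ℝ} (hε : 0 < ε) {s s' : ℝ}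
    (hs : 0 < s) (hs' : 0 < s') (h : ∀ t, min s s' ≤ t → |halfProfile q ε t| ≤ C) :
    |halfPrim q ε s - halfPrim q ε s'| ≤ C * |s - s'| := by
  rw [halfPrim_sub hq hε hs'.le hs.le]
  exact intervalIntegral.norm_integral_le_of_norm_le_const (f := halfProfile q ε) fun t ht =>
    h t (by rw [min_comm]; exact ht.1.le)

theorem abs_log_le_rpow {s κ : ℝ} (hs : 0 < s) (hs1 : s ≤ 1) (hκ : 0 < κ) :
    |Real.log s| ≤ κ⁻¹ * s ^ (-κ) := by
  rw [abs_of_nonpos (Real.log_nonpos hs.le hs1), ← Real.log_inv]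
  have := Real.log_le_rpow_div (inv_nonneg.2 hs.le) hκ
  rw [Real.inv_rpow hs.le, ← Real.rpow_neg hs.le] at this
  rw [inv_mul_eq_div]
  exact this

/-- Since `h ≤ 3m ≤ 3`, the power `h^κ` dropped in passing from Lipschitz to Hölder is at most `3`.
-/
theorem rpow_holder_of_lipschitz {A h m κ : ℝ} (hA : 0 ≤ A) (hm : 0 < m) (hh : 0 ≤ h) (hhm : h ≤ 3 * m)
    (hκ : 0 < κ) (hκ1 : κ < 1) (hm1 : m ≤ 1) :
    A * m⁻¹ * h ≤ 3 * A * h ^ (1 - κ) * m ^ (0 - 1 : ℝ) := by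
  have e : m ^ (0 - 1 : ℝ) = m⁻¹ := by rw [zero_sub, Real.rpow_neg_one]
  rw [e]
  rcases eq_or_lt_of_le hh with h0 | h0
  · rw [← h0, mul_zero]; positivity
  · have h1 : h = h ^ κ * h ^ (1 - κ) := by rw [← Real.rpow_add h0]; simp
    have h2 : h ^ κ ≤ 3 := by
      rcases le_total h 1 with h3 | h3
      · exact (Real.rpow_le_one hh h3 hκ.le).trans (by norm_num)
      · calc h ^ κ ≤ h ^ (1 : ℝ) := Real.rpow_le_rpow_of_exponent_le h3 hκ1.le
          _ ≤ 3 := by rw [Real.rpow_one]; linarith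
    calc A * m⁻¹ * h = h ^ κ * (A * m⁻¹ * h ^ (1 - κ)) := by rw [mul_comm, ← mul_assoc]; nth_rw 1 [h1]; ring
      _ ≤ 3 * (A * m⁻¹ * h ^ (1 - κ)) := mul_le_mul_of_nonneg_right h2 (by positivity)
      _ = _ := by ring

/-- By scaling, the remainder is `H(x₁/ε) - a - |log ε|/(8π)`. If `x₁ ≥ ε`, the logarithms combine
to `log x₁/(8π)` plus a bounded term; if `x₁ ≤ ε`, then `H` is bounded and `|log ε| ≤ |log x₁|`.
Either way the size is `O(1 + |log x₁|)`, hence `O(x₁^(-κ))`. The Hölder bound comes from the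
integrand of the primitive being at most a multiple of `1/x₁`, uniformly in `ε`. -/
theorem exists_tendstoWHolder_faceRem {q : E3 → ℝ} (hq : CorrWeight q) :
    ∃ a, ∀ κ : ℝ, 0 < κ → κ < 1 → TendstoWHolder faceQ edgesD (1 - κ) (-κ) (faceRem q a)
      (fun x => Real.log (x 0) / (8 * Real.pi)) := by
  obtain ⟨a, C, hC, hlim, hbig, hsmall⟩ := exists_tendsto_halfPrim hq
  obtain ⟨C1, hC1, h1⟩ := exists_halfCorr_bound hq
  refine ⟨a, fun κ hκ hκ1 => ?_⟩
  have hpi := Real.pi_pos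
  have hpi8 : 1 ≤ 8 * Real.pi := by nlinarith [Real.pi_gt_three]
  have hdiv : ∀ u : ℝ, |u / (8 * Real.pi)| ≤ |u| := fun u => by
    rw [abs_div, abs_of_pos (by positivity : 0 < 8 * Real.pi)]
    exact div_le_self (abs_nonneg _) hpi8
  have hxb : ∀ x ∈ faceQ \ edgesD, 0 < x 0 ∧ x 0 ≤ 1 := fun x hx =>
    ⟨(mem_tetraQ_diff_edgesD.1 (faceQ_diff_subset hx)).2,
      (tetraQ_bounds (mem_faceQ.1 hx.1).1 0).2.2⟩
  have hhol : ∀ {κ : ℝ}, 0 < κ → κ < 1 → ∀ ε, 0 < ε → ∀ x ∈ faceQ \ edgesD, ∀ y ∈ faceQ \ edgesD,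
      dist x y ≤ 3 * min (x 0) (y 0) → |faceRem q a ε x - faceRem q a ε y| ≤
        3 * C1 * dist x y ^ (1 - κ) * min (x 0) (y 0) ^ (0 - 1 : ℝ) := by
    intro κ hκ hκ1 ε hε x hx y hy hxy
    obtain ⟨hx0, hx1⟩ := hxb x hx
    obtain ⟨hy0, hy1⟩ := hxb y hy
    have hm : 0 < min (x 0) (y 0) := lt_min hx0 hy0
    have h2 := abs_halfPrim_sub_le hq hε hx0 hy0 (C := C1 * (min (x 0) (y 0))⁻¹) fun t ht => by
      have ht0 := hm.trans_le ht
      refine (h1 ε (vertical t) (by simpa)).trans ?_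
      rw [vertical_two]
      gcongr
    have h3 : |faceRem q a ε x - faceRem q a ε y| ≤ C1 * (min (x 0) (y 0))⁻¹ * dist x y := by
      rw [faceRem, faceRem, show ∀ p q r s : ℝ, p - r - s - (q - r - s) = p - q by intros; ring]
      exact h2.trans (mul_le_mul_of_nonneg_left (abs_coord_sub_le_dist 0 x y) (by positivity))
    exact h3.trans (rpow_holder_of_lipschitz hC1 hm dist_nonneg hxy hκ hκ1 (min_le_of_left_le hx1))
  have hmk : ∀ {κ : ℝ}, 0 < κ → κ < 1 → ∀ ε B, 0 < ε → 0 ≤ B → (∀ x ∈ faceQ \ edgesD,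
      |faceRem q a ε x| ≤ B * x 0 ^ (0 - κ)) →
      WHolderBound faceQ edgesD (1 - κ) (0 - κ) (max B (3 * C1) * 6 ^ (1 - 0 : ℝ)) (faceRem q a ε) := by
    intro κ hκ hκ1 ε B hε hB hb
    refine wHolderBound_of_comparable (r := fun x => x 0)
      (fun x hx => comparable_edgesD x (faceQ_diff_subset hx))
      (abs_coord_sub_le_dist 0) le_rfl hκ hκ1 (le_max_of_le_left hB) ?_ ?_
    · intro x hx
      have := (hxb x hx).1
      exact (hb x hx).trans (mul_le_mul_of_nonneg_right (le_max_left _ _) (by positivity))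
    · intro x hx y hy hxy
      have hm : 0 < min (x 0) (y 0) := lt_min (hxb x hx).1 (hxb y hy).1
      refine (hhol hκ hκ1 ε hε x hx y hy hxy).trans ?_
      have : 3 * C1 ≤ max B (3 * C1) := le_max_right _ _
      gcongr
  have one_le : ∀ {κ s : ℝ}, 0 < κ → 0 < s → s ≤ 1 → 1 ≤ s ^ (0 - κ) := fun hκ hs hs1 =>
    Real.one_le_rpow_of_pos_of_le_one_of_nonpos hs hs1 (by linarith)
  rw [← zero_sub κ]
  refine tendstoWHolder_of_bounds isCompact_faceQ (fun x hx =>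
    (comparable_edgesD x (faceQ_diff_subset hx)).1.trans_le
      (comparable_edgesD x (faceQ_diff_subset hx)).2.1) le_rfl ?_ ?_ ?_ hκ hκ1
  -- Membership is required for all `ε > 0`, including `ε > 1`, where `|log ε|` no longer cancels;
  -- here the constant may depend on `ε`.
  · intro κ hκ hκ1 ε hε
    obtain ⟨C2, hC2, h2⟩ := exists_halfCorr_bound_of_pos hq hε
    refine ⟨_, hmk hκ hκ1 ε (C2 + |a| + |Real.log ε|) hε (by positivity) fun x hx => ?_⟩
    obtain ⟨hx0, hx1⟩ := hxb x hx
    have h3 : |halfPrim q ε (x 0)| ≤ C2 := by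
      have := intervalIntegral.norm_integral_le_of_norm_le_const (a := 0) (b := x 0) (C := C2)
        (f := halfProfile q ε) (fun t ht => by
          rw [uIoc_of_le hx0.le] at ht
          exact h2 _ (by simpa using ht.1))
      rw [sub_zero, abs_of_pos hx0] at this
      exact this.trans (mul_le_of_le_one_right hC2 hx1)
    have h4 := hdiv |Real.log ε|
    rw [abs_abs] at h4
    have h5 : |faceRem q a ε x| ≤ C2 + |a| + |Real.log ε| := by
      rw [faceRem]
      have := abs_sub (halfPrim q ε (x 0) - a) (|Real.log ε| / (8 * Real.pi))
      have := abs_sub (halfPrim q ε (x 0)) a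
      linarith
    exact h5.trans (le_mul_of_one_le_right (by positivity) (one_le hκ hx0 hx1))
  · intro κ hκ hκ1
    refine ⟨_, fun ε hε hε1 => hmk hκ hκ1 ε (C + |a| + κ⁻¹) hε (by positivity) fun x hx => ?_⟩
    obtain ⟨hx0, hx1⟩ := hxb x hx
    have hlog := abs_log_le_rpow hx0 hx1 hκ
    have hone := one_le hκ hx0 hx1
    have hS : 0 < ε⁻¹ * x 0 := by positivity
    have habs : |Real.log ε| = -Real.log ε := abs_of_nonpos (Real.log_nonpos hε.le hε1)
    have h5 : |faceRem q a ε x| ≤ C + |a| + |Real.log (x 0)| := by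
      rw [faceRem, halfPrim_scale hε]
      rcases le_total 1 (ε⁻¹ * x 0) with hS1 | hS1
      · have h6 := hbig _ hS1
        have e : Real.log (ε⁻¹ * x 0) = -Real.log ε + Real.log (x 0) := by
          rw [Real.log_mul (by positivity) hx0.ne', Real.log_inv]
        rw [e] at h6
        have h7 := hdiv (Real.log (x 0))
        rw [habs]
        have h8 : halfPrim q 1 (ε⁻¹ * x 0) - a - -Real.log ε / (8 * Real.pi) =
          (halfPrim q 1 (ε⁻¹ * x 0) - (-Real.log ε + Real.log (x 0)) / (8 * Real.pi)) - a +
            Real.log (x 0) / (8 * Real.pi) := by ring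
        rw [h8]
        refine (abs_add_le _ _).trans (add_le_add ((abs_sub _ _).trans (by linarith)) h7)
      · have h6 := hsmall _ hS hS1
        have h7 : |Real.log ε| ≤ |Real.log (x 0)| := by
          have hxe : x 0 ≤ ε := by
            rwa [inv_mul_le_iff₀ hε, mul_one] at hS1
          rw [habs, abs_of_nonpos (Real.log_nonpos hx0.le hx1)]
          linarith [Real.log_le_log hx0 hxe]
        have h4 := hdiv |Real.log ε|
        rw [abs_abs] at h4
        have := abs_sub (halfPrim q 1 (ε⁻¹ * x 0) - a) (|Real.log ε| / (8 * Real.pi))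
        have := abs_sub (halfPrim q 1 (ε⁻¹ * x 0)) a
        linarith
    refine h5.trans ?_
    rw [zero_sub] at hone ⊢
    have : 0 ≤ C + |a| := by positivity
    nlinarith
  · intro x hx
    obtain ⟨hx0, hx1⟩ := hxb x hx
    have h2 : Tendsto (fun ε : ℝ => ε⁻¹ * x 0) (𝓝[>] 0) atTop :=
      tendsto_inv_nhdsGT_zero.atTop_mul_const hx0
    have h3 := ((hlim.comp h2).sub_const a).add_const (Real.log (x 0) / (8 * Real.pi))
    rw [sub_self, zero_add] at h3
    refine h3.congr' ?_
    filter_upwards [self_mem_nhdsWithin, nhdsWithin_le_nhds (eventually_le_nhds zero_lt_one)] with ε hε hε1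
    have hε0 : 0 < ε := hε
    have habs : |Real.log ε| = -Real.log ε := abs_of_nonpos (Real.log_nonpos hε0.le hε1)
    rw [faceRem, halfPrim_scale hε0, habs, Function.comp_apply,
      Real.log_mul (by positivity) hx0.ne', Real.log_inv]
    ring

section

/-! ### The autocorrelation of a mollifier -/

/-- The autocorrelation `z ↦ ∫ ρ(v) ρ(z - v) dv` of a (symmetric) mollifier. -/
def Mollifier3.autocorr (ρ : Mollifier3) (z : E3) : ℝ := ∫ v, ρ.toFun v * ρ.toFun (z - v)

theorem Mollifier3.autocorr_eq (ρ : Mollifier3) :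
    ρ.autocorr = MeasureTheory.convolution ρ.toFun ρ.toFun (ContinuousLinearMap.mul ℝ ℝ) volume := by
  ext z; rfl

theorem Mollifier3.continuous (ρ : Mollifier3) : Continuous ρ.toFun := ρ.smooth.continuous

theorem Mollifier3.integrable (ρ : Mollifier3) : Integrable ρ.toFun :=
  ρ.continuous.integrable_of_hasCompactSupport ρ.compact

theorem Mollifier3.corrWeight_autocorr (ρ : Mollifier3) : CorrWeight ρ.autocorr where
  continuous := by
    rw [ρ.autocorr_eq]
    exact ρ.compact.continuous_convolution_right _ ρ.integrable.locallyIntegrable ρ.continuous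
  compact := by
    rw [ρ.autocorr_eq]
    exact ρ.compact.convolution _ ρ.compact
  nonneg z := integral_nonneg fun v => mul_nonneg (ρ.nonneg _) (ρ.nonneg _)
  integral_eq_one := by
    rw [ρ.autocorr_eq, integral_convolution _ ρ.integrable ρ.integrable, ρ.integral_eq_one]
    simp
  even z := by
    rw [Mollifier3.autocorr, Mollifier3.autocorr,
      ← integral_neg_eq_self (fun v => ρ.toFun v * ρ.toFun (z - v))]
    congr 1
    ext v
    rw [ρ.symm, ← ρ.symm (-z - v), neg_sub, sub_neg_eq_add, sub_neg_eq_add, add_comm]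

theorem Mollifier3.testFn_apply (ρ : Mollifier3) {ε : ℝ} (hε : 0 < ε) (y z : E3) :
    ρ.testFn hε y z = ρ.scaled ε (y - z) := rfl

theorem Mollifier3.integral_testFn_mul (ρ : Mollifier3) {ε : ℝ} (hε : 0 < ε) (y u : E3) :
    ∫ z, ρ.testFn hε y z * ρ.testFn hε (y + ε • u) z = (ε ^ 3)⁻¹ * ρ.autocorr u := by
  simp_rw [Mollifier3.testFn_apply]
  have h1 := integral_sub_left_eq_self (fun t => ρ.scaled ε t * ρ.scaled ε (t + ε • u)) volume y
  have e1 : ∀ z, y + ε • u - z = y - z + ε • u := fun z => by abel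
  simp_rw [e1]
  rw [h1]
  have e2 : ∀ t : E3, ρ.scaled ε t * ρ.scaled ε (t + ε • u) =
      (ε⁻¹ ^ 6) * (fun s => ρ.toFun s * ρ.toFun (s + u)) (ε⁻¹ • t) := fun t => by
    rw [Mollifier3.scaled, Mollifier3.scaled, smul_add, inv_smul_smul₀ hε.ne']
    ring
  rw [integral_congr_ae (Eventually.of_forall e2), integral_const_mul,
    integral_comp_inv_smul_E3 (fun s => ρ.toFun s * ρ.toFun (s + u)) hε,
    ← integral_neg_eq_self (fun s => ρ.toFun s * ρ.toFun (s + u)), Mollifier3.autocorr]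
  have e3 : ∀ s, ρ.toFun (-s) * ρ.toFun (-s + u) = ρ.toFun s * ρ.toFun (u - s) := fun s => by
    rw [ρ.symm, neg_add_eq_sub]
  simp_rw [e3]
  field_simp

/-! ### Regularity of the mollified noise -/

/-- Translates of a smooth compactly supported function depend continuously on the translation in
the Schwartz topology: every derivative is uniformly continuous, and for nearby translations the
supports stay in one ball, which bounds the polynomial weight. Hence the mollified noise has
continuous sample paths. -/
theorem Mollifier3.continuous_testFn (ρ : Mollifier3) {ε : ℝ} (hε : 0 < ε) :
    Continuous (ρ.testFn hε) := by
  rw [continuous_iff_continuousAt]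
  intro y
  rw [ContinuousAt, (schwartz_withSeminorms ℝ E3 ℝ).tendsto_nhds]
  rintro ⟨k, n⟩ δ hδ
  set g : E3 → ℝ := fun t => ρ.scaled ε (0 - t) with hg
  have hgs : ContDiff ℝ ∞ g := ρ.scaled_contDiff ε 0
  have hgc : HasCompactSupport g := ρ.scaled_compact hε 0
  set G := iteratedFDeriv ℝ n g with hG
  have hGc : Continuous G := hgs.continuous_iteratedFDeriv (mod_cast le_top)
  have hGs : HasCompactSupport G := hgc.iteratedFDeriv n
  have hGu : UniformContinuous G := hGs.uniformContinuous_of_continuous hGc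
  obtain ⟨R, hR⟩ := hGs.isCompact.isBounded.subset_closedBall 0
  have hG0 : ∀ t, R < ‖t‖ → G t = 0 := fun t ht => by
    by_contra h
    have := hR (subset_closure h)
    rw [mem_closedBall_zero_iff] at this
    linarith
  have hder : ∀ y' z, iteratedFDeriv ℝ n (ρ.testFn hε y') z = G (z - y') := by
    intro y' z
    have e : (ρ.testFn hε y' : E3 → ℝ) = fun z => g (z + -y') := by
      ext z
      rw [Mollifier3.testFn_apply, hg]
      congr 1
      abel
    rw [e, iteratedFDeriv_comp_add_right, hG, sub_eq_add_neg]
  set L := (‖y‖ + |R| + 1) ^ k with hL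
  have hLpos : 0 < L := by positivity
  obtain ⟨s, hs, hsG⟩ := Metric.uniformContinuous_iff.1 hGu (δ / (2 * L)) (by positivity)
  filter_upwards [Metric.ball_mem_nhds y (lt_min hs one_pos)] with y' hy'
  have hy1 : dist y' y < s := (Metric.mem_ball.1 hy').trans_le (min_le_left _ _)
  have hy2 : dist y' y < 1 := (Metric.mem_ball.1 hy').trans_le (min_le_right _ _)
  refine lt_of_le_of_lt ?_ (half_lt_self hδ)
  refine SchwartzMap.seminorm_le_bound ℝ k n _ (half_pos hδ).le fun z => ?_
  have e1 : iteratedFDeriv ℝ n (ρ.testFn hε y' - ρ.testFn hε y : 𝓢(E3, ℝ)) z =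
      G (z - y') - G (z - y) := by
    rw [← hder, ← hder]
    have h1 : ContDiffAt ℝ n (ρ.testFn hε y') z := ((ρ.testFn hε y').smooth n).contDiffAt
    have h2 : ContDiffAt ℝ n (ρ.testFn hε y) z := ((ρ.testFn hε y).smooth n).contDiffAt
    exact iteratedFDeriv_sub_apply h1 h2
  rw [e1]
  rcases le_or_gt ‖z‖ (‖y‖ + |R| + 1) with hz | hz
  · have h1 : dist (G (z - y')) (G (z - y)) < δ / (2 * L) := hsG (by
      rw [dist_sub_left]; exact hy1)
    rw [dist_eq_norm] at h1
    calc ‖z‖ ^ k * ‖G (z - y') - G (z - y)‖ ≤ L * (δ / (2 * L)) := by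
          rw [hL] at h1 ⊢
          gcongr
      _ = δ / 2 := by field_simp
  · have h1 : R < ‖z - y‖ := by
      have := norm_sub_norm_le z y
      have := le_abs_self R
      linarith
    have h2 : R < ‖z - y'‖ := by
      have h3 := norm_sub_norm_le z y'
      have := le_abs_self R
      have h4 := norm_le_norm_add_norm_sub' y' y
      rw [← dist_eq_norm] at h4
      rw [dist_comm] at h4
      linarith [dist_comm y y']
    rw [hG0 _ h1, hG0 _ h2]
    simp
    positivity

theorem continuous_mollify (ρ : Mollifier3) {ε : ℝ} (hε : 0 < ε) (ξ : 𝓢(E3, ℝ) →L[ℝ] ℝ) :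
    Continuous (mollify ρ hε ξ) := ξ.continuous.comp (ρ.continuous_testFn hε)

/-! ### Second moments -/

section Noise

variable {Ω : Type*} [MeasurableSpace Ω] {P : Measure Ω} {ξ : Ω → (𝓢(E3, ℝ) →L[ℝ] ℝ)}

theorem IsWhiteNoise.second_moment (hξ : IsWhiteNoise P ξ) (φ : 𝓢(E3, ℝ)) :
    Integrable (fun w => ξ w φ ^ 2) P ∧ ∫ w, ξ w φ ^ 2 ∂P = ∫ x, φ x ^ 2 := by
  have hX := hξ φ
  set v := Real.toNNReal (∫ x, φ x ^ 2) with hv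
  have hmem : MemLp id 2 (gaussianReal 0 v) := memLp_id_gaussianReal 2
  have hint : Integrable (fun x : ℝ => x ^ 2) (gaussianReal 0 v) := hmem.integrable_sq
  constructor
  · have h1 : Integrable (fun x : ℝ => x ^ 2) (P.map fun w => ξ w φ) := by rwa [hX.map_eq]
    exact h1.comp_aemeasurable hX.aemeasurable
  · have h1 := hX.integral_comp (f := fun x : ℝ => x ^ 2) hint.aestronglyMeasurable
    have h2 : ∫ x : ℝ, x ^ 2 ∂gaussianReal 0 v = v := by
      have h3 := variance_fun_id_gaussianReal (μ := 0) (v := v)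
      rw [variance_eq_integral measurable_id'.aemeasurable] at h3
      simpa using h3
    have h4 : ∫ w, ξ w φ ^ 2 ∂P = ∫ x : ℝ, x ^ 2 ∂gaussianReal 0 v := h1
    rw [h4, h2, hv, Real.coe_toNNReal _ (integral_nonneg fun x => sq_nonneg _)]

theorem integrable_schwartz_mul (φ φ' : 𝓢(E3, ℝ)) : Integrable fun x => φ x * φ' x := by
  have h1 : MemLp φ 2 := φ.memLp 2
  have h2 : MemLp φ' 2 := φ'.memLp 2
  exact h1.integrable_mul h2

/-- Polarisation: the definition prescribes only variances, and the linearity of each realisation of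
`ξ` gives the rest. -/
theorem IsWhiteNoise.covariance (hξ : IsWhiteNoise P ξ) (φ φ' : 𝓢(E3, ℝ)) :
    Integrable (fun w => ξ w φ * ξ w φ') P ∧ ∫ w, ξ w φ * ξ w φ' ∂P = ∫ x, φ x * φ' x := by
  obtain ⟨i1, e1⟩ := hξ.second_moment (φ + φ')
  obtain ⟨i2, e2⟩ := hξ.second_moment (φ - φ')
  have e : ∀ w, ξ w φ * ξ w φ' = 1 / 4 * (ξ w (φ + φ') ^ 2 - ξ w (φ - φ') ^ 2) := fun w => by
    rw [map_add, map_sub]; ring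
  have e' : ∀ x, φ x * φ' x = 1 / 4 * ((φ + φ') x ^ 2 - (φ - φ') x ^ 2) := fun x => by
    rw [add_apply, sub_apply]; ring
  simp_rw [e]
  refine ⟨(i1.sub i2).const_mul _, ?_⟩
  have j : ∀ φ : 𝓢(E3, ℝ), Integrable fun x => φ x ^ 2 := fun φ => by
    simpa only [pow_two] using integrable_schwartz_mul φ φ
  rw [integral_const_mul, integral_sub i1 i2, e1, e2]
  simp_rw [e']
  rw [integral_const_mul, integral_sub (j _) (j _)]

/-- Each `F · y` is measurable only up to a null set depending on `y`. One null set serves a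
countable dense set of `y`, and continuity of the paths covers the others. -/
theorem aestronglyMeasurable_uncurry_of_continuous [SFinite P] {F : Ω → E3 → ℝ}
    (hc : ∀ w, Continuous (F w)) (hm : ∀ y, AEMeasurable (fun w => F w y) P) :
    AEStronglyMeasurable (fun p : Ω × E3 => F p.1 p.2) (P.prod volume) := by
  set d := TopologicalSpace.denseSeq E3
  have hd : ∀ᵐ w ∂P, ∀ k, F w (d k) = (hm (d k)).mk _ w :=
    ae_all_iff.2 fun k => (hm (d k)).ae_eq_mk
  obtain ⟨N, hN, hNm, hN0⟩ := exists_measurable_superset_of_null (ae_iff.1 hd)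
  set F' : E3 → Ω → ℝ := fun y w => Nᶜ.indicator (fun w => F w y) w with hF'
  have hF'c : ∀ w, Continuous fun y => F' y w := by
    intro w
    by_cases hw : w ∈ N
    · have : ∀ y, F' y w = 0 := fun y => indicator_of_notMem (notMem_compl_iff.2 hw) _
      simp_rw [this]; exact continuous_const
    · have : ∀ y, F' y w = F w y := fun y => indicator_of_mem (mem_compl hw) _
      simp_rw [this]; exact hc w
  have hF'd : ∀ k, Measurable (F' (d k)) := by
    intro k
    have : F' (d k) = Nᶜ.indicator ((hm (d k)).mk _) := by
      ext w
      by_cases hw : w ∈ N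
      · simp [hF', hw]
      · have h1 : ∀ k, F w (d k) = (hm (d k)).mk _ w := by
          by_contra h; exact hw (hN h)
        simp [hF', hw, h1 k]
    rw [this]
    exact (hm (d k)).measurable_mk.indicator hNm.compl
  have hF'm : ∀ y, Measurable (F' y) := by
    intro y
    obtain ⟨u, hu, hlim⟩ := mem_closure_iff_seq_limit.1
      ((TopologicalSpace.denseRange_denseSeq E3) y)
    refine measurable_of_tendsto_metrizable (f := fun n => F' (u n)) (fun n => ?_)
      (tendsto_pi_nhds.2 fun w => ((hF'c w).tendsto y).comp hlim)
    obtain ⟨k, hk⟩ := hu n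
    rw [← hk]; exact hF'd k
  have hmeas := measurable_uncurry_of_continuous_of_measurable hF'c hF'm
  refine ⟨fun p => Function.uncurry F' p.swap, (hmeas.comp measurable_swap).stronglyMeasurable, ?_⟩
  have hae : ∀ᵐ w ∂P, w ∉ N := by
    rw [ae_iff]; simpa using hN0
  filter_upwards [Measure.quasiMeasurePreserving_fst.ae hae] with p hp
  simp [Function.uncurry, hF', hp]

theorem integral_prod_shear {K : E3 × E3 → ℝ} (hK : Integrable K) {ε : ℝ} (hε : 0 < ε) :
    ∫ p, K p = ∫ y, ε ^ 3 * ∫ u, K (y, y + ε • u) := by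
  have hmp : MeasurePreserving (fun z : E3 × E3 => (z.1, z.1 + z.2)) volume volume :=
    measurePreserving_prod_add volume volume
  have h1 : ∫ p, K p = ∫ z : E3 × E3, K (z.1, z.1 + z.2) := by
    conv_lhs => rw [← hmp.map_eq]
    rw [integral_map hmp.measurable.aemeasurable (by rw [hmp.map_eq]; exact hK.aestronglyMeasurable)]
  have hi := hmp.integrable_comp_of_integrable hK
  have h2 : ∫ z : E3 × E3, K (z.1, z.1 + z.2) = ∫ y, ∫ v, K (y, y + v) := by
    rw [Measure.volume_eq_prod] at hi ⊢
    exact integral_prod _ hi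
  rw [h1, h2]
  congr 1
  ext y
  rw [← integral_comp_inv_smul_E3 _ hε]
  simp_rw [smul_inv_smul₀ hε.ne']

/-- The second moment of the mollified noise tested against an integrable function. -/
theorem IsWhiteNoise.sq_integral_mollify [IsProbabilityMeasure P] (hξ : IsWhiteNoise P ξ)
    (ρ : Mollifier3) {ε : ℝ} (hε : 0 < ε) {h : E3 → ℝ} (hh : Integrable h)
    (hc : Integrable (corrIntegrand ρ.autocorr ε h h)) :
    Integrable (fun w => (∫ y, h y * mollify ρ hε (ξ w) y) ^ 2) P ∧
      ∫ w, (∫ y, h y * mollify ρ hε (ξ w) y) ^ 2 ∂P = corr ρ.autocorr ε h h := by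
  set F : Ω → E3 → ℝ := fun w y => mollify ρ hε (ξ w) y with hF
  have hFm := aestronglyMeasurable_uncurry_of_continuous (P := P) (F := F)
    (fun w => continuous_mollify ρ hε (ξ w)) (fun y => (hξ _).aemeasurable)
  have hsq : ∀ y, Integrable (fun w => F w y ^ 2) P ∧ ∫ w, F w y ^ 2 ∂P =
      (ε ^ 3)⁻¹ * ρ.autocorr 0 := fun y => by
    refine ⟨(hξ.second_moment _).1, ((hξ.second_moment _).2).trans ?_⟩
    have := ρ.integral_testFn_mul hε y 0
    rw [smul_zero, add_zero] at this
    simpa only [pow_two] using this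
  set v := (ε ^ 3)⁻¹ * ρ.autocorr 0
  set T : Ω × (E3 × E3) → ℝ := fun p => (h p.2.1 * h p.2.2) * (F p.1 p.2.1 * F p.1 p.2.2) with hT
  have hhm := hh.aestronglyMeasurable
  have hHm : Integrable (fun p : E3 × E3 => h p.1 * h p.2) (volume.prod volume) := hh.mul_prod hh
  have hTm : AEStronglyMeasurable T (P.prod (volume.prod volume)) := by
    refine (hHm.aestronglyMeasurable.comp_quasiMeasurePreserving
      Measure.quasiMeasurePreserving_snd).mul ?_
    refine AEStronglyMeasurable.mul ?_ ?_
    · exact hFm.comp_quasiMeasurePreserving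
        (MeasureTheory.QuasiMeasurePreserving.prodMap
          (Measure.QuasiMeasurePreserving.id P) Measure.quasiMeasurePreserving_fst)
    · exact hFm.comp_quasiMeasurePreserving
        (MeasureTheory.QuasiMeasurePreserving.prodMap
          (Measure.QuasiMeasurePreserving.id P) Measure.quasiMeasurePreserving_snd)
  have hFF := fun y y' => hξ.covariance (ρ.testFn hε y) (ρ.testFn hε y')
  -- By stationarity `E|F(y) F(y')|` is at most the common variance `v`, so the joint integrability
  -- needed for Fubini follows from that of `h ⊗ h`.
  have hTi : Integrable T (P.prod (volume.prod volume)) := by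
    refine (integrable_prod_iff' hTm).2 ⟨Eventually.of_forall fun p => ?_, ?_⟩
    · exact (hFF p.1 p.2).1.const_mul (h p.1 * h p.2)
    · refine (hHm.norm.mul_const v).mono' ?_ (Eventually.of_forall fun p => ?_)
      · exact (hTm.norm.prod_swap).integral_prod_right'
      · have h1 : ∫ w, ‖T (w, p)‖ ∂P ≤ ∫ w, ‖h p.1 * h p.2‖ * ((F w p.1 ^ 2 + F w p.2 ^ 2) / 2) ∂P := by
          refine integral_mono ((hFF p.1 p.2).1.const_mul (h p.1 * h p.2)).norm
            ((((hsq p.1).1.add (hsq p.2).1).div_const 2).const_mul _) fun w => ?_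
          simp only [hT, norm_mul]
          refine mul_le_mul_of_nonneg_left ?_ (by positivity)
          rw [Real.norm_eq_abs, Real.norm_eq_abs, ← sq_abs (F w p.1), ← sq_abs (F w p.2)]
          nlinarith [sq_nonneg (|F w p.1| - |F w p.2|)]
        rw [Real.norm_of_nonneg (integral_nonneg fun w => norm_nonneg _)]
        refine h1.trans (le_of_eq ?_)
        rw [integral_const_mul, integral_div, integral_add (hsq _).1 (hsq _).1, (hsq _).2, (hsq _).2]
        ring
  have hinner : ∀ w, ∫ p : E3 × E3, T (w, p) ∂(volume.prod volume) = (∫ y, h y * F w y) ^ 2 := by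
    intro w
    rw [pow_two, ← integral_prod_mul]
    congr 1; ext p; simp only [hT]; ring
  have hleft := hTi.integral_prod_left
  simp_rw [hinner] at hleft
  refine ⟨hleft, ?_⟩
  have hswap := integral_integral_swap (f := fun w p => T (w, p)) hTi
  simp_rw [hinner] at hswap
  rw [hswap]
  have hK : ∀ p : E3 × E3, ∫ w, T (w, p) ∂P = h p.1 * h p.2 *
      ∫ z, ρ.testFn hε p.1 z * ρ.testFn hε p.2 z := fun p => by
    simp only [hT]
    rw [integral_const_mul, ← (hFF p.1 p.2).2]
    rfl
  have hright := hTi.integral_prod_right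
  simp_rw [hK] at hright ⊢
  rw [← Measure.volume_eq_prod] at hright ⊢
  rw [integral_prod_shear hright hε]
  simp only [ρ.integral_testFn_mul hε]
  rw [corr]
  have hc' := hc
  rw [Measure.volume_eq_prod] at hc'
  rw [Measure.volume_eq_prod, integral_prod_symm _ hc']
  congr 1
  ext y
  rw [← integral_const_mul]
  congr 1
  ext u
  simp only [corrIntegrand]
  field_simp

end Noise

/-! ### The bulk constant -/

theorem fderiv_greenK {x : E3} (hx : x ≠ 0) (j : Fin 3) :
    DifferentiableAt ℝ greenK x ∧ fderiv ℝ greenK x (EuclideanSpace.single j 1) = kern j x := by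
  have hn : 0 < ‖x‖ := norm_pos_iff.2 hx
  have hpi := Real.pi_pos
  have h1 : HasFDerivAt (fun y : E3 => ‖y‖ ^ 2) (2 • innerSL ℝ x) x :=
    (hasStrictFDerivAt_norm_sq x).hasFDerivAt
  have h2 : HasDerivAt (fun s : ℝ => (4 * Real.pi * √s)⁻¹)
      (-(4 * Real.pi * (1 / (2 * √(‖x‖ ^ 2)))) / (4 * Real.pi * √(‖x‖ ^ 2)) ^ 2) (‖x‖ ^ 2) := by
    refine HasDerivAt.inv ((Real.hasDerivAt_sqrt (by positivity)).const_mul _) ?_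
    rw [Real.sqrt_sq hn.le]; positivity
  have h3 := h2.comp_hasFDerivAt x h1
  have e : (fun s : ℝ => (4 * Real.pi * √s)⁻¹) ∘ (fun y : E3 => ‖y‖ ^ 2) = greenK := by
    ext y
    simp [greenK, Real.sqrt_sq (norm_nonneg y)]
  rw [e] at h3
  refine ⟨h3.differentiableAt, ?_⟩
  rw [h3.fderiv, Real.sqrt_sq hn.le]
  have e2 : (innerSL ℝ x) (EuclideanSpace.single j 1) = x j := by
    rw [innerSL_apply_apply, EuclideanSpace.inner_single_right]; simp
  simp only [smul_apply, e2, kern, nsmul_eq_mul, smul_eq_mul]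
  field_simp
  norm_num

theorem gradient_apply (f : E3 → ℝ) (x : E3) (j : Fin 3) :
    gradient f x j = fderiv ℝ f x (EuclideanSpace.single j 1) := by
  rw [← inner_gradient_left, EuclideanSpace.inner_single_right]
  simp

theorem gradientWithin_apply (f : E3 → ℝ) (s : Set E3) (x : E3) (j : Fin 3) :
    gradientWithin f s x j = fderivWithin ℝ f s x (EuclideanSpace.single j 1) := by
  rw [← inner_gradientWithin_left, EuclideanSpace.inner_single_right]
  simp

section Green

variable {Kbar : E3 → ℝ}

/-- The components of the gradient of `K - K̄`. -/
def greenRem (Kbar : E3 → ℝ) (j : Fin 3) (u : E3) : ℝ :=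
  fderiv ℝ (fun x => greenK x - Kbar x) u (EuclideanSpace.single j 1)

theorem continuous_greenRem (hK : IsTruncatedGreen Kbar) (j : Fin 3) :
    Continuous (greenRem Kbar j) := by
  have h := hK.smooth.continuous_fderiv (by simp)
  exact h.clm_apply continuous_const

theorem gradient_truncated (hK : IsTruncatedGreen Kbar) (j : Fin 3) {u : E3} (hu : u ≠ 0) :
    gradient Kbar u j = kern j u - greenRem Kbar j u := by
  obtain ⟨h1, h2⟩ := fderiv_greenK hu j
  have h3 : DifferentiableAt ℝ (fun x => greenK x - Kbar x) u :=
    (hK.smooth.differentiable (by simp)).differentiableAt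
  have e : Kbar = fun x => greenK x - (greenK x - Kbar x) := by ext x; ring
  rw [gradient_apply, greenRem, ← h2]
  conv_lhs => rw [e]
  rw [fderiv_fun_sub h1 h3]
  rfl

/-- Bounded on a large ball by compactness; outside the support of `K̄` it is the gradient of the
Green's function itself, of order `-2`. It is thus a regular function with cut-off scale one. -/
theorem exists_greenRem_bound (hK : IsTruncatedGreen Kbar) :
    ∃ C, 0 ≤ C ∧ ∀ j u, |greenRem Kbar j u| ≤ C * (max 1 ‖u‖) ^ (-2 : ℝ) := by
  obtain ⟨R, hR⟩ := hK.compact.isCompact.isBounded.subset_closedBall 0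
  set M := max 1 R with hM
  have hM1 : 1 ≤ M := le_max_left _ _
  have hb : ∀ j, ∃ B, ∀ u ∈ Metric.closedBall (0 : E3) M, ‖greenRem Kbar j u‖ ≤ B := fun j =>
    (isCompact_closedBall (0 : E3) M).exists_bound_of_continuousOn (continuous_greenRem hK j).continuousOn
  choose B hB using hb
  have hM0 : 0 < M := zero_lt_one.trans_le hM1
  refine ⟨max 1 ((∑ j, |B j|) * M ^ (2 : ℝ)), le_max_of_le_left zero_le_one, fun j u => ?_⟩
  have hm : 0 < max 1 ‖u‖ := lt_max_of_lt_left one_pos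
  rcases le_or_gt ‖u‖ M with hu | hu
  · have h1 := hB j u (by simpa using hu)
    rw [Real.norm_eq_abs] at h1
    have h2 : B j ≤ ∑ j, |B j| := (le_abs_self _).trans
      (Finset.single_le_sum (f := fun j => |B j|) (fun i _ => abs_nonneg _) (Finset.mem_univ j))
    have h3 : M ^ (-2 : ℝ) ≤ (max 1 ‖u‖) ^ (-2 : ℝ) :=
      Real.rpow_le_rpow_of_nonpos hm (max_le hM1 hu) (by norm_num)
    calc |greenRem Kbar j u| ≤ ∑ j, |B j| := h1.trans h2
      _ = (∑ j, |B j|) * M ^ (2 : ℝ) * M ^ (-2 : ℝ) := by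
          rw [mul_assoc, ← Real.rpow_add hM0]; norm_num
      _ ≤ max 1 ((∑ j, |B j|) * M ^ (2 : ℝ)) * (max 1 ‖u‖) ^ (-2 : ℝ) := by
          gcongr
          exact le_max_right _ _
  · have hu0 : u ≠ 0 := by
      rintro rfl
      rw [norm_zero] at hu
      linarith
    have hev : (fun x => greenK x - Kbar x) =ᶠ[𝓝 u] greenK := by
      have hopen : IsOpen (Metric.closedBall (0 : E3) R)ᶜ := Metric.isClosed_closedBall.isOpen_compl
      have hmem : u ∈ (Metric.closedBall (0 : E3) R)ᶜ := by
        rw [mem_compl_iff, mem_closedBall_zero_iff]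
        exact not_le.2 ((le_max_right _ _).trans_lt hu)
      filter_upwards [hopen.mem_nhds hmem] with x hx
      have : x ∉ tsupport Kbar := fun h => hx (hR h)
      rw [image_eq_zero_of_notMem_tsupport this, sub_zero]
    rw [greenRem, hev.fderiv_eq, (fderiv_greenK hu0 j).2, max_eq_right (show (1 : ℝ) ≤ ‖u‖ by linarith)]
    refine (abs_kern_le j u).trans (le_mul_of_one_le_left (by positivity) (le_max_left _ _))

theorem measurable_greenRem (hK : IsTruncatedGreen Kbar) (j : Fin 3) : Measurable (greenRem Kbar j) :=
  (continuous_greenRem hK j).measurable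

theorem abs_kern_sub_greenRem_le {C : ℝ} {j : Fin 3} {u : E3} (hu : u ≠ 0) (hC : 0 ≤ C)
    (h : |greenRem Kbar j u| ≤ C * (max 1 ‖u‖) ^ (-2 : ℝ)) :
    |kern j u - greenRem Kbar j u| ≤ (1 + C) * ‖u‖ ^ (-2 : ℝ) := by
  have h1 := abs_kern_le j u
  have h2 : (max 1 ‖u‖) ^ (-2 : ℝ) ≤ ‖u‖ ^ (-2 : ℝ) :=
    Real.rpow_le_rpow_of_nonpos (norm_pos_iff.2 hu) (le_max_right _ _) (by norm_num)
  have h3 := abs_sub (kern j u) (greenRem Kbar j u)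
  nlinarith

/-- Away from the origin this is the gradient of `K̄`, which has compact support and a singularity
of order `-2`. The kernel of `K` itself is not integrable at infinity. -/
theorem integrable_kern_sub_greenRem (hK : IsTruncatedGreen Kbar) (j : Fin 3) :
    Integrable fun u => kern j u - greenRem Kbar j u := by
  obtain ⟨C, hC, hb⟩ := exists_greenRem_bound hK
  obtain ⟨R, hR⟩ := hK.compact.isCompact.isBounded.subset_closedBall 0
  refine ((integrable_coreFn R (a := 2) (by norm_num)).const_mul (1 + C)).mono'
    ((measurable_kern j).sub (measurable_greenRem hK j)).aestronglyMeasurable ?_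
  filter_upwards [ae_ne_E3 0] with u hu
  by_cases hm : u ∈ Metric.closedBall (0 : E3) R
  · rw [coreFn, indicator_of_mem hm]
    exact abs_kern_sub_greenRem_le hu hC (hb j u)
  · have hz : u ∉ tsupport Kbar := fun h => hm (hR h)
    have hev : Kbar =ᶠ[𝓝 u] fun _ => 0 := by
      filter_upwards [(isClosed_tsupport Kbar).isOpen_compl.mem_nhds hz] with x hx
      exact image_eq_zero_of_notMem_tsupport hx
    rw [← gradient_truncated hK j hu, gradient_apply, hev.fderiv_eq]
    simp only [fderiv_fun_const, Pi.zero_apply, zero_apply, norm_zero]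
    exact mul_nonneg (by positivity) (coreFn_nonneg _ _ _)

variable {Ω : Type*} [MeasurableSpace Ω] {P : Measure Ω} {ξ : Ω → (𝓢(E3, ℝ) →L[ℝ] ℝ)}

/-- The deviation of the bulk constant from the correlation of the full-space kernels. -/
def bulkRem (Kbar q : E3 → ℝ) (ε : ℝ) : ℝ :=
  ∑ j, corr q ε (fun u => 2 * kern j u - greenRem Kbar j u) (greenRem Kbar j)

theorem bulk_bound (hK : IsTruncatedGreen Kbar) :
    ∃ A B, 0 ≤ A ∧ 0 ≤ B ∧ (∀ j u, u ≠ 0 → |2 * kern j u - greenRem Kbar j u| ≤ A * ‖0 - u‖ ^ (-2 : ℝ)) ∧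
      ∀ j u, |greenRem Kbar j u| ≤ B * (max 1 ‖0 - u‖) ^ (-2 : ℝ) := by
  obtain ⟨C, hC, hb⟩ := exists_greenRem_bound hK
  refine ⟨2 + C, C, by positivity, hC, fun j u hu => ?_, fun j u => ?_⟩
  · rw [zero_sub, norm_neg]
    have h1 := abs_kern_le j u
    have h2 := abs_kern_sub_greenRem_le hu hC (hb j u)
    have h3 := abs_add_le (kern j u) (kern j u - greenRem Kbar j u)
    rw [show 2 * kern j u - greenRem Kbar j u = kern j u + (kern j u - greenRem Kbar j u) by ring]
    nlinarith
  · rw [zero_sub, norm_neg]; exact hb j u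

theorem exists_bulkRem_bound (hK : IsTruncatedGreen Kbar) {q : E3 → ℝ} (hq : CorrWeight q) :
    ∃ C, 0 ≤ C ∧ ∀ ε, |bulkRem Kbar q ε| ≤ C := by
  obtain ⟨A, B, hA, hB, h1, h2⟩ := bulk_bound hK
  have h0 := corrConst_nonneg 2 2
  refine ⟨∑ _j : Fin 3, A * B * corrConst 2 2, by positivity, fun ε => ?_⟩
  refine (Finset.abs_sum_le_sum_abs _ _).trans (Finset.sum_le_sum fun j _ => ?_)
  have := abs_corr_le hq ε (f := fun u => 2 * kern j u - greenRem Kbar j u) zero_le_two (by norm_num)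
    zero_le_two (by norm_num) one_pos hA hB
    (((measurable_kern j).const_mul 2).sub (measurable_greenRem hK j)).aestronglyMeasurable
    (measurable_greenRem hK j).aestronglyMeasurable 0 0
    (by filter_upwards [ae_ne_E3 0] with u hu using h1 j u hu) (Eventually.of_forall (h2 j))
  simpa using this

theorem tendsto_bulkRem (hK : IsTruncatedGreen Kbar) {q : E3 → ℝ} (hq : CorrWeight q) :
    Tendsto (bulkRem Kbar q) (𝓝 0) (𝓝 (∑ j, ∫ u, (2 * kern j u - greenRem Kbar j u) *
      greenRem Kbar j u)) := by
  obtain ⟨A, B, hA, hB, h1, h2⟩ := bulk_bound hK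
  refine tendsto_finsetSum _ fun j _ => ?_
  have := tendsto_corr hq (f := fun u => 2 * kern j u - greenRem Kbar j u) one_pos hA hB
    (((measurable_kern j).const_mul 2).sub (measurable_greenRem hK j)).aestronglyMeasurable
    (measurable_greenRem hK j).aestronglyMeasurable 0
    (by filter_upwards [ae_ne_E3 0] with u hu using h1 j u hu) (Eventually.of_forall (h2 j))
    (Eventually.of_forall fun u => (continuous_greenRem hK j).continuousAt)
  rwa [corr_zero hq] at this

/-- For the symmetric form `corr`, with `g` the smooth part, this is `(k - g)² = k² - (2k - g) g`.
Only `k²` diverges as `ε` tends to zero. -/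
theorem corr_kern_sub_greenRem (hK : IsTruncatedGreen Kbar) {q : E3 → ℝ} (hq : CorrWeight q) {ε : ℝ}
    (hε : 0 < ε) :
    (∀ j, Integrable (corrIntegrand q ε (fun u => kern j u - greenRem Kbar j u)
      (fun u => kern j u - greenRem Kbar j u))) ∧
    ∑ j, corr q ε (fun u => kern j u - greenRem Kbar j u) (fun u => kern j u - greenRem Kbar j u) =
      ∑ j, corr q ε (kern j) (kern j) - bulkRem Kbar q ε := by
  obtain ⟨C, hC, hb⟩ := exists_greenRem_bound hK
  obtain ⟨M, -, hM⟩ := exists_corr_sing_bound hq hε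
  have hk := fun j => (measurable_kern j).aestronglyMeasurable (μ := (volume : Measure E3))
  have hg := fun j => (measurable_greenRem hK j).aestronglyMeasurable (μ := (volume : Measure E3))
  have bk : ∀ j, ∀ᵐ u : E3, |kern j u| ≤ 1 * ‖0 - u‖ ^ (-2 : ℝ) := fun j =>
    Eventually.of_forall fun u => by rw [zero_sub, norm_neg, one_mul]; exact abs_kern_le j u
  have bg : ∀ j, ∀ᵐ u : E3, |greenRem Kbar j u| ≤ C * ‖0 - u‖ ^ (-2 : ℝ) := fun j => by
    filter_upwards [ae_ne_E3 0] with u hu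
    rw [zero_sub, norm_neg]
    exact (hb j u).trans (mul_le_mul_of_nonneg_left (Real.rpow_le_rpow_of_nonpos
      (norm_pos_iff.2 hu) (le_max_right _ _) (by norm_num)) hC)
  have i1 := fun j => (hM 0 _ _ 1 1 zero_le_one zero_le_one (hk j) (hk j) (bk j) (bk j)).1
  have i2 := fun j => (hM 0 _ _ 1 C zero_le_one hC (hk j) (hg j) (bk j) (bg j)).1
  have i3 := fun j => (hM 0 _ _ C 1 hC zero_le_one (hg j) (hk j) (bg j) (bk j)).1
  have i4 := fun j => (hM 0 _ _ C C hC hC (hg j) (hg j) (bg j) (bg j)).1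
  have e1 : ∀ j, corrIntegrand q ε (fun u => kern j u - greenRem Kbar j u)
      (fun u => kern j u - greenRem Kbar j u) =
      corrIntegrand q ε (kern j) (kern j) - corrIntegrand q ε (kern j) (greenRem Kbar j) -
        corrIntegrand q ε (greenRem Kbar j) (kern j) +
        corrIntegrand q ε (greenRem Kbar j) (greenRem Kbar j) := fun j => by
    ext p; simp only [corrIntegrand, Pi.add_apply, Pi.sub_apply]; ring
  have e2 : ∀ j, corrIntegrand q ε (fun u => 2 * kern j u - greenRem Kbar j u) (greenRem Kbar j) =
      fun p => 2 * corrIntegrand q ε (kern j) (greenRem Kbar j) p -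
        corrIntegrand q ε (greenRem Kbar j) (greenRem Kbar j) p := fun j => by
    ext p; simp only [corrIntegrand]; ring
  refine ⟨fun j => ?_, ?_⟩
  · rw [e1]; exact (((i1 j).sub (i2 j)).sub (i3 j)).add (i4 j)
  · rw [bulkRem, ← Finset.sum_sub_distrib]
    refine Finset.sum_congr rfl fun j _ => ?_
    have hs := corr_swap (ε := ε) hq (hk j) (hg j)
    have c1 : corr q ε (fun u => kern j u - greenRem Kbar j u) (fun u => kern j u - greenRem Kbar j u)
        = corr q ε (kern j) (kern j) - corr q ε (kern j) (greenRem Kbar j) -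
          corr q ε (greenRem Kbar j) (kern j) + corr q ε (greenRem Kbar j) (greenRem Kbar j) := by
      rw [corr, e1, integral_add' (((i1 j).sub (i2 j)).sub (i3 j)) (i4 j),
        integral_sub' ((i1 j).sub (i2 j)) (i3 j), integral_sub' (i1 j) (i2 j)]
      rfl
    have c2 : corr q ε (fun u => 2 * kern j u - greenRem Kbar j u) (greenRem Kbar j) =
        2 * corr q ε (kern j) (greenRem Kbar j) - corr q ε (greenRem Kbar j) (greenRem Kbar j) := by
      rw [corr, e2, integral_sub ((i2 j).const_mul 2) (i4 j), integral_const_mul]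
      rfl
    rw [c1, c2, hs]
    ring

/-- The bulk renormalisation constant as a correlation. -/
theorem ellConst_eq [IsProbabilityMeasure P] (hK : IsTruncatedGreen Kbar) (hξ : IsWhiteNoise P ξ)
    (ρ : Mollifier3) {ε : ℝ} (hε : 0 < ε) (z : E3) :
    ellConst P Kbar (fun w => mollify ρ hε (ξ w)) z =
      ∑ j, corr ρ.autocorr ε (kern j) (kern j) - bulkRem Kbar ρ.autocorr ε := by
  have hq := ρ.corrWeight_autocorr
  obtain ⟨hci, hsum⟩ := corr_kern_sub_greenRem hK hq hε
  set G : Fin 3 → E3 → ℝ := fun j u => kern j u - greenRem Kbar j u with hG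
  have hGi : ∀ j, Integrable (G j) := fun j => integrable_kern_sub_greenRem hK j
  -- reflect the argument
  set H : Fin 3 → E3 → ℝ := fun j y => G j (z - y) with hH
  have hHi : ∀ j, Integrable (H j) := fun j => (hGi j).comp_sub_left z
  have hmp : MeasurePreserving (fun p : E3 × E3 => (-p.1, z - p.2)) volume volume := by
    rw [Measure.volume_eq_prod]
    exact (Measure.measurePreserving_neg volume).prod (Measure.measurePreserving_sub_left volume z)
  have hcorr : ∀ j p, corrIntegrand ρ.autocorr ε (H j) (H j) p =
      corrIntegrand ρ.autocorr ε (G j) (G j) (-p.1, z - p.2) := fun j p => by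
    simp only [corrIntegrand, hH, hq.even]
    congr 3
    rw [smul_neg]; abel
  have hHc : ∀ j, Integrable (corrIntegrand ρ.autocorr ε (H j) (H j)) := fun j =>
    (hmp.integrable_comp_of_integrable (hci j)).congr (Eventually.of_forall fun p => (hcorr j p).symm)
  have hHe : ∀ j, corr ρ.autocorr ε (H j) (H j) = corr ρ.autocorr ε (G j) (G j) := fun j => by
    rw [corr, corr]
    simp_rw [hcorr j]
    conv_rhs => rw [← hmp.map_eq]
    rw [integral_map hmp.measurable.aemeasurable
      (by rw [hmp.map_eq]; exact (hci j).aestronglyMeasurable)]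
  have hcoord : ∀ w j, (∫ y, mollify ρ hε (ξ w) y • gradient Kbar (z - y)) j =
      ∫ y, H j y * mollify ρ hε (ξ w) y := by
    intro w
    have hae : ∀ j, (fun y => mollify ρ hε (ξ w) y * gradient Kbar (z - y) j) =ᵐ[volume]
        fun y => H j y * mollify ρ hε (ξ w) y := fun j => by
      filter_upwards [ae_ne_E3 z] with y hy
      rw [gradient_truncated hK j (sub_ne_zero.2 hy.symm), mul_comm]
    -- Sample paths are continuous but not bounded, so integrability relies on the compact support
    -- of `K̄`.
    obtain ⟨R, hR⟩ := hK.compact.isCompact.isBounded.subset_closedBall 0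
    obtain ⟨B, hB⟩ := (isCompact_closedBall z R).exists_bound_of_continuousOn
      (continuous_mollify ρ hε (ξ w)).continuousOn
    have hint : ∀ j, Integrable fun y => H j y * mollify ρ hε (ξ w) y := by
      intro j
      refine ((hHi j).norm.mul_const B).mono' ((hHi j).aestronglyMeasurable.mul
        (continuous_mollify ρ hε (ξ w)).aestronglyMeasurable) ?_
      filter_upwards [ae_ne_E3 z] with y hy
      rw [norm_mul]
      by_cases hm : y ∈ Metric.closedBall z R
      · exact mul_le_mul_of_nonneg_left (hB y hm) (norm_nonneg _)
      · have hz : z - y ∉ tsupport Kbar := fun h => hm (by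
          have := hR h
          rw [mem_closedBall_zero_iff, ← dist_eq_norm, dist_comm] at this
          exact this)
        have hev : Kbar =ᶠ[𝓝 (z - y)] fun _ => 0 := by
          filter_upwards [(isClosed_tsupport Kbar).isOpen_compl.mem_nhds hz] with x hx
          exact image_eq_zero_of_notMem_tsupport hx
        have h0 : H j y = 0 := by
          simp only [hH, hG]
          rw [← gradient_truncated hK j (sub_ne_zero.2 hy.symm), gradient_apply, hev.fderiv_eq]
          simp
        simp [h0]
    have hvec : Integrable fun y => mollify ρ hε (ξ w) y • gradient Kbar (z - y) := by
      refine Integrable.of_eval_piLp fun j => ?_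
      refine (hint j).congr ?_
      filter_upwards [hae j] with y hy
      rw [← hy]; simp
    intro j
    rw [← integral_congr_ae (hae j)]
    exact ((EuclideanSpace.proj (𝕜 := ℝ) j).integral_comp_comm hvec).symm
  have hmom := fun j => hξ.sq_integral_mollify ρ hε (hHi j) (hHc j)
  rw [ellConst]
  simp_rw [EuclideanSpace.norm_sq_eq, hcoord, Real.norm_eq_abs, sq_abs]
  rw [integral_finsetSum _ fun j _ => (hmom j).1, ← hsum]
  refine Finset.sum_congr rfl fun j _ => ?_
  rw [(hmom j).2, hHe]

end Green

end

/-! ### The divergence theorem and Green's identity on the cube -/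

theorem convex_cubeD : Convex ℝ cubeD := by
  intro x hx y hy a b ha hb hab i
  have h1 := hx i
  have h2 := hy i
  simp only [PiLp.add_apply, PiLp.smul_apply, smul_eq_mul]
  constructor <;> nlinarith

theorem isCompact_cubeD : IsCompact cubeD := by
  have h : cubeD = (EuclideanSpace.equiv (Fin 3) ℝ).toHomeomorph ⁻¹' (univ.pi fun _ => Icc 0 2) := by
    ext x; simp [cubeD, -Set.pi_univ_Icc, Set.mem_pi]
  rw [h]
  exact (Homeomorph.isCompact_preimage _).2 (isCompact_univ_pi fun _ => isCompact_Icc)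

theorem measurableSet_cubeD : MeasurableSet cubeD := isClosed_cubeD.measurableSet

theorem interior_cubeD_nonempty : (interior cubeD).Nonempty := by
  rw [interior_cubeD]
  exact ⟨WithLp.toLp 2 fun _ => 1, fun i => by simp⟩

theorem uniqueDiffOn_cubeD : UniqueDiffOn ℝ cubeD :=
  uniqueDiffOn_convex convex_cubeD interior_cubeD_nonempty

theorem ae_mem_interior_cubeD : ∀ᵐ x : E3, x ∈ cubeD → x ∈ interior cubeD := by
  have h : volume (frontier cubeD) = 0 := convex_cubeD.addHaar_frontier volume
  filter_upwards [measure_eq_zero_iff_ae_notMem.1 h] with x hx hxD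
  by_contra hi
  exact hx ⟨subset_closure hxD, hi⟩

theorem cubeD_integrableOn {f : E3 → ℝ} (hf : ContinuousOn f cubeD) : IntegrableOn f cubeD :=
  hf.integrableOn_compact isCompact_cubeD

/-- The divergence theorem for boxes, transported from the product space. The fields of interest are
differentiable only in the interior and continuous up to the boundary, and the vanishing normal
component kills all face integrals. -/
theorem integral_divergence_cubeD {f : Fin 3 → E3 → ℝ} {h : E3 → ℝ}
    (hc : ∀ i, ContinuousOn (f i) cubeD)
    (hd : ∀ x ∈ interior cubeD, ∃ L : Fin 3 → E3 →L[ℝ] ℝ, (∀ i, HasFDerivAt (f i) (L i) x) ∧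
      ∑ i, L i (EuclideanSpace.single i 1) = h x)
    (hh : ContinuousOn h cubeD)
    (hb : ∀ x ∈ cubeD, ∀ i, (x i = 0 ∨ x i = 2) → f i x = 0) : ∫ x in cubeD, h x = 0 := by
  classical
  choose! L hL hLs using hd
  set e := EuclideanSpace.equiv (Fin 3) ℝ with he
  have hpre : (WithLp.toLp 2 : (Fin 3 → ℝ) → E3) ⁻¹' cubeD = Icc 0 2 := by
    ext x; simp [cubeD, Pi.le_def, forall_and]
  have hmem : ∀ x ∈ Icc (0 : Fin 3 → ℝ) 2, (WithLp.toLp 2 x : E3) ∈ cubeD := fun x hx => by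
    rw [← hpre] at hx; exact hx
  have hmp := PiLp.volume_preserving_toLp (Fin 3)
  have hemb : MeasurableEmbedding (WithLp.toLp 2 : (Fin 3 → ℝ) → E3) :=
    e.symm.toHomeomorph.measurableEmbedding
  set L' : Fin 3 → (Fin 3 → ℝ) → (Fin 3 → ℝ) →L[ℝ] ℝ := fun i x =>
    (L (WithLp.toLp 2 x) i).comp (e.symm : (Fin 3 → ℝ) →L[ℝ] E3) with hL'
  have hsum : ∀ x, (WithLp.toLp 2 x : E3) ∈ interior cubeD →
      ∑ i, L' i x (Pi.single i 1) = h (WithLp.toLp 2 x) := by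
    intro x hx
    rw [← hLs _ hx]
    rfl
  have hint : IntegrableOn (fun x : Fin 3 → ℝ => h (WithLp.toLp 2 x)) (Icc 0 2) := by
    rw [← hpre]
    exact (hmp.integrableOn_comp_preimage hemb).2 (cubeD_integrableOn hh)
  have hae : ∀ᵐ x : Fin 3 → ℝ, x ∈ Icc (0 : Fin 3 → ℝ) 2 →
      h (WithLp.toLp 2 x) = ∑ i, L' i x (Pi.single i 1) := by
    have := hmp.quasiMeasurePreserving.ae ae_mem_interior_cubeD
    filter_upwards [this] with x hx hxD using (hsum x (hx (hmem x hxD))).symm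
  have hdiv := integral_divergence_of_hasFDerivAt_off_countable' (0 : Fin 3 → ℝ) 2
    (by intro i; simp) (fun i x => f i (WithLp.toLp 2 x)) L' ∅ countable_empty
    (fun i => (hc i).comp (PiLp.continuous_toLp 2 _).continuousOn hmem)
    (fun x hx i => by
      have hx' : (WithLp.toLp 2 x : E3) ∈ interior cubeD := by
        rw [interior_cubeD]
        intro i
        exact hx.1 i trivial
      exact (hL _ hx' i).comp x e.symm.hasFDerivAt)
    (hint.congr_fun_ae ((ae_restrict_iff' measurableSet_Icc).2 hae))
  have hzero : ∀ i : Fin 3, ∀ c : ℝ, (c = 0 ∨ c = 2) →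
      ∀ x ∈ Icc ((0 : Fin 3 → ℝ) ∘ i.succAbove) ((2 : Fin 3 → ℝ) ∘ i.succAbove),
      f i (WithLp.toLp 2 (i.insertNth c x)) = 0 := by
    intro i c hcc x hx
    refine hb _ (hmem _ ⟨?_, ?_⟩) i (by simpa using hcc)
    · refine Fin.le_insertNth_iff.2 ⟨?_, hx.1⟩
      rcases hcc with rfl | rfl <;> simp
    · refine Fin.insertNth_le_iff.2 ⟨?_, hx.2⟩
      rcases hcc with rfl | rfl <;> simp
  have hrhs : ∫ x in Icc (0 : Fin 3 → ℝ) 2, ∑ i, L' i x (Pi.single i 1) = 0 := by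
    rw [hdiv]
    refine Finset.sum_eq_zero fun i _ => ?_
    rw [setIntegral_eq_zero_of_forall_eq_zero, setIntegral_eq_zero_of_forall_eq_zero, sub_zero]
    · exact hzero i _ (Or.inl rfl)
    · exact hzero i _ (Or.inr rfl)
  rw [← hrhs, ← setIntegral_congr_ae measurableSet_Icc hae, ← hpre]
  exact (hmp.setIntegral_preimage_emb hemb _ _).symm

/-- `Y` has continuous partial derivatives `p` on the cube, vanishing normal derivatives, and
Laplacian `g`. -/
structure HasNeumannLaplacian (Y : E3 → ℝ) (p : Fin 3 → E3 → ℝ) (g : E3 → ℝ) : Prop where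
  cont : ContinuousOn Y cubeD
  cont_partial : ∀ i, ContinuousOn (p i) cubeD
  cont_laplacian : ContinuousOn g cubeD
  hasFDerivAt : ∀ x ∈ interior cubeD, ∃ L : E3 →L[ℝ] ℝ, HasFDerivAt Y L x ∧
    ∀ i, L (EuclideanSpace.single i 1) = p i x
  hasFDerivAt_partial : ∀ x ∈ interior cubeD, ∃ L : Fin 3 → E3 →L[ℝ] ℝ,
    (∀ i, HasFDerivAt (p i) (L i) x) ∧ ∑ i, L i (EuclideanSpace.single i 1) = g x
  neumann : ∀ x ∈ cubeD, ∀ i, (x i = 0 ∨ x i = 2) → p i x = 0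

theorem HasNeumannLaplacian.green {Y Φ g h : E3 → ℝ} {p P : Fin 3 → E3 → ℝ}
    (hY : HasNeumannLaplacian Y p g) (hΦ : HasNeumannLaplacian Φ P h) :
    ∫ x in cubeD, Φ x * g x = ∫ x in cubeD, Y x * h x := by
  have key := integral_divergence_cubeD (f := fun i x => Φ x * p i x - Y x * P i x)
    (h := fun x => Φ x * g x - Y x * h x)
    (fun i => (hΦ.cont.mul (hY.cont_partial i)).sub (hY.cont.mul (hΦ.cont_partial i)))
    (fun x hx => by
      obtain ⟨L, hL, hLp⟩ := hY.hasFDerivAt x hx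
      obtain ⟨M, hM, hMP⟩ := hΦ.hasFDerivAt x hx
      obtain ⟨L2, hL2, hLs⟩ := hY.hasFDerivAt_partial x hx
      obtain ⟨M2, hM2, hMs⟩ := hΦ.hasFDerivAt_partial x hx
      refine ⟨_, fun i => (hM.mul (hL2 i)).sub (hL.mul (hM2 i)), ?_⟩
      rw [← hLs, ← hMs, Finset.mul_sum, Finset.mul_sum, ← Finset.sum_sub_distrib]
      refine Finset.sum_congr rfl fun i _ => ?_
      simp only [sub_apply, add_apply, smul_apply, smul_eq_mul, hLp, hMP]
      ring)
    ((hΦ.cont.mul hY.cont_laplacian).sub (hY.cont.mul hΦ.cont_laplacian))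
    (fun x hx i hi => by simp only [hY.neumann x hx i hi, hΦ.neumann x hx i hi, mul_zero, sub_zero])
  have h1 : IntegrableOn (fun x => Φ x * g x) cubeD :=
    cubeD_integrableOn (hΦ.cont.mul hY.cont_laplacian)
  have h2 : IntegrableOn (fun x => Y x * h x) cubeD :=
    cubeD_integrableOn (hY.cont.mul hΦ.cont_laplacian)
  rwa [integral_sub h1 h2, sub_eq_zero] at key

theorem hasNeumannLaplacian_one : HasNeumannLaplacian (fun _ => 1) (fun _ _ => 0) (fun _ => 0) where
  cont := continuousOn_const
  cont_partial _ := continuousOn_const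
  cont_laplacian := continuousOn_const
  hasFDerivAt x _ := ⟨0, hasFDerivAt_const _ _, fun _ => rfl⟩
  hasFDerivAt_partial x _ := ⟨fun _ => 0, fun _ => hasFDerivAt_const _ _, by simp⟩
  neumann _ _ _ _ := rfl

theorem HasNeumannLaplacian.integral_eq_zero {Y g : E3 → ℝ} {p : Fin 3 → E3 → ℝ}
    (hY : HasNeumannLaplacian Y p g) : ∫ x in cubeD, g x = 0 := by
  simpa using hY.green hasNeumannLaplacian_one

/-- A twice continuously differentiable function with vanishing normal derivatives. -/
theorem hasNeumannLaplacian_of_contDiff {Φ h : E3 → ℝ} {P : Fin 3 → E3 → ℝ}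
    {L : E3 → E3 →L[ℝ] ℝ} {M : Fin 3 → E3 → E3 →L[ℝ] ℝ}
    (hL : ∀ x, HasFDerivAt Φ (L x) x) (hLP : ∀ x i, L x (EuclideanSpace.single i 1) = P i x)
    (hM : ∀ i x, HasFDerivAt (P i) (M i x) x)
    (hMh : ∀ x, ∑ i, M i x (EuclideanSpace.single i 1) = h x) (hh : Continuous h)
    (hn : ∀ x ∈ cubeD, ∀ i, (x i = 0 ∨ x i = 2) → P i x = 0) : HasNeumannLaplacian Φ P h where
  cont := fun x _ => (hL x).continuousAt.continuousWithinAt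
  cont_partial i := fun x _ => (hM i x).continuousAt.continuousWithinAt
  cont_laplacian := hh.continuousOn
  hasFDerivAt x _ := ⟨L x, hL x, hLP x⟩
  hasFDerivAt_partial x _ := ⟨fun i => M i x, fun i => hM i x, hMh x⟩
  neumann := hn

theorem IsNeumannSolution.hasNeumannLaplacian {f Y : E3 → ℝ} (hf : Continuous f)
    (hY : IsNeumannSolution f Y) :
    HasNeumannLaplacian Y (fun i x => fderivWithin ℝ Y cubeD x (EuclideanSpace.single i 1))
      (fun x => f x - ⨍ y in cubeD, f y) where
  cont := hY.contDiffOn.continuousOn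
  cont_partial i := (hY.contDiffOn.continuousOn_fderivWithin uniqueDiffOn_cubeD (by norm_num)).clm_apply
    continuousOn_const
  cont_laplacian := (hf.sub continuous_const).continuousOn
  hasFDerivAt x hx := by
    have hn : cubeD ∈ 𝓝 x := mem_interior_iff_mem_nhds.1 hx
    have hd : DifferentiableAt ℝ Y x :=
      (hY.contDiffOn.differentiableOn (by norm_num)).differentiableAt hn
    refine ⟨fderiv ℝ Y x, hd.hasFDerivAt, fun i => ?_⟩
    rw [fderivWithin_of_mem_nhds hn]
  hasFDerivAt_partial x hx := by
    have hn : cubeD ∈ 𝓝 x := mem_interior_iff_mem_nhds.1 hx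
    have hc : ContDiffAt ℝ 2 Y x := hY.contDiffOn.contDiffAt hn
    have hd : DifferentiableAt ℝ (fderiv ℝ Y) x :=
      (hc.fderiv_right (m := 1) (by norm_num)).differentiableAt (by norm_num)
    refine ⟨fun i => (ContinuousLinearMap.apply ℝ ℝ (EuclideanSpace.single i 1)).comp
      (fderiv ℝ (fderiv ℝ Y) x), fun i => ?_, ?_⟩
    · have h1 := (ContinuousLinearMap.apply ℝ ℝ (EuclideanSpace.single i (1 : ℝ) : E3)).hasFDerivAt.comp x
        hd.hasFDerivAt
      refine h1.congr_of_eventuallyEq ?_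
      filter_upwards [isOpen_interior.mem_nhds hx] with y hy
      rw [fderivWithin_of_mem_nhds (mem_interior_iff_mem_nhds.1 hy)]
      rfl
    · rw [← hY.equation x hx, InnerProductSpace.laplacian_eq_iteratedFDeriv_orthonormalBasis Y
        (EuclideanSpace.basisFun (Fin 3) ℝ)]
      refine Finset.sum_congr rfl fun i _ => ?_
      rw [iteratedFDeriv_two_apply]
      simp
  neumann := hY.neumann

/-! ### Cosine modes on the cube -/

/-- The eigenfunctions of the Neumann Laplacian on the cube. -/
def cosMode (k : Fin 3 → ℕ) (y : E3) : ℝ := ∏ i, Real.cos (Real.pi / 2 * k i * y i)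

/-- The eigenvalues of the Neumann Laplacian on the cube. -/
def cosEig (k : Fin 3 → ℕ) : ℝ := ∑ i, (Real.pi / 2 * k i) ^ 2

theorem continuous_cosMode (k : Fin 3 → ℕ) : Continuous (cosMode k) := by
  unfold cosMode
  fun_prop

theorem abs_cosMode_le (k : Fin 3 → ℕ) (y : E3) : |cosMode k y| ≤ 1 := by
  rw [cosMode, Finset.abs_prod]
  exact Finset.prod_le_one (fun _ _ => abs_nonneg _) fun _ _ => Real.abs_cos_le_one _

theorem cosMode_zero (y : E3) : cosMode 0 y = 1 := by simp [cosMode]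

theorem cosEig_nonneg (k : Fin 3 → ℕ) : 0 ≤ cosEig k := Finset.sum_nonneg fun _ _ => sq_nonneg _

theorem cosEig_pos {k : Fin 3 → ℕ} (hk : k ≠ 0) : 0 < cosEig k := by
  obtain ⟨i, hi⟩ := Function.ne_iff.1 hk
  have h1 : (0 : ℝ) < k i := by exact_mod_cast Nat.pos_of_ne_zero hi
  have hpi := Real.pi_pos
  refine lt_of_lt_of_le (by positivity : 0 < (Real.pi / 2 * k i) ^ 2)
    (Finset.single_le_sum (f := fun i => (Real.pi / 2 * (k i : ℝ)) ^ 2) (fun _ _ => sq_nonneg _)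
      (Finset.mem_univ i))

theorem hasFDerivAt_coord (i : Fin 3) (x : E3) :
    HasFDerivAt (fun y : E3 => y i) (EuclideanSpace.proj i : E3 →L[ℝ] ℝ) x :=
  (EuclideanSpace.proj (𝕜 := ℝ) i : E3 →L[ℝ] ℝ).hasFDerivAt

theorem sin_pi_half_mul_eq_zero {n : ℕ} {t : ℝ} (ht : t = 0 ∨ t = 2) :
    Real.sin (Real.pi / 2 * n * t) = 0 := by
  rcases ht with rfl | rfl
  · simp
  · rw [show Real.pi / 2 * (n : ℝ) * 2 = n * Real.pi by ring, Real.sin_nat_mul_pi]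

theorem hasNeumannLaplacian_cosMode (k : Fin 3 → ℕ) :
    HasNeumannLaplacian (cosMode k) (fun i y => -(Real.pi / 2 * k i) * Real.sin (Real.pi / 2 * k i * y i) *
      ∏ m ∈ Finset.univ.erase i, Real.cos (Real.pi / 2 * k m * y m))
      (fun y => -cosEig k * cosMode k y) := by
  set c : Fin 3 → ℝ := fun i => Real.pi / 2 * k i with hc
  have hcos : ∀ i (x : E3), HasFDerivAt (fun y : E3 => Real.cos (c i * y i))
      (-(Real.sin (c i * x i)) • (c i • (EuclideanSpace.proj i : E3 →L[ℝ] ℝ))) x := fun i x =>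
    ((hasFDerivAt_coord i x).const_mul (c i)).cos
  have hsin : ∀ i (x : E3), HasFDerivAt (fun y : E3 => -c i * Real.sin (c i * y i))
      (-c i • (Real.cos (c i * x i) • (c i • (EuclideanSpace.proj i : E3 →L[ℝ] ℝ)))) x := fun i x =>
    (((hasFDerivAt_coord i x).const_mul (c i)).sin).const_mul (-c i)
  refine hasNeumannLaplacian_of_contDiff
    (fun x => HasFDerivAt.finsetProd fun i _ => hcos i x) ?_
    (fun i x => (hsin i x).mul (HasFDerivAt.finsetProd fun m _ => hcos m x)) ?_
    (continuous_const.mul (continuous_cosMode k)) ?_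
  · intro x i
    simp only [sum_apply, smul_apply, PiLp.proj_apply, smul_eq_mul]
    rw [Finset.sum_eq_single i]
    · simp; ring
    · intro m _ hm; simp [hm]
    · simp
  · intro x
    rw [cosEig, neg_mul, Finset.sum_mul, ← Finset.sum_neg_distrib]
    refine Finset.sum_congr rfl fun i _ => ?_
    simp only [add_apply, sum_apply, smul_apply, PiLp.proj_apply, smul_eq_mul]
    rw [Finset.sum_eq_zero]
    · have : cosMode k x = Real.cos (c i * x i) * ∏ m ∈ Finset.univ.erase i, Real.cos (c m * x m) :=
        (Finset.mul_prod_erase Finset.univ (fun m => Real.cos (c m * x m)) (Finset.mem_univ i)).symm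
      rw [this]
      simp
      ring
    · intro m hm
      have : m ≠ i := Finset.ne_of_mem_erase hm
      simp [this]
  · intro x _ i hi
    simp only [hc, sin_pi_half_mul_eq_zero hi, mul_zero, zero_mul]

/-! ### Orthogonality -/

theorem integral_cubeD_prod (f : Fin 3 → ℝ → ℝ) :
    ∫ y in cubeD, ∏ i, f i (y i) = ∏ i, ∫ t in Icc (0 : ℝ) 2, f i t := by
  have hmp := PiLp.volume_preserving_toLp (Fin 3)
  have hemb : MeasurableEmbedding (WithLp.toLp 2 : (Fin 3 → ℝ) → E3) :=
    (EuclideanSpace.equiv (Fin 3) ℝ).symm.toHomeomorph.measurableEmbedding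
  rw [← integral_indicator measurableSet_cubeD, ← hmp.integral_comp hemb]
  simp_rw [← integral_indicator measurableSet_Icc]
  rw [← integral_fintype_prod_volume_eq_prod]
  congr 1
  ext x
  by_cases hx : (WithLp.toLp 2 x : E3) ∈ cubeD
  · rw [indicator_of_mem hx]
    refine Finset.prod_congr rfl fun i _ => ?_
    rw [indicator_of_mem (show x i ∈ Icc (0 : ℝ) 2 from hx i)]
  · rw [indicator_of_notMem hx]
    have : ∃ i, x i ∉ Icc (0 : ℝ) 2 := by
      by_contra h
      push Not at h
      exact hx fun i => h i
    obtain ⟨i, hi⟩ := this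
    exact (Finset.prod_eq_zero (Finset.mem_univ i) (indicator_of_notMem hi _)).symm

theorem integral_cos_mul_int {n : ℤ} (hn : n ≠ 0) :
    ∫ t in (0 : ℝ)..2, Real.cos (Real.pi / 2 * n * t) = 0 := by
  have hpi := Real.pi_ne_zero
  have hn' : (n : ℝ) ≠ 0 := by exact_mod_cast hn
  rw [intervalIntegral.integral_comp_mul_left (fun t => Real.cos t) (by positivity), integral_cos,
    show Real.pi / 2 * (n : ℝ) * 2 = n * Real.pi by ring, Real.sin_int_mul_pi]
  simp

theorem integral_cos_mul_cos (n m : ℕ) : ∫ t in Icc (0 : ℝ) 2,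
    Real.cos (Real.pi / 2 * n * t) * Real.cos (Real.pi / 2 * m * t) =
      ((∫ t in (0 : ℝ)..2, Real.cos (Real.pi / 2 * ((n - m : ℤ) : ℝ) * t)) +
      ∫ t in (0 : ℝ)..2, Real.cos (Real.pi / 2 * ((n + m : ℤ) : ℝ) * t)) / 2 := by
  rw [integral_Icc_eq_integral_Ioc, ← intervalIntegral.integral_of_le zero_le_two,
    ← intervalIntegral.integral_add (Continuous.intervalIntegrable (by fun_prop) _ _)
      (Continuous.intervalIntegrable (by fun_prop) _ _), ← intervalIntegral.integral_div]
  congr 1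
  ext t
  push_cast
  rw [show Real.pi / 2 * ((n : ℝ) - m) * t = Real.pi / 2 * n * t - Real.pi / 2 * m * t by ring,
    show Real.pi / 2 * ((n : ℝ) + m) * t = Real.pi / 2 * n * t + Real.pi / 2 * m * t by ring,
    Real.cos_sub, Real.cos_add]
  ring

theorem integral_cosMode_mul_of_ne {k l : Fin 3 → ℕ} (hkl : k ≠ l) :
    ∫ y in cubeD, cosMode k y * cosMode l y = 0 := by
  simp only [cosMode, ← Finset.prod_mul_distrib]
  rw [integral_cubeD_prod fun i t => Real.cos (Real.pi / 2 * k i * t) * Real.cos (Real.pi / 2 * l i * t)]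
  obtain ⟨i, hi⟩ := Function.ne_iff.1 hkl
  refine Finset.prod_eq_zero (Finset.mem_univ i) ?_
  rw [integral_cos_mul_cos, integral_cos_mul_int (by omega), integral_cos_mul_int (by omega)]
  simp

/-- The squared norm of a cosine mode. -/
def cosNorm (k : Fin 3 → ℕ) : ℝ := ∫ y in cubeD, cosMode k y * cosMode k y

theorem one_le_cosNorm (k : Fin 3 → ℕ) : 1 ≤ cosNorm k := by
  simp only [cosNorm, cosMode, ← Finset.prod_mul_distrib]
  rw [integral_cubeD_prod fun i t => Real.cos (Real.pi / 2 * k i * t) * Real.cos (Real.pi / 2 * k i * t)]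
  refine (le_of_eq (by simp)).trans (Finset.prod_le_prod (f := fun _ : Fin 3 => (1 : ℝ))
    (fun _ _ => zero_le_one) fun i _ => ?_)
  rw [integral_cos_mul_cos]
  have h1 : ∫ t in (0 : ℝ)..2, Real.cos (Real.pi / 2 * ((k i - k i : ℤ) : ℝ) * t) = 2 := by simp
  rw [h1]
  have h2 : 0 ≤ ∫ t in (0 : ℝ)..2, Real.cos (Real.pi / 2 * ((k i + k i : ℤ) : ℝ) * t) := by
    rcases eq_or_ne (k i) 0 with h0 | h0
    · simp [h0]
    · rw [integral_cos_mul_int (by omega)]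
  linarith

theorem integral_one_cubeD : ∫ _y in cubeD, (1 : ℝ) = 8 := by
  have := integral_cubeD_prod fun _ _ => 1
  simp at this
  simp
  rw [this]; norm_num

/-! ### Coefficients and Bessel's inequality -/

/-- The (unnormalised) cosine coefficients. -/
def cosCoef (ψ : E3 → ℝ) (k : Fin 3 → ℕ) : ℝ := ∫ y in cubeD, ψ y * cosMode k y

theorem integrableOn_mul_cosMode {ψ : E3 → ℝ} (hψ : ContinuousOn ψ cubeD) (k : Fin 3 → ℕ) :
    IntegrableOn (fun y => ψ y * cosMode k y) cubeD :=
  cubeD_integrableOn (hψ.mul (continuous_cosMode k).continuousOn)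

theorem cosCoef_sum {F : Finset (Fin 3 → ℕ)} (b : (Fin 3 → ℕ) → ℝ) {φ : E3 → ℝ}
    (hφ : ContinuousOn φ cubeD) :
    ∫ y in cubeD, φ y * ∑ k ∈ F, b k * cosMode k y = ∑ k ∈ F, b k * cosCoef φ k := by
  simp_rw [Finset.mul_sum]
  rw [integral_finsetSum _ fun k _ => ?_]
  · refine Finset.sum_congr rfl fun k _ => ?_
    rw [cosCoef, ← integral_const_mul]
    congr 1; ext y; ring
  · refine ((integrableOn_mul_cosMode hφ k).const_mul (b k)).congr (Eventually.of_forall fun y => ?_)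
    simp only; ring

theorem bessel_cosCoef {ψ : E3 → ℝ} (hψ : ContinuousOn ψ cubeD) (F : Finset (Fin 3 → ℕ)) :
    ∑ k ∈ F, cosCoef ψ k ^ 2 / cosNorm k ≤ ∫ y in cubeD, ψ y * ψ y := by
  classical
  set b : (Fin 3 → ℕ) → ℝ := fun k => cosCoef ψ k / cosNorm k with hb
  set v : E3 → ℝ := fun y => ∑ k ∈ F, b k * cosMode k y with hv
  have hn : ∀ k, cosNorm k ≠ 0 := fun k => (zero_lt_one.trans_le (one_le_cosNorm k)).ne'
  have hvc : ContinuousOn v cubeD := by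
    refine (continuous_finsetSum _ fun k _ => ?_).continuousOn
    exact continuous_const.mul (continuous_cosMode k)
  have h1 : ∫ y in cubeD, ψ y * v y = ∑ k ∈ F, cosCoef ψ k ^ 2 / cosNorm k := by
    rw [cosCoef_sum b hψ]
    refine Finset.sum_congr rfl fun k _ => ?_
    simp only [hb]; ring
  have hcv : ∀ k ∈ F, cosCoef v k = cosCoef ψ k := by
    intro k hk
    have : ∀ y, v y * cosMode k y = cosMode k y * ∑ l ∈ F, b l * cosMode l y := fun y => mul_comm _ _
    rw [cosCoef]
    simp_rw [this]
    rw [cosCoef_sum b (continuous_cosMode k).continuousOn, Finset.sum_eq_single_of_mem k hk]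
    · show b k * cosNorm k = _
      simp only [hb]
      exact div_mul_cancel₀ _ (hn k)
    · intro l _ hl
      rw [cosCoef, integral_cosMode_mul_of_ne hl.symm, mul_zero]
  have h2 : ∫ y in cubeD, v y * v y = ∑ k ∈ F, cosCoef ψ k ^ 2 / cosNorm k := by
    rw [cosCoef_sum b hvc]
    refine Finset.sum_congr rfl fun k hk => ?_
    rw [hcv k hk]; simp only [hb]; ring
  have h3 : 0 ≤ ∫ y in cubeD, (ψ y - v y) ^ 2 := integral_nonneg fun y => sq_nonneg _
  have i1 : IntegrableOn (fun y => ψ y * ψ y) cubeD := cubeD_integrableOn (hψ.mul hψ)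
  have i2 : IntegrableOn (fun y => ψ y * v y) cubeD := cubeD_integrableOn (hψ.mul hvc)
  have i3 : IntegrableOn (fun y => v y * v y) cubeD := cubeD_integrableOn (hvc.mul hvc)
  have h4 : ∫ y in cubeD, (ψ y - v y) ^ 2 = (∫ y in cubeD, ψ y * ψ y) -
      2 * (∫ y in cubeD, ψ y * v y) + ∫ y in cubeD, v y * v y := by
    have e : ∀ y, (ψ y - v y) ^ 2 = ψ y * ψ y - 2 * (ψ y * v y) + v y * v y := fun y => by ring
    simp_rw [e]
    have i12 : IntegrableOn (fun y => ψ y * ψ y - 2 * (ψ y * v y)) cubeD := i1.sub (i2.const_mul 2)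
    rw [integral_add i12 i3, integral_sub i1 (i2.const_mul 2), integral_const_mul]
  rw [h4, h1, h2] at h3
  linarith

/-! ### Summability of the eigenvalues -/

theorem summable_prod_fin {u : ℕ → ℝ} (hu : ∀ n, 0 ≤ u n) (hs : Summable u) :
    Summable fun k : Fin 3 → ℕ => ∏ i, u (k i) := by
  classical
  refine summable_of_sum_le (c := (∑' n, u n) ^ 3) (fun k => Finset.prod_nonneg fun i _ => hu _)
    fun F => ?_
  obtain ⟨N, hN⟩ : ∃ N, F ⊆ Fintype.piFinset fun _ : Fin 3 => Finset.range N := by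
    refine ⟨(F.sup fun k => Finset.univ.sup k) + 1, fun k hk => ?_⟩
    rw [Fintype.mem_piFinset]
    intro i
    rw [Finset.mem_range, Nat.lt_succ_iff]
    exact (Finset.le_sup (f := k) (Finset.mem_univ i)).trans
      (Finset.le_sup (f := fun k : Fin 3 → ℕ => Finset.univ.sup k) hk)
  calc ∑ k ∈ F, ∏ i, u (k i) ≤ ∑ k ∈ Fintype.piFinset fun _ : Fin 3 => Finset.range N, ∏ i, u (k i) :=
        Finset.sum_le_sum_of_subset_of_nonneg hN fun k _ _ => Finset.prod_nonneg fun i _ => hu _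
    _ = ∏ _i : Fin 3, ∑ n ∈ Finset.range N, u n :=
        (Finset.prod_univ_sum (fun _ => Finset.range N) fun _ n => u n).symm
    _ = (∑ n ∈ Finset.range N, u n) ^ 3 := by simp
    _ ≤ _ := by
        gcongr
        · exact Finset.sum_nonneg fun n _ => hu n
        · exact hs.sum_le_tsum _ fun n _ => hu n

/-- With `N` the largest of the `k i`, the eigenvalue is at least `N²`, and the product of the `(k i
+ 1)^(4/3)` is at most `(2N)⁴`. The exponent `4/3` exceeds one, and three of them make exactly the
available power `4`. -/
theorem summable_inv_cosEig_sq : Summable fun k : Fin 3 → ℕ => (cosEig k ^ 2)⁻¹ := by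
  set u : ℕ → ℝ := fun n => 1 / ((n : ℝ) + 1) ^ (4 / 3 : ℝ) with hu
  have hsu : Summable u := by
    have h := (Real.summable_one_div_nat_rpow (p := 4 / 3)).2 (by norm_num)
    have := (summable_nat_add_iff 1).2 h
    simpa [hu] using this
  have hs := (summable_prod_fin (fun n => by positivity) hsu).mul_left 16
  refine Summable.of_nonneg_of_le (fun k => by positivity) (fun k => ?_) hs
  rcases eq_or_ne k 0 with rfl | hk
  · have h0 : cosEig 0 = 0 := by simp [cosEig]
    rw [h0, zero_pow two_ne_zero, inv_zero]
    exact mul_nonneg (by norm_num) (Finset.prod_nonneg fun i _ => by positivity)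
  set N := Finset.univ.sup k with hN
  have hkN : ∀ i, k i ≤ N := fun i => Finset.le_sup (f := k) (Finset.mem_univ i)
  obtain ⟨m, -, hm⟩ := Finset.exists_mem_eq_sup Finset.univ Finset.univ_nonempty k
  have hN1 : 1 ≤ N := by
    obtain ⟨i, hi⟩ := Function.ne_iff.1 hk
    exact (Nat.one_le_iff_ne_zero.2 hi).trans (hkN i)
  have hN1' : (1 : ℝ) ≤ N := by exact_mod_cast hN1
  have h1 : (N : ℝ) ^ 2 ≤ cosEig k := by
    have h2 : (Real.pi / 2 * k m) ^ 2 ≤ cosEig k :=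
      Finset.single_le_sum (f := fun i => (Real.pi / 2 * (k i : ℝ)) ^ 2) (fun _ _ => sq_nonneg _)
        (Finset.mem_univ m)
    rw [← hm, ← hN] at h2
    refine le_trans ?_ h2
    have : 1 ≤ Real.pi / 2 := by linarith [Real.pi_gt_three]
    gcongr
    exact le_mul_of_one_le_left (by positivity) this
  have h3 : ∏ i : Fin 3, (((k i : ℝ) + 1) ^ (4 / 3 : ℝ)) ≤ 16 * (N : ℝ) ^ 4 := by
    calc ∏ i : Fin 3, (((k i : ℝ) + 1) ^ (4 / 3 : ℝ)) ≤ ∏ _i : Fin 3, ((2 * N : ℝ) ^ (4 / 3 : ℝ)) := by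
          refine Finset.prod_le_prod (fun i _ => by positivity) fun i _ => ?_
          have : (k i : ℝ) ≤ N := by exact_mod_cast hkN i
          gcongr
          linarith
      _ = ((2 * N : ℝ) ^ (4 / 3 : ℝ)) ^ 3 := by simp
      _ = (2 * N : ℝ) ^ 4 := by
          rw [← Real.rpow_natCast, ← Real.rpow_mul (by positivity), ← Real.rpow_natCast]
          norm_num
      _ = 16 * (N : ℝ) ^ 4 := by ring
  have h4 : ∏ i : Fin 3, u (k i) = (∏ i : Fin 3, (((k i : ℝ) + 1) ^ (4 / 3 : ℝ)))⁻¹ := by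
    simp [hu, Finset.prod_inv_distrib]
  rw [h4, ← div_eq_mul_inv, le_div_iff₀ (Finset.prod_pos fun i _ => by positivity)]
  rw [inv_mul_le_iff₀ (pow_pos (cosEig_pos hk) 2)]
  refine h3.trans ?_
  have : (N : ℝ) ^ 4 ≤ cosEig k ^ 2 := by
    calc (N : ℝ) ^ 4 = ((N : ℝ) ^ 2) ^ 2 := by ring
      _ ≤ _ := by gcongr
  linarith

/-! ### The inverse of the Neumann Laplacian -/

/-- The solution `S` of `-ΔS = ψ` with Neumann conditions, for `ψ` of average zero. -/
def invNeumann (ψ : E3 → ℝ) (y : E3) : ℝ :=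
  ∑' k, cosCoef ψ k * cosMode k y / (cosEig k * cosNorm k)

/-- Cauchy–Schwarz between Bessel's inequality for the coefficients and the summability of the
inverse squared eigenvalues, the latter because the dimension is below four. The `8` is the volume
of the cube. The absolute convergence makes the inverse Laplacian bounded in the supremum norm. -/
theorem exists_invNeumann_bound : ∃ C, 0 ≤ C ∧ ∀ (ψ : E3 → ℝ) (B : ℝ), ContinuousOn ψ cubeD → 0 ≤ B →
    (∀ y ∈ cubeD, |ψ y| ≤ B) →
    Summable (fun k => |cosCoef ψ k| / (cosEig k * cosNorm k)) ∧
    ∑' k, |cosCoef ψ k| / (cosEig k * cosNorm k) ≤ C * B := by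
  set Λ := ∑' k : Fin 3 → ℕ, (cosEig k ^ 2)⁻¹ with hΛ
  have hΛ0 : 0 ≤ Λ := tsum_nonneg fun k => by positivity
  refine ⟨√(8 * Λ), Real.sqrt_nonneg _, fun ψ B hψ hB hb => ?_⟩
  have hn0 : ∀ k, 0 < cosNorm k := fun k => zero_lt_one.trans_le (one_le_cosNorm k)
  have hnn : ∀ k, 0 ≤ |cosCoef ψ k| / (cosEig k * cosNorm k) := fun k =>
    div_nonneg (abs_nonneg _) (mul_nonneg (cosEig_nonneg k) (hn0 k).le)
  have hL2 : ∫ y in cubeD, ψ y * ψ y ≤ 8 * B ^ 2 := by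
    calc ∫ y in cubeD, ψ y * ψ y ≤ ∫ _y in cubeD, B ^ 2 * 1 := by
          refine setIntegral_mono_on (cubeD_integrableOn (hψ.mul hψ))
            (cubeD_integrableOn continuousOn_const) measurableSet_cubeD fun y hy => ?_
          have := hb y hy
          rw [← abs_mul_abs_self, mul_one]
          nlinarith [abs_nonneg (ψ y)]
      _ = 8 * B ^ 2 := by rw [integral_const_mul, integral_one_cubeD]; ring
  have hF : ∀ F : Finset (Fin 3 → ℕ), ∑ k ∈ F, |cosCoef ψ k| / (cosEig k * cosNorm k) ≤
      √(8 * Λ) * B := by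
    intro F
    have hcs := Finset.sum_mul_sq_le_sq_mul_sq F (fun k => |cosCoef ψ k| / √(cosNorm k))
      (fun k => (cosEig k * √(cosNorm k))⁻¹)
    have e1 : ∀ k, |cosCoef ψ k| / √(cosNorm k) * (cosEig k * √(cosNorm k))⁻¹ =
        |cosCoef ψ k| / (cosEig k * cosNorm k) := fun k => by
      rw [← div_eq_mul_inv, div_div]
      congr 1
      rw [mul_left_comm, Real.mul_self_sqrt (hn0 k).le]
    have e2 : ∀ k, (|cosCoef ψ k| / √(cosNorm k)) ^ 2 = cosCoef ψ k ^ 2 / cosNorm k := fun k => by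
      rw [div_pow, sq_abs, Real.sq_sqrt (hn0 k).le]
    simp_rw [e1, e2] at hcs
    have h1 : ∑ k ∈ F, cosCoef ψ k ^ 2 / cosNorm k ≤ 8 * B ^ 2 := (bessel_cosCoef hψ F).trans hL2
    have h2 : ∑ k ∈ F, ((cosEig k * √(cosNorm k))⁻¹) ^ 2 ≤ Λ := by
      refine (Finset.sum_le_sum fun k _ => ?_).trans
        (summable_inv_cosEig_sq.sum_le_tsum F fun k _ => by positivity)
      rw [inv_pow, mul_pow, Real.sq_sqrt (hn0 k).le, mul_inv]
      exact mul_le_of_le_one_right (by positivity) (inv_le_one_of_one_le₀ (one_le_cosNorm k))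
    have h3 : (∑ k ∈ F, |cosCoef ψ k| / (cosEig k * cosNorm k)) ^ 2 ≤ (√(8 * Λ) * B) ^ 2 := by
      rw [mul_pow, Real.sq_sqrt (by positivity)]
      refine hcs.trans ?_
      calc _ ≤ (8 * B ^ 2) * Λ := mul_le_mul h1 h2 (Finset.sum_nonneg fun k _ => by positivity) (by positivity)
        _ = _ := by ring
    exact le_of_sq_le_sq h3 (by positivity)
  exact ⟨summable_of_sum_le hnn hF, (summable_of_sum_le hnn hF).tsum_le_of_sum_le hF⟩

theorem exists_bound_cubeD {ψ : E3 → ℝ} (hψ : ContinuousOn ψ cubeD) :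
    ∃ B, 0 ≤ B ∧ ∀ y ∈ cubeD, |ψ y| ≤ B := by
  obtain ⟨B, hB⟩ := isCompact_cubeD.exists_bound_of_continuousOn hψ
  exact ⟨max B 0, le_max_right _ _, fun y hy => (hB y hy).trans (le_max_left _ _)⟩

theorem abs_invNeumann_term_le (ψ : E3 → ℝ) (k : Fin 3 → ℕ) (y : E3) :
    |cosCoef ψ k * cosMode k y / (cosEig k * cosNorm k)| ≤ |cosCoef ψ k| / (cosEig k * cosNorm k) := by
  have h0 : 0 ≤ cosEig k * cosNorm k :=
    mul_nonneg (cosEig_nonneg k) (zero_le_one.trans (one_le_cosNorm k))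
  rw [abs_div, abs_mul, abs_of_nonneg h0]
  exact div_le_div_of_nonneg_right (mul_le_of_le_one_right (abs_nonneg _) (abs_cosMode_le k y)) h0

theorem summable_invNeumann {ψ : E3 → ℝ} (hψ : ContinuousOn ψ cubeD) (y : E3) :
    Summable fun k => cosCoef ψ k * cosMode k y / (cosEig k * cosNorm k) := by
  obtain ⟨C, -, hC⟩ := exists_invNeumann_bound
  obtain ⟨B, hB, hb⟩ := exists_bound_cubeD hψ
  exact Summable.of_norm_bounded (hC ψ B hψ hB hb).1 fun k => abs_invNeumann_term_le ψ k y

theorem exists_abs_invNeumann_le : ∃ C, 0 ≤ C ∧ ∀ (ψ : E3 → ℝ) (B : ℝ), ContinuousOn ψ cubeD → 0 ≤ B →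
    (∀ y ∈ cubeD, |ψ y| ≤ B) → ∀ y, |invNeumann ψ y| ≤ C * B := by
  obtain ⟨C, hC0, hC⟩ := exists_invNeumann_bound
  refine ⟨C, hC0, fun ψ B hψ hB hb y => ?_⟩
  obtain ⟨h1, h2⟩ := hC ψ B hψ hB hb
  exact (tsum_of_norm_bounded (f := fun k => cosCoef ψ k * cosMode k y / (cosEig k * cosNorm k))
    h1.hasSum fun k => abs_invNeumann_term_le ψ k y).trans h2

theorem continuous_invNeumann {ψ : E3 → ℝ} (hψ : ContinuousOn ψ cubeD) : Continuous (invNeumann ψ) := by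
  obtain ⟨C, -, hC⟩ := exists_invNeumann_bound
  obtain ⟨B, hB, hb⟩ := exists_bound_cubeD hψ
  refine continuous_tsum (f := fun k y => cosCoef ψ k * cosMode k y / (cosEig k * cosNorm k))
    (fun k => ?_) (hC ψ B hψ hB hb).1 fun k y => abs_invNeumann_term_le ψ k y
  exact (continuous_const.mul (continuous_cosMode k)).div_const _

theorem invNeumann_add {φ ψ : E3 → ℝ} (hφ : ContinuousOn φ cubeD) (hψ : ContinuousOn ψ cubeD) (y : E3) :
    invNeumann (fun y => φ y + ψ y) y = invNeumann φ y + invNeumann ψ y := by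
  rw [invNeumann, invNeumann, invNeumann, ← (summable_invNeumann hφ y).tsum_add (summable_invNeumann hψ y)]
  congr 1
  ext k
  have : cosCoef (fun y => φ y + ψ y) k = cosCoef φ k + cosCoef ψ k := by
    rw [cosCoef, cosCoef, cosCoef, ← integral_add (integrableOn_mul_cosMode hφ k)
      (integrableOn_mul_cosMode hψ k)]
    simp_rw [add_mul]
  rw [this]; ring

theorem invNeumann_const_mul (c : ℝ) (ψ : E3 → ℝ) (y : E3) :
    invNeumann (fun y => c * ψ y) y = c * invNeumann ψ y := by
  rw [invNeumann, invNeumann, ← tsum_mul_left]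
  congr 1
  ext k
  have : cosCoef (fun y => c * ψ y) k = c * cosCoef ψ k := by
    rw [cosCoef, cosCoef, ← integral_const_mul]
    simp_rw [mul_assoc]
  rw [this]; ring

theorem invNeumann_cosMode (k : Fin 3 → ℕ) (y : E3) :
    invNeumann (cosMode k) y = cosMode k y / cosEig k := by
  rw [invNeumann, tsum_eq_single k]
  · have hn : cosNorm k ≠ 0 := (zero_lt_one.trans_le (one_le_cosNorm k)).ne'
    rw [show cosCoef (cosMode k) k = cosNorm k from rfl, mul_comm (cosEig k),
      mul_div_mul_left _ _ hn]
  · intro l hl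
    rw [cosCoef, integral_cosMode_mul_of_ne hl.symm]
    simp

/-! ### Density of the cosine modes -/

/-- The product formula `cos a cos b = (cos(a+b) + cos(a-b))/2` in each coordinate; a Boolean per
coordinate selects the sum or the difference. As cosine is even, the difference may be taken in
absolute value and the frequency stays a natural number. -/
theorem cosMode_mul_mem (k l : Fin 3 → ℕ) : ∃ (F : Finset (Fin 3 → Bool)) (a : (Fin 3 → Bool) → ℝ)
    (m : (Fin 3 → Bool) → Fin 3 → ℕ), ∀ y, cosMode k y * cosMode l y = ∑ s ∈ F, a s * cosMode (m s) y := by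
  classical
  refine ⟨Fintype.piFinset fun _ => Finset.univ, fun _ => (1 / 2) ^ 3,
    fun s i => if s i then k i + l i else Nat.dist (k i) (l i), fun y => ?_⟩
  have h1 : ∀ i, Real.cos (Real.pi / 2 * k i * y i) * Real.cos (Real.pi / 2 * l i * y i) =
      ∑ b : Bool, 1 / 2 * Real.cos (Real.pi / 2 *
        ((if b then k i + l i else Nat.dist (k i) (l i) : ℕ) : ℝ) * y i) := by
    intro i
    have h2 : Real.cos (Real.pi / 2 * ((Nat.dist (k i) (l i) : ℕ) : ℝ) * y i) =
        Real.cos (Real.pi / 2 * k i * y i - Real.pi / 2 * l i * y i) := by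
      rcases le_total (k i) (l i) with h | h
      · rw [Nat.dist_eq_sub_of_le h, Nat.cast_sub h, ← Real.cos_neg]
        congr 1; ring
      · rw [Nat.dist_eq_sub_of_le_right h, Nat.cast_sub h]
        congr 1; ring
    simp only [Fintype.sum_bool, if_true, Bool.false_eq_true, if_false]
    rw [h2, Nat.cast_add, show Real.pi / 2 * ((k i : ℝ) + l i) * y i =
      Real.pi / 2 * k i * y i + Real.pi / 2 * l i * y i by ring, Real.cos_sub, Real.cos_add]
    ring
  simp only [cosMode]
  rw [← Finset.prod_mul_distrib]
  simp_rw [h1]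
  rw [Finset.prod_univ_sum]
  refine Finset.sum_congr rfl fun s _ => ?_
  rw [Finset.prod_mul_distrib]
  simp

/-- Stone–Weierstrass: the span of the modes is an algebra by the product formula, and it separates
points because `cos(πt/2)` is injective on `[0, 2]`. -/
theorem exists_cosMode_approx {ψ : E3 → ℝ} (hψ : ContinuousOn ψ cubeD) {δ : ℝ} (hδ : 0 < δ) :
    ∃ (F : Finset (Fin 3 → ℕ)) (a : (Fin 3 → ℕ) → ℝ),
      ∀ y ∈ cubeD, |ψ y - ∑ k ∈ F, a k * cosMode k y| ≤ δ := by
  haveI : CompactSpace cubeD := isCompact_iff_compactSpace.1 isCompact_cubeD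
  set c : (Fin 3 → ℕ) → C(cubeD, ℝ) := fun k => ⟨fun y => cosMode k y,
    (continuous_cosMode k).comp continuous_subtype_val⟩ with hc
  set V : Submodule ℝ C(cubeD, ℝ) := Submodule.span ℝ (range c) with hV
  have hone : (1 : C(cubeD, ℝ)) ∈ V := by
    refine Submodule.subset_span ⟨0, ?_⟩
    ext y; simp [hc, cosMode_zero]
  have hmul : ∀ x y, x ∈ V → y ∈ V → x * y ∈ V := by
    have hle : V * V ≤ V := by
      rw [hV, Submodule.span_mul_span, Submodule.span_le]
      rintro _ ⟨_, ⟨k, rfl⟩, _, ⟨l, rfl⟩, rfl⟩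
      obtain ⟨F, a, m, h⟩ := cosMode_mul_mem k l
      have e : c k * c l = ∑ s ∈ F, a s • c (m s) := by
        ext y
        simpa [hc] using h y
      show c k * c l ∈ V
      rw [e]
      exact Submodule.sum_mem _ fun s _ => Submodule.smul_mem _ _ (Submodule.subset_span ⟨_, rfl⟩)
    exact fun x y hx hy => hle (Submodule.mul_mem_mul hx hy)
  set A := V.toSubalgebra hone hmul with hA
  have hsep : A.SeparatesPoints := by
    intro x y hxy
    have h1 : ∃ i, (x : E3) i ≠ (y : E3) i := by
      by_contra h
      push Not at h
      exact hxy (Subtype.ext (PiLp.ext h))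
    obtain ⟨i, hi⟩ := h1
    refine ⟨c (Pi.single i 1), ⟨c (Pi.single i 1), Submodule.subset_span ⟨_, rfl⟩, rfl⟩, ?_⟩
    have hval : ∀ z : cubeD, c (Pi.single i 1) z = Real.cos (Real.pi / 2 * (z : E3) i) := by
      intro z
      show cosMode _ _ = _
      rw [cosMode, Finset.prod_eq_single i]
      · simp
      · intro m _ hm; simp [hm]
      · simp
    rw [hval, hval]
    intro h
    have hm : ∀ z : cubeD, Real.pi / 2 * (z : E3) i ∈ Icc 0 Real.pi := fun z => by
      have := z.2 i
      have hpi := Real.pi_pos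
      constructor <;> nlinarith
    have h2 := Real.injOn_cos (hm x) (hm y) h
    exact hi (mul_left_cancel₀ (by positivity) h2)
  obtain ⟨g, hg⟩ := ContinuousMap.exists_mem_subalgebra_near_continuous_of_separatesPoints A hsep
    (fun y : cubeD => ψ y) (continuousOn_iff_continuous_domRestrict.1 hψ) δ hδ
  obtain ⟨b, hb⟩ := Finsupp.mem_span_range_iff_exists_finsupp.1 (show (g : C(cubeD, ℝ)) ∈ V from g.2)
  refine ⟨b.support, b, fun y hy => ?_⟩
  have h1 := hg ⟨y, hy⟩
  have h2 : (g : C(cubeD, ℝ)) ⟨y, hy⟩ = ∑ k ∈ b.support, b k * cosMode k y := by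
    rw [← hb]
    simp [Finsupp.sum, hc]
  rw [abs_sub_comm, ← h2]
  exact h1.le

/-- A Neumann function tested against a mean-zero function. -/
theorem HasNeumannLaplacian.integral_mul_eq {Y g : E3 → ℝ} {p : Fin 3 → E3 → ℝ}
    (hY : HasNeumannLaplacian Y p g) {ψ : E3 → ℝ} (hψ : ContinuousOn ψ cubeD)
    (h0 : ∫ y in cubeD, ψ y = 0) :
    ∫ y in cubeD, Y y * ψ y = -∫ y in cubeD, g y * invNeumann ψ y := by
  obtain ⟨C, hC0, hC⟩ := exists_abs_invNeumann_le
  obtain ⟨BY, hBY0, hBY⟩ := exists_bound_cubeD hY.cont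
  obtain ⟨Bg, hBg0, hBg⟩ := exists_bound_cubeD hY.cont_laplacian
  -- `Λ` is linear, bounded for the supremum norm, and vanishes on every cosine mode, so it vanishes
  -- by density. The last term makes it vanish on constants, and is zero for `ψ` of mean zero.
  set Λ : (E3 → ℝ) → ℝ := fun φ => (∫ y in cubeD, Y y * φ y) + (∫ y in cubeD, g y * invNeumann φ y) -
    (∫ y in cubeD, Y y) / 8 * ∫ y in cubeD, φ y with hΛ
  have iY : ∀ {φ : E3 → ℝ}, ContinuousOn φ cubeD → IntegrableOn (fun y => Y y * φ y) cubeD :=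
    fun hφ => cubeD_integrableOn (hY.cont.mul hφ)
  have ig : ∀ {φ : E3 → ℝ}, ContinuousOn φ cubeD → IntegrableOn (fun y => g y * invNeumann φ y) cubeD :=
    fun hφ => cubeD_integrableOn (hY.cont_laplacian.mul (continuous_invNeumann hφ).continuousOn)
  have hadd : ∀ {φ χ : E3 → ℝ}, ContinuousOn φ cubeD → ContinuousOn χ cubeD →
      Λ (fun y => φ y + χ y) = Λ φ + Λ χ := by
    intro φ χ hφ hχ
    simp only [hΛ, mul_add, invNeumann_add hφ hχ]
    rw [integral_add (iY hφ) (iY hχ), integral_add (ig hφ) (ig hχ),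
      integral_add (cubeD_integrableOn hφ) (cubeD_integrableOn hχ)]
    ring
  have hsmul : ∀ (a : ℝ) (φ : E3 → ℝ), Λ (fun y => a * φ y) = a * Λ φ := by
    intro a φ
    simp only [hΛ, invNeumann_const_mul, mul_left_comm _ a, integral_const_mul]
    ring
  have hmode : ∀ k, Λ (cosMode k) = 0 := by
    intro k
    rcases eq_or_ne k 0 with rfl | hk
    -- The eigenvalue of the constant mode is zero, so by the convention for division by zero
    -- `invNeumann` annihilates constants.
    · have e : cosMode 0 = fun _ => 1 := funext cosMode_zero
      have e2 : ∀ y, invNeumann (cosMode 0) y = 0 := fun y => by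
        rw [invNeumann_cosMode]
        simp [cosEig]
      simp only [hΛ, e2]
      simp only [e, mul_one, mul_zero, integral_zero, integral_one_cubeD]
      ring
    · have hgreen := hY.green (hasNeumannLaplacian_cosMode k)
      have hmean := (hasNeumannLaplacian_cosMode k).integral_eq_zero
      have hne := (cosEig_pos hk).ne'
      rw [integral_const_mul] at hmean
      have hmean' : ∫ y in cubeD, cosMode k y = 0 := by
        rcases mul_eq_zero.1 hmean with h | h
        · exact absurd (neg_eq_zero.1 h) hne
        · exact h
      have e1 : ∫ y in cubeD, Y y * (-cosEig k * cosMode k y) =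
          -cosEig k * ∫ y in cubeD, Y y * cosMode k y := by
        rw [← integral_const_mul]; congr 1; ext y; ring
      have e2 : ∫ y in cubeD, g y * invNeumann (cosMode k) y =
          (cosEig k)⁻¹ * ∫ y in cubeD, cosMode k y * g y := by
        rw [← integral_const_mul]; congr 1; ext y; rw [invNeumann_cosMode]; ring
      simp only [hΛ, hmean', mul_zero, sub_zero]
      rw [e2, hgreen, e1]
      field_simp
      ring
  have hcm : ∀ (a : (Fin 3 → ℕ) → ℝ) k, ContinuousOn (fun y => a k * cosMode k y) cubeD := fun a k =>
    (continuous_const.mul (continuous_cosMode k)).continuousOn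
  have hsum : ∀ (F : Finset (Fin 3 → ℕ)) (a : (Fin 3 → ℕ) → ℝ),
      ContinuousOn (fun y => ∑ k ∈ F, a k * cosMode k y) cubeD ∧
      Λ (fun y => ∑ k ∈ F, a k * cosMode k y) = 0 := by
    classical
    intro F a
    induction F using Finset.induction_on with
    | empty =>
      refine ⟨by simpa using continuousOn_const, ?_⟩
      have := hsmul 0 (cosMode 0)
      simpa using this
    | insert k F hk ih =>
      simp_rw [Finset.sum_insert hk]
      refine ⟨(hcm a k).add ih.1, ?_⟩
      rw [hadd (hcm a k) ih.1, ih.2, hsmul, hmode]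
      simp
  have hbound : ∀ (φ : E3 → ℝ) (B : ℝ), ContinuousOn φ cubeD → 0 ≤ B → (∀ y ∈ cubeD, |φ y| ≤ B) →
      |Λ φ| ≤ (BY * 8 + Bg * C * 8 + |(∫ y in cubeD, Y y) / 8| * 8) * B := by
    intro φ B hφ hB hb
    have hI : ∀ (u : E3 → ℝ) (K : ℝ), (∀ y ∈ cubeD, |u y| ≤ K) → |∫ y in cubeD, u y| ≤ K * 8 := by
      intro u K hu
      have hfin : volume cubeD < ⊤ := isCompact_cubeD.measure_lt_top
      have h8 : (volume : Measure E3).real cubeD = 8 := by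
        have := integral_one_cubeD
        simpa using this
      have := norm_setIntegral_le_of_norm_le_const (f := u) hfin hu
      rwa [h8] at this
    have h1 := hI (fun y => Y y * φ y) (BY * B) fun y hy => by
      rw [abs_mul]; exact mul_le_mul (hBY y hy) (hb y hy) (abs_nonneg _) hBY0
    have h2 := hI (fun y => g y * invNeumann φ y) (Bg * (C * B)) fun y hy => by
      rw [abs_mul]; exact mul_le_mul (hBg y hy) (hC φ B hφ hB hb y) (abs_nonneg _) hBg0
    have h3 := hI φ B hb
    simp only [hΛ]
    have h4 := abs_sub ((∫ y in cubeD, Y y * φ y) + (∫ y in cubeD, g y * invNeumann φ y))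
      ((∫ y in cubeD, Y y) / 8 * ∫ y in cubeD, φ y)
    have h5 := abs_add_le (∫ y in cubeD, Y y * φ y) (∫ y in cubeD, g y * invNeumann φ y)
    have h6 : |(∫ y in cubeD, Y y) / 8 * ∫ y in cubeD, φ y| ≤ |(∫ y in cubeD, Y y) / 8| * (B * 8) := by
      rw [abs_mul]; exact mul_le_mul_of_nonneg_left h3 (abs_nonneg _)
    calc _ ≤ _ := h4
      _ ≤ BY * B * 8 + Bg * (C * B) * 8 + |(∫ y in cubeD, Y y) / 8| * (B * 8) := by linarith
      _ = _ := by ring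
  have hΛψ : Λ ψ = 0 := by
    set K := BY * 8 + Bg * C * 8 + |(∫ y in cubeD, Y y) / 8| * 8 with hK
    have hK0 : 0 ≤ K := by positivity
    by_contra hne
    have hpos : 0 < |Λ ψ| := abs_pos.2 hne
    obtain ⟨F, a, ha⟩ := exists_cosMode_approx hψ (δ := |Λ ψ| / (2 * (K + 1))) (by positivity)
    obtain ⟨hvc, hv0⟩ := hsum F a
    have h1 := hbound (fun y => ψ y - ∑ k ∈ F, a k * cosMode k y) _ (hψ.sub hvc) (by positivity) ha
    have h2 := hadd hvc (hψ.sub hvc)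
    have e3 : (ψ - fun y => ∑ k ∈ F, a k * cosMode k y) = fun y => ψ y - ∑ k ∈ F, a k * cosMode k y := rfl
    simp only [Pi.sub_apply, add_sub_cancel, e3] at h2
    rw [hv0, zero_add] at h2
    have h3 : |Λ ψ| ≤ K * (|Λ ψ| / (2 * (K + 1))) := by
      rw [← h2] at h1; exact h1
    have h4 : K * (|Λ ψ| / (2 * (K + 1))) < |Λ ψ| := by
      rw [mul_div_assoc', div_lt_iff₀ (by positivity)]
      nlinarith
    linarith
  simp only [hΛ, h0, mul_zero, sub_zero] at hΛψ
  linarith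

section

/-! ### Fields of the form `z_j c(‖z‖²)` -/

/-- A twice continuously differentiable profile `c` with derivatives `c1`, `c2`. -/
structure RadialProfile (c c1 c2 : ℝ → ℝ) : Prop where
  deriv_one : ∀ s, HasDerivAt c (c1 s) s
  deriv_two : ∀ s, HasDerivAt c1 (c2 s) s
  cont : Continuous c2

/-- The field `z_j c(‖z‖²)`. -/
def radField (j : Fin 3) (c : ℝ → ℝ) (z : E3) : ℝ := z j * c (‖z‖ ^ 2)

/-- The partial derivatives of `radField j c`. -/
def radFieldDeriv (j : Fin 3) (c c1 : ℝ → ℝ) (i : Fin 3) (z : E3) : ℝ :=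
  (if i = j then c (‖z‖ ^ 2) else 0) + 2 * z i * z j * c1 (‖z‖ ^ 2)

/-- The Laplacian of `radField j c`. -/
def radFieldLap (j : Fin 3) (c1 c2 : ℝ → ℝ) (z : E3) : ℝ :=
  z j * (10 * c1 (‖z‖ ^ 2) + 4 * ‖z‖ ^ 2 * c2 (‖z‖ ^ 2))

/-- Minus the divergence of the vector field `z c(‖z‖²)`. -/
def radBump (c c1 : ℝ → ℝ) (z : E3) : ℝ := -(3 * c (‖z‖ ^ 2) + 2 * ‖z‖ ^ 2 * c1 (‖z‖ ^ 2))

variable {c c1 c2 : ℝ → ℝ}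

theorem hasFDerivAt_norm_sq_comp {b : ℝ → ℝ} {b' : ℝ} {z : E3} (h : HasDerivAt b b' (‖z‖ ^ 2)) :
    HasFDerivAt (fun z : E3 => b (‖z‖ ^ 2)) (b' • (2 • innerSL ℝ z)) z :=
  h.comp_hasFDerivAt z (hasStrictFDerivAt_norm_sq z).hasFDerivAt

theorem innerSL_single (z : E3) (i : Fin 3) : innerSL ℝ z (EuclideanSpace.single i 1) = z i := by
  simp [innerSL_apply_apply, EuclideanSpace.inner_single_right]

theorem single_apply_ite (i j : Fin 3) :
    (EuclideanSpace.single i (1 : ℝ) : E3) j = if i = j then 1 else 0 := by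
  rw [PiLp.single_apply]
  simp [eq_comm]

theorem RadialProfile.hasFDerivAt_radField (hc : RadialProfile c c1 c2) (j : Fin 3) (z : E3) :
    ∃ L : E3 →L[ℝ] ℝ, HasFDerivAt (radField j c) L z ∧
      ∀ i, L (EuclideanSpace.single i 1) = radFieldDeriv j c c1 i z := by
  refine ⟨_, (hasFDerivAt_coord j z).mul (hasFDerivAt_norm_sq_comp (hc.deriv_one _)), fun i => ?_⟩
  simp only [add_apply, smul_apply, PiLp.proj_apply, smul_eq_mul, innerSL_single, single_apply_ite,
    radFieldDeriv]
  split_ifs <;> simp <;> ring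

theorem RadialProfile.hasFDerivAt_radFieldDeriv (hc : RadialProfile c c1 c2) (j : Fin 3) (z : E3) :
    ∃ L : Fin 3 → E3 →L[ℝ] ℝ, (∀ i, HasFDerivAt (radFieldDeriv j c c1 i) (L i) z) ∧
      ∑ i, L i (EuclideanSpace.single i 1) = radFieldLap j c1 c2 z := by
  have h1 : ∀ i, ∃ L : E3 →L[ℝ] ℝ, HasFDerivAt (radFieldDeriv j c c1 i) L z ∧
      L (EuclideanSpace.single i 1) = (if i = j then 2 * z i * c1 (‖z‖ ^ 2) else 0) +
        (2 * z j * c1 (‖z‖ ^ 2) + (if i = j then 2 * z i * c1 (‖z‖ ^ 2) else 0) +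
          4 * z i ^ 2 * z j * c2 (‖z‖ ^ 2)) := by
    intro i
    have h2 : HasFDerivAt (fun z : E3 => if i = j then c (‖z‖ ^ 2) else 0)
        (if i = j then c1 (‖z‖ ^ 2) • (2 • innerSL ℝ z) else 0) z := by
      split_ifs
      · exact hasFDerivAt_norm_sq_comp (hc.deriv_one _)
      · exact hasFDerivAt_const _ _
    refine ⟨_, h2.add ((((hasFDerivAt_coord i z).const_mul 2).mul (hasFDerivAt_coord j z)).mul
      (hasFDerivAt_norm_sq_comp (hc.deriv_two _))), ?_⟩
    simp only [add_apply, smul_apply, PiLp.proj_apply, smul_eq_mul, innerSL_single, single_apply_ite]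
    rcases eq_or_ne i j with rfl | hij
    · simp [innerSL_single]; ring
    · simp [hij]; ring
  choose L hL hLs using h1
  refine ⟨L, hL, ?_⟩
  simp_rw [hLs]
  have e : ‖z‖ ^ 2 = ∑ i, z i ^ 2 := by
    rw [EuclideanSpace.norm_sq_eq]; simp
  rw [Finset.sum_add_distrib, Finset.sum_add_distrib, Finset.sum_add_distrib]
  have e2 : ∑ i, 4 * z i ^ 2 * z j * c2 (‖z‖ ^ 2) = 4 * ‖z‖ ^ 2 * z j * c2 (‖z‖ ^ 2) := by
    rw [← Finset.sum_mul, ← Finset.sum_mul, ← Finset.mul_sum, ← e]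
  rw [e2]
  simp only [Finset.sum_ite_eq', Finset.mem_univ, if_true, Finset.sum_const, Finset.card_univ,
    Fintype.card_fin, nsmul_eq_mul, radFieldLap]
  push_cast
  ring

/-- The field `z c(‖z‖²)` is curl-free, so the gradient of its divergence is its componentwise
Laplacian. This allows the source of the kernel to be integrated by parts as a derivative of a
scalar bump. -/
theorem RadialProfile.hasFDerivAt_radBump (hc : RadialProfile c c1 c2) (z : E3) :
    ∃ L : E3 →L[ℝ] ℝ, HasFDerivAt (radBump c c1) L z ∧
      ∀ j, L (EuclideanSpace.single j 1) = -radFieldLap j c1 c2 z := by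
  have h : HasDerivAt (fun s => -(3 * c s + 2 * s * c1 s))
      (-(3 * c1 (‖z‖ ^ 2) + (2 * 1 * c1 (‖z‖ ^ 2) + 2 * ‖z‖ ^ 2 * c2 (‖z‖ ^ 2)))) (‖z‖ ^ 2) :=
    (((hc.deriv_one _).const_mul 3).add ((((hasDerivAt_id _).const_mul 2)).mul (hc.deriv_two _))).neg
  refine ⟨_, hasFDerivAt_norm_sq_comp h, fun j => ?_⟩
  simp only [smul_apply, smul_eq_mul, innerSL_single, radFieldLap]
  simp
  ring

theorem RadialProfile.continuous_radFieldLap (hc : RadialProfile c c1 c2) (j : Fin 3) :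
    Continuous (radFieldLap j c1 c2) := by
  have h1 : Continuous c1 := continuous_iff_continuousAt.2 fun s => (hc.deriv_two s).continuousAt
  have h2 := hc.cont
  unfold radFieldLap
  fun_prop

theorem RadialProfile.continuous_radField (hc : RadialProfile c c1 c2) (j : Fin 3) :
    Continuous (radField j c) := by
  have h1 : Continuous c := continuous_iff_continuousAt.2 fun s => (hc.deriv_one s).continuousAt
  unfold radField
  fun_prop

theorem RadialProfile.continuous_radBump (hc : RadialProfile c c1 c2) :
    Continuous (radBump c c1) := by
  have h1 : Continuous c := continuous_iff_continuousAt.2 fun s => (hc.deriv_one s).continuousAt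
  have h2 : Continuous c1 := continuous_iff_continuousAt.2 fun s => (hc.deriv_two s).continuousAt
  unfold radBump
  fun_prop

/-- The scaling leaves the profile `s^(-3/2)` of the gradient of the Green's function unchanged and
only moves the cut-off to scale `δ`; the associated bump becomes an approximate identity. -/
theorem RadialProfile.scale (hc : RadialProfile c c1 c2) (δ : ℝ) :
    RadialProfile (fun s => δ⁻¹ ^ 3 * c (δ⁻¹ ^ 2 * s)) (fun s => δ⁻¹ ^ 5 * c1 (δ⁻¹ ^ 2 * s))
      (fun s => δ⁻¹ ^ 7 * c2 (δ⁻¹ ^ 2 * s)) := by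
  have h : ∀ {b b' : ℝ → ℝ} (k : ℕ), (∀ s, HasDerivAt b (b' s) s) → ∀ s,
      HasDerivAt (fun s => δ⁻¹ ^ k * b (δ⁻¹ ^ 2 * s)) (δ⁻¹ ^ (k + 2) * b' (δ⁻¹ ^ 2 * s)) s := by
    intro b b' k hb s
    have := ((hb (δ⁻¹ ^ 2 * s)).comp s ((hasDerivAt_id s).const_mul (δ⁻¹ ^ 2))).const_mul (δ⁻¹ ^ k)
    refine this.congr_deriv ?_
    ring
  exact ⟨h 3 hc.deriv_one, h 5 hc.deriv_two, continuous_const.mul (hc.cont.comp (by fun_prop))⟩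

theorem RadialProfile.sub {b b1 b2 : ℝ → ℝ} (hc : RadialProfile c c1 c2) (hb : RadialProfile b b1 b2) :
    RadialProfile (fun s => c s - b s) (fun s => c1 s - b1 s) (fun s => c2 s - b2 s) :=
  ⟨fun s => (hc.deriv_one s).sub (hb.deriv_one s), fun s => (hc.deriv_two s).sub (hb.deriv_two s),
    hc.cont.sub hb.cont⟩

theorem radBump_scale (δ : ℝ) (z : E3) :
    radBump (fun s => δ⁻¹ ^ 3 * c (δ⁻¹ ^ 2 * s)) (fun s => δ⁻¹ ^ 5 * c1 (δ⁻¹ ^ 2 * s)) z =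
      δ⁻¹ ^ 3 * radBump c c1 (δ⁻¹ • z) := by
  have : ‖δ⁻¹ • z‖ ^ 2 = δ⁻¹ ^ 2 * ‖z‖ ^ 2 := by rw [norm_smul, mul_pow, Real.norm_eq_abs, sq_abs]
  simp only [radBump, this]
  ring

/-! ### Image sums -/

theorem reflect_single (σ : Fin 3 → ℤˣ) (i : Fin 3) :
    reflect σ (EuclideanSpace.single i 1) = ((σ i : ℤ) : ℝ) • EuclideanSpace.single i 1 := by
  ext k
  simp only [reflect_apply, single_apply_ite, PiLp.smul_apply, smul_eq_mul]
  split_ifs with h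
  · rw [h]
  · simp

theorem unit_mul_self (σ : Fin 3 → ℤˣ) (i : Fin 3) : ((σ i : ℤ) : ℝ) * ((σ i : ℤ) : ℝ) = 1 := by
  rcases Int.units_eq_one_or (σ i) with h | h <;> simp [h]

theorem hasFDerivAt_comp_image {F : E3 → ℝ} {L : E3 →L[ℝ] ℝ} {x y : E3} {σ : Fin 3 → ℤˣ}
    (hF : HasFDerivAt F L (x - reflect σ y)) :
    ∃ M : E3 →L[ℝ] ℝ, HasFDerivAt (fun y => F (x - reflect σ y)) M y ∧
      ∀ i, M (EuclideanSpace.single i 1) = -(((σ i : ℤ) : ℝ) * L (EuclideanSpace.single i 1)) := by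
  have h1 : HasFDerivAt (fun y => x - reflect σ y)
      (-((reflect σ).toContinuousLinearEquiv : E3 →L[ℝ] E3)) y :=
    ((reflect σ).toContinuousLinearEquiv : E3 →L[ℝ] E3).hasFDerivAt.const_sub x
  refine ⟨_, hF.comp y h1, fun i => ?_⟩
  have : ((reflect σ).toContinuousLinearEquiv : E3 →L[ℝ] E3) (EuclideanSpace.single i 1) =
      ((σ i : ℤ) : ℝ) • EuclideanSpace.single i 1 := reflect_single σ i
  rw [ContinuousLinearMap.comp_apply, neg_apply, this, map_neg, map_smul, smul_eq_mul]

theorem continuous_image (σ : Fin 3 → ℤˣ) (x : E3) : Continuous fun y => x - reflect σ y :=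
  continuous_const.sub (reflect σ).continuous

/-- Sums over images which are odd under a reflection vanish on the corresponding face. -/
theorem sum_image_eq_zero {i : Fin 3} {x y : E3} (hy : y i = 0) (F : E3 → ℝ) :
    ∑ σ : Fin 3 → ℤˣ, ((σ i : ℤ) : ℝ) * F (x - reflect σ y) = 0 := by
  have h := Equiv.sum_comp (Equiv.mulLeft (flipSign i))
    (fun σ : Fin 3 → ℤˣ => ((σ i : ℤ) : ℝ) * F (x - reflect σ y))
  have h2 : ∀ σ : Fin 3 → ℤˣ, reflect (flipSign i * σ) y = reflect σ y := by
    intro σ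
    ext k
    rcases eq_or_ne k i with rfl | hk
    · simp [reflect_apply, hy]
    · simp [reflect_apply, flipSign, hk]
  simp only [Equiv.coe_mulLeft, h2] at h
  have h3 : ∀ σ : Fin 3 → ℤˣ, (((flipSign i * σ) i : ℤ) : ℝ) = -((σ i : ℤ) : ℝ) := by
    intro σ; simp [flipSign]
  simp only [h3, neg_mul, Finset.sum_neg_distrib] at h
  linarith

theorem one_le_norm_sq_image {i : Fin 3} {x y : E3} (h0 : 0 ≤ x i) (h1 : x i ≤ 1) (hy : y i = 2)
    (σ : Fin 3 → ℤˣ) : 1 ≤ ‖x - reflect σ y‖ ^ 2 := by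
  have h2 : 1 ≤ |(x - reflect σ y) i| := by
    rw [PiLp.sub_apply, reflect_apply, hy]
    rcases Int.units_eq_one_or (σ i) with h | h
    · rw [h, abs_of_nonpos] <;> push_cast <;> linarith
    · rw [h, abs_of_nonneg] <;> push_cast <;> linarith
  have := h2.trans (abs_coord_le_norm _ i)
  nlinarith

/-- On a face `y i = 0` the images under `σ` and under `σ` with sign `i` flipped coincide, and their
normal derivatives cancel. On a face `y i = 2` every image is at distance at least one from `x`,
because `x i ≤ 1`, and there the profile and its derivative vanish. -/
theorem RadialProfile.hasNeumannLaplacian_image (hc : RadialProfile c c1 c2)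
    (h0 : ∀ s, 1 ≤ s → c s = 0) (h1 : ∀ s, 1 ≤ s → c1 s = 0) (j : Fin 3) {x : E3}
    (hx : ∀ i, 0 ≤ x i ∧ x i ≤ 1) :
    HasNeumannLaplacian (fun y => ∑ σ : Fin 3 → ℤˣ, radField j c (x - reflect σ y))
      (fun i y => ∑ σ : Fin 3 → ℤˣ, -(((σ i : ℤ) : ℝ) * radFieldDeriv j c c1 i (x - reflect σ y)))
      (fun y => ∑ σ : Fin 3 → ℤˣ, radFieldLap j c1 c2 (x - reflect σ y)) := by
  have e1 : ∀ (y : E3) (σ : Fin 3 → ℤˣ), ∃ M : E3 →L[ℝ] ℝ,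
      HasFDerivAt (fun y => radField j c (x - reflect σ y)) M y ∧ ∀ i,
      M (EuclideanSpace.single i 1) = -(((σ i : ℤ) : ℝ) * radFieldDeriv j c c1 i (x - reflect σ y)) := by
    intro y σ
    obtain ⟨L, hL, hLi⟩ := hc.hasFDerivAt_radField j (x - reflect σ y)
    obtain ⟨M, hM, hMi⟩ := hasFDerivAt_comp_image hL
    exact ⟨M, hM, fun i => by rw [hMi, hLi]⟩
  have e2 : ∀ (y : E3) (σ : Fin 3 → ℤˣ), ∃ M : Fin 3 → E3 →L[ℝ] ℝ,
      (∀ i, HasFDerivAt (fun y => -(((σ i : ℤ) : ℝ) * radFieldDeriv j c c1 i (x - reflect σ y))) (M i) y) ∧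
      ∑ i, M i (EuclideanSpace.single i 1) = radFieldLap j c1 c2 (x - reflect σ y) := by
    intro y σ
    obtain ⟨L, hL, hLi⟩ := hc.hasFDerivAt_radFieldDeriv j (x - reflect σ y)
    choose M hM hMi using fun i => hasFDerivAt_comp_image (hL i)
    refine ⟨fun i => -(((σ i : ℤ) : ℝ) • M i), fun i => ((hM i).const_mul _).neg, ?_⟩
    rw [← hLi]
    refine Finset.sum_congr rfl fun i _ => ?_
    rw [neg_apply, smul_apply, hMi, smul_eq_mul, mul_neg, neg_neg, ← mul_assoc, unit_mul_self, one_mul]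
  choose L hL hLi using e1
  choose M hM hMi using e2
  refine hasNeumannLaplacian_of_contDiff (L := fun y => ∑ σ, L y σ)
    (M := fun i y => ∑ σ, M y σ i) (fun y => HasFDerivAt.fun_sum fun σ _ => hL y σ) (fun y i => ?_)
    (fun i y => HasFDerivAt.fun_sum fun σ _ => hM y σ i) (fun y => ?_) ?_ ?_
  · rw [sum_apply]
    exact Finset.sum_congr rfl fun σ _ => hLi y σ i
  · simp only [sum_apply]
    rw [Finset.sum_comm]
    exact Finset.sum_congr rfl fun σ _ => hMi y σ
  · exact continuous_finsetSum _ fun σ _ => (hc.continuous_radFieldLap j).comp (continuous_image σ x)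
  · rintro y - i (hy | hy)
    · rw [Finset.sum_neg_distrib, sum_image_eq_zero hy, neg_zero]
    · refine Finset.sum_eq_zero fun σ _ => ?_
      have h2 := one_le_norm_sq_image (hx i).1 (hx i).2 hy σ
      rw [radFieldDeriv, h0 _ h2, h1 _ h2]
      simp

/-- Integration by parts against an image sum of bumps. -/
theorem RadialProfile.integral_image_lap (hc : RadialProfile c c1 c2)
    (h0 : ∀ s, 1 ≤ s → 3 * c s + 2 * s * c1 s = 0) (j : Fin 3) {x : E3}
    (hx : ∀ i, 0 ≤ x i ∧ x i ≤ 1) {Y g : E3 → ℝ} {p : Fin 3 → E3 → ℝ}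
    (hY : HasNeumannLaplacian Y p g) :
    ∫ y in cubeD, Y y * ∑ σ : Fin 3 → ℤˣ, radFieldLap j c1 c2 (x - reflect σ y) =
      -∫ y in cubeD, p j y * ∑ σ : Fin 3 → ℤˣ, ((σ j : ℤ) : ℝ) * radBump c c1 (x - reflect σ y) := by
  set B : E3 → ℝ := fun y => ∑ σ : Fin 3 → ℤˣ, ((σ j : ℤ) : ℝ) * radBump c c1 (x - reflect σ y) with hB
  set Λ : E3 → ℝ := fun y => ∑ σ : Fin 3 → ℤˣ, radFieldLap j c1 c2 (x - reflect σ y) with hΛ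
  have hBc : Continuous B := continuous_finsetSum _ fun σ _ =>
    continuous_const.mul (hc.continuous_radBump.comp (continuous_image σ x))
  have hΛc : Continuous Λ := continuous_finsetSum _ fun σ _ =>
    (hc.continuous_radFieldLap j).comp (continuous_image σ x)
  have hBd : ∀ y, ∃ M : E3 →L[ℝ] ℝ, HasFDerivAt B M y ∧ M (EuclideanSpace.single j 1) = Λ y := by
    intro y
    have : ∀ σ : Fin 3 → ℤˣ, ∃ M : E3 →L[ℝ] ℝ,
        HasFDerivAt (fun y => ((σ j : ℤ) : ℝ) * radBump c c1 (x - reflect σ y)) M y ∧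
        M (EuclideanSpace.single j 1) = radFieldLap j c1 c2 (x - reflect σ y) := by
      intro σ
      obtain ⟨L, hL, hLi⟩ := hc.hasFDerivAt_radBump (x - reflect σ y)
      obtain ⟨M, hM, hMi⟩ := hasFDerivAt_comp_image hL
      refine ⟨_, hM.const_mul _, ?_⟩
      rw [smul_apply, hMi, hLi, smul_eq_mul, mul_neg, mul_neg, mul_neg, neg_neg, ← mul_assoc,
        unit_mul_self, one_mul]
    choose M hM hMi using this
    exact ⟨∑ σ, M σ, HasFDerivAt.fun_sum fun σ _ => hM σ, by
      rw [sum_apply]; exact Finset.sum_congr rfl fun σ _ => hMi σ⟩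
  -- The field is `Y B e_j`. On the faces normal to `e_j`, `B` vanishes by oddness at `y j = 0` and
  -- by the support of the bump at `y j = 2`, so no boundary condition on `Y` is used here.
  have key := integral_divergence_cubeD (f := fun i y => if i = j then Y y * B y else 0)
    (h := fun y => Y y * Λ y + p j y * B y) (fun i => by
      split_ifs
      · exact hY.cont.mul hBc.continuousOn
      · exact continuousOn_const)
    (fun y hy => by
      obtain ⟨L, hL, hLp⟩ := hY.hasFDerivAt y hy
      obtain ⟨M, hM, hMj⟩ := hBd y
      refine ⟨fun i => if i = j then Y y • M + B y • L else 0, fun i => ?_, ?_⟩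
      · simp only
        split_ifs
        · exact hL.mul hM
        · exact hasFDerivAt_const _ _
      · rw [Finset.sum_eq_single j (fun i _ hi => by simp [hi]) (by simp)]
        simp only [if_true, add_apply, smul_apply, smul_eq_mul, hMj, hLp]
        ring)
    ((hY.cont.mul hΛc.continuousOn).add ((hY.cont_partial j).mul hBc.continuousOn))
    (fun y _ i hi => by
      split_ifs with hij
      · subst hij
        have : B y = 0 := by
          rcases hi with hi | hi
          · exact sum_image_eq_zero hi _
          · refine Finset.sum_eq_zero fun σ _ => ?_
            rw [radBump, h0 _ (one_le_norm_sq_image (hx i).1 (hx i).2 hi σ)]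
            simp
        rw [this, mul_zero]
      · rfl)
  have i1 : IntegrableOn (fun y => Y y * Λ y) cubeD := cubeD_integrableOn (hY.cont.mul hΛc.continuousOn)
  have i2 : IntegrableOn (fun y => p j y * B y) cubeD :=
    cubeD_integrableOn ((hY.cont_partial j).mul hBc.continuousOn)
  rw [integral_add i1 i2] at key
  linarith

end

/-! ### The cut-off profile -/

/-- The cut-off used to localise the Green's function. -/
def cutoffFn (s : ℝ) : ℝ := Real.smoothTransition (4 * s - 1)

/-- The profile of the cut-off kernel. -/
def cutoffProf (s : ℝ) : ℝ := -(cutoffFn s * s ^ (-(3 / 2) : ℝ)) / (4 * Real.pi)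

theorem cutoffFn_nonneg (s : ℝ) : 0 ≤ cutoffFn s := Real.smoothTransition.nonneg _

theorem cutoffFn_le_one (s : ℝ) : cutoffFn s ≤ 1 := Real.smoothTransition.le_one _

theorem cutoffFn_eq_zero {s : ℝ} (hs : s ≤ 1 / 4) : cutoffFn s = 0 :=
  Real.smoothTransition.zero_of_nonpos (by linarith)

theorem cutoffFn_eq_one {s : ℝ} (hs : 1 / 2 ≤ s) : cutoffFn s = 1 :=
  Real.smoothTransition.one_of_one_le (by linarith)

theorem contDiff_cutoffFn : ContDiff ℝ ∞ cutoffFn :=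
  (Real.smoothTransition.contDiff (n := ⊤)).comp (by fun_prop : ContDiff ℝ ∞ fun s : ℝ => 4 * s - 1)

theorem contDiff_cutoffProf : ContDiff ℝ ∞ cutoffProf := by
  refine contDiff_iff_contDiffAt.2 fun s => ?_
  rcases lt_or_ge s (1 / 4) with hs | hs
  · refine (contDiffAt_const (c := (0 : ℝ))).congr_of_eventuallyEq ?_
    filter_upwards [Iio_mem_nhds hs] with t ht
    simp [cutoffProf, cutoffFn_eq_zero (le_of_lt ht)]
  · refine ((contDiff_cutoffFn.contDiffAt.mul ?_).neg).div_const _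
    exact Real.contDiffAt_rpow_const_of_ne (by linarith)

/-- The derivative of the cut-off profile. -/
def cutoffProf1 : ℝ → ℝ := deriv cutoffProf

/-- The second derivative of the cut-off profile. -/
def cutoffProf2 : ℝ → ℝ := deriv cutoffProf1

theorem contDiff_cutoffProf1 : ContDiff ℝ ∞ cutoffProf1 :=
  (contDiff_infty_iff_deriv.1 contDiff_cutoffProf).2

theorem contDiff_cutoffProf2 : ContDiff ℝ ∞ cutoffProf2 :=
  (contDiff_infty_iff_deriv.1 contDiff_cutoffProf1).2

theorem radialProfile_cutoff : RadialProfile cutoffProf cutoffProf1 cutoffProf2 where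
  deriv_one s := ((contDiff_infty_iff_deriv.1 contDiff_cutoffProf).1 s).hasDerivAt
  deriv_two s := ((contDiff_infty_iff_deriv.1 contDiff_cutoffProf1).1 s).hasDerivAt
  cont := contDiff_cutoffProf2.continuous

theorem cutoffProf_of_le {s : ℝ} (hs : 1 / 2 ≤ s) :
    cutoffProf s = -(s ^ (-(3 / 2) : ℝ)) / (4 * Real.pi) := by
  rw [cutoffProf, cutoffFn_eq_one hs, one_mul]

theorem cutoffProf1_of_lt {s : ℝ} (hs : 1 / 2 < s) :
    cutoffProf1 s = 3 / 2 * s ^ (-(5 / 2) : ℝ) / (4 * Real.pi) := by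
  have h1 : cutoffProf =ᶠ[𝓝 s] fun s => -(s ^ (-(3 / 2) : ℝ)) / (4 * Real.pi) := by
    filter_upwards [Ioi_mem_nhds hs] with t ht using cutoffProf_of_le (le_of_lt ht)
  have h2 := ((Real.hasDerivAt_rpow_const (x := s) (p := -(3 / 2)) (Or.inl (by linarith))).neg).div_const
    (4 * Real.pi)
  rw [cutoffProf1, h1.deriv_eq]
  refine h2.deriv.trans ?_
  norm_num

/-- Beyond the cut-off the field is the gradient of the Green's function, which is divergence-free.
-/
theorem cutoffProf_relation {s : ℝ} (hs : 1 / 2 < s) : 3 * cutoffProf s + 2 * s * cutoffProf1 s = 0 := by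
  have h0 : 0 < s := by linarith
  rw [cutoffProf_of_le hs.le, cutoffProf1_of_lt hs,
    show (-(3 / 2) : ℝ) = -(5 / 2) + 1 by norm_num, Real.rpow_add h0, Real.rpow_one]
  ring

/-- The bump `-div (z cutoffProf(‖z‖²))`, of integral one. -/
def coreBump : E3 → ℝ := radBump cutoffProf cutoffProf1

theorem coreBump_eq_zero {z : E3} (hz : 1 ≤ ‖z‖) : coreBump z = 0 := by
  rw [coreBump, radBump, cutoffProf_relation, neg_zero]
  nlinarith

theorem continuous_coreBump : Continuous coreBump := radialProfile_cutoff.continuous_radBump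

theorem hasCompactSupport_coreBump : HasCompactSupport coreBump := by
  refine HasCompactSupport.of_support_subset_isCompact (isCompact_closedBall (0 : E3) 1) fun z hz => ?_
  rw [mem_closedBall_zero_iff]
  by_contra h
  exact hz (coreBump_eq_zero (not_le.1 h).le)

theorem integrable_coreBump : Integrable coreBump :=
  continuous_coreBump.integrable_of_hasCompactSupport hasCompactSupport_coreBump

/-- The total flux of the Green's function: in polar coordinates the integrand `r² f(r)` is the
derivative of `-r³ cutoffProf(r²)`, which rises from `0` to `1/(4π)`. -/
theorem integral_coreBump : ∫ z, coreBump z = 1 := by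
  set f : ℝ → ℝ := fun r => -(3 * cutoffProf (r ^ 2) + 2 * r ^ 2 * cutoffProf1 (r ^ 2)) with hf
  have h1 : ∫ z, coreBump z = ∫ z : E3, f ‖z‖ := rfl
  have hfz : ∀ r, 1 < r → f r = 0 := fun r hr => by
    simp only [hf]
    rw [cutoffProf_relation (by nlinarith), neg_zero]
  have hd : ∀ r, HasDerivAt (fun r => -(r ^ 3 * cutoffProf (r ^ 2))) (r ^ 2 * f r) r := by
    intro r
    have h3 := ((hasDerivAt_pow 3 r).mul
      ((radialProfile_cutoff.deriv_one (r ^ 2)).comp r (hasDerivAt_pow 2 r))).neg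
    refine h3.congr_deriv ?_
    simp only [hf, Function.comp]
    push_cast
    ring
  have hfc : Continuous f := by
    have h1 := contDiff_cutoffProf.continuous
    have h2 := contDiff_cutoffProf1.continuous
    simp only [hf]; fun_prop
  have h4 : ∫ r in Ioi (0 : ℝ), r ^ 2 * f r = 1 / (4 * Real.pi) := by
    have : ∫ r in Ioi (0 : ℝ), r ^ 2 * f r = ∫ r in Ioc (0 : ℝ) 1, r ^ 2 * f r := by
      refine setIntegral_eq_of_subset_of_forall_sdiff_eq_zero measurableSet_Ioi Ioc_subset_Ioi_self
        fun r hr => ?_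
      have : 1 < r := by
        by_contra h
        exact hr.2 ⟨hr.1, not_lt.1 h⟩
      rw [hfz r this, mul_zero]
    rw [this, ← intervalIntegral.integral_of_le zero_le_one,
      intervalIntegral.integral_eq_sub_of_hasDerivAt (fun r _ => hd r)
        (Continuous.intervalIntegrable (by fun_prop) _ _)]
    rw [one_pow, one_pow, cutoffProf_of_le (by norm_num)]
    simp
    ring
  rw [h1, integral_fun_norm_addHaar]
  simp only [finrank_euclideanSpace, Fintype.card_fin, smul_eq_mul, nsmul_eq_mul]
  norm_num
  rw [h4]
  have hv : (volume : Measure E3).real (Metric.ball 0 1) = Real.pi * 4 / 3 := by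
    rw [Measure.real, EuclideanSpace.volume_ball_fin_three]
    simp
    positivity
  rw [hv]
  have := Real.pi_pos
  field_simp

/-- The bump is not claimed to be nonnegative, so the approximate identity argument is dominated
convergence with majorant `M |coreBump|`. -/
theorem tendsto_integral_coreBump {u : E3 → ℝ} {M : ℝ} {x : E3} (hu : AEStronglyMeasurable u)
    (hM : ∀ y, |u y| ≤ M) (hx : ContinuousAt u x) :
    Tendsto (fun δ : ℝ => ∫ y, u y * (δ⁻¹ ^ 3 * coreBump (δ⁻¹ • (x - y)))) (𝓝[>] 0) (𝓝 (u x)) := by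
  have h1 : ∀ δ : ℝ, 0 < δ → ∫ y, u y * (δ⁻¹ ^ 3 * coreBump (δ⁻¹ • (x - y))) =
      ∫ v, u (x - δ • v) * coreBump v := by
    intro δ hδ
    have e1 := integral_sub_left_eq_self (fun w => u (x - w) * (δ⁻¹ ^ 3 * coreBump (δ⁻¹ • w))) volume x
    simp only [sub_sub_cancel] at e1
    rw [e1]
    have e2 := integral_comp_inv_smul_E3 (fun v => u (x - δ • v) * (δ⁻¹ ^ 3 * coreBump v)) hδ
    simp only [smul_inv_smul₀ hδ.ne'] at e2
    rw [e2, ← integral_const_mul]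
    congr 1
    ext v
    field_simp
  have h2 : Tendsto (fun δ : ℝ => ∫ v, u (x - δ • v) * coreBump v) (𝓝[>] 0) (𝓝 (∫ v, u x * coreBump v)) := by
    refine tendsto_integral_filter_of_dominated_convergence (fun v => M * |coreBump v|) ?_ ?_
      (integrable_coreBump.abs.const_mul M) ?_
    · filter_upwards [self_mem_nhdsWithin] with δ hδ
      have hδ' : δ ≠ 0 := (show (0 : ℝ) < δ from hδ).ne'
      refine AEStronglyMeasurable.mul ?_ continuous_coreBump.aestronglyMeasurable
      have hq : Measure.QuasiMeasurePreserving (fun v : E3 => x - δ • v) := by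
        have q1 : Measure.QuasiMeasurePreserving (fun v : E3 => δ • v) volume volume :=
          Measure.quasiMeasurePreserving_smul volume hδ'
        exact (Measure.measurePreserving_sub_left volume x).quasiMeasurePreserving.comp q1
      exact hu.comp_quasiMeasurePreserving hq
    · refine Eventually.of_forall fun δ => Eventually.of_forall fun v => ?_
      rw [norm_mul]
      exact mul_le_mul_of_nonneg_right (hM _) (abs_nonneg _)
    · refine Eventually.of_forall fun v => ?_
      have h3 : Tendsto (fun δ : ℝ => x - δ • v) (𝓝[>] 0) (𝓝 x) := by
        have : Continuous fun δ : ℝ => x - δ • v := by fun_prop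
        have := this.tendsto 0
        simp only [zero_smul, sub_zero] at this
        exact this.mono_left nhdsWithin_le_nhds
      exact (hx.tendsto.comp h3).mul_const _
  rw [integral_const_mul, integral_coreBump, mul_one] at h2
  refine h2.congr' ?_
  filter_upwards [self_mem_nhdsWithin] with δ hδ using (h1 δ hδ).symm

/-! ### The representation formula -/

theorem radField_scaled (j : Fin 3) {δ : ℝ} (hδ : 0 < δ) (z : E3) :
    radField j (fun s => δ⁻¹ ^ 3 * cutoffProf (δ⁻¹ ^ 2 * s)) z = cutoffFn (δ⁻¹ ^ 2 * ‖z‖ ^ 2) * kern j z := by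
  rcases eq_or_ne z 0 with rfl | hz
  · simp [radField, kern]
  have h0 := norm_pos_iff.2 hz
  have e : (δ⁻¹ ^ 2 * ‖z‖ ^ 2) ^ (-(3 / 2) : ℝ) = ((δ⁻¹ * ‖z‖) ^ 3)⁻¹ := by
    rw [← mul_pow, ← Real.rpow_natCast (δ⁻¹ * ‖z‖) 2, ← Real.rpow_mul (by positivity),
      ← Real.rpow_natCast (δ⁻¹ * ‖z‖) 3, ← Real.rpow_neg (by positivity)]
    norm_num
  rw [radField, cutoffProf, e, kern]
  field_simp

theorem radField_cutoffProf (j : Fin 3) (z : E3) :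
    radField j cutoffProf z = cutoffFn (‖z‖ ^ 2) * kern j z := by
  have := radField_scaled j one_pos z
  simpa using this

theorem norm_sub_le_norm_sub_reflect {x y : E3} (hx : ∀ i, 0 ≤ x i) (hy : ∀ i, 0 ≤ y i)
    (σ : Fin 3 → ℤˣ) : ‖x - y‖ ≤ ‖x - reflect σ y‖ := by
  refine norm_le_norm_of_abs_le fun k => ?_
  simp only [PiLp.sub_apply, reflect_apply]
  have h1 := hx k
  have h2 := hy k
  rcases Int.units_eq_one_or (σ k) with h | h
  · simp [h]
  · rw [h]
    push_cast
    rw [neg_one_mul, sub_neg_eq_add, abs_of_nonneg (add_nonneg h1 h2), abs_sub_le_iff]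
    constructor <;> linarith

theorem norm_sub_le_four {x y : E3} (hx : x ∈ cubeD) (hy : y ∈ cubeD) : ‖x - y‖ ≤ 4 := by
  have h : ‖x - y‖ ^ 2 ≤ 4 ^ 2 := by
    rw [EuclideanSpace.norm_sq_eq, Fin.sum_univ_three]
    have : ∀ i, ‖(x - y) i‖ ^ 2 ≤ 4 := fun i => by
      have h1 := hx i
      have h2 := hy i
      rw [PiLp.sub_apply, Real.norm_eq_abs, sq_abs]
      nlinarith
    linarith [this 0, this 1, this 2]
  nlinarith [norm_nonneg (x - y)]

/-- Uniform integrability of `‖x - y‖^(-a)` over the cube. -/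
theorem integrableOn_norm_sub_rpow {a : ℝ} (ha : a < 3) {x : E3} (hx : x ∈ cubeD) :
    IntegrableOn (fun y => ‖x - y‖ ^ (-a)) cubeD ∧
      ∫ y in cubeD, ‖x - y‖ ^ (-a) ≤ ∫ y, coreFn 4 a y := by
  have h1 : Integrable fun y => coreFn 4 a (x - y) := (integrable_coreFn 4 ha).comp_sub_left x
  have h2 : EqOn (fun y => coreFn 4 a (x - y)) (fun y => ‖x - y‖ ^ (-a)) cubeD := fun y hy => by
    simp only [coreFn]
    rw [indicator_of_mem]
    rw [mem_closedBall_zero_iff]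
    exact norm_sub_le_four hx hy
  refine ⟨(h1.integrableOn).congr_fun h2 measurableSet_cubeD, ?_⟩
  rw [← setIntegral_congr_fun measurableSet_cubeD h2, ← integral_sub_left_eq_self (coreFn 4 a) volume x]
  exact setIntegral_le_integral h1 (Eventually.of_forall fun y => coreFn_nonneg _ _ _)

/-- The octant of the cube next to the origin. -/
def unitOctant : Set E3 := {x | ∀ i, 0 ≤ x i ∧ x i ≤ 1}

theorem unitOctant_subset : unitOctant ⊆ cubeD := fun _ hx i => ⟨(hx i).1, (hx i).2.trans one_le_two⟩

theorem measurable_image (σ : Fin 3 → ℤˣ) (x : E3) : Measurable fun y => x - reflect σ y :=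
  (continuous_image σ x).measurable

/-- The smooth source of the localised Neumann kernel. -/
def imageSource (j : Fin 3) (x y : E3) : ℝ :=
  ∑ σ : Fin 3 → ℤˣ, radFieldLap j cutoffProf1 cutoffProf2 (x - reflect σ y)

theorem continuous_imageSource (j : Fin 3) (x : E3) : Continuous (imageSource j x) :=
  continuous_finsetSum _ fun σ _ => (radialProfile_cutoff.continuous_radFieldLap j).comp (continuous_image σ x)

/-- The localised Neumann kernel. -/
def localKern (j : Fin 3) (x y : E3) : ℝ :=
  ∑ σ : Fin 3 → ℤˣ, (kern j (x - reflect σ y) - radField j cutoffProf (x - reflect σ y))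

/-- The test function is the image sum for the difference of the profiles cut off at scales `δ` and
one. It is smooth, as both vanish near the origin, and it vanishes beyond distance one, where both
are the gradient of the Green's function; so Green's identity applies. On the source side the `δ`
part is a derivative of an approximate identity and is integrated by parts onto the gradient of `Y`,
while the scale-one part is `imageSource`. -/
theorem regularised_representation (j : Fin 3) {x : E3} (hx : x ∈ unitOctant) {Y g : E3 → ℝ}
    {p : Fin 3 → E3 → ℝ} (hY : HasNeumannLaplacian Y p g) {δ : ℝ} (hδ : 0 < δ) (hδ1 : δ ≤ 1) :
    ∫ y in cubeD, (∑ σ : Fin 3 → ℤˣ, (cutoffFn (δ⁻¹ ^ 2 * ‖x - reflect σ y‖ ^ 2) * kern j (x - reflect σ y) -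
        radField j cutoffProf (x - reflect σ y))) * g y =
      -(∫ y in cubeD, p j y * ∑ σ : Fin 3 → ℤˣ, ((σ j : ℤ) : ℝ) *
        (δ⁻¹ ^ 3 * coreBump (δ⁻¹ • (x - reflect σ y)))) - ∫ y in cubeD, Y y * imageSource j x y := by
  have hinv : 1 ≤ δ⁻¹ ^ 2 := one_le_pow₀ ((one_le_inv₀ hδ).2 hδ1)
  have hge : ∀ s : ℝ, 1 ≤ s → 1 ≤ δ⁻¹ ^ 2 * s := fun s hs => one_le_mul_of_one_le_of_one_le hinv hs
  have hsc := radialProfile_cutoff.scale δ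
  have hν := hsc.sub radialProfile_cutoff
  -- Homogeneity of the uncut profiles, needed with `k = 3` for the profile and `k = 5` for its
  -- derivative.
  have hpow : ∀ (k : ℕ) (s : ℝ), 0 < s → (δ⁻¹ ^ 2 * s) ^ (-((k : ℝ) / 2)) = (δ⁻¹ ^ k)⁻¹ * s ^ (-((k : ℝ) / 2)) := by
    intro k s hs
    rw [Real.mul_rpow (by positivity) hs.le, ← Real.rpow_natCast δ⁻¹ 2, ← Real.rpow_mul (by positivity),
      ← Real.rpow_natCast δ⁻¹ k, ← Real.rpow_neg (by positivity)]
    congr 2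
    push_cast
    ring
  have h0 : ∀ s, 1 ≤ s → δ⁻¹ ^ 3 * cutoffProf (δ⁻¹ ^ 2 * s) - cutoffProf s = 0 := by
    intro s hs
    have := hpow 3 s (by linarith)
    norm_num at this
    rw [cutoffProf_of_le (by linarith [hge s hs]), cutoffProf_of_le (by linarith)]
    norm_num [this]
    field_simp
    ring
  have h1 : ∀ s, 1 ≤ s → δ⁻¹ ^ 5 * cutoffProf1 (δ⁻¹ ^ 2 * s) - cutoffProf1 s = 0 := by
    intro s hs
    have := hpow 5 s (by linarith)
    norm_num at this
    rw [cutoffProf1_of_lt (by linarith [hge s hs]), cutoffProf1_of_lt (by linarith)]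
    norm_num [this]
    field_simp
    ring
  have hG := hY.green (hν.hasNeumannLaplacian_image h0 h1 j hx)
  have hB := hsc.integral_image_lap (fun s hs => by
    have := cutoffProf_relation (s := δ⁻¹ ^ 2 * s) (by linarith [hge s hs])
    have e : 3 * (δ⁻¹ ^ 3 * cutoffProf (δ⁻¹ ^ 2 * s)) + 2 * s * (δ⁻¹ ^ 5 * cutoffProf1 (δ⁻¹ ^ 2 * s)) =
      δ⁻¹ ^ 3 * (3 * cutoffProf (δ⁻¹ ^ 2 * s) + 2 * (δ⁻¹ ^ 2 * s) * cutoffProf1 (δ⁻¹ ^ 2 * s)) := by ring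
    rw [e, this, mul_zero]) j hx hY
  have eL : ∀ z : E3, radField j (fun s => δ⁻¹ ^ 3 * cutoffProf (δ⁻¹ ^ 2 * s) - cutoffProf s) z =
      cutoffFn (δ⁻¹ ^ 2 * ‖z‖ ^ 2) * kern j z - radField j cutoffProf z := by
    intro z
    rw [← radField_scaled j hδ z]
    simp only [radField]; ring
  have eR : ∀ z : E3, radFieldLap j (fun s => δ⁻¹ ^ 5 * cutoffProf1 (δ⁻¹ ^ 2 * s) - cutoffProf1 s)
      (fun s => δ⁻¹ ^ 7 * cutoffProf2 (δ⁻¹ ^ 2 * s) - cutoffProf2 s) z =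
      radFieldLap j (fun s => δ⁻¹ ^ 5 * cutoffProf1 (δ⁻¹ ^ 2 * s))
        (fun s => δ⁻¹ ^ 7 * cutoffProf2 (δ⁻¹ ^ 2 * s)) z - radFieldLap j cutoffProf1 cutoffProf2 z := by
    intro z
    simp only [radFieldLap]; ring
  simp only [eL, eR, Finset.sum_sub_distrib, mul_sub] at hG
  simp only [Finset.sum_sub_distrib]
  rw [hG]
  have i1 : IntegrableOn (fun y => Y y * ∑ σ : Fin 3 → ℤˣ,
      radFieldLap j (fun s => δ⁻¹ ^ 5 * cutoffProf1 (δ⁻¹ ^ 2 * s))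
        (fun s => δ⁻¹ ^ 7 * cutoffProf2 (δ⁻¹ ^ 2 * s)) (x - reflect σ y)) cubeD := by
    refine cubeD_integrableOn (hY.cont.mul (Continuous.continuousOn ?_))
    exact continuous_finsetSum _ fun σ _ => (hsc.continuous_radFieldLap j).comp (continuous_image σ x)
  have i2 : IntegrableOn (fun y => Y y * ∑ σ : Fin 3 → ℤˣ,
      radFieldLap j cutoffProf1 cutoffProf2 (x - reflect σ y)) cubeD :=
    cubeD_integrableOn (hY.cont.mul (continuous_imageSource j x).continuousOn)
  rw [integral_sub i1 i2, hB]
  simp only [radBump_scale]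
  rfl

theorem mem_unitOctant_nonneg {x : E3} (hx : x ∈ unitOctant) : ∀ i, 0 ≤ x i := fun i => (hx i).1

theorem mem_cubeD_nonneg {x : E3} (hx : x ∈ cubeD) : ∀ i, 0 ≤ x i := fun i => (hx i).1

theorem abs_kern_image_le (j : Fin 3) {x y : E3} (hx : x ∈ cubeD) (hy : y ∈ cubeD) (hne : y ≠ x)
    (σ : Fin 3 → ℤˣ) : |kern j (x - reflect σ y)| ≤ ‖x - y‖ ^ (-2 : ℝ) := by
  have h1 : 0 < ‖x - y‖ := norm_pos_iff.2 (sub_ne_zero.2 hne.symm)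
  exact (abs_kern_le j _).trans (Real.rpow_le_rpow_of_nonpos h1
    (norm_sub_le_norm_sub_reflect (mem_cubeD_nonneg hx) (mem_cubeD_nonneg hy) σ) (by norm_num))

theorem ae_restrict_mem_ne (x : E3) : ∀ᵐ y ∂volume.restrict cubeD, y ∈ cubeD ∧ y ≠ x := by
  filter_upwards [ae_restrict_mem measurableSet_cubeD, ae_restrict_of_ae (ae_ne_E3 x)] with y h1 h2
    using ⟨h1, h2⟩

theorem measurable_kern_image (j : Fin 3) (σ : Fin 3 → ℤˣ) (x : E3) :
    Measurable fun y => kern j (x - reflect σ y) := (measurable_kern j).comp (measurable_image σ x)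

/-- Images are at least as far from `x` as `y` is, so `2 ‖x - y‖^(-2)` dominates each term. For
fixed `y ≠ x` the cut-off at scale `δ` is inactive as soon as `δ` is below the distance to the
image. -/
theorem tendsto_localKern (j : Fin 3) {x : E3} (hx : x ∈ unitOctant) {g : E3 → ℝ}
    (hg : ContinuousOn g cubeD) :
    Tendsto (fun δ : ℝ => ∫ y in cubeD, (∑ σ : Fin 3 → ℤˣ,
      (cutoffFn (δ⁻¹ ^ 2 * ‖x - reflect σ y‖ ^ 2) * kern j (x - reflect σ y) -
        radField j cutoffProf (x - reflect σ y))) * g y) (𝓝[>] 0)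
      (𝓝 (∫ y in cubeD, localKern j x y * g y)) := by
  obtain ⟨B, hB0, hB⟩ := exists_bound_cubeD hg
  have hxD := unitOctant_subset hx
  have hθ : Continuous cutoffFn := contDiff_cutoffFn.continuous
  refine tendsto_integral_filter_of_dominated_convergence
    (fun y => (∑ _σ : Fin 3 → ℤˣ, 2 * ‖x - y‖ ^ (-2 : ℝ)) * B) ?_ ?_ ?_ ?_
  · refine Eventually.of_forall fun δ => ?_
    refine AEStronglyMeasurable.mul ?_ (hg.aestronglyMeasurable measurableSet_cubeD)
    refine Measurable.aestronglyMeasurable ?_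
    refine Finset.measurable_sum _ fun σ _ => ?_
    refine Measurable.sub (Measurable.mul ?_ (measurable_kern_image j σ x)) ?_
    · exact hθ.measurable.comp (measurable_const.mul ((measurable_image σ x).norm.pow_const 2))
    · exact (radialProfile_cutoff.continuous_radField j).measurable.comp (measurable_image σ x)
  · refine Eventually.of_forall fun δ => ?_
    filter_upwards [ae_restrict_mem_ne x] with y hy
    rw [norm_mul]
    refine mul_le_mul ?_ (hB y hy.1) (norm_nonneg _) (Finset.sum_nonneg fun _ _ => by positivity)
    refine (norm_sum_le _ _).trans (Finset.sum_le_sum fun σ _ => ?_)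
    have h1 := abs_kern_image_le j hxD hy.1 hy.2 σ
    rw [radField_cutoffProf, ← sub_mul, Real.norm_eq_abs, abs_mul]
    refine mul_le_mul ?_ h1 (abs_nonneg _) zero_le_two
    rw [abs_le]
    constructor <;> linarith [cutoffFn_nonneg (δ⁻¹ ^ 2 * ‖x - reflect σ y‖ ^ 2),
      cutoffFn_le_one (δ⁻¹ ^ 2 * ‖x - reflect σ y‖ ^ 2), cutoffFn_nonneg (‖x - reflect σ y‖ ^ 2),
      cutoffFn_le_one (‖x - reflect σ y‖ ^ 2)]
  · refine Integrable.mul_const (integrable_finsetSum _ fun σ _ => ?_) _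
    exact (integrableOn_norm_sub_rpow (by norm_num) hxD).1.const_mul 2
  · filter_upwards [ae_restrict_mem_ne x] with y hy
    refine Tendsto.mul_const _ (tendsto_finsetSum _ fun σ _ => Tendsto.sub_const ?_ _)
    have h1 : 0 < ‖x - reflect σ y‖ := (norm_pos_iff.2 (sub_ne_zero.2 hy.2.symm)).trans_le
      (norm_sub_le_norm_sub_reflect (mem_unitOctant_nonneg hx) (mem_cubeD_nonneg hy.1) σ)
    refine tendsto_const_nhds.congr' ?_
    filter_upwards [Ioo_mem_nhdsGT h1] with δ hδ
    have h2 : 1 ≤ δ⁻¹ * ‖x - reflect σ y‖ := by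
      rw [inv_mul_eq_div, one_le_div hδ.1]; exact hδ.2.le
    rw [cutoffFn_eq_one, one_mul]
    rw [← mul_pow]
    nlinarith

/-- A nontrivial reflection puts the image of the cube at distance at least the smallest coordinate
of `x`. For `δ` below that, only the identity contributes and the bumps form an approximate
identity. -/
theorem tendsto_image_coreBump (j : Fin 3) {x : E3} (hx : x ∈ unitOctant) (hx0 : ∀ i, 0 < x i)
    {u : E3 → ℝ} (hu : ContinuousOn u cubeD) :
    Tendsto (fun δ : ℝ => ∫ y in cubeD, u y * ∑ σ : Fin 3 → ℤˣ, ((σ j : ℤ) : ℝ) *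
        (δ⁻¹ ^ 3 * coreBump (δ⁻¹ • (x - reflect σ y)))) (𝓝[>] 0) (𝓝 (u x)) := by
  obtain ⟨B, hB0, hB⟩ := exists_bound_cubeD hu
  have hxI : x ∈ interior cubeD := by
    rw [interior_cubeD]
    exact fun i => ⟨hx0 i, (hx i).2.trans_lt one_lt_two⟩
  have h1 := tendsto_integral_coreBump (u := cubeD.indicator u) (M := B) (x := x)
    ((aestronglyMeasurable_indicator_iff measurableSet_cubeD).2
      (hu.aestronglyMeasurable measurableSet_cubeD))
    (fun y => by
      by_cases hy : y ∈ cubeD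
      · rw [indicator_of_mem hy]; exact hB y hy
      · rw [indicator_of_notMem hy, abs_zero]; exact hB0)
    (by
      have hn := mem_interior_iff_mem_nhds.1 hxI
      refine (hu.continuousAt hn).congr ?_
      filter_upwards [hn] with y hy
      rw [indicator_of_mem hy])
  rw [indicator_of_mem (interior_subset hxI)] at h1
  refine h1.congr' ?_
  obtain ⟨m, hm0, hm⟩ : ∃ m, 0 < m ∧ ∀ i, m ≤ x i :=
    ⟨min (x 0) (min (x 1) (x 2)), lt_min (hx0 0) (lt_min (hx0 1) (hx0 2)), fun i => by
      fin_cases i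
      · exact min_le_left _ _
      · exact (min_le_right _ _).trans (min_le_left _ _)
      · exact (min_le_right _ _).trans (min_le_right _ _)⟩
  filter_upwards [Ioo_mem_nhdsGT hm0] with δ hδ
  rw [← integral_indicator measurableSet_cubeD]
  congr 1
  ext y
  by_cases hy : y ∈ cubeD
  · rw [indicator_of_mem hy, indicator_of_mem hy, Finset.sum_eq_single 1]
    · simp [reflect_one]
    · intro σ _ hσ
      obtain ⟨i, hi⟩ := Function.ne_iff.1 hσ
      have hi' : σ i = -1 := (Int.units_eq_one_or (σ i)).resolve_left hi
      have h2 : m ≤ ‖x - reflect σ y‖ := by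
        refine le_trans ?_ (abs_coord_le_norm _ i)
        rw [PiLp.sub_apply, reflect_apply, hi']
        push_cast
        rw [neg_one_mul, sub_neg_eq_add, abs_of_nonneg (add_nonneg (hx0 i).le (hy i).1)]
        linarith [hm i, (hy i).1]
      rw [coreBump_eq_zero, mul_zero, mul_zero]
      rw [norm_smul, norm_inv, Real.norm_of_nonneg hδ.1.le, inv_mul_eq_div, one_le_div hδ.1]
      exact hδ.2.le.trans h2
    · simp
  · rw [indicator_of_notMem hy, indicator_of_notMem hy, zero_mul]

theorem representation_of_pos (j : Fin 3) {x : E3} (hx : x ∈ unitOctant) (hx0 : ∀ i, 0 < x i)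
    {Y g : E3 → ℝ} {p : Fin 3 → E3 → ℝ} (hY : HasNeumannLaplacian Y p g) :
    p j x = -(∫ y in cubeD, localKern j x y * g y) - ∫ y in cubeD, Y y * imageSource j x y := by
  have h1 := tendsto_localKern j hx hY.cont_laplacian
  have h2 := (tendsto_image_coreBump j hx hx0 (hY.cont_partial j)).neg.sub_const
    (∫ y in cubeD, Y y * imageSource j x y)
  have h3 := tendsto_nhds_unique (h1.congr' (by
    filter_upwards [Ioc_mem_nhdsGT one_pos] with δ hδ
      using regularised_representation j hx hY hδ.1 hδ.2)) h2
  rw [h3]; ring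

/-- The kernel `-∂_{x_j} G` of the Neumann problem on the cube, without its mean. -/
def neumannKern₀ (j : Fin 3) (x y : E3) : ℝ := localKern j x y - invNeumann (imageSource j x) y

theorem representation_of_pos' (j : Fin 3) {x : E3} (hx : x ∈ unitOctant) (hx0 : ∀ i, 0 < x i)
    {Y g : E3 → ℝ} {p : Fin 3 → E3 → ℝ} (hY : HasNeumannLaplacian Y p g)
    (hi : IntegrableOn (fun y => localKern j x y * g y) cubeD) :
    p j x = -∫ y in cubeD, neumannKern₀ j x y * g y := by
  have hc := (continuous_imageSource j x).continuousOn (s := cubeD)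
  -- The representation applied to the constant solution `1` shows that the source has mean zero,
  -- which is the condition for inverting the Neumann Laplacian on it.
  have h0 : ∫ y in cubeD, imageSource j x y = 0 := by
    have := representation_of_pos j hx hx0 hasNeumannLaplacian_one
    simpa using this
  rw [representation_of_pos j hx hx0 hY, hY.integral_mul_eq hc h0]
  have i2 : IntegrableOn (fun y => invNeumann (imageSource j x) y * g y) cubeD :=
    cubeD_integrableOn ((continuous_invNeumann hc).continuousOn.mul hY.cont_laplacian)
  simp only [neumannKern₀, sub_mul]
  rw [integral_sub hi i2]
  simp only [mul_comm (g _)]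
  ring

/-! ### Hölder dependence of the Neumann kernel on its base point -/

theorem SingFam.sum {ι : Type*} (s : Finset ι) {X : Set E3} {β : ℝ} {C : ι → ℝ}
    {f : ι → E3 → E3 → ℝ} (hf : ∀ i ∈ s, SingFam X β (C i) (f i)) :
    SingFam X β (∑ i ∈ s, C i) (fun x y => ∑ i ∈ s, f i x y) := by
  classical
  induction s using Finset.induction_on with
  | empty =>
    refine ⟨by simp, fun x _ => ?_, fun x _ => ?_, fun x _ x' _ => ?_⟩
    · simpa using aestronglyMeasurable_const
    · simp
    · simp
  | insert i s hi ih =>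
    simp_rw [Finset.sum_insert hi]
    exact (hf i (Finset.mem_insert_self i s)).add (ih fun k hk => hf k (Finset.mem_insert_of_mem hk))

/-- Bounded Hölder families supported in the cube. -/
theorem regFam_indicator_cubeD {X : Set E3} (hX : X ⊆ cubeD) {r : E3 → ℝ} (hr : ∀ x ∈ X, 0 < r x)
    (hr4 : ∀ x ∈ X, r x ≤ 4) {β C : ℝ} (hβ : 0 < β) (hβ1 : β < 1) (hC : 0 ≤ C) {u : E3 → E3 → ℝ}
    (hm : ∀ x ∈ X, ContinuousOn (u x) cubeD) (hb : ∀ x ∈ X, ∀ y ∈ cubeD, |u x y| ≤ C)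
    (hh : ∀ x ∈ X, ∀ x' ∈ X, ∀ y ∈ cubeD, |u x y - u x' y| ≤ C * ‖x - x'‖ ^ β) :
    RegFam X r β (64 * C) (fun x => cubeD.indicator (u x)) where
  nonneg := by positivity
  pos := hr
  meas x hx := (aestronglyMeasurable_indicator_iff measurableSet_cubeD).2
    ((hm x hx).aestronglyMeasurable measurableSet_cubeD)
  bound x hx := by
    refine Eventually.of_forall fun y => ?_
    have h0 : 0 < max (r x) ‖x - y‖ := lt_max_of_lt_left (hr x hx)
    by_cases hy : y ∈ cubeD
    · rw [indicator_of_mem hy]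
      have h1 := Real.rpow_le_rpow_of_nonpos h0 (max_le (hr4 x hx) (norm_sub_le_four (hX hx) hy))
        (by norm_num : (-2 : ℝ) ≤ 0)
      have h2 : (4 : ℝ) ^ (-2 : ℝ) = 1 / 16 := by
        rw [Real.rpow_neg (by norm_num), Real.rpow_two]; norm_num
      rw [h2] at h1
      nlinarith [hb x hx y hy]
    · rw [indicator_of_notMem hy, abs_zero]
      positivity
  holder x hx x' hx' := by
    refine Eventually.of_forall fun y => ?_
    have h0 : 0 < max (r x) ‖x - y‖ := lt_max_of_lt_left (hr x hx)
    have h0' : 0 < max (r x') ‖x' - y‖ := lt_max_of_lt_left (hr x' hx')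
    by_cases hy : y ∈ cubeD
    · rw [indicator_of_mem hy, indicator_of_mem hy]
      have h1 := Real.rpow_le_rpow_of_nonpos h0 (max_le (hr4 x hx) (norm_sub_le_four (hX hx) hy))
        (by linarith : (-(2 + β) : ℝ) ≤ 0)
      -- Both `r x` and `‖x - y‖` are at most `4` and the order `2 + β` is below `3`, whence the
      -- factor `4³ = 64`.
      have h2 : (1 : ℝ) / 64 ≤ (4 : ℝ) ^ (-(2 + β) : ℝ) := by
        calc (1 : ℝ) / 64 = (4 : ℝ) ^ (-3 : ℝ) := by
              rw [Real.rpow_neg (by norm_num)]; norm_num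
          _ ≤ _ := Real.rpow_le_rpow_of_exponent_le (by norm_num) (by linarith)
      have h3 : 0 ≤ (max (r x') ‖x' - y‖) ^ (-(2 + β)) := by positivity
      refine (hh x hx x' hx' y hy).trans ?_
      calc C * ‖x - x'‖ ^ β = 64 * C * ‖x - x'‖ ^ β * (1 / 64) := by ring
        _ ≤ _ := by gcongr; linarith
    · rw [indicator_of_notMem hy, indicator_of_notMem hy, sub_zero, abs_zero]
      positivity

theorem SingFam.integral_cubeD {X : Set E3} (hX : X ⊆ cubeD) {β C B : ℝ}
    {f : E3 → E3 → ℝ} (hf : SingFam X β C f) {g : E3 → ℝ} (hg : ContinuousOn g cubeD)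
    (hB : ∀ y ∈ cubeD, |g y| ≤ B) (hB0 : 0 ≤ B) {x : E3} (hx : x ∈ X) :
    IntegrableOn (fun y => f x y * g y) cubeD ∧
    |∫ y in cubeD, f x y * g y| ≤ C * B * ∫ y, coreFn 4 2 y := by
  obtain ⟨i1, i2⟩ := integrableOn_norm_sub_rpow (a := 2) (by norm_num) (hX hx)
  have hgm := hg.aestronglyMeasurable measurableSet_cubeD (μ := volume)
  have hae : ∀ᵐ y ∂volume.restrict cubeD, ‖f x y * g y‖ ≤ C * B * ‖x - y‖ ^ (-2 : ℝ) := by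
    filter_upwards [ae_restrict_of_ae (hf.bound x hx), ae_restrict_mem measurableSet_cubeD] with y h1 h2
    rw [norm_mul]
    calc _ ≤ (C * ‖x - y‖ ^ (-2 : ℝ)) * B := mul_le_mul h1 (hB y h2) (abs_nonneg _) ((abs_nonneg _).trans h1)
      _ = _ := by ring
  refine ⟨(i1.const_mul (C * B)).mono' ((hf.meas x hx).restrict.mul hgm) hae, ?_⟩
  refine (norm_integral_le_of_norm_le (i1.const_mul (C * B)) hae).trans ?_
  rw [integral_const_mul]
  exact mul_le_mul_of_nonneg_left i2 (mul_nonneg hf.nonneg hB0)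

theorem SingFam.integral_cubeD_sub {X : Set E3} (hX : X ⊆ cubeD) {β C B : ℝ} (hβ1 : β < 1) (hβ : 0 < β)
    {f : E3 → E3 → ℝ} (hf : SingFam X β C f) {g : E3 → ℝ} (hg : ContinuousOn g cubeD)
    (hB : ∀ y ∈ cubeD, |g y| ≤ B) (hB0 : 0 ≤ B) {x x' : E3} (hx : x ∈ X) (hx' : x' ∈ X) :
    |(∫ y in cubeD, f x y * g y) - ∫ y in cubeD, f x' y * g y| ≤
      C * B * (2 * ∫ y, coreFn 4 (2 + β) y) * ‖x - x'‖ ^ β := by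
  obtain ⟨i1, -⟩ := hf.integral_cubeD hX hg hB hB0 hx
  obtain ⟨i1', -⟩ := hf.integral_cubeD hX hg hB hB0 hx'
  rw [← integral_sub (f := fun y => f x y * g y) i1 i1']
  obtain ⟨j1, j2⟩ := integrableOn_norm_sub_rpow (a := 2 + β) (by linarith) (hX hx)
  obtain ⟨j1', j2'⟩ := integrableOn_norm_sub_rpow (a := 2 + β) (by linarith) (hX hx')
  have hC := hf.nonneg
  have hj : IntegrableOn (fun y => C * B * ‖x - x'‖ ^ β *
      (‖x - y‖ ^ (-(2 + β)) + ‖x' - y‖ ^ (-(2 + β)))) cubeD := (j1.add j1').const_mul _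
  refine (norm_integral_le_of_norm_le (f := fun y => f x y * g y - f x' y * g y) hj ?_).trans ?_
  · filter_upwards [ae_restrict_of_ae (hf.holder x hx x' hx'), ae_restrict_mem measurableSet_cubeD]
      with y h1 h2
    rw [← sub_mul, norm_mul]
    calc _ ≤ (C * ‖x - x'‖ ^ β * (‖x - y‖ ^ (-(2 + β)) + ‖x' - y‖ ^ (-(2 + β)))) * B :=
          mul_le_mul h1 (hB y h2) (abs_nonneg _) ((abs_nonneg _).trans h1)
      _ = _ := by ring
  · rw [integral_const_mul, integral_add j1 j1']
    have : 0 ≤ ‖x - x'‖ ^ β := by positivity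
    calc _ ≤ C * B * ‖x - x'‖ ^ β * ((∫ y, coreFn 4 (2 + β) y) + ∫ y, coreFn 4 (2 + β) y) := by gcongr
      _ = _ := by ring

/-! ### Smooth families of images -/

theorem exists_image_lipschitz {F : E3 → ℝ} (hF : ContDiff ℝ ∞ F) : ∃ K, 0 ≤ K ∧
    ∀ x ∈ cubeD, ∀ x' ∈ cubeD, ∀ y ∈ cubeD,
      |∑ σ : Fin 3 → ℤˣ, F (x - reflect σ y)| ≤ K ∧
      |(∑ σ : Fin 3 → ℤˣ, F (x - reflect σ y)) - ∑ σ : Fin 3 → ℤˣ, F (x' - reflect σ y)| ≤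
        K * ‖x - x'‖ := by
  obtain ⟨K, hK⟩ := (hF.contDiffOn (s := Metric.closedBall (0 : E3) 8)).exists_lipschitzOnWith
    (by simp) (convex_closedBall _ _) (isCompact_closedBall _ _)
  obtain ⟨M, hM⟩ := (isCompact_closedBall (0 : E3) 8).exists_bound_of_continuousOn
    hF.continuous.continuousOn
  have hn : ∀ z ∈ cubeD, ‖z‖ ≤ 4 := fun z hz => by
    have := norm_sub_le_four hz (show (0 : E3) ∈ cubeD from fun i => by simp)
    simpa using this
  have hmem : ∀ x ∈ cubeD, ∀ y ∈ cubeD, ∀ σ, x - reflect σ y ∈ Metric.closedBall (0 : E3) 8 := by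
    intro x hx y hy σ
    rw [mem_closedBall_zero_iff]
    have h1 := norm_sub_le x (reflect σ y)
    rw [LinearIsometryEquiv.norm_map] at h1
    linarith [hn x hx, hn y hy]
  have hM0 : 0 ≤ M := (norm_nonneg _).trans (hM 0 (by simp))
  refine ⟨∑ _σ : Fin 3 → ℤˣ, (M + K), Finset.sum_nonneg fun _ _ => by positivity,
    fun x hx x' hx' y hy => ⟨?_, ?_⟩⟩
  · refine (Finset.abs_sum_le_sum_abs _ _).trans (Finset.sum_le_sum fun σ _ => ?_)
    have := hM _ (hmem x hx y hy σ)
    rw [Real.norm_eq_abs] at this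
    linarith [K.2]
  · rw [← Finset.sum_sub_distrib, Finset.sum_mul]
    refine (Finset.abs_sum_le_sum_abs _ _).trans (Finset.sum_le_sum fun σ _ => ?_)
    have := hK.dist_le_mul _ (hmem x hx y hy σ) _ (hmem x' hx' y hy σ)
    rw [Real.dist_eq, dist_eq_norm, sub_sub_sub_cancel_right] at this
    have h2 : 0 ≤ M * ‖x - x'‖ := by positivity
    linarith

theorem norm_sub_le_rpow {β : ℝ} (hβ : 0 < β) (hβ1 : β < 1) {x x' : E3} (hx : x ∈ cubeD) (hx' : x' ∈ cubeD) :
    ‖x - x'‖ ≤ 4 * ‖x - x'‖ ^ β := by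
  rcases (norm_nonneg (x - x')).eq_or_lt with h | h
  · rw [← h]; positivity
  have h1 : ‖x - x'‖ = ‖x - x'‖ ^ (1 - β) * ‖x - x'‖ ^ β := by
    rw [← Real.rpow_add h]; simp
  have h2 : ‖x - x'‖ ^ (1 - β) ≤ 4 := by
    calc ‖x - x'‖ ^ (1 - β) ≤ 4 ^ (1 - β) :=
          Real.rpow_le_rpow h.le (norm_sub_le_four hx hx') (by linarith)
      _ ≤ 4 ^ (1 : ℝ) := Real.rpow_le_rpow_of_exponent_le (by norm_num) (by linarith)
      _ = 4 := Real.rpow_one _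
  calc _ = _ := h1
    _ ≤ _ := by gcongr

theorem contDiff_radField (j : Fin 3) : ContDiff ℝ ∞ (radField j cutoffProf) := by
  unfold radField
  exact (EuclideanSpace.proj j : E3 →L[ℝ] ℝ).contDiff.mul (contDiff_cutoffProf.comp (contDiff_norm_sq ℝ))

theorem contDiff_radFieldLap (j : Fin 3) : ContDiff ℝ ∞ (radFieldLap j cutoffProf1 cutoffProf2) := by
  unfold radFieldLap
  refine (EuclideanSpace.proj j : E3 →L[ℝ] ℝ).contDiff.mul ?_
  exact (contDiff_const.mul (contDiff_cutoffProf1.comp (contDiff_norm_sq ℝ))).add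
    ((contDiff_const.mul (contDiff_norm_sq ℝ)).mul (contDiff_cutoffProf2.comp (contDiff_norm_sq ℝ)))

/-- The regular part of `neumannKern₀`. -/
def neumannRem₀ (j : Fin 3) (x y : E3) : ℝ :=
  -(∑ σ : Fin 3 → ℤˣ, radField j cutoffProf (x - reflect σ y)) - invNeumann (imageSource j x) y

theorem continuous_neumannRem₀ (j : Fin 3) (x : E3) : Continuous (neumannRem₀ j x) := by
  refine Continuous.sub (Continuous.neg ?_) ?_
  · exact continuous_finsetSum _ fun σ _ => (contDiff_radField j).continuous.comp (continuous_image σ x)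
  · exact continuous_invNeumann (continuous_imageSource j x).continuousOn

/-- The inverse Laplacian acts on `y`, is additive and homogeneous, and is bounded in the supremum
norm. Hence it passes the Lipschitz dependence of the source on `x` to the remainder. -/
theorem exists_neumannRem₀_bound (j : Fin 3) : ∃ K, 0 ≤ K ∧
    ∀ x ∈ cubeD, ∀ x' ∈ cubeD, ∀ y ∈ cubeD, |neumannRem₀ j x y| ≤ K ∧
      |neumannRem₀ j x y - neumannRem₀ j x' y| ≤ K * ‖x - x'‖ := by
  obtain ⟨K1, hK1, h1⟩ := exists_image_lipschitz (contDiff_radField j)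
  obtain ⟨K2, hK2, h2⟩ := exists_image_lipschitz (contDiff_radFieldLap j)
  obtain ⟨C, hC, h3⟩ := exists_abs_invNeumann_le
  have hc : ∀ x, ContinuousOn (imageSource j x) cubeD := fun x => (continuous_imageSource j x).continuousOn
  refine ⟨K1 + C * K2, by positivity, fun x hx x' hx' y hy => ⟨?_, ?_⟩⟩
  · have a1 := (h1 x hx x' hx' y hy).1
    have a2 := h3 (imageSource j x) K2 (hc x) hK2 (fun y hy => (h2 x hx x' hx' y hy).1) y
    rw [neumannRem₀]
    refine (abs_sub _ _).trans ?_
    rw [abs_neg]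
    linarith
  · have a1 := (h1 x hx x' hx' y hy).2
    have hd : ContinuousOn (fun y => imageSource j x y + (-1) * imageSource j x' y) cubeD :=
      (hc x).add (continuousOn_const.mul (hc x'))
    have a2 := h3 _ (K2 * ‖x - x'‖) hd (by positivity) (fun y hy => by
      have := (h2 x hx x' hx' y hy).2
      rw [neg_one_mul, ← sub_eq_add_neg]
      exact this) y
    have hm : ContinuousOn (fun y => (-1) * imageSource j x' y) cubeD := continuousOn_const.mul (hc x')
    rw [invNeumann_add (hc x) hm, invNeumann_const_mul] at a2
    have e : neumannRem₀ j x y - neumannRem₀ j x' y =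
        -((∑ σ : Fin 3 → ℤˣ, radField j cutoffProf (x - reflect σ y)) -
          ∑ σ : Fin 3 → ℤˣ, radField j cutoffProf (x' - reflect σ y)) -
        (invNeumann (imageSource j x) y + (-1) * invNeumann (imageSource j x') y) := by
      rw [neumannRem₀, neumannRem₀]; ring
    rw [e]
    refine (abs_sub _ _).trans ?_
    rw [abs_neg]
    linarith

/-- The kernel without its mean, extended by zero. -/
def neumannFam₀ (j : Fin 3) (x y : E3) : ℝ :=
  (∑ σ : Fin 3 → ℤˣ, imageKern j σ cubeD x y) + cubeD.indicator (neumannRem₀ j x) y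

theorem neumannFam₀_eq (j : Fin 3) (x : E3) {y : E3} (hy : y ∈ cubeD) :
    neumannFam₀ j x y = neumannKern₀ j x y := by
  simp only [neumannFam₀, imageKern, indicator_of_mem hy, neumannRem₀, neumannKern₀, localKern,
    Finset.sum_sub_distrib]
  ring

theorem singFam_sum_imageKern (j : Fin 3) {β : ℝ} (hβ : 0 < β) (hβ1 : β < 1) :
    SingFam cubeD β (∑ _σ : Fin 3 → ℤˣ, 2) (fun x y => ∑ σ : Fin 3 → ℤˣ, imageKern j σ cubeD x y) :=
  SingFam.sum _ fun σ _ => singFam_imageKern j σ measurableSet_cubeD hβ hβ1 fun _ hx _ hy =>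
    norm_sub_le_norm_sub_reflect (mem_cubeD_nonneg hx) (mem_cubeD_nonneg hy) σ

theorem exists_singFam_neumannFam₀ (j : Fin 3) {β : ℝ} (hβ : 0 < β) (hβ1 : β < 1) :
    ∃ C, SingFam cubeD β C (neumannFam₀ j) := by
  obtain ⟨K, hK, h⟩ := exists_neumannRem₀_bound j
  have h1 := regFam_indicator_cubeD (X := cubeD) (r := fun _ => 1) (C := 4 * K) subset_rfl
    (fun _ _ => one_pos) (fun _ _ => by norm_num) hβ hβ1 (by positivity)
    (fun x _ => (continuous_neumannRem₀ j x).continuousOn)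
    (fun x hx y hy => by linarith [(h x hx x hx y hy).1])
    (fun x hx x' hx' y hy => (h x hx x' hx' y hy).2.trans (by
      calc K * ‖x - x'‖ ≤ K * (4 * ‖x - x'‖ ^ β) := by gcongr; exact norm_sub_le_rpow hβ hβ1 hx hx'
        _ = _ := by ring))
  exact ⟨_, (singFam_sum_imageKern j hβ hβ1).add (h1.singFam hβ.le)⟩

/-- The mean of the kernel. -/
def neumannMean (j : Fin 3) (x : E3) : ℝ := (∫ y in cubeD, neumannFam₀ j x y) / 8

theorem exists_neumannMean_bound (j : Fin 3) {β : ℝ} (hβ : 0 < β) (hβ1 : β < 1) : ∃ K, 0 ≤ K ∧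
    ∀ x ∈ cubeD, ∀ x' ∈ cubeD, |neumannMean j x| ≤ K ∧
      |neumannMean j x - neumannMean j x'| ≤ K * ‖x - x'‖ ^ β := by
  obtain ⟨C, hC⟩ := exists_singFam_neumannFam₀ j hβ hβ1
  have hC0 := hC.nonneg
  have I1 : 0 ≤ ∫ y, coreFn 4 2 y := integral_nonneg fun y => coreFn_nonneg _ _ _
  have I2 : 0 ≤ ∫ y, coreFn 4 (2 + β) y := integral_nonneg fun y => coreFn_nonneg _ _ _
  refine ⟨C * 1 * (∫ y, coreFn 4 2 y) + C * 1 * (2 * ∫ y, coreFn 4 (2 + β) y), by positivity,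
    fun x hx x' hx' => ⟨?_, ?_⟩⟩
  · have h := (hC.integral_cubeD subset_rfl (g := fun _ => 1) (B := 1) continuousOn_const
      (fun _ _ => by simp) zero_le_one hx).2
    simp only [mul_one] at h
    rw [neumannMean, abs_div, abs_of_pos (by norm_num : (0 : ℝ) < 8), div_le_iff₀ (by norm_num)]
    have : 0 ≤ C * ∫ y, coreFn 4 (2 + β) y := by positivity
    have : 0 ≤ C * ∫ y, coreFn 4 2 y := by positivity
    linarith
  · have h := hC.integral_cubeD_sub subset_rfl hβ1 hβ (g := fun _ => 1) (B := 1) continuousOn_const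
      (fun _ _ => by simp) zero_le_one hx hx'
    simp only [mul_one] at h
    rw [neumannMean, neumannMean, ← sub_div, abs_div, abs_of_pos (by norm_num : (0 : ℝ) < 8),
      div_le_iff₀ (by norm_num)]
    have a1 : 0 ≤ C * (∫ y, coreFn 4 (2 + β) y) * ‖x - x'‖ ^ β := by positivity
    have a2 : 0 ≤ C * (∫ y, coreFn 4 2 y) * ‖x - x'‖ ^ β := by positivity
    linarith

/-- The regular part of the Neumann kernel. -/
def neumannRem (j : Fin 3) (x y : E3) : ℝ := neumannRem₀ j x y - neumannMean j x

/-- The kernel `-∂_{x_j} G` of the Neumann problem on the cube, extended by zero. -/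
def neumannFam (j : Fin 3) (x y : E3) : ℝ :=
  (∑ σ : Fin 3 → ℤˣ, imageKern j σ cubeD x y) + cubeD.indicator (neumannRem j x) y

theorem neumannFam_eq (j : Fin 3) (x : E3) {y : E3} (hy : y ∈ cubeD) :
    neumannFam j x y = neumannFam₀ j x y - neumannMean j x := by
  simp only [neumannFam₀, neumannFam, indicator_of_mem hy, neumannRem]
  ring

theorem neumannFam_of_notMem (j : Fin 3) (x : E3) {y : E3} (hy : y ∉ cubeD) : neumannFam j x y = 0 := by
  simp [neumannFam, imageKern, indicator_of_notMem hy]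

theorem exists_regFam_neumannRem (j : Fin 3) {β : ℝ} (hβ : 0 < β) (hβ1 : β < 1) : ∃ C,
    ∀ (X : Set E3) (r : E3 → ℝ), X ⊆ cubeD → (∀ x ∈ X, 0 < r x) → (∀ x ∈ X, r x ≤ 4) →
      RegFam X r β C (fun x => cubeD.indicator (neumannRem j x)) := by
  obtain ⟨K, hK, h⟩ := exists_neumannRem₀_bound j
  obtain ⟨K', hK', h'⟩ := exists_neumannMean_bound j hβ hβ1
  refine ⟨_, fun X r hX hr hr4 => regFam_indicator_cubeD (C := 4 * K + K') hX hr hr4 hβ hβ1 (by positivity)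
    (fun x _ => ((continuous_neumannRem₀ j x).sub continuous_const).continuousOn)
    (fun x hx y hy => ?_) (fun x hx x' hx' y hy => ?_)⟩
  · have h1 := (h x (hX hx) x (hX hx) y hy).1
    have h2 := (h' x (hX hx) x (hX hx)).1
    rw [neumannRem]
    linarith [abs_sub (neumannRem₀ j x y) (neumannMean j x)]
  · have h1 := (h x (hX hx) x' (hX hx') y hy).2
    have h2 := (h' x (hX hx) x' (hX hx')).2
    have h3 : K * ‖x - x'‖ ≤ K * (4 * ‖x - x'‖ ^ β) := by
      gcongr; exact norm_sub_le_rpow hβ hβ1 (hX hx) (hX hx')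
    have e : neumannRem j x y - neumannRem j x' y =
      (neumannRem₀ j x y - neumannRem₀ j x' y) - (neumannMean j x - neumannMean j x') := by
      rw [neumannRem, neumannRem]; ring
    rw [e]
    linarith [abs_sub (neumannRem₀ j x y - neumannRem₀ j x' y) (neumannMean j x - neumannMean j x')]

theorem exists_singFam_neumannFam (j : Fin 3) {β : ℝ} (hβ : 0 < β) (hβ1 : β < 1) :
    ∃ C, SingFam cubeD β C (neumannFam j) := by
  obtain ⟨C, hC⟩ := exists_regFam_neumannRem j hβ hβ1
  exact ⟨_, (singFam_sum_imageKern j hβ hβ1).add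
    ((hC cubeD (fun _ => 1) subset_rfl (fun _ _ => one_pos) (fun _ _ => by norm_num)).singFam hβ.le)⟩

/-! ### The representation of the gradient -/

/-- The formula with strictly positive coordinates extends to the faces along the segment from `x`
towards `(1, 1, 1)`: the left side is continuous on the closed cube, and the right side is Hölder in
the base point. -/
theorem HasNeumannLaplacian.partial_eq {Y g : E3 → ℝ} {p : Fin 3 → E3 → ℝ}
    (hY : HasNeumannLaplacian Y p g) (j : Fin 3) {x : E3} (hx : x ∈ unitOctant) :
    p j x = -∫ y in cubeD, neumannFam₀ j x y * g y := by
  obtain ⟨B, hB0, hB⟩ := exists_bound_cubeD hY.cont_laplacian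
  obtain ⟨C, hC⟩ := exists_singFam_neumannFam₀ j (β := 1 / 2) (by norm_num) (by norm_num)
  have hpos : ∀ z ∈ unitOctant, (∀ i, 0 < z i) → p j z = -∫ y in cubeD, neumannFam₀ j z y * g y := by
    intro z hz hz0
    have hi := (hC.integral_cubeD subset_rfl hY.cont_laplacian hB hB0
      (unitOctant_subset hz)).1
    have e : EqOn (fun y => neumannFam₀ j z y * g y) (fun y => neumannKern₀ j z y * g y) cubeD :=
      fun y hy => by simp only [neumannFam₀_eq j z hy]
    have hi2 : IntegrableOn (fun y => localKern j z y * g y) cubeD := by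
      have h1 := (hi.congr_fun e measurableSet_cubeD).add (cubeD_integrableOn
        ((continuous_invNeumann (continuous_imageSource j z).continuousOn).continuousOn.mul
          hY.cont_laplacian))
      refine h1.congr (Eventually.of_forall fun y => ?_)
      simp only [Pi.add_apply, Pi.mul_apply, neumannKern₀]
      ring
    rw [representation_of_pos' j hz hz0 hY hi2, setIntegral_congr_fun measurableSet_cubeD e]
  set c : E3 := WithLp.toLp 2 fun _ => 1 with hc
  set path : ℝ → E3 := fun t => x + t • (c - x) with hpath
  have hcoord : ∀ t i, path t i = (1 - t) * x i + t := fun t i => by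
    simp [hpath, hc]; ring
  have hmem : ∀ t ∈ Ioo (0 : ℝ) 1, path t ∈ unitOctant ∧ ∀ i, 0 < path t i := by
    intro t ht
    refine ⟨fun i => ?_, fun i => ?_⟩
    · rw [hcoord]
      have := hx i
      constructor <;> nlinarith [ht.1, ht.2]
    · rw [hcoord]
      have := hx i
      nlinarith [ht.1, ht.2]
  have hpt : Tendsto path (𝓝[>] 0) (𝓝 x) := by
    have : Continuous path := by fun_prop
    have := this.tendsto 0
    simp only [hpath, zero_smul, add_zero] at this
    exact this.mono_left nhdsWithin_le_nhds
  have hev : ∀ᶠ t in 𝓝[>] (0 : ℝ), t ∈ Ioo (0 : ℝ) 1 := Ioo_mem_nhdsGT one_pos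
  have hxD := unitOctant_subset hx
  have l1 : Tendsto (fun t => p j (path t)) (𝓝[>] 0) (𝓝 (p j x)) :=
    (hY.cont_partial j x hxD).tendsto.comp (tendsto_nhdsWithin_iff.2
      ⟨hpt, hev.mono fun t ht => unitOctant_subset (hmem t ht).1⟩)
  have l2 : Tendsto (fun t => ∫ y in cubeD, neumannFam₀ j (path t) y * g y) (𝓝[>] 0)
      (𝓝 (∫ y in cubeD, neumannFam₀ j x y * g y)) := by
    rw [tendsto_iff_dist_tendsto_zero]
    have l3 : Tendsto (fun t => C * B * (2 * ∫ y, coreFn 4 (2 + 1 / 2) y) * ‖path t - x‖ ^ (1 / 2 : ℝ))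
        (𝓝[>] 0) (𝓝 0) := by
      have h1 : Tendsto (fun t => ‖path t - x‖) (𝓝[>] 0) (𝓝 0) := by
        have := (hpt.sub_const x).norm
        simpa using this
      have h2 := (h1.rpow_const (p := 1 / 2) (Or.inr (by norm_num))).const_mul
        (C * B * (2 * ∫ y, coreFn 4 (2 + 1 / 2) y))
      rwa [Real.zero_rpow (by norm_num), mul_zero] at h2
    refine squeeze_zero' (Eventually.of_forall fun t => dist_nonneg) ?_ l3
    filter_upwards [hev] with t ht
    rw [Real.dist_eq]
    exact hC.integral_cubeD_sub subset_rfl (by norm_num) (by norm_num) hY.cont_laplacian hB hB0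
      (unitOctant_subset (hmem t ht).1) hxD
  exact tendsto_nhds_unique l1 (l2.neg.congr' (hev.mono fun t ht => (hpos _ (hmem t ht).1 (hmem t ht).2).symm))

/-- The mean subtracted from `f` is moved onto the kernel. As the kernel vanishes outside the cube,
the integral is over the whole space, which is the form required by the second moment formula. -/
theorem IsNeumannSolution.partial_eq {f Y : E3 → ℝ} (hf : Continuous f) (hY : IsNeumannSolution f Y)
    (j : Fin 3) {x : E3} (hx : x ∈ unitOctant) :
    fderivWithin ℝ Y cubeD x (EuclideanSpace.single j 1) = -∫ y, neumannFam j x y * f y := by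
  have h := (hY.hasNeumannLaplacian hf).partial_eq j hx
  rw [h, neg_inj]
  obtain ⟨B, hB0, hB⟩ := exists_bound_cubeD hf.continuousOn
  obtain ⟨C, hC⟩ := exists_singFam_neumannFam₀ j (β := 1 / 2) (by norm_num) (by norm_num)
  have hxD := unitOctant_subset hx
  have i1 := (hC.integral_cubeD subset_rfl hf.continuousOn hB hB0 hxD).1
  have i2 := (hC.integral_cubeD subset_rfl (g := fun _ => 1) (B := 1)
    continuousOn_const (fun _ _ => by simp) zero_le_one hxD).1
  simp only [mul_one] at i2
  have i3 : IntegrableOn f cubeD := cubeD_integrableOn hf.continuousOn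
  have h8 : (volume : Measure E3).real cubeD = 8 := by
    have := integral_one_cubeD
    simpa using this
  have e1 : ∫ y, neumannFam j x y * f y = ∫ y in cubeD, neumannFam j x y * f y := by
    rw [setIntegral_eq_integral_of_forall_compl_eq_zero]
    intro y hy
    rw [neumannFam_of_notMem j x hy, zero_mul]
  have e2 : ∫ y in cubeD, neumannFam j x y * f y =
      ∫ y in cubeD, (neumannFam₀ j x y * f y - neumannMean j x * f y) :=
    setIntegral_congr_fun measurableSet_cubeD fun y hy => by
      simp only [neumannFam_eq j x hy, sub_mul]
  rw [e1, e2, integral_sub i1 (i3.const_mul _), integral_const_mul]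
  simp only [mul_sub]
  rw [integral_sub i1 (i2.mul_const _), integral_mul_const, setAverage_eq, h8, neumannMean]
  simp only [smul_eq_mul]
  ring

section

/-! ### The cube kernel against the half-space kernel -/

theorem SingFam.subset {X X' : Set E3} {β C : ℝ} {f : E3 → E3 → ℝ} (hf : SingFam X β C f)
    (h : X' ⊆ X) : SingFam X' β C f where
  nonneg := hf.nonneg
  meas x hx := hf.meas x (h hx)
  bound x hx := hf.bound x (h hx)
  holder x hx x' hx' := hf.holder x (h hx) x' (h hx')

/-- The difference between the Neumann kernels of the cube and of the half-space. -/
def cubeRem (j : Fin 3) (x y : E3) : ℝ :=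
  (∑ σ ∈ (Finset.univ.erase 1).erase (flipSign 2), imageKern j σ cubeD x y) +
    -imageKern j 1 (halfSpace \ cubeD) x y + -imageKern j (flipSign 2) (halfSpace \ cubeD) x y +
    cubeD.indicator (neumannRem j x) y

theorem flipSign_ne_one (i : Fin 3) : flipSign i ≠ 1 := by
  intro h
  have := congrFun h i
  simp [flipSign] at this

theorem cubeD_subset_halfSpace : cubeD ⊆ halfSpace := fun _ hy => (hy 2).1

/-- The identity and the bottom reflection, extended from the cube to the half-space, form the
half-space kernel; `cubeRem` removes this extension and contains the other images and the regular
part. -/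
theorem neumannFam_eq_add (j : Fin 3) (x y : E3) :
    neumannFam j x y = halfKern j x y + cubeRem j x y := by
  have h1 : ∀ σ, imageKern j σ halfSpace x y =
      imageKern j σ cubeD x y + imageKern j σ (halfSpace \ cubeD) x y := by
    intro σ
    by_cases hy : y ∈ cubeD
    · simp [imageKern, hy, cubeD_subset_halfSpace hy]
    · by_cases hy' : y ∈ halfSpace <;> simp [imageKern, hy, hy']
  have h2 := Finset.sum_erase_add (Finset.univ : Finset (Fin 3 → ℤˣ))
    (fun σ => imageKern j σ cubeD x y) (Finset.mem_univ 1)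
  have h3 := Finset.sum_erase_add ((Finset.univ : Finset (Fin 3 → ℤˣ)).erase 1)
    (fun σ => imageKern j σ cubeD x y)
    (Finset.mem_erase.2 ⟨flipSign_ne_one 2, Finset.mem_univ (flipSign 2)⟩)
  rw [neumannFam, halfKern, cubeRem, h1, h1, ← h2, ← h3]
  ring

/-- The tetrahedron without its edge on the boundary. -/
def tetraOff : Set E3 := {x | x ∈ tetraQ ∧ 0 < x 0}

theorem tetraQ_subset_unitOctant : tetraQ ⊆ unitOctant := fun _ hx i =>
  ⟨hx.1.trans (tetraQ_bounds hx i).1, (tetraQ_bounds hx i).2.2⟩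

/-- Such a `σ` reflects one of the first two coordinates, where the image is separated from `x` by
`x i + y i ≥ x i ≥ x 0`. -/
theorem le_norm_image_of_ne {σ : Fin 3 → ℤˣ} (h1 : σ ≠ 1) (h2 : σ ≠ flipSign 2) {x y : E3}
    (hx : x ∈ tetraQ) (hy : y ∈ cubeD) : x 0 ≤ ‖x - reflect σ y‖ := by
  have hi : ∃ i, i ≠ 2 ∧ σ i = -1 := by
    by_contra h
    push Not at h
    have h3 : ∀ i, i ≠ 2 → σ i = 1 := fun i hi => (Int.units_eq_one_or (σ i)).resolve_right (h i hi)
    rcases Int.units_eq_one_or (σ 2) with h4 | h4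
    · refine h1 (funext fun i => ?_)
      rcases eq_or_ne i 2 with rfl | hi
      · exact h4
      · exact h3 i hi
    · refine h2 (funext fun i => ?_)
      rcases eq_or_ne i 2 with rfl | hi
      · simp [flipSign, h4]
      · simp [flipSign, hi, h3 i hi]
  obtain ⟨i, hi2, hi⟩ := hi
  have hx0 : 0 ≤ x 0 := hx.1.trans (tetraQ_bounds hx 0).1
  have hxi : x 0 ≤ x i := by
    fin_cases i
    · exact le_rfl
    · exact hx.2.2.1
    · exact absurd rfl hi2
  refine le_trans ?_ (abs_coord_le_norm _ i)
  have := (hy i).1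
  rw [PiLp.sub_apply, reflect_apply, hi]
  push_cast
  rw [neg_one_mul, sub_neg_eq_add, abs_of_nonneg (by linarith)]
  linarith

/-- Some coordinate of `y` leaves `[0, 2]`. If it is negative, it is a horizontal one, and the
separation is at least `x i ≥ x 0`; if it exceeds `2`, the separation is at least one, which bounds
`x 0`. -/
theorem le_norm_image_of_notMem {σ : Fin 3 → ℤˣ} (hσ : ∀ i, i ≠ 2 → σ i = 1) {x y : E3}
    (hx : x ∈ tetraQ) (hy : y ∈ halfSpace \ cubeD) : x 0 ≤ ‖x - reflect σ y‖ := by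
  have hy2 : 0 ≤ y 2 := hy.1
  have hx2 := hx.1
  have hx1 := (tetraQ_bounds hx 0).2.2
  obtain ⟨i, hi⟩ : ∃ i, ¬(0 ≤ y i ∧ y i ≤ 2) := by
    by_contra h
    push Not at h
    exact hy.2 h
  refine le_trans ?_ (abs_coord_le_norm _ i)
  rw [PiLp.sub_apply, reflect_apply]
  have hb := tetraQ_bounds hx i
  rcases eq_or_ne i 2 with rfl | hi2
  · have : 2 < y 2 := by
      by_contra h
      exact hi ⟨hy2, not_lt.1 h⟩
    rcases Int.units_eq_one_or (σ 2) with h | h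
    · rw [h, abs_of_nonpos] <;> push_cast <;> linarith [hb.2.2]
    · rw [h, abs_of_nonneg] <;> push_cast <;> linarith [hb.2.2]
  · have hxi : x 0 ≤ x i := by
      fin_cases i
      · exact le_rfl
      · exact hx.2.2.1
      · exact absurd rfl hi2
    rw [hσ i hi2]
    push_cast
    rw [one_mul]
    rcases lt_or_ge (y i) 0 with h | h
    · rw [abs_of_nonneg (by linarith [hb.1])]
      linarith
    · have : 2 < y i := by
        by_contra h'
        exact hi ⟨h, not_lt.1 h'⟩
      rw [abs_of_nonpos (by linarith [hb.2.2])]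
      linarith [hb.2.2]

theorem flipSign_two_apply (i : Fin 3) (hi : i ≠ 2) : flipSign 2 i = 1 := by simp [flipSign, hi]

theorem measurableSet_halfSpace_diff : MeasurableSet (halfSpace \ cubeD) :=
  measurableSet_halfSpace.diff measurableSet_cubeD

/-- Every contribution is smooth at distance less than `x 0` from `x`, up to the jump at the
boundary of its region: the other images and the part of the half-space outside the cube by
distance, the regular part because `x 0 ≤ 1`. -/
theorem exists_regFam_cubeRem (j : Fin 3) {β : ℝ} (hβ : 0 < β) (hβ1 : β < 1) :
    ∃ C, RegFam tetraOff (fun x => x 0) β C (cubeRem j) := by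
  have hr : ∀ x ∈ tetraOff, 0 < x 0 := fun x hx => hx.2
  have h1 : RegFam tetraOff (fun x => x 0) β _ _ :=
    RegFam.sum ((Finset.univ.erase 1).erase (flipSign 2)) hr fun σ hσ =>
      regFam_imageKern j σ measurableSet_cubeD hr hβ hβ1
        (fun x hx y hy => norm_sub_le_norm_sub_reflect (fun i => hx.1.1.trans (tetraQ_bounds hx.1 i).1)
          (mem_cubeD_nonneg hy) σ)
        (fun x hx y hy => le_norm_image_of_ne (Finset.ne_of_mem_erase (Finset.mem_of_mem_erase hσ))
          (Finset.ne_of_mem_erase hσ) hx.1 hy)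
  have h2 : RegFam tetraOff (fun x => x 0) β 2 (imageKern j 1 (halfSpace \ cubeD)) :=
    regFam_imageKern j 1 measurableSet_halfSpace_diff hr hβ hβ1
      (fun x hx y hy => by rw [reflect_one])
      (fun x hx y hy => le_norm_image_of_notMem (fun _ _ => rfl) hx.1 hy)
  have h3 : RegFam tetraOff (fun x => x 0) β 2 (imageKern j (flipSign 2) (halfSpace \ cubeD)) :=
    regFam_imageKern j _ measurableSet_halfSpace_diff hr hβ hβ1
      (fun x hx y hy => norm_sub_le_norm_sub_flip hx.1.1 hy.1)
      (fun x hx y hy => le_norm_image_of_notMem flipSign_two_apply hx.1 hy)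
  obtain ⟨C, hC⟩ := exists_regFam_neumannRem j hβ hβ1
  have h4 := hC tetraOff (fun x => x 0) (fun x hx => tetraQ_subset_cubeD hx.1) hr
    (fun x hx => by linarith [(tetraQ_bounds hx.1 0).2.2])
  exact ⟨_, ((h1.add h2.neg).add h3.neg).add h4⟩

theorem ae_notMem_frontier_cubeD : ∀ᵐ y : E3, y ∉ frontier cubeD :=
  measure_eq_zero_iff_ae_notMem.1 (convex_cubeD.addHaar_frontier volume)

theorem convex_halfSpace : Convex ℝ halfSpace := by
  intro x hx y hy a b ha hb _
  have hx' : 0 ≤ x 2 := hx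
  have hy' : 0 ≤ y 2 := hy
  show 0 ≤ (a • x + b • y) 2
  simp only [PiLp.add_apply, PiLp.smul_apply, smul_eq_mul]
  positivity

theorem ae_notMem_frontier_halfSpace_diff : ∀ᵐ y : E3, y ∉ frontier (halfSpace \ cubeD) := by
  have h1 : ∀ᵐ y : E3, y ∉ frontier halfSpace :=
    measure_eq_zero_iff_ae_notMem.1 (convex_halfSpace.addHaar_frontier volume)
  filter_upwards [h1, ae_notMem_frontier_cubeD] with y hy1 hy2 hy
  rw [sdiff_eq] at hy
  rcases frontier_inter_subset halfSpace cubeDᶜ hy with h | h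
  · exact hy1 h.1
  · rw [frontier_compl] at h
    exact hy2 h.2

theorem ae_continuousAt_cubeRem (j : Fin 3) {x : E3} (hx : x ∈ tetraOff) :
    ∀ᵐ y, ContinuousAt (cubeRem j x) y := by
  filter_upwards [ae_notMem_frontier_cubeD, ae_notMem_frontier_halfSpace_diff] with y hy1 hy2
  have hpos : ∀ {z : E3}, x 0 ≤ ‖z‖ → z ≠ 0 := fun h => norm_pos_iff.1 (hx.2.trans_le h)
  refine (((tendsto_finsetSum _ fun σ hσ => ?_ : ContinuousAt _ y).add
    (ContinuousAt.neg ?_)).add (ContinuousAt.neg ?_)).add ?_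
  · exact continuousAt_imageKern j σ hy1 fun hy => hpos (le_norm_image_of_ne
      (Finset.ne_of_mem_erase (Finset.mem_of_mem_erase hσ)) (Finset.ne_of_mem_erase hσ) hx.1 hy)
  · exact continuousAt_imageKern j 1 hy2 fun hy => hpos
      (le_norm_image_of_notMem (fun _ _ => rfl) hx.1 hy)
  · exact continuousAt_imageKern j _ hy2 fun hy => hpos
      (le_norm_image_of_notMem flipSign_two_apply hx.1 hy)
  · have hc : Continuous (neumannRem j x) := (continuous_neumannRem₀ j x).sub continuous_const
    by_cases hyD : y ∈ cubeD
    · have hn : cubeD ∈ 𝓝 y := mem_interior_iff_mem_nhds.1 (by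
        by_contra h
        exact hy1 ⟨subset_closure hyD, h⟩)
      refine hc.continuousAt.congr ?_
      filter_upwards [hn] with z hz
      rw [indicator_of_mem hz]
    · refine (continuousAt_const (y := (0 : ℝ))).congr ?_
      filter_upwards [isClosed_cubeD.isOpen_compl.mem_nhds hyD] with z hz
      rw [indicator_of_notMem hz]

/-! ### The third remainder -/

theorem exists_singFam_two_half_add (j : Fin 3) {β : ℝ} (hβ : 0 < β) (hβ1 : β < 1) :
    ∃ C, SingFam tetraOff β C (fun x y => 2 * halfKern j x y + cubeRem j x y) := by
  obtain ⟨C, hC⟩ := exists_regFam_cubeRem j hβ hβ1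
  exact ⟨_, (((singFam_halfKern j hβ hβ1).subset fun x hx => hx.1.1).const_mul 2).add
    (hC.singFam hβ.le)⟩

/-- The correction to `E|∇Y|²` due to the faces of the cube other than the bottom one. -/
def edgeCorr (q : E3 → ℝ) (ε : ℝ) (x : E3) : ℝ :=
  ∑ j, corr q ε (fun y => 2 * halfKern j x y + cubeRem j x y) (cubeRem j x)

theorem exists_edgeCorr_bound {q : E3 → ℝ} (hq : CorrWeight q) :
    ∃ C, 0 ≤ C ∧ ∀ ε : ℝ, ∀ x ∈ tetraOff, |edgeCorr q ε x| ≤ C * (x 0)⁻¹ := by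
  choose A hA using fun j => exists_singFam_two_half_add j one_half_pos one_half_lt_one
  choose B hB using fun j => exists_regFam_cubeRem j one_half_pos one_half_lt_one
  have h0 := corrConst_nonneg 2 2
  refine ⟨∑ j, A j * B j * corrConst 2 2, Finset.sum_nonneg fun j _ =>
    mul_nonneg (mul_nonneg (hA j).nonneg (hB j).nonneg) h0, fun ε x hx => ?_⟩
  rw [edgeCorr, Finset.sum_mul]
  refine (Finset.abs_sum_le_sum_abs _ _).trans (Finset.sum_le_sum fun j _ => ?_)
  have h := (hA j).abs_corr_le hq (hB j) ε hx
  rwa [Real.rpow_neg_one] at h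

theorem exists_edgeCorr_holder {q : E3 → ℝ} (hq : CorrWeight q) {β : ℝ} (hβ : 0 < β) (hβ1 : β < 1) :
    ∃ C, 0 ≤ C ∧ ∀ ε : ℝ, ∀ x ∈ tetraOff, ∀ x' ∈ tetraOff,
      |edgeCorr q ε x - edgeCorr q ε x'| ≤ C * ‖x - x'‖ ^ β * (min (x 0) (x' 0)) ^ (-1 - β) := by
  choose A hA using fun j => exists_singFam_two_half_add j hβ hβ1
  choose B hB using fun j => exists_regFam_cubeRem j hβ hβ1
  have h1 := corrConst_nonneg (2 + β) 2
  have h2 := corrConst_nonneg 2 (2 + β)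
  refine ⟨∑ j, 4 * (A j * B j * (corrConst (2 + β) 2 + corrConst 2 (2 + β))),
    Finset.sum_nonneg fun j _ => ?_, fun ε x hx x' hx' => ?_⟩
  · have := (hA j).nonneg
    have := (hB j).nonneg
    positivity
  · rw [edgeCorr, edgeCorr, Finset.sum_mul, Finset.sum_mul, ← Finset.sum_sub_distrib]
    refine (Finset.abs_sum_le_sum_abs _ _).trans (Finset.sum_le_sum fun j _ => ?_)
    exact (hA j).abs_corr_sub_le hq hβ hβ1 (hB j) ε hx hx'

theorem tendsto_edgeCorr {q : E3 → ℝ} (hq : CorrWeight q) {x : E3} (hx : x ∈ tetraOff) :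
    Tendsto (fun ε => edgeCorr q ε x) (𝓝 0)
      (𝓝 (∑ j, ∫ y, (2 * halfKern j x y + cubeRem j x y) * cubeRem j x y)) := by
  refine tendsto_finsetSum _ fun j _ => ?_
  obtain ⟨A, h1⟩ := exists_singFam_two_half_add j one_half_pos one_half_lt_one
  obtain ⟨B, h2⟩ := exists_regFam_cubeRem j one_half_pos one_half_lt_one
  have := tendsto_corr hq hx.2 h1.nonneg h2.nonneg (h1.meas x hx) (h2.meas x hx) x (h1.bound x hx)
    (h2.bound x hx) (ae_continuousAt_cubeRem j hx)
  rwa [corr_zero hq] at this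

/-- The third remainder. -/
def edgeRem (Kbar q : E3 → ℝ) (ε : ℝ) (x : E3) : ℝ := bulkRem Kbar q ε + edgeCorr q ε x

/-- The limit of the third remainder. -/
def edgeRemLim (Kbar : E3 → ℝ) (x : E3) : ℝ :=
  (∑ j, ∫ u, (2 * kern j u - greenRem Kbar j u) * greenRem Kbar j u) +
    ∑ j, ∫ y, (2 * halfKern j x y + cubeRem j x y) * cubeRem j x y

variable {Kbar : E3 → ℝ}

/-- The bulk error is constant in `x`: it disappears from the differences, and in the supremum bound
it is absorbed by the weight, which is at least one since `x 0 ≤ 1`. -/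
theorem exists_wHolderBound_edgeRem (hK : IsTruncatedGreen Kbar) {q : E3 → ℝ} (hq : CorrWeight q)
    {κ : ℝ} (hκ : 0 < κ) (hκ1 : κ < 1) :
    ∃ C, ∀ ε, WHolderBound tetraQ edgesD (1 - κ) (-1 - κ) C (edgeRem Kbar q ε) := by
  obtain ⟨C0, hC0, h0⟩ := exists_bulkRem_bound hK hq
  obtain ⟨C1, hC1, h1⟩ := exists_edgeCorr_bound hq
  obtain ⟨C2, hC2, h2⟩ := exists_edgeCorr_holder (β := 1 - κ) hq (by linarith) (by linarith)
  have hm : ∀ x ∈ tetraQ \ edgesD, x ∈ tetraOff := fun x hx => mem_tetraQ_diff_edgesD.1 hx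
  have h1x : ∀ x ∈ tetraOff, x 0 ≤ 1 := fun x hx => (tetraQ_bounds hx.1 0).2.2
  refine ⟨_, fun ε => wHolderBound_of_comparable (A := C0 + C1 + C2) (η := -1) comparable_edgesD
    (abs_coord_sub_le_dist 0) (by norm_num) hκ hκ1 (by positivity) (fun x hx => ?_)
    (fun x hx y hy _ => ?_)⟩
  · have hx' := hm x hx
    have p0 := hx'.2
    have e1 : 1 ≤ x 0 ^ (-1 - κ) := Real.one_le_rpow_of_pos_of_le_one_of_nonpos p0 (h1x x hx') (by linarith)
    have e2 : (x 0)⁻¹ ≤ x 0 ^ (-1 - κ) := by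
      rw [← Real.rpow_neg_one]
      exact Real.rpow_le_rpow_of_exponent_ge p0 (h1x x hx') (by linarith)
    rw [edgeRem]
    calc _ ≤ |bulkRem Kbar q ε| + |edgeCorr q ε x| := abs_add_le _ _
      _ ≤ C0 * 1 + C1 * (x 0)⁻¹ + 0 := by linarith [h0 ε, h1 ε x hx']
      _ ≤ C0 * x 0 ^ (-1 - κ) + C1 * x 0 ^ (-1 - κ) + C2 * x 0 ^ (-1 - κ) := by
          gcongr
          positivity
      _ = _ := by ring
  · have hx' := hm x hx
    have hy' := hm y hy
    have p0 : 0 < min (x 0) (y 0) := lt_min hx'.2 hy'.2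
    have p1 : min (x 0) (y 0) ≤ 1 := (min_le_left _ _).trans (h1x x hx')
    have e : edgeRem Kbar q ε x - edgeRem Kbar q ε y = edgeCorr q ε x - edgeCorr q ε y := by
      rw [edgeRem, edgeRem]; ring
    rw [e, dist_eq_norm]
    refine (h2 ε x hx' y hy').trans ?_
    have e3 : min (x 0) (y 0) ^ (-1 - (1 - κ)) ≤ min (x 0) (y 0) ^ (-1 - 1 : ℝ) :=
      Real.rpow_le_rpow_of_exponent_ge p0 p1 (by linarith)
    gcongr
    linarith

theorem tendstoWHolder_edgeRem (hK : IsTruncatedGreen Kbar) {q : E3 → ℝ} (hq : CorrWeight q)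
    {κ : ℝ} (hκ : 0 < κ) (hκ1 : κ < 1) :
    TendstoWHolder tetraQ edgesD (1 - κ) (-1 - κ) (edgeRem Kbar q) (edgeRemLim Kbar) := by
  refine tendstoWHolder_of_bounds isCompact_tetraQ
    (fun x hx => (comparable_edgesD x hx).1.trans_le (comparable_edgesD x hx).2.1) (by norm_num) ?_ ?_ ?_
    hκ hκ1
  · intro κ hκ hκ1 ε _
    obtain ⟨C, hC⟩ := exists_wHolderBound_edgeRem hK hq hκ hκ1
    exact ⟨C, hC ε⟩
  · intro κ hκ hκ1
    obtain ⟨C, hC⟩ := exists_wHolderBound_edgeRem hK hq hκ hκ1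
    exact ⟨C, fun ε _ _ => hC ε⟩
  · intro x hx
    exact ((tendsto_bulkRem hK hq).add (tendsto_edgeCorr hq (mem_tetraQ_diff_edgesD.1 hx))).mono_left
      nhdsWithin_le_nhds

/-! ### The mean square of the gradient -/

/-- The mean square gradient as a correlation. -/
def neumannCorr (q : E3 → ℝ) (ε : ℝ) (x : E3) : ℝ :=
  ∑ j, corr q ε (neumannFam j x) (neumannFam j x)

theorem corr_comp_sub {q : E3 → ℝ} (hq : CorrWeight q) (ε : ℝ) (f w : E3 → ℝ) (z : E3) :
    corr q ε (fun y => f (z - y)) (fun y => w (z - y)) = corr q ε f w := by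
  have hmp : MeasurePreserving (fun p : E3 × E3 => (-p.1, z - p.2)) volume volume := by
    rw [Measure.volume_eq_prod]
    exact (Measure.measurePreserving_neg volume).prod (Measure.measurePreserving_sub_left volume z)
  have hemb : MeasurableEmbedding (fun p : E3 × E3 => (-p.1, z - p.2)) :=
    ((Homeomorph.neg E3).prodCongr (Homeomorph.subLeft z)).measurableEmbedding
  rw [corr, corr, ← hmp.integral_comp hemb]
  congr 1
  ext p
  simp only [corrIntegrand, hq.even]
  congr 3
  · abel
  · rw [smul_neg]; abel

theorem neumannCorr_terms {q : E3 → ℝ} (hq : CorrWeight q) {ε : ℝ} (hε : 0 < ε) :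
    ∃ C, 0 ≤ C ∧ ∀ x ∈ cubeD, (∀ j, Integrable (corrIntegrand q ε (neumannFam j x) (neumannFam j x))) ∧
      |neumannCorr q ε x| ≤ C := by
  obtain ⟨C, hC0, hC⟩ := exists_corr_sing_bound hq hε
  choose A hA using fun j => exists_singFam_neumannFam j one_half_pos one_half_lt_one
  have h := fun x (hx : x ∈ cubeD) j => hC x (neumannFam j x) (neumannFam j x) (A j) (A j)
    (hA j).nonneg (hA j).nonneg ((hA j).meas x hx) ((hA j).meas x hx) ((hA j).bound x hx)
    ((hA j).bound x hx)
  refine ⟨∑ j, A j * A j * C, Finset.sum_nonneg fun j _ => mul_nonneg (mul_self_nonneg _) hC0,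
    fun x hx => ⟨fun j => (h x hx j).1, ?_⟩⟩
  exact (Finset.abs_sum_le_sum_abs _ _).trans (Finset.sum_le_sum fun j _ => (h x hx j).2)

/-- With `H` the half-space kernel and `W` the remainder, `N² = k² + (H² - k²) + (N² - H²)` and `N²
- H² = (2H + W) W`. At fixed `ε > 0` every piece is integrable separately; `x 2 > 0` is what the
half-space difference requires. -/
theorem neumannCorr_eq {q : E3 → ℝ} (hq : CorrWeight q) {ε : ℝ} (hε : 0 < ε) {x : E3} (hx : x ∈ tetraQ)
    (hx2 : 0 < x 2) :
    neumannCorr q ε x = ∑ j, corr q ε (kern j) (kern j) + halfCorr q ε x + edgeCorr q ε x := by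
  have hxo : x ∈ tetraOff := ⟨hx, hx2.trans_le hx.2.1⟩
  have hxh : x ∈ {x : E3 | 0 ≤ x 2} := hx.1
  rw [halfCorr_eq hq hε hx2, edgeCorr, neumannCorr, ← Finset.sum_add_distrib, ← Finset.sum_add_distrib]
  refine Finset.sum_congr rfl fun j _ => ?_
  rw [corr_comp_sub hq, add_sub_cancel]
  have hh := (singFam_halfKern j one_half_pos one_half_lt_one)
  obtain ⟨B, hw⟩ := exists_regFam_cubeRem j one_half_pos one_half_lt_one
  have i1 := (hh.subset (X' := tetraOff) fun x hx => hx.1.1).integrable_corr hq hw ε hxo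
  have i2 := (hw.singFam one_half_pos.le).integrable_corr hq hw ε hxo
  obtain ⟨C, -, hC⟩ := exists_corr_sing_bound hq hε
  have i3 := (hC x _ _ 4 4 (by norm_num) (by norm_num) (hh.meas x hxh) (hh.meas x hxh) (hh.bound x hxh)
    (hh.bound x hxh)).1
  have e : neumannFam j x = halfKern j x + cubeRem j x := by
    ext y; exact neumannFam_eq_add j x y
  have e2 : (fun y => 2 * halfKern j x y + cubeRem j x y) =
      halfKern j x + (halfKern j x + cubeRem j x) := by
    ext y; simp only [Pi.add_apply]; ring
  have i1' := integrable_corrIntegrand_swap hq i1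
  have add_int : ∀ {f g h : E3 → ℝ}, Integrable (corrIntegrand q ε f h) →
      Integrable (corrIntegrand q ε g h) → Integrable (corrIntegrand q ε (f + g) h) := by
    intro f g h h1 h2
    refine (h1.add h2).congr (Eventually.of_forall fun p => ?_)
    simp only [corrIntegrand, Pi.add_apply]; ring
  rw [e, e2, corr_add_left i1 (add_int i1 i2), corr_add_left i1 i2,
    corr_add_right (add_int i3 i1') (add_int i1 i2), corr_add_left i3 i1', corr_add_left i1 i2,
    corr_swap hq (hw.meas x hxo) (hh.meas x hxh)]
  ring

end

section

/-! ### Integrals over the tetrahedron -/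

/-- The tetrahedron without its bottom face. -/
def tetraPos : Set E3 := {x | x ∈ tetraQ ∧ 0 < x 2}

theorem measurableSet_tetraPos : MeasurableSet tetraPos :=
  isClosed_tetraQ.measurableSet.inter (measurableSet_lt measurable_const (measurable_coord 2))

theorem tetraQ_ae_eq : tetraQ =ᵐ[volume] tetraPos := by
  filter_upwards [ae_coord_ne 2 0] with x hx
  exact propext ⟨fun h => ⟨h, lt_of_le_of_ne h.1 hx.symm⟩, fun h => h.1⟩

theorem ae_restrict_tetraPos : ∀ᵐ x ∂volume.restrict tetraQ, x ∈ tetraPos := by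
  rw [Measure.restrict_congr_set tetraQ_ae_eq]
  exact ae_restrict_mem measurableSet_tetraPos

theorem integrableOn_tetraQ {v : E3 → ℝ} {C : ℝ} (hv : ContinuousOn v tetraPos)
    (hC : ∀ x ∈ tetraPos, |v x| ≤ C) : IntegrableOn v tetraQ := by
  have hfin : volume tetraQ < ⊤ := isCompact_tetraQ.measure_lt_top
  refine IntegrableOn.of_bound hfin ?_ C ?_
  · rw [Measure.restrict_congr_set tetraQ_ae_eq]
    exact hv.aestronglyMeasurable measurableSet_tetraPos
  · filter_upwards [ae_restrict_tetraPos] with x hx using hC x hx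

theorem continuousOn_of_holder {X : Set E3} {r v : E3 → ℝ} {C : ℝ} (hr : Continuous r)
    (hpos : ∀ x ∈ X, 0 < r x) (h : ∀ x ∈ X, ∀ x' ∈ X,
      |v x - v x'| ≤ C * ‖x - x'‖ ^ (1 / 2 : ℝ) * (min (r x) (r x')) ^ (-1 - 1 / 2 : ℝ)) :
    ContinuousOn v X := by
  intro x hx
  rw [ContinuousWithinAt, tendsto_iff_dist_tendsto_zero]
  have hlim : Tendsto (fun z => C * ‖z - x‖ ^ (1 / 2 : ℝ) * (min (r z) (r x)) ^ (-1 - 1 / 2 : ℝ))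
      (𝓝[X] x) (𝓝 0) := by
    have hc : ContinuousAt (fun z => C * ‖z - x‖ ^ (1 / 2 : ℝ) *
        (min (r z) (r x)) ^ (-1 - 1 / 2 : ℝ)) x := by
      refine (continuousAt_const.mul ((continuousAt_id.sub continuousAt_const).norm.rpow_const
        (Or.inr (by norm_num)))).mul ((hr.continuousAt.min continuousAt_const).rpow_const (Or.inl ?_))
      simp [(hpos x hx).ne']
    have := hc.tendsto
    rw [sub_self, norm_zero, Real.zero_rpow (by norm_num), mul_zero, zero_mul] at this
    exact this.mono_left nhdsWithin_le_nhds
  refine squeeze_zero' (Eventually.of_forall fun _ => dist_nonneg) ?_ hlim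
  filter_upwards [self_mem_nhdsWithin] with z hz
  rw [Real.dist_eq]
  exact h z hz x hx

theorem continuousOn_halfCorr {q : E3 → ℝ} (hq : CorrWeight q) (ε : ℝ) :
    ContinuousOn (halfCorr q ε) tetraPos := by
  obtain ⟨C, -, hC⟩ := exists_halfCorr_holder hq one_half_pos one_half_lt_one
  exact continuousOn_of_holder (continuous_coord 2) (fun x hx => hx.2)
    fun x hx x' hx' => hC ε x x' hx.2 hx'.2

theorem continuousOn_edgeCorr {q : E3 → ℝ} (hq : CorrWeight q) (ε : ℝ) :
    ContinuousOn (edgeCorr q ε) tetraPos := by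
  obtain ⟨C, -, hC⟩ := exists_edgeCorr_holder hq one_half_pos one_half_lt_one
  have hm : ∀ x ∈ tetraPos, x ∈ tetraOff := fun x hx => ⟨hx.1, hx.2.trans_le hx.1.2.1⟩
  exact continuousOn_of_holder (continuous_coord 0) (fun x hx => (hm x hx).2)
    fun x hx x' hx' => hC ε x (hm x hx) x' (hm x' hx')

/-- The triangle underlying the bottom face. -/
def baseTri : Set (ℝ × ℝ) := {p | 0 ≤ p.1 ∧ p.1 ≤ p.2 ∧ p.2 ≤ 1}

theorem isClosed_baseTri : IsClosed baseTri :=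
  (isClosed_le continuous_const continuous_fst).inter
    ((isClosed_le continuous_fst continuous_snd).inter (isClosed_le continuous_snd continuous_const))

theorem isCompact_baseTri : IsCompact baseTri :=
  (isCompact_Icc.prod isCompact_Icc : IsCompact (Icc (0 : ℝ) 1 ×ˢ Icc (0 : ℝ) 1)).of_isClosed_subset
    isClosed_baseTri fun _ hp => ⟨⟨hp.1, hp.2.1.trans hp.2.2⟩, ⟨hp.1.trans hp.2.1, hp.2.2⟩⟩

theorem continuous_facePoint : Continuous fun p : ℝ × ℝ => (!₂[p.1, p.2, 0] : E3) := by
  refine (PiLp.continuous_toLp 2 _).comp (continuous_pi fun i => ?_)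
  fin_cases i <;> simp <;> fun_prop

theorem continuousOn_halfPrim {q : E3 → ℝ} (hq : CorrWeight q) {ε : ℝ} (hε : 0 < ε) :
    ContinuousOn (halfPrim q ε) (Icc 0 1) := by
  have h := intervalIntegrable_halfProfile hq hε (le_refl (0 : ℝ)) zero_le_one
  have h2 : IntegrableOn (halfProfile q ε) (uIcc 0 1) := by
    rw [uIcc_of_le zero_le_one]
    exact (intervalIntegrable_iff_integrableOn_Icc_of_le zero_le_one).1 h
  have := intervalIntegral.continuousOn_primitive_interval h2
  rwa [uIcc_of_le zero_le_one] at this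

theorem exists_bound_of_test {ψ : E3 → ℝ} (hψ : Continuous ψ) (hc : HasCompactSupport ψ) :
    ∃ M, 0 ≤ M ∧ ∀ x, |ψ x| ≤ M := by
  obtain ⟨M, hM⟩ := hψ.bounded_above_of_compact_support hc
  exact ⟨M, (norm_nonneg _).trans (hM 0), hM⟩

theorem integrableOn_halfCorr_mul {q : E3 → ℝ} (hq : CorrWeight q) {ε : ℝ} (hε : 0 < ε) {φ : E3 → ℝ}
    (hφ : Continuous φ) {M : ℝ} (hM : ∀ x, |φ x| ≤ M) :
    IntegrableOn (fun x => halfCorr q ε x * φ x) tetraQ := by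
  obtain ⟨C, hC0, hC⟩ := exists_halfCorr_bound_of_pos hq hε
  refine integrableOn_tetraQ (C := C * M) ((continuousOn_halfCorr hq ε).mul hφ.continuousOn)
    fun x hx => ?_
  rw [abs_mul]
  exact mul_le_mul (hC x hx.2) (hM x) (abs_nonneg _) hC0

/-- Integration in the vertical direction. -/
theorem integral_halfCorr_proj {q : E3 → ℝ} (hq : CorrWeight q) {ε : ℝ} (hε : 0 < ε) {ψ : E3 → ℝ}
    (hψ : Continuous ψ) {M : ℝ} (hM : ∀ x, |ψ x| ≤ M) :
    ∫ x in tetraQ, halfCorr q ε x * ψ (projBdry x) = deltaBdry (fun x => halfPrim q ε (x 0)) ψ := by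
  have hint := integrableOn_halfCorr_mul hq hε (φ := fun x => ψ (projBdry x))
    (hψ.comp continuous_projBdry) fun x => hM _
  have hm := isClosed_tetraQ.measurableSet
  rw [← integral_indicator hm, integral_coords]
  have hi := integrable_coords_iff.2 ((integrable_indicator_iff hm).2 hint)
  rw [Measure.volume_eq_prod] at hi ⊢
  rw [integral_prod_symm _ hi]
  show _ = ∫ p in baseTri, _
  rw [← integral_indicator isClosed_baseTri.measurableSet]
  congr 1
  ext p
  by_cases hp : p ∈ baseTri
  · rw [indicator_of_mem hp]
    -- The fibre of `Q` above `(x₁, x₂)` is `0 ≤ x₃ ≤ x₁`, which is why the primitive is evaluated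
    -- at `x₁`.
    have e : ∀ t : ℝ, tetraQ.indicator (fun x => halfCorr q ε x * ψ (projBdry x)) !₂[p.1, p.2, t] =
        (Icc 0 p.1).indicator (fun t => halfProfile q ε t * ψ !₂[p.1, p.2, 0]) t := by
      intro t
      have hiff : (!₂[p.1, p.2, t] : E3) ∈ tetraQ ↔ t ∈ Icc 0 p.1 := by
        simp only [tetraQ, mem_ofPred_eq, mem_Icc]
        exact ⟨fun h => ⟨h.1, h.2.1⟩, fun h => ⟨h.1, h.2, hp.2.1, hp.2.2⟩⟩
      by_cases ht : t ∈ Icc 0 p.1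
      · rw [indicator_of_mem ht, indicator_of_mem (hiff.2 ht), ← halfProfile_apply]
        rfl
      · rw [indicator_of_notMem ht, indicator_of_notMem (mt hiff.1 ht)]
    simp_rw [e]
    rw [integral_indicator measurableSet_Icc, integral_mul_const, integral_Icc_eq_integral_Ioc,
      ← intervalIntegral.integral_of_le hp.1]
    rfl
  · rw [indicator_of_notMem hp]
    have e : ∀ t : ℝ, tetraQ.indicator (fun x => halfCorr q ε x * ψ (projBdry x)) !₂[p.1, p.2, t] = 0 := by
      intro t
      refine indicator_of_notMem (fun h => hp ?_) _
      exact ⟨h.1.trans h.2.1, h.2.2.1, h.2.2.2⟩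
    simp [e]

theorem deltaBdry_add {q : E3 → ℝ} (hq : CorrWeight q) {ε : ℝ} (hε : 0 < ε) (a : ℝ) {ψ : E3 → ℝ}
    (hψ : Continuous ψ) :
    deltaBdry (fun _ => a + |Real.log ε| / (8 * Real.pi)) ψ + deltaBdry (faceRem q a ε) ψ =
      deltaBdry (fun x => halfPrim q ε (x 0)) ψ := by
  have hc : Continuous fun p : ℝ × ℝ => ψ !₂[p.1, p.2, 0] := hψ.comp continuous_facePoint
  have hp : ContinuousOn (fun p : ℝ × ℝ => halfPrim q ε p.1) baseTri :=
    (continuousOn_halfPrim hq hε).comp continuous_fst.continuousOn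
      fun p hp => ⟨hp.1, hp.2.1.trans hp.2.2⟩
  have i1 : IntegrableOn (fun p : ℝ × ℝ => (a + |Real.log ε| / (8 * Real.pi)) * ψ !₂[p.1, p.2, 0])
      baseTri := (continuous_const.mul hc).continuousOn.integrableOn_compact isCompact_baseTri
  have i2 : IntegrableOn (fun p : ℝ × ℝ => (halfPrim q ε p.1 - a - |Real.log ε| / (8 * Real.pi)) *
      ψ !₂[p.1, p.2, 0]) baseTri :=
    (((hp.sub continuousOn_const).sub continuousOn_const).mul hc.continuousOn).integrableOn_compact
      isCompact_baseTri
  show (∫ p in baseTri, _) + (∫ p in baseTri, _) = ∫ p in baseTri, _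
  simp only [faceRem]
  refine (integral_add i1 i2).symm.trans (integral_congr_ae (Eventually.of_forall fun p => ?_))
  simp
  ring

/-! ### The mean square gradient -/

variable {Ω : Type u} [MeasurableSpace Ω] {P : Measure Ω} [IsProbabilityMeasure P]
  {ξ : Ω → (𝓢(E3, ℝ) →L[ℝ] ℝ)}

theorem integrable_neumannFam (j : Fin 3) {x : E3} (hx : x ∈ cubeD) : Integrable (neumannFam j x) := by
  obtain ⟨C, hC⟩ := exists_singFam_neumannFam j one_half_pos one_half_lt_one
  have h := (hC.integral_cubeD subset_rfl (g := fun _ => 1) (B := 1)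
    continuousOn_const (fun _ _ => by simp) zero_le_one hx).1
  simp only [mul_one] at h
  refine (integrableOn_iff_integrable_of_support_subset fun y hy => ?_).1 h
  by_contra hyD
  exact hy (neumannFam_of_notMem j x hyD)

/-- This holds at every point of `Q`, faces and edges included, since the representation of the
gradient does; the sign in that representation disappears in the square. -/
theorem meanSqGrad_eq (hξ : IsWhiteNoise P ξ) (ρ : Mollifier3) {ε : ℝ} (hε : 0 < ε) {Y : Ω → E3 → ℝ}
    (hY : ∀ᵐ w ∂P, IsNeumannSolution (mollify ρ hε (ξ w)) (Y w)) {x : E3} (hx : x ∈ tetraQ) :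
    Integrable (fun w => ‖gradientWithin (Y w) cubeD x‖ ^ 2) P ∧
      meanSqGrad P Y x = neumannCorr ρ.autocorr ε x := by
  have hq := ρ.corrWeight_autocorr
  have hxD := tetraQ_subset_cubeD hx
  obtain ⟨_, -, hC⟩ := neumannCorr_terms hq hε
  have h := fun j => hξ.sq_integral_mollify ρ hε (integrable_neumannFam j hxD) ((hC x hxD).1 j)
  have hae : (fun w => ∑ j, (∫ y, neumannFam j x y * mollify ρ hε (ξ w) y) ^ 2) =ᵐ[P]
      fun w => ‖gradientWithin (Y w) cubeD x‖ ^ 2 := by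
    filter_upwards [hY] with w hw
    rw [EuclideanSpace.real_norm_sq_eq]
    refine Finset.sum_congr rfl fun j _ => ?_
    rw [gradientWithin_apply, hw.partial_eq (continuous_mollify ρ hε (ξ w)) j
      (tetraQ_subset_unitOctant hx), neg_sq]
  have hi : Integrable (fun w => ∑ j, (∫ y, neumannFam j x y * mollify ρ hε (ξ w) y) ^ 2) P :=
    integrable_finsetSum _ fun j _ => (h j).1
  refine ⟨hi.congr hae, ?_⟩
  rw [meanSqGrad, ← integral_congr_ae hae, integral_finsetSum _ fun j _ => (h j).1]
  exact Finset.sum_congr rfl fun j _ => (h j).2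

variable {Kbar : E3 → ℝ}

theorem meanSqGrad_decomposition (hK : IsTruncatedGreen Kbar) (hξ : IsWhiteNoise P ξ) (ρ : Mollifier3)
    {ε : ℝ} (hε : 0 < ε) {Y : Ω → E3 → ℝ}
    (hY : ∀ᵐ w ∂P, IsNeumannSolution (mollify ρ hε (ξ w)) (Y w)) (z : E3) {x : E3} (hx : x ∈ tetraPos) :
    meanSqGrad P Y x = ellConst P Kbar (fun w => mollify ρ hε (ξ w)) z +
      halfCorr ρ.autocorr ε x + edgeRem Kbar ρ.autocorr ε x := by
  rw [(meanSqGrad_eq hξ ρ hε hY hx.1).2, neumannCorr_eq ρ.corrWeight_autocorr hε hx.1 hx.2,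
    ellConst_eq hK hξ ρ hε z, edgeRem]
  ring

/-- At fixed `ε` all other terms of the decomposition are bounded up to the faces, so solving it for
the remainder gives the bound. -/
theorem exists_edgeRem_bound_of_pos (hK : IsTruncatedGreen Kbar) {q : E3 → ℝ} (hq : CorrWeight q)
    {ε : ℝ} (hε : 0 < ε) : ∃ C, 0 ≤ C ∧ ∀ x ∈ tetraPos, |edgeRem Kbar q ε x| ≤ C := by
  obtain ⟨C1, hC1, h1⟩ := neumannCorr_terms hq hε
  obtain ⟨C2, hC2, h2⟩ := exists_halfCorr_bound_of_pos hq hε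
  obtain ⟨C3, hC3, h3⟩ := exists_bulkRem_bound hK hq
  set S := ∑ j, corr q ε (kern j) (kern j) with hS
  refine ⟨C1 + C2 + C3 + |S|, by positivity, fun x hx => ?_⟩
  have e : edgeRem Kbar q ε x = neumannCorr q ε x - halfCorr q ε x + bulkRem Kbar q ε - S := by
    rw [neumannCorr_eq hq hε hx.1 hx.2, edgeRem]
    ring
  have b1 := (h1 x (tetraQ_subset_cubeD hx.1)).2
  have b2 := h2 x hx.2
  have b3 := h3 ε
  rw [e]
  rw [abs_le] at *
  have := neg_abs_le S
  have := le_abs_self S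
  constructor <;> linarith [b1.1, b1.2, b2.1, b2.2, b3.1, b3.2]

theorem lemma3p1 (Kbar : E3 → ℝ) (hKbar : IsTruncatedGreen Kbar) :
    -- the limits depend neither on the mollifier nor on `κ`
    ∃ R10 R20 R30 : E3 → ℝ, ∀ ρ : Mollifier3, ∃ (a : ℝ) (R1 R2 R3 : ℝ → E3 → ℝ),
      -- convergence of the remainders
      (∀ κ : ℝ, 0 < κ → κ < 1 →
        TendstoWHolder faceQ edgesD (1 - κ) (-κ) R1 R10 ∧
        TendstoWHolder tetraQ bdryD (1 - κ) (-1 - κ) R2 R20 ∧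
        TendstoWHolder tetraQ edgesD (1 - κ) (-1 - κ) R3 R30) ∧
      -- the second remainder and its limit only depend on the third coordinate
      (∀ i : Fin 3, i = 0 ∨ i = 1 → ∀ x ∈ tetraQ \ bdryD,
        (∀ ε : ℝ, 0 < ε →
          HasLineDerivWithinAt ℝ (R2 ε) 0 tetraQ x (EuclideanSpace.single i 1)) ∧
        HasLineDerivWithinAt ℝ R20 0 tetraQ x (EuclideanSpace.single i 1)) ∧
      -- the decomposition on `Q`
      ∀ (Ω : Type u) [MeasurableSpace Ω] (P : Measure Ω) [IsProbabilityMeasure P]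
        (ξ : Ω → (𝓢(E3, ℝ) →L[ℝ] ℝ)), IsWhiteNoise P ξ →
      ∀ (ε : ℝ) (hε : 0 < ε) (Y : Ω → E3 → ℝ),
        (∀ᵐ w ∂P, IsNeumannSolution (mollify ρ hε (ξ w)) (Y w)) →
        (∀ x ∈ tetraQ, Integrable (fun w => ‖gradientWithin (Y w) cubeD x‖ ^ 2) P) ∧
        IntegrableOn (meanSqGrad P Y) tetraQ ∧
        ∀ (z : E3) (ψ : E3 → ℝ), ContDiff ℝ ∞ ψ → HasCompactSupport ψ →
          distQ (meanSqGrad P Y) ψ =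
            distQ (fun _ => ellConst P Kbar (fun w => mollify ρ hε (ξ w)) z) ψ +
            deltaBdry (fun _ => a + |Real.log ε| / (8 * Real.pi)) ψ +
            deltaBdry (R1 ε) ψ + renormR (R2 ε) ψ + distQ (R3 ε) ψ := by
  refine ⟨fun x => Real.log (x 0) / (8 * Real.pi), fun x => 1 / (8 * Real.pi * x 2), edgeRemLim Kbar,
    fun ρ => ?_⟩
  have hq := ρ.corrWeight_autocorr
  set q := ρ.autocorr with hqdef
  obtain ⟨a, ha⟩ := exists_tendstoWHolder_faceRem hq
  refine ⟨a, faceRem q a, halfCorr q, edgeRem Kbar q, fun κ hκ hκ1 =>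
    ⟨ha κ hκ hκ1, tendstoWHolder_halfCorr hq hκ hκ1, tendstoWHolder_edgeRem hKbar hq hκ hκ1⟩,
    fun i hi x _ => ?_, ?_⟩
  · have hi2 : i ≠ 2 := by rcases hi with rfl | rfl <;> decide
    exact ⟨fun ε _ => hasLineDerivWithinAt_of_coord (fun x x' h => halfCorr_congr q ε h) hi2 _ _,
      hasLineDerivWithinAt_of_coord (fun x x' h => by rw [h]) hi2 _ _⟩
  intro Ω _ P _ ξ hξ ε hε Y hY
  obtain ⟨C2, hC2, h2⟩ := exists_halfCorr_bound_of_pos hq hε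
  obtain ⟨C3, hC3, h3⟩ := exists_edgeRem_bound_of_pos hKbar hq hε
  have hec : ContinuousOn (edgeRem Kbar q ε) tetraPos := continuousOn_const.add (continuousOn_edgeCorr hq ε)
  have hhc := continuousOn_halfCorr hq ε
  refine ⟨fun x hx => (meanSqGrad_eq hξ ρ hε hY hx).1, ?_, fun z ψ hψ hψc => ?_⟩
  · set ℓ := ellConst P Kbar (fun w => mollify ρ hε (ξ w)) 0 with hℓ
    have hint : IntegrableOn (fun x => ℓ + halfCorr q ε x + edgeRem Kbar q ε x) tetraQ :=
      integrableOn_tetraQ (C := |ℓ| + C2 + C3) ((continuousOn_const.add hhc).add hec) fun x hx =>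
        (abs_add_three _ _ _).trans (add_le_add (add_le_add le_rfl (h2 x hx.2)) (h3 x hx))
    refine hint.congr ?_
    filter_upwards [ae_restrict_tetraPos] with x hx
    exact (meanSqGrad_decomposition hKbar hξ ρ hε hY 0 hx).symm
  · have hψ' := hψ.continuous
    obtain ⟨M, hM0, hM⟩ := exists_bound_of_test hψ' hψc
    set ℓ := ellConst P Kbar (fun w => mollify ρ hε (ξ w)) z with hℓ
    have i1 : IntegrableOn (fun x => ℓ * ψ x) tetraQ :=
      (continuous_const.mul hψ').continuousOn.integrableOn_compact isCompact_tetraQ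
    have i2 := integrableOn_halfCorr_mul hq hε hψ' hM
    have i2' := integrableOn_halfCorr_mul hq hε (φ := fun x => ψ (projBdry x))
      (hψ'.comp continuous_projBdry) fun x => hM _
    have i3 : IntegrableOn (fun x => edgeRem Kbar q ε x * ψ x) tetraQ :=
      integrableOn_tetraQ (C := C3 * M) (hec.mul hψ'.continuousOn) fun x hx => by
        rw [abs_mul]
        exact mul_le_mul (h3 x hx) (hM x) (abs_nonneg _) hC3
    have e1 : distQ (meanSqGrad P Y) ψ =
        ∫ x in tetraQ, (ℓ * ψ x + halfCorr q ε x * ψ x + edgeRem Kbar q ε x * ψ x) := by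
      refine integral_congr_ae ?_
      filter_upwards [ae_restrict_tetraPos] with x hx
      rw [meanSqGrad_decomposition hKbar hξ ρ hε hY z hx]
      ring
    have i12 : IntegrableOn (fun x => ℓ * ψ x + halfCorr q ε x * ψ x) tetraQ := i1.add i2
    -- At fixed `ε` both integrals converge, so the renormalised distribution is the plain one minus
    -- a term concentrated on the face; that term is restored by the counterterm together with `R¹`.
    have e2 : renormR (halfCorr q ε) ψ = (∫ x in tetraQ, halfCorr q ε x * ψ x) -
        ∫ x in tetraQ, halfCorr q ε x * ψ (projBdry x) := by
      rw [renormR]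
      simp_rw [mul_sub]
      exact integral_sub i2 i2'
    rw [e1, integral_add i12 i3, integral_add i1 i2, e2, integral_halfCorr_proj hq hε hψ' hM,
      ← deltaBdry_add hq hε a hψ', distQ, distQ]
    ring

end

end
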